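/- Let $M$ be a smooth real supermanifold of dimension $n|m$ (Hausdorff, second countable), given by an atlas of charts with even coordinates $x^1,\dots,x^n$ and odd coordinates $\xi^1,\dots,\xi^m$, jointly denoted $x^a$ with parities $\tilde a\in\mathbb Z_2$. For two overlapping charts put $J=Dx'/Dx=\operatorname{sgn}\det\bigl(\partial x'^{\,\rm even}/\partial x^{\rm even}\bigr)\cdot\operatorname{Ber}(\partial x'/\partial x)$, and assume that all these factors $J$ are positive (which is automatic for $m=0$). Let $\mathfrak V(M)$ be the commutative superalgebra of densities, whose elements are finite formal sums $\boldsymbol\psi=\sum_{w\in\mathbb R}\psi_w(x)\,(Dx)^w$, where $(Dx')^w=J^w(Dx)^w$ and $(Dx)^w$ is even. For compactly supported densities let $\langle\boldsymbol\psi,\boldsymbol\chi\rangle$ be the Berezin integral over $M$ of the component of weight $1$ of $\boldsymbol\psi\boldsymbol\chi$; for a linear operator $\Delta$ on $\mathfrak V(M)$ of parity $\varepsilon$, the equality $\Delta^*=\Delta$ means $\langle\Delta\boldsymbol\psi,\boldsymbol\chi\rangle=(-1)^{\tilde\psi\varepsilon}\langle\boldsymbol\psi,\Delta\boldsymbol\chi\rangle$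 for all compactly supported $\boldsymbol\psi,\boldsymbol\chi$. Let $\lambda\in\mathbb R$, $\varepsilon\in\mathbb Z_2$, and let $\{\,\cdot\,;\cdot\,\}$ be a long bracket on $M$ of parity $\varepsilon$ and weight $\lambda$, i.e. an $\mathbb R$-bilinear operation on $\mathfrak V(M)$ with $$\widetilde{\{\boldsymbol\psi;\boldsymbol\chi\}}=\tilde\psi+\tilde\chi+\varepsilon,\quad w(\{\boldsymbol\psi;\boldsymbol\chi\})=w(\boldsymbol\psi)+w(\boldsymbol\chi)+\lambda,\quad \{\boldsymbol\psi;\boldsymbol\chi\}=(-1)^{\tilde\psi\tilde\chi}\{\boldsymbol\chi;\boldsymbol\psi\},$$ $$\{\boldsymbol\psi;\boldsymbol\chi\boldsymbol\varphi\}=\{\boldsymbol\psi;\boldsymbol\chi\}\boldsymbol\varphi+(-1)^{(\tilde\psi+\varepsilon)\tilde\chi}\boldsymbol\chi\{\boldsymbol\psi;\boldsymbol\varphi\}.$$ (1) There is a unique linear operator $\Delta$ of parity $\varepsilon$ on $\mathfrak V(M)$ such that $\Delta^*=\Delta$, $\Delta(1)=0$ and $$\{\boldsymbol\psi;\boldsymbol\chi\}=\Delta(\boldsymbol\psi\boldsymbol\chi)-\Delta\boldsymbol\psi\cdot\boldsymbol\chi-(-1)^{\tilde\psi\varepsilon}\boldsymbol\psi\cdot\Delta\boldsymbol\chi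 .$$ (2) This $\Delta$ has weight $\lambda$. If in a chart the bracket is given by superfunctions $S^{ab}=(-1)^{\tilde a\tilde b}S^{ba}$, $\gamma^a$, $\theta$ of parities $\tilde a+\tilde b+\varepsilon$, $\tilde a+\varepsilon$, $\varepsilon$ through $$\{\psi(Dx)^{w_1};\chi(Dx)^{w_2}\}=\Bigl(S^{ab}\partial_b\psi\,\partial_a\chi\,(-1)^{\tilde a\tilde\psi}+\gamma^a\bigl(w_2\,\partial_a\psi\,\chi+(-1)^{\tilde a\tilde\psi}w_1\,\psi\,\partial_a\chi\bigr)+w_1w_2\,\theta\,\psi\chi\Bigr)(Dx)^{w_1+w_2+\lambda},$$ then in this chart $\Delta(\psi(Dx)^w)=(\Delta_w\psi)(Dx)^{w+\lambda}$ with the canonical pencil $$\Delta_w=\tfrac12\Bigl(S^{ab}\partial_b\partial_a+\bigl(\partial_bS^{ba}(-1)^{\tilde b(\varepsilon+1)}+(2w+\lambda-1)\gamma^a\bigr)\partial_a+w\,\partial_a\gamma^a(-1)^{\tilde a(\varepsilon+1)}+w(w+\lambda-1)\,\theta\Bigr).$$ (3) If the bracket depends continuously on the weights (for densities $\boldsymbol\chi_w=f(x)(Dx)^w$,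 $w\in\mathbb R$, with one and the same coefficient $f$ in a chart, and for $\boldsymbol\psi$ homogeneous in weight, the coefficient of $\{\boldsymbol\psi;\boldsymbol\chi_w\}$ at each point of the chart is continuous in $w$), then in every chart it is given in this way by unique data $S^{ab},\gamma^a,\theta$. Here all derivatives are left derivatives and summation over repeated indices is understood. -/

import Mathlib

open scoped ContDiff

universe u v

/-! ### Grassmann algebras -/

/-- The real Grassmann algebra `Λ(ξ¹, …, ξᵐ)`. -/
abbrev Grassmann (m : ℕ) : Type := ExteriorAlgebra ℝ (Fin m → ℝ)

namespace Grassmann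

variable {m : ℕ}

/-- The basis of ordered monomials `ξ^I = ξ^{i₁} ⋯ ξ^{iₖ}`, `i₁ < ⋯ < iₖ`. -/
noncomputable def monomials (m : ℕ) : Module.Basis (Finset (Fin m)) ℝ (Grassmann m) :=
  (Pi.basisFun ℝ (Fin m)).ExteriorAlgebra

/-- The coefficient of the monomial `ξ^I`. -/
noncomputable def coeff (I : Finset (Fin m)) : Grassmann m →ₗ[ℝ] ℝ := (monomials m).coord I

/-- The generator `ξ^α`. -/
noncomputable def xi (α : Fin m) : Grassmann m := ExteriorAlgebra.ι ℝ (Pi.single α 1)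

/-- The body `Λ → ℝ`, which sends all generators to zero. -/
noncomputable def body : Grassmann m →ₐ[ℝ] ℝ := ExteriorAlgebra.algebraMapInv

/-- The even (`p = 0`) or odd (`p = 1`) elements. -/
def part (m : ℕ) (p : ZMod 2) : Submodule ℝ (Grassmann m) :=
  CliffordAlgebra.evenOdd (0 : QuadraticForm ℝ (Fin m → ℝ)) p

/-- The left derivative `∂/∂ξ^α`. -/
noncomputable def oddDeriv (α : Fin m) : Grassmann m →ₗ[ℝ] Grassmann m :=
  CliffordAlgebra.contractLeft (LinearMap.proj α : (Fin m → ℝ) →ₗ[ℝ] ℝ)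

/-- The Berezin integral over the odd variables: the coefficient of `ξ¹ξ² ⋯ ξᵐ`. -/
noncomputable def top (f : Grassmann m) : ℝ := coeff Finset.univ f

theorem ι_anticomm (v w : Fin m → ℝ) :
    ExteriorAlgebra.ι ℝ v * ExteriorAlgebra.ι ℝ w
      = -(ExteriorAlgebra.ι ℝ w * ExteriorAlgebra.ι ℝ v) :=
  eq_neg_of_add_eq_zero_left (ExteriorAlgebra.ι_add_mul_swap v w)

theorem ι_mul_ι_comm (v w : Fin m → ℝ) (x : Grassmann m) :
    Commute (ExteriorAlgebra.ι ℝ v * ExteriorAlgebra.ι ℝ w) x := by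
  induction x using ExteriorAlgebra.induction with
  | algebraMap r => exact Algebra.commutes' r _ |>.symm
  | ι z =>
    change _ * _ = _ * _
    rw [mul_assoc, ι_anticomm w z, mul_neg, ← mul_assoc, ι_anticomm v z, neg_mul, neg_neg,
      mul_assoc]
  | mul a b ha hb => exact ha.mul_right hb
  | add a b ha hb => exact ha.add_right hb

/-- Even elements are central. -/
theorem even_comm {x : Grassmann m} (hx : x ∈ part m 0) (y : Grassmann m) : Commute x y := by
  induction x, hx using CliffordAlgebra.even_induction with
  | algebraMap r => exact Algebra.commutes' r y
  | add a b _ _ iha ihb => exact iha.add_left ihb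
  | ι_mul_ι_mul v w a _ ih => exact (ι_mul_ι_comm v w y).mul_left ih

/-- An even element without body is nilpotent. -/
theorem even_nilpotent {x : Grassmann m} (hx : x ∈ part m 0) :
    IsNilpotent (x - algebraMap ℝ _ (body x)) := by
  induction x, hx using CliffordAlgebra.even_induction with
  | algebraMap r =>
    have : body (algebraMap ℝ (Grassmann m) r) = r := by simp
    rw [this]
    simp
  | add a b ha hb iha ihb =>
    have key : a + b - algebraMap ℝ _ (body (a + b))
        = (a - algebraMap ℝ _ (body a)) + (b - algebraMap ℝ _ (body b)) := by
      simp only [map_add]; abel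
    rw [key]
    refine Commute.isNilpotent_add ?_ iha ihb
    exact even_comm (Submodule.sub_mem _ ha (SetLike.algebraMap_mem_graded
      (CliffordAlgebra.evenOdd (0 : QuadraticForm ℝ (Fin m → ℝ))) _)) _
  | ι_mul_ι_mul v w a _ ih =>
    have h0 : body (ExteriorAlgebra.ι ℝ v * ExteriorAlgebra.ι ℝ w * a) = 0 := by
      simp [body, ExteriorAlgebra.algebraMapInv]
    have h2 : (ExteriorAlgebra.ι ℝ v * ExteriorAlgebra.ι ℝ w) ^ 2 = (0 : Grassmann m) := by
      rw [pow_two, mul_assoc, ← mul_assoc (ExteriorAlgebra.ι ℝ w), ι_anticomm w v, neg_mul,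
        mul_assoc, ExteriorAlgebra.ι_sq_zero]
      simp
    change IsNilpotent (ExteriorAlgebra.ι ℝ v * ExteriorAlgebra.ι ℝ w * a
      - algebraMap ℝ _ (body (ExteriorAlgebra.ι ℝ v * ExteriorAlgebra.ι ℝ w * a)))
    rw [h0, map_zero, sub_zero]
    exact (ι_mul_ι_comm v w a).isNilpotent_mul_right ⟨2, h2⟩

/-- The commutative algebra of even elements of the Grassmann algebra. -/
abbrev Even (m : ℕ) : Type :=
  CliffordAlgebra.even (0 : QuadraticForm ℝ (Fin m → ℝ))

noncomputable instance : CommRing (Even m) :=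
  { (inferInstance : Ring (Even m)) with
    mul_comm := fun a b => Subtype.ext (even_comm a.2 b) }

noncomputable instance : Module ℚ (Even m) := Module.compHom (Even m) (algebraMap ℚ ℝ)

/-- The even component of an element. -/
noncomputable def evenPart (x : Grassmann m) : Even m :=
  ⟨DirectSum.decompose (CliffordAlgebra.evenOdd (0 : QuadraticForm ℝ (Fin m → ℝ))) x 0,
    (DirectSum.decompose (CliffordAlgebra.evenOdd (0 : QuadraticForm ℝ (Fin m → ℝ))) x 0).2⟩

/-- The nilpotent part of an even element. -/
noncomputable def soul (x : Even m) : Even m := x - algebraMap ℝ _ (body (x : Grassmann m))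

theorem soul_nilpotent (x : Even m) : IsNilpotent (soul x) := by
  obtain ⟨k, hk⟩ := even_nilpotent x.2
  exact ⟨k, Subtype.ext hk⟩

/-- For an even `x` with body `b > 0` and soul `ν`, the (finite) logarithmic series
`log (1 + ν / b) = ∑_{k ≥ 1} (-1)^{k+1} (ν / b)^k / k`. Here `ν ^ (m + 1) = 0`. -/
noncomputable def logSoul (x : Even m) : Even m :=
  ∑ k ∈ Finset.Icc 1 m,
    ((-1 : ℝ) ^ (k + 1) / (k : ℝ)) • ((body (x : Grassmann m))⁻¹ • soul x) ^ k

theorem logSoul_nilpotent (x : Even m) : IsNilpotent (logSoul x) := by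
  have hs : ∀ (r : ℝ) (y : Even m), IsNilpotent y → IsNilpotent (r • y) := fun r y hy => by
    rw [Algebra.smul_def]; exact (Commute.all _ _).isNilpotent_mul_left hy
  refine isNilpotent_sum fun k hk => hs _ _ ?_
  exact (hs _ _ (soul_nilpotent x)).pow_of_pos (by have := (Finset.mem_Icc.1 hk).1; omega)

/-- The real power `x ^ w = exp (w log x)` of an even element `x` with positive body. -/
noncomputable def pow (x : Even m) (w : ℝ) : Even m :=
  Real.exp (w * Real.log (body (x : Grassmann m))) • IsNilpotent.exp (w • logSoul x)

theorem smul_logSoul_nilpotent (x : Even m) (w : ℝ) : IsNilpotent (w • logSoul x) := by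
  rw [Algebra.smul_def]; exact (Commute.all _ _).isNilpotent_mul_left (logSoul_nilpotent x)

theorem pow_zero' (x : Even m) : pow x 0 = 1 := by
  have : IsNilpotent.exp (0 : Even m) = 1 := by
    rw [IsNilpotent.exp_eq_sum (k := 1) (by simp)]
    simp
  simp [pow, this]

theorem pow_add' (x : Even m) (w₁ w₂ : ℝ) : pow x (w₁ + w₂) = pow x w₁ * pow x w₂ := by
  simp only [pow]
  rw [add_mul, Real.exp_add, add_smul, IsNilpotent.exp_add_of_commute (Commute.all _ _)
    (smul_logSoul_nilpotent x w₁) (smul_logSoul_nilpotent x w₂), smul_mul_smul_comm]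

/-- The Berezinian `det (A - B D⁻¹ C) / det D` of an even supermatrix
`(A, B; C, D)`: the blocks `A`, `D` have even entries, the blocks `B`, `C` odd entries. -/
noncomputable def berezinian {n : ℕ}
    (M : Matrix (Fin n ⊕ Fin m) (Fin n ⊕ Fin m) (Grassmann m)) : Even m :=
  let D : Matrix (Fin m) (Fin m) (Even m) := M.toBlocks₂₂.map evenPart
  let Dinv : Matrix (Fin m) (Fin m) (Grassmann m) := D⁻¹.map Subtype.val
  ((M.toBlocks₁₁ - M.toBlocks₁₂ * Dinv * M.toBlocks₂₁).map evenPart).det * Ring.inverse D.det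

/-- `sgn (det A) · Ber M`, the factor by which the Berezin integral changes under a change of
variables with Jacobi matrix `M = (A, B; C, D)`. -/
noncomputable def orientedBerezinian {n : ℕ}
    (M : Matrix (Fin n ⊕ Fin m) (Fin n ⊕ Fin m) (Grassmann m)) : Even m :=
  Real.sign (M.toBlocks₁₁.map body).det • berezinian M

end Grassmann

/-! ### Superfunctions in a chart -/

section SuperFunctions

variable {n m : ℕ} {X : Type u} [TopologicalSpace X]

open Classical in
/-- Extension of a Grassmann-valued function by zero. -/
noncomputable def extendZero {W : TopologicalSpace.Opens X} (f : W → Grassmann m) :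
    X → Grassmann m :=
  fun x => if h : x ∈ W then f ⟨x, h⟩ else 0

theorem extendZero_apply {W : TopologicalSpace.Opens X} (f : W → Grassmann m) (x : W) :
    extendZero f x = f x := by
  simp [extendZero]

/-- Over an open subset `W` of the domain of a chart `c = (x¹, …, xⁿ)`, the superalgebra
`C^∞(W) ⊗ Λ(ξ¹, …, ξᵐ)`: Grassmann-valued functions on `W` all of whose coefficients are smooth
functions of `x¹, …, xⁿ`. -/
noncomputable def SuperFun (m : ℕ) (c : OpenPartialHomeomorph X (Fin n → ℝ))
    (W : TopologicalSpace.Opens X) : Subalgebra ℝ (W → Grassmann m) where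
  carrier := {f | ∀ I : Finset (Fin m), ContDiffOn ℝ ∞
    (fun y => Grassmann.coeff I (extendZero f (c.symm y))) (c.target ∩ c.symm ⁻¹' W)}
  mul_mem' := by
    intro f g hf hg I
    have key : ∀ y ∈ c.target ∩ c.symm ⁻¹' W,
        Grassmann.coeff I (extendZero (f * g) (c.symm y)) =
          ∑ J, ∑ K, Grassmann.coeff J (extendZero f (c.symm y)) *
            Grassmann.coeff K (extendZero g (c.symm y)) *
            Grassmann.coeff I (Grassmann.monomials m J * Grassmann.monomials m K) := by
      intro y hy
      have hW : c.symm y ∈ W := hy.2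
      have h1 : extendZero (f * g) (c.symm y)
          = extendZero f (c.symm y) * extendZero g (c.symm y) := by
        simp [extendZero, hW]
      rw [h1]
      conv_lhs => rw [← (Grassmann.monomials m).sum_repr (extendZero f (c.symm y)),
        ← (Grassmann.monomials m).sum_repr (extendZero g (c.symm y))]
      simp only [Finset.sum_mul_sum, map_sum, smul_mul_smul_comm, map_smul, smul_eq_mul]
      rfl
    refine ContDiffOn.congr ?_ key
    exact ContDiffOn.sum fun J _ => ContDiffOn.sum fun K _ =>
      ((hf J).mul (hg K)).mul contDiffOn_const
  add_mem' := by
    intro f g hf hg I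
    refine ContDiffOn.congr ((hf I).add (hg I)) fun y hy => ?_
    have hW : c.symm y ∈ W := hy.2
    simp [extendZero, hW]
  algebraMap_mem' := by
    intro r I
    refine ContDiffOn.congr (contDiffOn_const (c := Grassmann.coeff I (algebraMap ℝ _ r)))
      fun y hy => ?_
    have hW : c.symm y ∈ W := hy.2
    simp [extendZero, hW]

variable {c : OpenPartialHomeomorph X (Fin n → ℝ)}

/-- Restriction of superfunctions to a smaller open set. -/
noncomputable def SuperFun.res {W W' : TopologicalSpace.Opens X} (h : W' ≤ W) :
    SuperFun m c W →ₐ[ℝ] SuperFun m c W' where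
  toFun f := ⟨fun x => f.1 ⟨x, h x.2⟩, fun I => by
    refine ContDiffOn.congr ((f.2 I).mono fun y hy => ⟨hy.1, h hy.2⟩) fun y hy => ?_
    have h1 : c.symm y ∈ W' := hy.2
    have h2 : c.symm y ∈ W := h hy.2
    simp [extendZero, h1, h2]⟩
  map_one' := rfl
  map_mul' _ _ := rfl
  map_zero' := rfl
  map_add' _ _ := rfl
  commutes' _ := rfl

/-- The parity of a coordinate: `x¹, …, xⁿ` are even and `ξ¹, …, ξᵐ` are odd. -/
def coordParity : Fin n ⊕ Fin m → ZMod 2 := Sum.elim (fun _ => 0) (fun _ => 1)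

/-- The coordinates `x^a`, `ξ^α` as superfunctions. -/
noncomputable def SuperFun.coord (m : ℕ) (c : OpenPartialHomeomorph X (Fin n → ℝ))
    (W : TopologicalSpace.Opens X) : Fin n ⊕ Fin m → SuperFun m c W
  | Sum.inl a => ⟨fun x => algebraMap ℝ _ (c x a), fun I => by
      have h : ContDiff ℝ ∞ (fun y : Fin n → ℝ => y a * Grassmann.coeff (m := m) I 1) :=
        (contDiff_apply ℝ ℝ a).mul contDiff_const
      refine ContDiffOn.congr h.contDiffOn fun y hy => ?_
      have h1 : c.symm y ∈ W := hy.2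
      simp [extendZero, h1, Algebra.algebraMap_eq_smul_one, c.right_inv hy.1]⟩
  | Sum.inr α => ⟨fun _ => Grassmann.xi α, fun I => by
      refine ContDiffOn.congr (contDiffOn_const (c := Grassmann.coeff I (Grassmann.xi α)))
        fun y hy => ?_
      have h1 : c.symm y ∈ W := hy.2
      simp [extendZero, h1]⟩

/-- The (left) partial derivative `∂_A` with respect to a coordinate of the chart `c`. -/
noncomputable def superDeriv (c : OpenPartialHomeomorph X (Fin n → ℝ)) :
    Fin n ⊕ Fin m → (X → Grassmann m) → X → Grassmann m
  | Sum.inl a, f, x => ∑ I : Finset (Fin m),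
      fderiv ℝ (fun y => Grassmann.coeff I (f (c.symm y))) (c x) (Pi.single a 1) •
        Grassmann.monomials m I
  | Sum.inr α, f, x => Grassmann.oddDeriv α (f x)

end SuperFunctions

/-! ### Supermanifolds -/

/-- A structure of a smooth supermanifold of dimension `n|m` on the topological space `X`: `X` is
covered by charts, over the domain of each chart the structure sheaf is `C^∞ ⊗ Λ(ξ¹, …, ξᵐ)`,
and these sheaves are glued over the intersections of the chart domains by isomorphisms of
sheaves of superalgebras `trans i j` (which express a superfunction given in the `i`-th
coordinates through the `j`-th coordinates) that satisfy the cocycle condition. -/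
structure SuperManifold (n m : ℕ) (X : Type u) [TopologicalSpace X] where
  /-- The index set of the atlas. -/
  Index : Type v
  /-- The underlying charts of `X`. -/
  chart : Index → OpenPartialHomeomorph X (Fin n → ℝ)
  exists_chart : ∀ x, ∃ i, x ∈ (chart i).source
  /-- The change of coordinates over an open subset `W` of the intersection of two domains. -/
  trans : ∀ (i j : Index) (W : TopologicalSpace.Opens X),
    (W : Set X) ⊆ (chart i).source → (W : Set X) ⊆ (chart j).source →
      (SuperFun m (chart i) W →ₐ[ℝ] SuperFun m (chart j) W)
  trans_parity : ∀ i j W hi hj (p : ZMod 2) (f : SuperFun m (chart i) W),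
    (∀ x, f.1 x ∈ Grassmann.part m p) → ∀ x, (trans i j W hi hj f).1 x ∈ Grassmann.part m p
  trans_res : ∀ i j (W W' : TopologicalSpace.Opens X) (h : W' ≤ W) hi hj hi' hj'
    (f : SuperFun m (chart i) W),
    SuperFun.res h (trans i j W hi hj f) = trans i j W' hi' hj' (SuperFun.res h f)
  trans_self : ∀ i W hi hi' (f : SuperFun m (chart i) W), trans i i W hi hi' f = f
  trans_trans : ∀ i j k W hi hj hk (f : SuperFun m (chart i) W),
    trans j k W hj hk (trans i j W hi hj f) = trans i k W hi hk f

namespace SuperManifold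

variable {n m : ℕ} {X : Type u} [TopologicalSpace X] (M : SuperManifold.{u, v} n m X)

/-- The domain of a chart. -/
def dom (i : M.Index) : TopologicalSpace.Opens X := ⟨(M.chart i).source, (M.chart i).open_source⟩

/-- The superfunctions on the domain of the `i`-th chart. -/
abbrev Fn (i : M.Index) : Type u := SuperFun m (M.chart i) (M.dom i)

/-- The change of coordinates over `dom i ⊓ dom j`. -/
noncomputable def change (i j : M.Index) :
    SuperFun m (M.chart i) (M.dom i ⊓ M.dom j) →ₐ[ℝ] SuperFun m (M.chart j) (M.dom i ⊓ M.dom j) :=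
  M.trans i j (M.dom i ⊓ M.dom j) (fun _ h => h.1) (fun _ h => h.2)

/-- The Jacobi matrix `(∂x_i^B / ∂x_j^A)_{A, B}` of the coordinates of the `i`-th chart with
respect to those of the `j`-th chart, at a point of `dom i ⊓ dom j`. -/
noncomputable def jacobiMatrix (i j : M.Index) (x : X) :
    Matrix (Fin n ⊕ Fin m) (Fin n ⊕ Fin m) (Grassmann m) :=
  Matrix.of fun A B => superDeriv (M.chart j) A
    (extendZero (M.change i j (SuperFun.coord m (M.chart i) _ B)).1) x

/-- The factor `J = Dx_i / Dx_j` between the coordinate volume elements. -/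
noncomputable def jacobian (i j : M.Index) (x : X) : Grassmann.Even m :=
  Grassmann.orientedBerezinian (M.jacobiMatrix i j x)

/-- All factors `J = Dx_i / Dx_j = sgn (det (∂x_i/∂x_j)) Ber` between coordinate volume elements
are positive, so that they have real powers and volume forms can be integrated over `X`. This
holds for all ordinary manifolds (`m = 0`), orientable or not. -/
def PositiveJacobians : Prop :=
  ∀ i j x, x ∈ M.dom i → x ∈ M.dom j →
    0 < Grassmann.body (M.jacobian i j x : Grassmann m)

/-! ### The algebra of densities -/

/-- A family of local expressions `ψ_i = ∑_w ψ_{i,w}(x_i) (Dx_i)^w` is compatible with the changes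
of coordinates. -/
def Compatible (ψ : ∀ i, AddMonoidAlgebra (M.Fn i) ℝ) : Prop :=
  ∀ i j (w : ℝ) (x : X) (hi : x ∈ M.dom i) (hj : x ∈ M.dom j),
    ((ψ j).coeff w).1 ⟨x, hj⟩ =
      (M.change i j (SuperFun.res inf_le_left ((ψ i).coeff w))).1 ⟨x, hi, hj⟩ *
        (Grassmann.pow (M.jacobian i j x) w : Grassmann m)

/-- The coefficients of a product in a monoid algebra. -/
theorem coeff_mul_of_subset {R : Type*} [Ring R] (f g : AddMonoidAlgebra R ℝ) {s t : Finset ℝ}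
    (hs : f.coeff.support ⊆ s) (ht : g.coeff.support ⊆ t) (w : ℝ) :
    (f * g).coeff w = ∑ a ∈ s, ∑ b ∈ t, if a + b = w then f.coeff a * g.coeff b else 0 := by
  classical
  rw [AddMonoidAlgebra.coeff_mul, Finsupp.sum_of_support_subset _ hs _ (by simp)]
  refine Finset.sum_congr rfl fun a _ => ?_
  rw [Finsupp.sum_of_support_subset _ ht _ (by simp)]

/-- The algebra `𝔙(M)` of densities: finite formal sums `∑_w ψ_w (Dx)^w`, `w ∈ ℝ`, of densities of
weight `w`. In each chart an element is given by its generating function `∑_w ψ_w(x) t^w`, and the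
local expressions are compatible. -/
noncomputable def Densities : Subalgebra ℝ (∀ i, AddMonoidAlgebra (M.Fn i) ℝ) where
  carrier := {ψ | M.Compatible ψ ∧ ∃ s : Finset ℝ, ∀ i, (ψ i).coeff.support ⊆ s}
  mul_mem' := by
    classical
    rintro f g ⟨hf, s, hs⟩ ⟨hg, t, ht⟩
    refine ⟨fun i j w x hi hj => ?_, Finset.image₂ (· + ·) s t, fun i => ?_⟩
    · have e1 := coeff_mul_of_subset (f j) (g j) (hs j) (ht j) w
      have e2 := coeff_mul_of_subset (f i) (g i) (hs i) (ht i) w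
      have hsub : ∀ (k : M.Index) (W : TopologicalSpace.Opens X) (y : W)
          (F : ℝ → ℝ → SuperFun m (M.chart k) W),
          (∑ a ∈ s, ∑ b ∈ t, F a b).1 y = ∑ a ∈ s, ∑ b ∈ t, (F a b).1 y := by
        intro k W y F
        simp [Finset.sum_apply]
      change ((f j * g j).coeff w).1 ⟨x, hj⟩ =
        (M.change i j (SuperFun.res inf_le_left ((f i * g i).coeff w))).1 ⟨x, hi, hj⟩ * _
      rw [e1, e2]
      simp only [map_sum]
      rw [hsub, hsub, Finset.sum_mul]
      refine Finset.sum_congr rfl fun a _ => ?_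
      rw [Finset.sum_mul]
      refine Finset.sum_congr rfl fun b _ => ?_
      split_ifs with hab
      · subst hab
        rw [map_mul, map_mul, Grassmann.pow_add']
        change ((f j).coeff a).1 ⟨x, hj⟩ * ((g j).coeff b).1 ⟨x, hj⟩ = _
        rw [hf i j a x hi hj, hg i j b x hi hj]
        simp only [MulMemClass.coe_mul, Pi.mul_apply]
        have hc := (Grassmann.even_comm (Grassmann.pow (M.jacobian i j x) a).2
          ((M.change i j (SuperFun.res inf_le_left ((g i).coeff b))).1 ⟨x, hi, hj⟩)).eq
        rw [mul_assoc, ← mul_assoc (Grassmann.pow (M.jacobian i j x) a : Grassmann m), hc]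
        simp only [mul_assoc]
      · simp
    · intro w hw
      by_contra hn
      refine Finsupp.mem_support_iff.1 hw ?_
      change (f i * g i).coeff w = 0
      rw [coeff_mul_of_subset (f i) (g i) (hs i) (ht i) w]
      refine Finset.sum_eq_zero fun a ha => Finset.sum_eq_zero fun b hb => ?_
      rw [if_neg]
      rintro rfl
      exact hn (Finset.mem_image₂_of_mem ha hb)
  add_mem' := by
    classical
    rintro f g ⟨hf, s, hs⟩ ⟨hg, t, ht⟩
    refine ⟨fun i j w x hi hj => ?_, s ∪ t, fun i => ?_⟩
    · change ((f j).coeff w).1 ⟨x, hj⟩ + ((g j).coeff w).1 ⟨x, hj⟩ =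
        (M.change i j (SuperFun.res inf_le_left ((f i).coeff w + (g i).coeff w))).1 ⟨x, hi, hj⟩ * _
      rw [hf i j w x hi hj, hg i j w x hi hj, map_add, map_add, ← add_mul]
      rfl
    · exact Finsupp.support_add.trans (Finset.union_subset_union (hs i) (ht i))
  algebraMap_mem' := by
    classical
    intro r
    have key : ∀ (i : M.Index) (w : ℝ),
        ((algebraMap ℝ (∀ i, AddMonoidAlgebra (M.Fn i) ℝ) r) i).coeff w
          = if w = 0 then algebraMap ℝ (M.Fn i) r else 0 := by
      intro i w
      change (algebraMap ℝ (AddMonoidAlgebra (M.Fn i) ℝ) r).coeff w = _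
      rw [AddMonoidAlgebra.coe_algebraMap]
      simp [Finsupp.single_apply, eq_comm]
    refine ⟨fun i j w x hi hj => ?_, {0}, fun i => ?_⟩
    · rw [key, key]
      split_ifs with h
      · subst h
        rw [Grassmann.pow_zero', AlgHom.commutes, AlgHom.commutes]
        simp
      · simp
    · intro w hw
      by_contra hn
      refine Finsupp.mem_support_iff.1 hw ?_
      rw [key, if_neg (by simpa using hn)]

noncomputable instance : Ring M.Densities :=
  Subalgebra.toRing (R := ℝ) (A := ∀ i, AddMonoidAlgebra (M.Fn i) ℝ) M.Densities

variable {M}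

/-- The coefficient `ψ_w` of the density `ψ` in the `i`-th chart (extended by zero). -/
noncomputable def component (ψ : M.Densities) (i : M.Index) (w : ℝ) : X → Grassmann m :=
  extendZero ((ψ.1 i).coeff w).1

/-- `ψ` is homogeneous of weight `w`. -/
def HasWeight (ψ : M.Densities) (w : ℝ) : Prop :=
  ∀ i, (ψ.1 i).coeff.support ⊆ {w}

/-- `ψ` is homogeneous of parity `p`. -/
def HasParity (ψ : M.Densities) (p : ZMod 2) : Prop :=
  ∀ i w x, component ψ i w x ∈ Grassmann.part m p

/-- `ψ` vanishes outside the set `K`. -/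
def VanishesOutside (ψ : M.Densities) (K : Set X) : Prop :=
  ∀ i w, ∀ x ∉ K, component ψ i w x = 0

/-- `ψ` has compact support. -/
def CompactlySupported (ψ : M.Densities) : Prop :=
  ∃ K : Set X, IsCompact K ∧ VanishesOutside ψ K

/-- The Berezin integral, in the coordinates of the `i`-th chart, of the component of weight `1`
(the volume form) of a density. -/
noncomputable def chartIntegral (i : M.Index) (ψ : M.Densities) : ℝ :=
  ∫ y in (M.chart i).target, Grassmann.top (component ψ i 1 ((M.chart i).symm y))

/-- `c` is the integral over the supermanifold of the component of weight `1` of `ψ`: the density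
`ψ` is a finite sum of densities with compact supports in charts, and `c` is the sum of their
integrals in these charts. -/
def HasIntegral (ψ : M.Densities) (c : ℝ) : Prop :=
  ∃ (N : ℕ) (i : Fin N → M.Index) (φ : Fin N → M.Densities),
    (∀ k, ∃ K ⊆ (M.chart (i k)).source, IsCompact K ∧ VanishesOutside (φ k) K) ∧
    ψ = ∑ k, φ k ∧ c = ∑ k, chartIntegral (i k) (φ k)

open Classical in
/-- The integral over the supermanifold of the component of weight `1` of a density with compact
support. -/
noncomputable def integral (ψ : M.Densities) : ℝ :=
  if h : ∃ c, HasIntegral ψ c then h.choose else 0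

/-- The scalar product `⟨ψ, χ⟩`: the integral of the part of weight `1` of `ψ χ`. -/
noncomputable def scalarProduct (ψ χ : M.Densities) : ℝ := integral (ψ * χ)

/-! ### Brackets and operators -/

/-- The sign `(-1)^p`. -/
def sgn (p : ZMod 2) : ℝ := (-1) ^ p.val

/-- A long bracket of parity `ε` and weight `l`: a symmetric bi-derivation of the algebra of
densities. -/
structure IsLongBracket (ε : ZMod 2) (l : ℝ)
    (B : M.Densities →ₗ[ℝ] M.Densities →ₗ[ℝ] M.Densities) : Prop where
  parity : ∀ {ψ χ p q}, HasParity ψ p → HasParity χ q → HasParity (B ψ χ) (p + q + ε)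
  weight : ∀ {ψ χ w₁ w₂}, HasWeight ψ w₁ → HasWeight χ w₂ → HasWeight (B ψ χ) (w₁ + w₂ + l)
  symm : ∀ {ψ χ p q}, HasParity ψ p → HasParity χ q → B ψ χ = sgn (p * q) • B χ ψ
  leibniz : ∀ {ψ χ p q} (φ : M.Densities), HasParity ψ p → HasParity χ q →
    B ψ (χ * φ) = B ψ χ * φ + sgn ((p + ε) * q) • (χ * B ψ φ)

/-- The bracket `B` of weight `l` depends continuously on the weights of its arguments: for
densities `χ_w = f(x) (Dx)^w` of weights `w ∈ ℝ` with the same coefficient `f` in a chart, the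
value of the coefficient of `{ψ; χ_w}` at each point of the chart is continuous in `w`. (By
symmetry the same then holds for the first argument.) -/
def ContinuousInWeight (l : ℝ) (B : M.Densities →ₗ[ℝ] M.Densities →ₗ[ℝ] M.Densities) : Prop :=
  ∀ (i : M.Index) (ψ : M.Densities) (w₁ : ℝ) (χ : ℝ → M.Densities),
    HasWeight ψ w₁ → (∀ w, HasWeight (χ w) w) →
    (∀ w w', component (χ w) i w = component (χ w') i w') →
    ∀ (x : M.dom i) (I : Finset (Fin m)),
      Continuous fun w => Grassmann.coeff I (component (B ψ (χ w)) i (w₁ + w + l) x)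

/-- The operator `Δ` has parity `ε`. -/
def OperatorParity (ε : ZMod 2) (Δ : M.Densities →ₗ[ℝ] M.Densities) : Prop :=
  ∀ ψ p, HasParity ψ p → HasParity (Δ ψ) (p + ε)

/-- The operator `Δ` has weight `l`. -/
def OperatorWeight (l : ℝ) (Δ : M.Densities →ₗ[ℝ] M.Densities) : Prop :=
  ∀ ψ w, HasWeight ψ w → HasWeight (Δ ψ) (w + l)

/-- `Δ* = Δ` for an operator of parity `ε`: formal self-adjointness with respect to the scalar
product, `⟨Δψ, χ⟩ = (-1)^{ε p} ⟨ψ, Δχ⟩` for `ψ` of parity `p`. -/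
def SelfAdjoint (ε : ZMod 2) (Δ : M.Densities →ₗ[ℝ] M.Densities) : Prop :=
  ∀ ψ χ p, HasParity ψ p → CompactlySupported ψ → CompactlySupported χ →
    scalarProduct (Δ ψ) χ = sgn (p * ε) * scalarProduct ψ (Δ χ)

/-- The operator `Δ` generates the bracket `B`. -/
def Generates (ε : ZMod 2) (Δ : M.Densities →ₗ[ℝ] M.Densities)
    (B : M.Densities →ₗ[ℝ] M.Densities →ₗ[ℝ] M.Densities) : Prop :=
  ∀ ψ χ p, HasParity ψ p → B ψ χ = Δ (ψ * χ) - Δ ψ * χ - sgn (p * ε) • (ψ * Δ χ)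

/-- The operator `Δ` of parity `ε` is self-adjoint, annihilates `1` and generates the bracket
`B`. -/
structure IsCanonicalGenerator (ε : ZMod 2)
    (B : M.Densities →ₗ[ℝ] M.Densities →ₗ[ℝ] M.Densities)
    (Δ : M.Densities →ₗ[ℝ] M.Densities) : Prop where
  parity : OperatorParity ε Δ
  selfAdjoint : SelfAdjoint ε Δ
  map_one : Δ 1 = 0
  generates : Generates ε Δ B

/-! ### Expressions in local coordinates -/

variable (M) in
/-- Local data `S^{ab}`, `γ^a`, `θ` of a bracket of parity `ε` in the coordinates of the `i`-th
chart. -/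
structure BracketData (ε : ZMod 2) (i : M.Index) where
  S : Fin n ⊕ Fin m → Fin n ⊕ Fin m → M.Fn i
  γ : Fin n ⊕ Fin m → M.Fn i
  θ : M.Fn i
  parity_S : ∀ a b x, (S a b).1 x ∈ Grassmann.part m (coordParity a + coordParity b + ε)
  parity_γ : ∀ a x, (γ a).1 x ∈ Grassmann.part m (coordParity a + ε)
  parity_θ : ∀ x, θ.1 x ∈ Grassmann.part m ε
  symm_S : ∀ a b, S a b = sgn (coordParity a * coordParity b) • S b a

/-- In the `i`-th chart, the bracket `B` of weight `l` is given by the data `d`: for `ψ` of weight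
`w₁` and parity `p` and `χ` of weight `w₂`,
`{ψ; χ} = ((-1)^{a p} S^{ab} ∂_b ψ ∂_a χ + γ^a (w₂ ∂_a ψ χ + (-1)^{a p} w₁ ψ ∂_a χ)`
`+ w₁ w₂ θ ψ χ) (Dx)^{w₁ + w₂ + l}`. -/
def BracketData.Represents {ε : ZMod 2} {i : M.Index} (d : M.BracketData ε i) (l : ℝ)
    (B : M.Densities →ₗ[ℝ] M.Densities →ₗ[ℝ] M.Densities) : Prop :=
  ∀ (ψ χ : M.Densities) (w₁ w₂ : ℝ) (p : ZMod 2),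
    HasWeight ψ w₁ → HasWeight χ w₂ → HasParity ψ p → ∀ x : M.dom i,
      component (B ψ χ) i (w₁ + w₂ + l) x =
        (∑ a, ∑ b, sgn (coordParity a * p) •
          ((d.S a b).1 x * superDeriv (M.chart i) b (component ψ i w₁) x *
            superDeriv (M.chart i) a (component χ i w₂) x)) +
        (∑ a, (d.γ a).1 x *
          (w₂ • (superDeriv (M.chart i) a (component ψ i w₁) x * component χ i w₂ x) +
            (sgn (coordParity a * p) * w₁) •
              (component ψ i w₁ x * superDeriv (M.chart i) a (component χ i w₂) x))) +
        (w₁ * w₂) • (d.θ.1 x * component ψ i w₁ x * component χ i w₂ x)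

/-- The canonical pencil `Δ_w` of weight `l` built from the data `d`, applied to a superfunction
`f` on the domain of the `i`-th chart:
`Δ_w f = 1/2 (S^{ab} ∂_b ∂_a f + ((-1)^{b (ε + 1)} ∂_b S^{ba} + (2 w + l - 1) γ^a) ∂_a f`
`+ w (-1)^{a (ε + 1)} ∂_a γ^a f + w (w + l - 1) θ f)`. -/
noncomputable def BracketData.pencil {ε : ZMod 2} {i : M.Index} (d : M.BracketData ε i) (l w : ℝ)
    (f : X → Grassmann m) (x : M.dom i) : Grassmann m :=
  (1 / 2 : ℝ) •
    ((∑ a, ∑ b, (d.S a b).1 x *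
        superDeriv (M.chart i) b (superDeriv (M.chart i) a f) x) +
      (∑ a, ((∑ b, sgn (coordParity b * (ε + 1)) •
          superDeriv (M.chart i) b (extendZero (d.S b a).1) x) +
          (2 * w + l - 1) • (d.γ a).1 x) * superDeriv (M.chart i) a f x) +
      w • ((∑ a, sgn (coordParity a * (ε + 1)) •
        superDeriv (M.chart i) a (extendZero (d.γ a).1) x) * f x) +
      (w * (w + l - 1)) • (d.θ.1 x * f x))

/-- In the `i`-th chart, the operator `Δ` of weight `l` is the canonical pencil built from `d`. -/
def BracketData.IsPencilOf {ε : ZMod 2} {i : M.Index} (d : M.BracketData ε i) (l : ℝ)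
    (Δ : M.Densities →ₗ[ℝ] M.Densities) : Prop :=
  ∀ (ψ : M.Densities) (w : ℝ), HasWeight ψ w → ∀ x : M.dom i,
    component (Δ ψ) i (w + l) x = d.pencil l w (component ψ i w) x

end SuperManifold

/-! Suppose a self-adjoint `Δ` with `Δ 1 = 0` generates the bracket. Integrating the generating
identity gives ∫{ψ;χ} = ∫Δ(ψχ) − 2⟨Δψ, χ⟩, and formally ∫Δ(ψχ) = ±⟨ψχ, Δ1⟩ = 0. So `Δ` has to be
defined by ⟨Δψ, χ⟩ = −½ ∫{ψ;χ} for all test densities χ: up to the factor −½, Δψ is the divergence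
of the superderivation {ψ; ·} of the algebra of densities.

Existence of divergences (`exists_divergence`). A superderivation of the densities is local.
Hadamard's lemma, together with the nilpotency of the augmentation ideal of the Grassmann algebra,
shows that in a chart it is Σ Y^A ∂_A + C_w on densities of weight w, with C_w additive in w
(`pointDerivation_eq_sum`, `component_derivation`). Integration by parts then yields a divergence in
each chart. The local divergences glue without any computation of transformation laws: near a common
point they represent the same functional χ ↦ ∫Dχ, and the Berezin pairing is nondegenerate
(`localDiv_compatible`, `component_eq_zero_of_chartIntegral_mul`).

This rests on the invariance of the Berezin integral (`chartInt_change`). The Jacobian J is a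
superfunction with logarithmic derivative str(∂M · M⁻¹), M being the Jacobi matrix
(`map_berezinian`, `exists_jacobian`). Hence the super Piola identity (`piola`): a derivative in one
chart, multiplied by J, is a divergence in the other and integrates to zero. A superfunction is its
top coefficient times ξ¹⋯ξᵐ plus odd derivatives, so only the top term is left, and for it the
classical change of variables applies. The cocycle property of J and of its real powers follows from
the principle that an even Grassmann element with positive body is determined by its body and its
logarithmic odd derivatives (`Grassmann.eq_pow`).

The rest of (1) is algebra in a supercommutative algebra with a nondegenerate trace
(`IsBiderivation`, `IsTestIntegral`). Symmetry of the bracket makes Δ self-adjoint, {1; ·} = 0 gives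
Δ1 = 0, and the generating identity, tested against c, is the defect formula {xy;z} = {x;yz} ±
{y;xz} − 2{x;y}z. Two generators differ by a self-adjoint superderivation E; comparing the Leibniz
rule with self-adjointness gives x E(y) = 0 for test elements x, y, and this propagates to E = 0.

The pencil in (2) is the coordinate divergence of {ψ; ·} (`divFn_bracketData`). For ψ of weight w
the test density has weight 1 − w − λ, which is the origin of the coefficients 2w + λ − 1 and w(w +
λ − 1). For (3), the local form of a derivation is applied in each argument in turn; the dependence
on the weight is additive, and by continuity linear (`component_germ_one_eq_smul`). -/

namespace SuperManifold

/-! ### Signs. -/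

@[simp] theorem sgn_zero : sgn 0 = 1 := by simp [sgn]
@[simp] theorem sgn_one : sgn 1 = -1 := by simp [sgn, ZMod.val_one]

theorem zmod_two_cases (p : ZMod 2) : p = 0 ∨ p = 1 := by revert p; decide

theorem sgn_add (p q : ZMod 2) : sgn (p + q) = sgn p * sgn q := by
  have h : (1 + 1 : ZMod 2) = 0 := by decide
  rcases zmod_two_cases p with rfl | rfl <;> rcases zmod_two_cases q with rfl | rfl <;> simp [h]

theorem sgn_mul_self (p : ZMod 2) : sgn p * sgn p = 1 := by
  rcases zmod_two_cases p with rfl | rfl <;> simp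

theorem sgn_smul_sgn_smul {V : Type*} [AddCommGroup V] [Module ℝ V] (p : ZMod 2) (x : V) :
    sgn p • sgn p • x = x := by
  rw [smul_smul, sgn_mul_self, one_smul]

end SuperManifold

open SuperManifold (sgn sgn_zero sgn_one sgn_add sgn_mul_self zmod_two_cases)

/-! ### Parity, supercommutativity and odd derivatives in the Grassmann algebra. -/

namespace Grassmann

variable {m : ℕ}

theorem mul_mem_part {p q : ZMod 2} {x y : Grassmann m} (hx : x ∈ part m p) (hy : y ∈ part m q) :
    x * y ∈ part m (p + q) :=
  CliffordAlgebra.evenOdd_mul_le 0 p q (Submodule.mul_mem_mul hx hy)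

theorem algebraMap_mem_part (r : ℝ) : algebraMap ℝ (Grassmann m) r ∈ part m 0 :=
  SetLike.algebraMap_mem_graded (CliffordAlgebra.evenOdd (0 : QuadraticForm ℝ (Fin m → ℝ))) _

theorem one_mem_part : (1 : Grassmann m) ∈ part m 0 := by
  simpa using algebraMap_mem_part (m := m) 1

theorem xi_mem_part (α : Fin m) : xi α ∈ part m 1 := CliffordAlgebra.ι_mem_evenOdd_one _ _

theorem ι_mem_part (v : Fin m → ℝ) : ExteriorAlgebra.ι ℝ v ∈ part m 1 :=
  CliffordAlgebra.ι_mem_evenOdd_one _ _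

/-- The `p`-th power of the parity involution. -/
noncomputable def twist (p : ZMod 2) : Grassmann m →ₐ[ℝ] Grassmann m :=
  if p = 0 then AlgHom.id ℝ _ else CliffordAlgebra.involute

@[simp] theorem twist_zero (x : Grassmann m) : twist 0 x = x := by simp [twist]

theorem twist_one (x : Grassmann m) : twist 1 x = CliffordAlgebra.involute x := by simp [twist]

theorem twist_of_mem {p q : ZMod 2} {x : Grassmann m} (hx : x ∈ part m q) :
    twist p x = sgn (p * q) • x := by
  rcases zmod_two_cases p with rfl | rfl
  · simp
  · rw [twist_one]
    rcases zmod_two_cases q with rfl | rfl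
    · simpa using CliffordAlgebra.involute_eq_of_mem_even hx
    · simpa using CliffordAlgebra.involute_eq_of_mem_odd hx

theorem twist_twist (p q : ZMod 2) (x : Grassmann m) : twist p (twist q x) = twist (p + q) x := by
  have h : (1 + 1 : ZMod 2) = 0 := by decide
  rcases zmod_two_cases p with rfl | rfl <;> rcases zmod_two_cases q with rfl | rfl
  · simp
  · simp
  · simp
  · rw [h, twist_one, twist_one, CliffordAlgebra.involute_involute, twist_zero]

/-- The component of parity `p`. -/
noncomputable def proj (p : ZMod 2) : Grassmann m →ₗ[ℝ] Grassmann m :=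
  (1 / 2 : ℝ) • (LinearMap.id + sgn p • (twist 1).toLinearMap)

theorem proj_apply (p : ZMod 2) (x : Grassmann m) :
    proj p x = (1 / 2 : ℝ) • (x + sgn p • twist 1 x) := rfl

theorem proj_add_proj (x : Grassmann m) : proj 0 x + proj 1 x = x := by
  simp only [proj_apply, sgn_zero, sgn_one]
  module

theorem proj_of_mem {p : ZMod 2} {x : Grassmann m} (hx : x ∈ part m p) : proj p x = x := by
  rw [proj_apply, twist_of_mem hx, one_mul, SuperManifold.sgn_smul_sgn_smul]
  module

theorem proj_of_mem_ne {p q : ZMod 2} {x : Grassmann m} (hx : x ∈ part m q) (h : p ≠ q) :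
    proj p x = 0 := by
  rw [proj_apply, twist_of_mem hx, one_mul]
  rcases zmod_two_cases p with rfl | rfl <;> rcases zmod_two_cases q with rfl | rfl
  · exact absurd rfl h
  · simp
  · simp
  · exact absurd rfl h

theorem exists_part_decomp (x : Grassmann m) :
    ∃ y ∈ part m 0, ∃ z ∈ part m 1, x = y + z := by
  have h := (CliffordAlgebra.evenOdd_isCompl (0 : QuadraticForm ℝ (Fin m → ℝ))).sup_eq_top
  have hx : x ∈ part m 0 ⊔ part m 1 := by rw [part, part, h]; trivial
  obtain ⟨y, hy, z, hz, rfl⟩ := Submodule.mem_sup.1 hx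
  exact ⟨y, hy, z, hz, rfl⟩

theorem proj_mem (p : ZMod 2) (x : Grassmann m) : proj p x ∈ part m p := by
  obtain ⟨y, hy, z, hz, rfl⟩ := exists_part_decomp x
  rw [map_add]
  rcases zmod_two_cases p with rfl | rfl
  · rw [proj_of_mem hy, proj_of_mem_ne hz (by decide), add_zero]; exact hy
  · rw [proj_of_mem hz, proj_of_mem_ne hy (by decide), zero_add]; exact hz

theorem odd_anticomm {x y : Grassmann m} (hx : x ∈ part m 1) (hy : y ∈ part m 1) :
    x * y = -(y * x) := by
  induction x, hx using CliffordAlgebra.odd_induction with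
  | ι v =>
    induction y, hy using CliffordAlgebra.odd_induction with
    | ι w => exact ι_anticomm v w
    | add a b _ _ iha ihb => rw [mul_add, iha, ihb, add_mul, neg_add]
    | ι_mul_ι_mul w w' a _ ih =>
      have h := (ι_mul_ι_comm w w' (ExteriorAlgebra.ι ℝ v)).eq
      change ExteriorAlgebra.ι ℝ v * (ExteriorAlgebra.ι ℝ w * ExteriorAlgebra.ι ℝ w' * a)
        = -(ExteriorAlgebra.ι ℝ w * ExteriorAlgebra.ι ℝ w' * a * ExteriorAlgebra.ι ℝ v)
      change ExteriorAlgebra.ι ℝ v * a = -(a * ExteriorAlgebra.ι ℝ v) at ih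
      rw [← mul_assoc, ← h, mul_assoc, ih, mul_neg, mul_assoc, mul_assoc, mul_assoc]
  | add a b _ _ iha ihb => rw [mul_add, add_mul, iha, ihb, neg_add]
  | ι_mul_ι_mul w w' a _ ih =>
    have h := (ι_mul_ι_comm w w' y).eq
    change ExteriorAlgebra.ι ℝ w * ExteriorAlgebra.ι ℝ w' * a * y
      = -(y * (ExteriorAlgebra.ι ℝ w * ExteriorAlgebra.ι ℝ w' * a))
    rw [mul_assoc, ih, mul_neg, ← mul_assoc, h, mul_assoc, mul_assoc]

theorem mul_comm_of_mem {p q : ZMod 2} {x y : Grassmann m} (hx : x ∈ part m p)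
    (hy : y ∈ part m q) : x * y = sgn (p * q) • (y * x) := by
  rcases zmod_two_cases p with rfl | rfl
  · simpa using (even_comm hx y).eq
  · rcases zmod_two_cases q with rfl | rfl
    · simpa using (even_comm hy x).eq.symm
    · simpa using odd_anticomm hx hy

/-- The second factor need not be homogeneous: the sign, which depends on its parity, is absorbed in
the automorphism `twist p`. Superderivations can thus be handled on all elements without splitting
them into parity parts. -/
theorem mul_comm_twist {p : ZMod 2} {x : Grassmann m} (hx : x ∈ part m p) (y : Grassmann m) :
    x * y = twist p y * x := by
  obtain ⟨a, ha, b, hb, rfl⟩ := exists_part_decomp y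
  rw [mul_add, map_add, add_mul, twist_of_mem ha, twist_of_mem hb, mul_comm_of_mem hx ha,
    mul_comm_of_mem hx hb, smul_mul_assoc, smul_mul_assoc]

@[simp] theorem body_algebraMap (r : ℝ) : body (algebraMap ℝ (Grassmann m) r) = r := by simp

@[simp] theorem body_ι (v : Fin m → ℝ) : body (ExteriorAlgebra.ι ℝ v) = 0 := by
  simp [body, ExteriorAlgebra.algebraMapInv]

@[simp] theorem body_xi (α : Fin m) : body (xi α) = 0 := body_ι _

theorem body_twist (p : ZMod 2) (x : Grassmann m) : body (twist p x) = body x := by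
  rcases zmod_two_cases p with rfl | rfl
  · simp
  · have : (body (m := m)).comp (twist 1) = body := by
      apply ExteriorAlgebra.hom_ext
      ext i
      change body (twist 1 (ExteriorAlgebra.ι ℝ _)) = body (ExteriorAlgebra.ι ℝ _)
      rw [twist_one]
      erw [CliffordAlgebra.involute_ι]
      rw [map_neg]
      erw [body_ι]
      simp
    exact DFunLike.congr_fun this x

theorem body_of_odd {x : Grassmann m} (hx : x ∈ part m 1) : body x = 0 := by
  have h := body_twist 1 x
  rw [twist_of_mem hx] at h
  simp at h
  linarith

/-! #### Odd derivatives -/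

theorem oddDeriv_ι_mul (α : Fin m) (v : Fin m → ℝ) (x : Grassmann m) :
    oddDeriv α (ExteriorAlgebra.ι ℝ v * x) = v α • x - ExteriorAlgebra.ι ℝ v * oddDeriv α x :=
  CliffordAlgebra.contractLeft_ι_mul _ _ _

@[simp] theorem oddDeriv_algebraMap (α : Fin m) (r : ℝ) :
    oddDeriv α (algebraMap ℝ (Grassmann m) r) = 0 :=
  CliffordAlgebra.contractLeft_algebraMap _ _ _

@[simp] theorem oddDeriv_one (α : Fin m) : oddDeriv α (1 : Grassmann m) = 0 := by
  simpa using oddDeriv_algebraMap (m := m) α 1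

@[simp] theorem oddDeriv_ι (α : Fin m) (v : Fin m → ℝ) :
    oddDeriv α (ExteriorAlgebra.ι ℝ v) = algebraMap ℝ _ (v α) :=
  CliffordAlgebra.contractLeft_ι _ _ _

theorem oddDeriv_xi (α β : Fin m) : oddDeriv α (xi β) = if α = β then 1 else 0 := by
  rw [xi, oddDeriv_ι, Pi.single_apply]
  split_ifs <;> simp

theorem oddDeriv_anticomm (α β : Fin m) (x : Grassmann m) :
    oddDeriv α (oddDeriv β x) = -oddDeriv β (oddDeriv α x) :=
  CliffordAlgebra.contractLeft_comm _ _ _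

/-- The parity involution replaces the sign of the Leibniz rule for inhomogeneous `x`. The induction
on `x` keeps `y` arbitrary, so that a product can be peeled off one factor at a time. -/
theorem oddDeriv_mul (α : Fin m) (x y : Grassmann m) :
    oddDeriv α (x * y) = oddDeriv α x * y + twist 1 x * oddDeriv α y := by
  induction x using ExteriorAlgebra.induction generalizing y with
  | algebraMap r =>
    rw [oddDeriv_algebraMap, zero_mul, zero_add, AlgHom.commutes, ← Algebra.smul_def, map_smul,
      ← Algebra.smul_def]
  | ι v =>
    rw [oddDeriv_ι_mul, oddDeriv_ι, ← Algebra.smul_def, twist_one]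
    erw [CliffordAlgebra.involute_ι]
    rw [neg_mul, sub_eq_add_neg]
  | mul a b ha hb => rw [mul_assoc, ha, hb, ha, map_mul]; noncomm_ring
  | add a b ha hb => rw [add_mul, map_add, ha, hb, map_add, map_add]; noncomm_ring

theorem mem_part_iff {p : ZMod 2} {x : Grassmann m} : x ∈ part m p ↔ twist 1 x = sgn p • x := by
  refine ⟨fun h => by rw [twist_of_mem h, one_mul], fun h => ?_⟩
  have := proj_mem p x
  rw [proj_apply, h, SuperManifold.sgn_smul_sgn_smul] at this
  convert this using 1
  module

theorem oddDeriv_twist (α : Fin m) (x : Grassmann m) :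
    oddDeriv α (twist 1 x) = -twist 1 (oddDeriv α x) := by
  induction x using ExteriorAlgebra.induction with
  | algebraMap r => rw [AlgHom.commutes, oddDeriv_algebraMap]; simp
  | ι v =>
    rw [twist_of_mem (ι_mem_part v), map_smul, oddDeriv_ι, AlgHom.commutes]
    simp
  | mul a b ha hb =>
    rw [map_mul, oddDeriv_mul, oddDeriv_mul, ha, hb, map_add, map_mul, map_mul]
    noncomm_ring
  | add a b ha hb => rw [map_add, map_add, map_add, map_add, ha, hb]; abel

theorem oddDeriv_mem (α : Fin m) {p : ZMod 2} {x : Grassmann m} (hx : x ∈ part m p) :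
    oddDeriv α x ∈ part m (p + 1) := by
  rw [mem_part_iff] at hx ⊢
  have h := oddDeriv_twist α x
  rw [hx, map_smul] at h
  rw [sgn_add, sgn_one, mul_neg_one, neg_smul, h, neg_neg]

end Grassmann

/-! ### The augmentation ideal, the degree filtration and the top coefficient. -/

namespace Grassmann

variable {m : ℕ}

/-- The augmentation ideal, the kernel of the body. -/
noncomputable def aug (m : ℕ) : Submodule ℝ (Grassmann m) := LinearMap.ker (body (m := m)).toLinearMap

theorem mem_aug {x : Grassmann m} : x ∈ aug m ↔ body x = 0 := Iff.rfl

/-- An element minus its body has a generator in front of every term. In this form the powers of the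
ideal can be compared with the exterior powers. -/
theorem aug_eq : aug m = LinearMap.range (ExteriorAlgebra.ι ℝ : (Fin m → ℝ) →ₗ[ℝ] _) * ⊤ := by
  set L := LinearMap.range (ExteriorAlgebra.ι ℝ : (Fin m → ℝ) →ₗ[ℝ] _) with hL
  apply le_antisymm
  · have key : ∀ x : Grassmann m, x - algebraMap ℝ _ (body x) ∈ L * ⊤ := by
      intro x
      induction x using ExteriorAlgebra.induction with
      | algebraMap r => rw [body_algebraMap, sub_self]; exact Submodule.zero_mem _
      | ι v =>
        rw [body_ι, map_zero, sub_zero, ← mul_one (ExteriorAlgebra.ι ℝ v)]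
        exact Submodule.mul_mem_mul ⟨v, rfl⟩ trivial
      | mul a b ha hb =>
        have : a * b - algebraMap ℝ _ (body (a * b)) = (a - algebraMap ℝ _ (body a)) * b
            + body a • (b - algebraMap ℝ _ (body b)) := by
          rw [map_mul, map_mul, Algebra.smul_def]; noncomm_ring
        rw [this]
        refine Submodule.add_mem _ ?_ (Submodule.smul_mem _ _ hb)
        have h2 := Submodule.mul_mem_mul ha (Submodule.mem_top (x := b) (R := ℝ))
        rw [mul_assoc] at h2
        exact (mul_le_mul' le_rfl le_top : _ ≤ _ * (⊤ : Submodule ℝ (Grassmann m))) h2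
      | add a b ha hb =>
        have : a + b - algebraMap ℝ _ (body (a + b)) = (a - algebraMap ℝ _ (body a))
            + (b - algebraMap ℝ _ (body b)) := by rw [map_add, map_add]; abel
        rw [this]
        exact Submodule.add_mem _ ha hb
    intro x hx
    have := key x
    rwa [mem_aug.1 hx, map_zero, sub_zero] at this
  · rw [Submodule.mul_le]
    rintro _ ⟨v, rfl⟩ y -
    rw [mem_aug, map_mul, body_ι, zero_mul]

theorem top_mul_aug_le : ⊤ * aug m ≤ aug m := by
  rw [Submodule.mul_le]
  intro x _ y hy
  rw [mem_aug] at *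
  rw [map_mul, hy, mul_zero]

theorem aug_pow_le (k : ℕ) : aug m ^ k ≤ (⋀[ℝ]^k (Fin m → ℝ)) * ⊤ := by
  induction k with
  | zero =>
    intro x _
    change x ∈ _ ^ 0 * ⊤
    rw [pow_zero, one_mul]; trivial
  | succ k ih =>
    calc aug m ^ (k + 1) = aug m ^ k * aug m := pow_succ _ _
      _ ≤ (⋀[ℝ]^k (Fin m → ℝ)) * ⊤ * aug m := mul_le_mul' ih le_rfl
      _ = (⋀[ℝ]^k (Fin m → ℝ)) * (⊤ * aug m) := mul_assoc _ _ _
      _ ≤ (⋀[ℝ]^k (Fin m → ℝ)) * aug m := mul_le_mul' le_rfl top_mul_aug_le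
      _ = _ := by rw [aug_eq, ← mul_assoc]; rfl

theorem exteriorPower_succ_eq_bot : (⋀[ℝ]^(m + 1) (Fin m → ℝ)) = ⊥ := by
  have h := exteriorPower.finrank_eq ℝ (m + 1) (M := Fin m → ℝ)
  rw [Module.finrank_fin_fun, Nat.choose_succ_self] at h
  exact Submodule.finrank_eq_zero.1 h

/-- The k-th power of the ideal consists of terms of degree at least k, and there are none in degree
m + 1. The bound is uniform, so it serves for superfunctions as well as for their values at points;
it also justifies truncating the logarithmic and exponential series at m. -/
theorem aug_pow_succ_eq_bot : aug m ^ (m + 1) = ⊥ := by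
  have := aug_pow_le (m := m) (m + 1)
  rwa [exteriorPower_succ_eq_bot, Submodule.bot_mul, le_bot_iff] at this

theorem pow_succ_eq_zero {x : Grassmann m} (hx : body x = 0) : x ^ (m + 1) = 0 := by
  have := Submodule.pow_mem_pow (aug m) (mem_aug.2 hx) (m + 1)
  rwa [aug_pow_succ_eq_bot] at this

theorem sub_body_mem_aug (x : Grassmann m) : x - algebraMap ℝ _ (body x) ∈ aug m := by
  rw [mem_aug, map_sub, body_algebraMap, sub_self]

/-! #### Monomials -/

theorem sum_coeff (x : Grassmann m) : ∑ I, coeff I x • monomials m I = x :=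
  (monomials m).sum_repr x

theorem coeff_monomials (I J : Finset (Fin m)) :
    coeff I (monomials m J) = if J = I then 1 else 0 := by
  classical
  simp [coeff, Finsupp.single_apply]

theorem ext_coeff {x y : Grassmann m} (h : ∀ I, coeff I x = coeff I y) : x = y :=
  (monomials m).ext_elem h

theorem monomials_mem (I : Finset (Fin m)) :
    monomials m I ∈ (⋀[ℝ]^I.card (Fin m → ℝ)) := by
  have := ExteriorAlgebra.basis_eq_coe_basis (Pi.basisFun ℝ (Fin m))
    (Set.powersetCard.ofCard (rfl : I.card = I.card))
  rw [Set.powersetCard.val_ofCard] at this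
  rw [monomials, this]
  exact Subtype.mem _

theorem coeff_of_mem {k : ℕ} {x : Grassmann m} (hx : x ∈ (⋀[ℝ]^k (Fin m → ℝ)))
    {I : Finset (Fin m)} (hI : I.card ≠ k) : coeff I x = 0 := by
  have h := ((Pi.basisFun ℝ (Fin m)).exteriorPower k).sum_repr ⟨x, hx⟩
  have h2 := congrArg ((coeff I).comp (Submodule.subtype (⋀[ℝ]^k (Fin m → ℝ)))) h
  rw [map_sum] at h2
  refine h2.symm.trans (Finset.sum_eq_zero fun s _ => ?_)
  rw [map_smul, LinearMap.comp_apply, Submodule.subtype_apply,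
    ← ExteriorAlgebra.basis_eq_coe_basis]
  have h3 := coeff_monomials I s.val
  rw [monomials] at h3
  rw [h3, if_neg, smul_zero]
  rintro rfl
  exact hI s.2

theorem monomials_empty : monomials m ∅ = 1 := by
  rw [monomials, ExteriorAlgebra.basis_apply_ofCard _ (n := 0) (by simp)]
  simp [ExteriorAlgebra.ιMulti_family]

theorem monomials_univ_eq_ιMulti :
    monomials m Finset.univ = ExteriorAlgebra.ιMulti ℝ m (fun i => Pi.single i (1 : ℝ)) := by
  rw [monomials, ExteriorAlgebra.basis_apply_ofCard _ (n := m) (by simp)]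
  simp only [ExteriorAlgebra.ιMulti_family]
  congr 1
  ext i : 1
  have h : (Set.powersetCard.ofFinEmbEquiv.symm (Set.powersetCard.ofCard
      (show (Finset.univ : Finset (Fin m)).card = m by simp))) = RelEmbedding.refl (· ≤ ·) := by
    rw [Equiv.symm_apply_eq]
    ext i
    simp only [Set.powersetCard.ofCard, Finset.mem_univ, true_iff]
    exact (Set.powersetCard.mem_ofFinEmbEquiv_iff_mem_range _ _).2 ⟨i, rfl⟩
  have h2 := congrArg (fun f => f i) h
  simp only [Function.comp_apply, Pi.basisFun_apply] at h2 ⊢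
  rw [h2]
  rfl

theorem monomials_univ_eq_prod : monomials m Finset.univ = (List.ofFn xi).prod := by
  rw [monomials_univ_eq_ιMulti, ExteriorAlgebra.ιMulti_apply]; rfl

theorem eq_smul_of_mem_top {x : Grassmann m} (hx : x ∈ (⋀[ℝ]^m (Fin m → ℝ))) :
    x = top x • monomials m Finset.univ := by
  conv_lhs => rw [← sum_coeff x]
  rw [Finset.sum_eq_single Finset.univ]
  · rfl
  · intro I _ hI
    rw [coeff_of_mem hx, zero_smul]
    intro h
    exact hI ((Finset.card_eq_iff_eq_univ I).1 (by simpa using h))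
  · simp

theorem oddDeriv_mem_power (α : Fin m) (k : ℕ) {x : Grassmann m}
    (hx : x ∈ (⋀[ℝ]^(k + 1) (Fin m → ℝ))) : oddDeriv α x ∈ (⋀[ℝ]^k (Fin m → ℝ)) := by
  induction k generalizing x with
  | zero =>
    change x ∈ _ ^ 1 at hx
    rw [pow_one] at hx
    obtain ⟨v, rfl⟩ := hx
    rw [oddDeriv_ι]
    change _ ∈ _ ^ 0
    rw [pow_zero]
    exact Submodule.algebraMap_mem _
  | succ k ih =>
    change x ∈ _ ^ (k + 1 + 1) at hx
    rw [pow_succ'] at hx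
    induction hx using Submodule.mul_induction_on' with
    | mem_mul_mem a ha b hb =>
      obtain ⟨v, rfl⟩ := ha
      rw [oddDeriv_ι_mul]
      refine Submodule.sub_mem _ (Submodule.smul_mem _ _ hb) ?_
      change _ ∈ _ ^ (k + 1)
      rw [pow_succ']
      exact Submodule.mul_mem_mul ⟨v, rfl⟩ (ih hb)
    | add x _ y _ hx hy => rw [map_add]; exact Submodule.add_mem _ hx hy

/-- An odd derivative lowers the degree by one, so nothing is left in degree m. This is integration
by parts in the odd variables. -/
theorem top_oddDeriv (α : Fin m) (x : Grassmann m) : top (oddDeriv α x) = 0 := by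
  rw [← sum_coeff x, map_sum, top, map_sum]
  refine Finset.sum_eq_zero fun I _ => ?_
  rw [map_smul, map_smul]
  obtain hI | hI := Nat.eq_zero_or_pos I.card
  · rw [Finset.card_eq_zero.1 hI, monomials_empty, oddDeriv_one, map_zero, smul_zero]
  · obtain ⟨k, hk⟩ : ∃ k, I.card = k + 1 := ⟨I.card - 1, by omega⟩
    rw [coeff_of_mem (oddDeriv_mem_power α k (hk ▸ monomials_mem I)), smul_zero]
    have := Finset.card_le_univ I
    simp at this ⊢
    omega

theorem sum_smul_xi (v : Fin m → ℝ) : ∑ α, v α • xi α = ExteriorAlgebra.ι ℝ v := by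
  simp only [xi, ← map_smul, ← map_sum]
  congr 1
  ext i
  simp [Finset.sum_apply, Pi.single_apply]

/-- The Euler operator counts the degree. -/
theorem sum_xi_mul_oddDeriv {k : ℕ} {x : Grassmann m} (hx : x ∈ (⋀[ℝ]^k (Fin m → ℝ))) :
    ∑ α, xi α * oddDeriv α x = (k : ℝ) • x := by
  induction k generalizing x with
  | zero =>
    change x ∈ _ ^ 0 at hx
    rw [pow_zero, Submodule.mem_one] at hx
    obtain ⟨r, rfl⟩ := hx
    simp
  | succ k ih =>
    change x ∈ _ ^ (k + 1) at hx
    rw [pow_succ'] at hx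
    induction hx using Submodule.mul_induction_on' with
    | mem_mul_mem a ha b hb =>
      obtain ⟨v, rfl⟩ := ha
      have h1 : ∀ α, xi α * oddDeriv α (ExteriorAlgebra.ι ℝ v * b)
          = (v α • xi α) * b + ExteriorAlgebra.ι ℝ v * (xi α * oddDeriv α b) := by
        intro α
        rw [oddDeriv_ι_mul, mul_sub, ← mul_assoc, odd_anticomm (xi_mem_part α) (ι_mem_part v),
          neg_mul, sub_neg_eq_add, mul_assoc, mul_smul_comm, smul_mul_assoc]
      rw [Finset.sum_congr rfl fun α _ => h1 α, Finset.sum_add_distrib, ← Finset.sum_mul,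
        sum_smul_xi, ← Finset.mul_sum, ih hb, mul_smul_comm]
      push_cast
      module
    | add x _ y _ hx hy =>
      simp only [map_add, mul_add, Finset.sum_add_distrib] at hx hy ⊢
      rw [hx, hy, smul_add]

/-- The Euler operator Σ ξ^α ∂_α kills `x` and multiplies the coefficient of ξ^I by |I|, so only I =
∅ can survive. -/
theorem eq_algebraMap_of_oddDeriv_eq_zero {x : Grassmann m} (h : ∀ α, oddDeriv α x = 0) :
    x = algebraMap ℝ _ (body x) := by
  have h1 : ∀ I : Finset (Fin m), (I.card : ℝ) * coeff I x = 0 := by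
    intro I
    have h2 : ∑ α, xi α * oddDeriv α x = 0 := by simp [h]
    have h3 : ∑ α, xi α * oddDeriv α x
        = ∑ J : Finset (Fin m), (J.card * coeff J x) • monomials m J := by
      conv_lhs => rw [← sum_coeff x]
      simp only [map_sum, map_smul, Finset.mul_sum, mul_smul_comm]
      rw [Finset.sum_comm]
      refine Finset.sum_congr rfl fun J _ => ?_
      rw [← Finset.smul_sum, sum_xi_mul_oddDeriv (monomials_mem J), smul_smul, mul_comm]
    have h4 := congrArg (coeff I) (h3.symm.trans h2)
    simpa [coeff_monomials] using h4
  have h5 : x = algebraMap ℝ _ (coeff ∅ x) := by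
    conv_lhs => rw [← sum_coeff x]
    rw [Finset.sum_eq_single ∅, monomials_empty, Algebra.algebraMap_eq_smul_one]
    · intro I _ hI
      have := (mul_eq_zero.1 (h1 I)).resolve_left (by simpa using hI)
      rw [this, zero_smul]
    · simp
  have h6 := congrArg body h5
  rw [body_algebraMap] at h6
  rw [h6, ← h5]

/-- A linear choice of primitives for the elements without top coefficient. -/
noncomputable def prim (α : Fin m) : Grassmann m →ₗ[ℝ] Grassmann m :=
  ∑ I ∈ Finset.univ.erase Finset.univ, ((m : ℝ) - I.card)⁻¹ •
    (coeff I).smulRight (xi α * monomials m I)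

/-- The operator Σ ∂_α ξ^α equals m minus the Euler operator, so it multiplies ξ^I by m − |I|. This
is invertible for every monomial except the top one; hence the factor (m − |I|)⁻¹ in `prim`. -/
theorem eq_top_add_sum_oddDeriv (x : Grassmann m) :
    x = top x • monomials m Finset.univ + ∑ α, oddDeriv α (prim α x) := by
  have h1 : ∀ I ∈ Finset.univ.erase (Finset.univ : Finset (Fin m)),
      ∑ α, oddDeriv α (xi α * monomials m I) = ((m : ℝ) - I.card) • monomials m I := by
    intro I _
    have h2 : ∀ α, oddDeriv α (xi α * monomials m I)
        = monomials m I - xi α * oddDeriv α (monomials m I) := by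
      intro α
      rw [xi, oddDeriv_ι_mul]; simp
    rw [Finset.sum_congr rfl fun α _ => h2 α, Finset.sum_sub_distrib,
      sum_xi_mul_oddDeriv (monomials_mem I)]
    simp only [Finset.sum_const, Finset.card_univ, Fintype.card_fin]
    module
  have h3 : ∑ α, oddDeriv α (prim α x)
      = ∑ I ∈ Finset.univ.erase Finset.univ, coeff I x • monomials m I := by
    simp only [prim, LinearMap.sum_apply, LinearMap.smul_apply, LinearMap.smulRight_apply, map_sum,
      map_smul]
    rw [Finset.sum_comm]
    refine Finset.sum_congr rfl fun I hI => ?_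
    rw [← Finset.smul_sum, ← Finset.smul_sum, h1 I hI, smul_comm, smul_smul _ _ (monomials m I),
      inv_mul_cancel₀, one_smul]
    have h4 : I.card < m := by
      have h5 := (Finset.card_lt_iff_ne_univ I).2 (Finset.ne_of_mem_erase hI)
      simpa using h5
    exact (sub_pos.2 (by exact_mod_cast h4)).ne'
  rw [h3, top]
  conv_lhs => rw [← sum_coeff x]
  exact (Finset.add_sum_erase _ _ (Finset.mem_univ _)).symm

theorem top_monomials_univ : top (monomials m Finset.univ) = 1 := by
  rw [top, coeff_monomials, if_pos rfl]

/-- Multiplication by the complementary monomial sends ξ^I to ± the top monomial. Any other ξ^J goes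
either to a wrong degree or, when |J| = |I|, to zero because a generator is repeated. The first
factor on the right is that sign, its own inverse. -/
theorem top_mul_monomials_compl (x : Grassmann m) (I : Finset (Fin m)) :
    coeff I x = top (monomials m I * monomials m Iᶜ) * top (x * monomials m Iᶜ) := by
  have h1 : ∀ J, J ≠ I → top (monomials m J * monomials m Iᶜ) = 0 := by
    intro J hJ
    by_cases hc : J.card = I.card
    · have hd : ¬Disjoint J Iᶜ := by
        intro hd
        have : J ⊆ I := by
          intro a ha
          by_contra hn
          exact Finset.disjoint_left.1 hd ha (Finset.mem_compl.2 hn)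
        exact hJ (Finset.eq_of_subset_of_card_le this hc.ge)
      have := ExteriorAlgebra.basis_mul_of_not_disjoint (Pi.basisFun ℝ (Fin m))
        (Set.powersetCard.ofCard (rfl : J.card = _)) (Set.powersetCard.ofCard (rfl : Iᶜ.card = _)) hd
      simp only [Set.powersetCard.val_ofCard] at this
      rw [monomials, this, top, map_zero]
    · have h2 := Submodule.mul_mem_mul (monomials_mem J) (monomials_mem Iᶜ)
      rw [← pow_add] at h2
      refine coeff_of_mem h2 ?_
      have h3 := Finset.card_compl I
      have h4 := Finset.card_le_univ I
      simp only [Finset.card_univ, Fintype.card_fin] at *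
      omega
  have h2 : top (monomials m I * monomials m Iᶜ) * top (monomials m I * monomials m Iᶜ) = 1 := by
    have hd : Disjoint I Iᶜ := disjoint_compl_right
    have := ExteriorAlgebra.basis_mul_of_disjoint (Pi.basisFun ℝ (Fin m))
        (Set.powersetCard.ofCard (rfl : I.card = _)) (Set.powersetCard.ofCard (rfl : Iᶜ.card = _)) hd
    have hu : I.disjUnion Iᶜ hd = Finset.univ := by
      rw [Finset.disjUnion_eq_union, Finset.union_compl]
    have this2 : monomials m I * monomials m Iᶜ = (Set.powersetCard.permOfDisjoint
        (s := Set.powersetCard.ofCard (rfl : I.card = _))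
        (t := Set.powersetCard.ofCard (rfl : Iᶜ.card = _)) hd).sign • monomials m Finset.univ := by
      rw [← hu]; exact this
    rw [this2]
    rcases Int.units_eq_one_or
      (Set.powersetCard.permOfDisjoint (s := Set.powersetCard.ofCard (rfl : I.card = _))
        (t := Set.powersetCard.ofCard (rfl : Iᶜ.card = _)) hd).sign with h | h
    · rw [h, one_smul, top_monomials_univ, one_mul]
    · rw [h, Units.neg_smul, one_smul, top, map_neg, ← top, top_monomials_univ]
      norm_num
  have h3 : top (x * monomials m Iᶜ) = coeff I x * top (monomials m I * monomials m Iᶜ) := by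
    conv_lhs => rw [← sum_coeff x, Finset.sum_mul, top, map_sum]
    rw [Finset.sum_eq_single I]
    · rw [smul_mul_assoc, map_smul]; rfl
    · intro J _ hJ
      rw [smul_mul_assoc, map_smul, ← top, h1 J hJ, smul_zero]
    · simp
  rw [h3, mul_comm (coeff I x), ← mul_assoc, h2, one_mul]

theorem eq_zero_of_top_mul {x : Grassmann m} (h : ∀ y, top (x * y) = 0) : x = 0 :=
  ext_coeff fun I => by rw [top_mul_monomials_compl, h, mul_zero, map_zero]

/-- The product of `m` elements without body. -/
theorem prod_ofFn_sub_mem {k : ℕ} (y z : Fin k → Grassmann m) (hy : ∀ i, y i ∈ aug m)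
    (hz : ∀ i, z i ∈ aug m) (hyz : ∀ i, y i - z i ∈ aug m ^ 2) :
    (List.ofFn y).prod - (List.ofFn z).prod ∈ aug m ^ (k + 1) ∧ (List.ofFn z).prod ∈ aug m ^ k := by
  induction k with
  | zero => simp
  | succ k ih =>
    obtain ⟨h1, h2⟩ := ih (fun i => y i.succ) (fun i => z i.succ) (fun i => hy _) (fun i => hz _)
      (fun i => hyz _)
    simp only [List.ofFn_succ, List.prod_cons]
    refine ⟨?_, ?_⟩
    · have : y 0 * (List.ofFn fun i => y i.succ).prod - z 0 * (List.ofFn fun i => z i.succ).prod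
          = y 0 * ((List.ofFn fun i => y i.succ).prod - (List.ofFn fun i => z i.succ).prod)
            + (y 0 - z 0) * (List.ofFn fun i => z i.succ).prod := by noncomm_ring
      rw [this]
      refine Submodule.add_mem _ ?_ ?_
      · rw [pow_succ' _ (k + 1)]; exact Submodule.mul_mem_mul (hy 0) h1
      · rw [show k + 1 + 1 = 2 + k by ring, pow_add]; exact Submodule.mul_mem_mul (hyz 0) h2
    · rw [pow_succ']; exact Submodule.mul_mem_mul (hz 0) h2

/-- Modulo the square of the augmentation ideal an element without body is its linear part, which is
read off from the bodies of its odd derivatives. -/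
theorem sub_sum_mem_aug_sq {x : Grassmann m} (hx : x ∈ aug m) :
    x - ExteriorAlgebra.ι ℝ (fun β => body (oddDeriv β x)) ∈ aug m ^ 2 := by
  rw [aug_eq] at hx
  induction hx using Submodule.mul_induction_on' with
  | mem_mul_mem a ha b _ =>
    obtain ⟨v, rfl⟩ := ha
    have h1 : (fun β => body (oddDeriv β (ExteriorAlgebra.ι ℝ v * b))) = body b • v := by
      ext β
      rw [oddDeriv_ι_mul, map_sub, map_smul, map_mul, body_ι, zero_mul, sub_zero]
      simp [mul_comm]
    rw [h1, map_smul]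
    have h2 : ExteriorAlgebra.ι ℝ v * b - body b • ExteriorAlgebra.ι ℝ v
        = ExteriorAlgebra.ι ℝ v * (b - algebraMap ℝ _ (body b)) := by
      rw [mul_sub, ← Algebra.commutes, ← Algebra.smul_def]
    rw [h2, pow_two]
    exact Submodule.mul_mem_mul (mem_aug.2 (body_ι v)) (sub_body_mem_aug b)
  | add x _ y _ hx hy =>
    have : (fun β => body (oddDeriv β (x + y))) = (fun β => body (oddDeriv β x))
        + fun β => body (oddDeriv β y) := by ext β; simp
    rw [this, map_add, add_sub_add_comm]
    exact Submodule.add_mem _ hx hy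

/-- An alternating m-form on an m-dimensional space is its value on the standard basis times the
determinant. -/
theorem top_ιMulti (v : Fin m → Fin m → ℝ) :
    top (ExteriorAlgebra.ιMulti ℝ m v) = (Matrix.of v).det := by
  let f : (Fin m → ℝ) [⋀^Fin m]→ₗ[ℝ] ℝ :=
    (coeff Finset.univ).compAlternatingMap (ExteriorAlgebra.ιMulti ℝ m)
  have h := AlternatingMap.eq_smul_basis_det (Pi.basisFun ℝ (Fin m)) f
  have h1 : f (Pi.basisFun ℝ (Fin m)) = 1 := by
    change coeff Finset.univ (ExteriorAlgebra.ιMulti ℝ m _) = 1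
    rw [← top_monomials_univ (m := m), top, monomials_univ_eq_ιMulti]
    congr 2
    ext i : 1
    simp
  rw [h1, one_smul] at h
  change f v = _
  rw [h, Pi.basisFun_det]
  rfl

/-- Replacing each of the m factors by its linear part changes the product by an element of the (m +
1)-st power of the ideal, which is zero. This computes how ξ¹⋯ξᵐ transforms under a change of
coordinates. -/
theorem prod_ofFn_eq {y : Fin m → Grassmann m} (hy : ∀ i, y i ∈ aug m) :
    (List.ofFn y).prod
      = (Matrix.of fun i j => body (oddDeriv j (y i))).det • monomials m Finset.univ := by
  have h := prod_ofFn_sub_mem y (fun i => ExteriorAlgebra.ι ℝ (fun β => body (oddDeriv β (y i))))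
    hy (fun i => mem_aug.2 (body_ι _)) (fun i => sub_sum_mem_aug_sq (hy i))
  have h1 := h.1
  rw [aug_pow_succ_eq_bot, Submodule.mem_bot, sub_eq_zero] at h1
  rw [h1, ← ExteriorAlgebra.ιMulti_apply, ← top_ιMulti]
  refine eq_smul_of_mem_top ?_
  exact ExteriorAlgebra.ιMulti_range ℝ m ⟨_, rfl⟩

theorem mul_monomials_univ (x : Grassmann m) :
    x * monomials m Finset.univ = body x • monomials m Finset.univ := by
  have h0 := prod_ofFn_sub_mem (m := m) (xi (m := m)) xi (fun i => mem_aug.2 (body_xi i))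
    (fun i => mem_aug.2 (body_xi i)) (fun i => by rw [sub_self]; exact Submodule.zero_mem _)
  have h1 := Submodule.mul_mem_mul (sub_body_mem_aug x) h0.2
  rw [← pow_succ', aug_pow_succ_eq_bot, Submodule.mem_bot, ← monomials_univ_eq_prod, sub_mul,
    sub_eq_zero, ← Algebra.smul_def] at h1
  exact h1

end Grassmann

/-! ### Superderivations and the Berezinian -/

/-- The homogeneous elements of a supercommutative superalgebra. -/
structure IsSupercommutative {A : Type*} [Ring A] [Algebra ℝ A] (P : ZMod 2 → Submodule ℝ A) :
    Prop where
  one_mem : 1 ∈ P 0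
  mul_mem : ∀ {p q x y}, x ∈ P p → y ∈ P q → x * y ∈ P (p + q)
  comm : ∀ {p q x y}, x ∈ P p → y ∈ P q → x * y = sgn (p * q) • (y * x)

/-- A left superderivation of parity `d`. -/
structure IsSuperderivation {A : Type*} [Ring A] [Algebra ℝ A] (P : ZMod 2 → Submodule ℝ A)
    (d : ZMod 2) (δ : A →ₗ[ℝ] A) : Prop where
  mem : ∀ {p x}, x ∈ P p → δ x ∈ P (p + d)
  mul : ∀ {p x} (y : A), x ∈ P p → δ (x * y) = δ x * y + sgn (d * p) • (x * δ y)

/-- `E` is the commutative ring of even elements, where determinants are taken, while the derivation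
takes values in the whole superalgebra `A`. Hence the separate embedding `φ`. -/
theorem map_finset_prod_of_leibniz {E A ι : Type*} [CommRing E] [Ring A] [DecidableEq ι]
    (φ : E →+* A) (D : E →+ A) (hD : ∀ a b, D (a * b) = φ a * D b + φ b * D a) (s : Finset ι)
    (f : ι → E) : D (∏ i ∈ s, f i) = ∑ i ∈ s, φ (∏ j ∈ s.erase i, f j) * D (f i) := by
  have h1 : D 1 = 0 := by simpa using hD 1 1
  induction s using Finset.induction_on with
  | empty => simpa using h1
  | insert a s ha ih =>
    rw [Finset.prod_insert ha, hD, ih, Finset.sum_insert ha, Finset.erase_insert ha, add_comm,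
      Finset.mul_sum]
    refine congrArg₂ (· + ·) rfl (Finset.sum_congr rfl fun i hi => ?_)
    have hne : a ≠ i := fun h => ha (h ▸ hi)
    rw [Finset.erase_insert_of_ne hne, Finset.prod_insert (fun h => ha (Finset.mem_of_mem_erase h)),
      map_mul, mul_assoc]

/-- Jacobi's formula for the derivative of a determinant. -/
theorem map_det_of_leibniz {E A ι : Type*} [CommRing E] [Ring A] [Fintype ι] [DecidableEq ι]
    (φ : E →+* A) (D : E →+ A) (hD : ∀ a b, D (a * b) = φ a * D b + φ b * D a)
    (M N : Matrix ι ι E) (h : M * N = 1) :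
    D M.det = φ M.det * ∑ a, ∑ b, φ (N b a) * D (M a b) := by
  have h1 : ∀ a b, M.adjugate b a = M.det * N b a := by
    intro a b
    have h2 : M.adjugate = M.det • N := by
      rw [← mul_one M.adjugate, ← h, ← mul_assoc, Matrix.adjugate_mul, Matrix.smul_mul, one_mul]
    rw [h2]; rfl
  -- The permutations with σ b = a give exactly those terms of the Leibniz expansion of D (det M) in
  -- which the factor M (σ b) b = M a b is differentiated.
  have h3 : ∀ a b, M.adjugate b a = ∑ σ : Equiv.Perm ι, if σ b = a then
      Equiv.Perm.sign σ • ∏ j ∈ Finset.univ.erase b, M (σ j) j else 0 := by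
    intro a b
    rw [Matrix.adjugate_apply, Matrix.det_apply]
    refine Finset.sum_congr rfl fun σ _ => ?_
    split_ifs with hσ
    · congr 1
      rw [← Finset.mul_prod_erase _ _ (Finset.mem_univ b), hσ, Matrix.updateRow_self,
        Pi.single_eq_same, one_mul]
      refine Finset.prod_congr rfl fun j hj => ?_
      rw [Matrix.updateRow_ne]
      rw [← hσ]
      exact fun h => Finset.ne_of_mem_erase hj (σ.injective h)
    · rw [Finset.prod_eq_zero (Finset.mem_univ (σ.symm a)), smul_zero]
      rw [Equiv.apply_symm_apply, Matrix.updateRow_self, Pi.single_apply, if_neg]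
      rintro rfl
      exact hσ (Equiv.apply_symm_apply _ _)
  have hs : ∀ (u : ℤˣ) x, D (u • x) = u • D x := fun u x => by
    rw [Units.smul_def, Units.smul_def, map_zsmul]
  have hφ : ∀ (u : ℤˣ) x, φ (u • x) = u • φ x := fun u x => by
    rw [Units.smul_def, Units.smul_def, map_zsmul]
  have h4 : ∀ a b, φ M.det * (φ (N b a) * D (M a b))
      = ∑ σ : Equiv.Perm ι, if σ b = a then
        Equiv.Perm.sign σ • (φ (∏ j ∈ Finset.univ.erase b, M (σ j) j) * D (M (σ b) b)) else 0 := by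
    intro a b
    rw [← mul_assoc, ← map_mul, ← h1, h3, map_sum, Finset.sum_mul]
    refine Finset.sum_congr rfl fun σ _ => ?_
    split_ifs with hσ
    · rw [hφ, hσ, smul_mul_assoc]
    · rw [map_zero, zero_mul]
  simp only [Finset.mul_sum, h4]
  rw [Finset.sum_comm]
  have h5 : ∀ b, ∑ a, ∑ σ : Equiv.Perm ι, (if σ b = a then
        Equiv.Perm.sign σ • (φ (∏ j ∈ Finset.univ.erase b, M (σ j) j) * D (M (σ b) b)) else 0)
      = ∑ σ : Equiv.Perm ι,
        Equiv.Perm.sign σ • (φ (∏ j ∈ Finset.univ.erase b, M (σ j) j) * D (M (σ b) b)) := by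
    intro b
    rw [Finset.sum_comm]
    simp
  rw [Finset.sum_congr rfl fun b _ => h5 b, Finset.sum_comm, Matrix.det_apply, map_sum]
  refine Finset.sum_congr rfl fun σ _ => ?_
  rw [hs, map_finset_prod_of_leibniz φ D hD, Finset.smul_sum]

section

variable {A : Type*} [Ring A] [Algebra ℝ A] {P : ZMod 2 → Submodule ℝ A}
  {ι : Type*} [Fintype ι]

/-- A matrix is even if its entry `(a, b)` has the parity of `a` plus the parity of `b`. -/
def Matrix.IsEvenSuper (P : ZMod 2 → Submodule ℝ A) (par : ι → ZMod 2) (M : Matrix ι ι A) : Prop :=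
  ∀ a b, M a b ∈ P (par a + par b)

/-- The supertrace. -/
def Matrix.supertrace (par : ι → ZMod 2) (M : Matrix ι ι A) : A := ∑ a, sgn (par a) • M a a

open Matrix

theorem Matrix.supertrace_add (par : ι → ZMod 2) (M N : Matrix ι ι A) :
    (M + N).supertrace par = M.supertrace par + N.supertrace par := by
  simp [supertrace, Finset.sum_add_distrib]

theorem Matrix.IsEvenSuper.mul (hP : IsSupercommutative P) {par : ι → ZMod 2} {M N : Matrix ι ι A}
    (hM : M.IsEvenSuper P par) (hN : N.IsEvenSuper P par) : (M * N).IsEvenSuper P par := by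
  intro a b
  rw [Matrix.mul_apply]
  refine Submodule.sum_mem _ fun c _ => ?_
  have : par a + par b = (par a + par c) + (par c + par b) := by
    generalize par a = p; generalize par b = q; generalize par c = r; revert p q r; decide
  rw [this]
  exact hP.mul_mem (hM a c) (hN c b)

/-- This is the cyclicity of the supertrace: carrying an entry of `M` past those of `Z` and `N`
produces the signs of the supertrace, and the extra sign d(a + b) put on `M` compensates the parity
d of `Z`. -/
theorem Matrix.supertrace_conj [DecidableEq ι] (hP : IsSupercommutative P) {par : ι → ZMod 2}
    {d : ZMod 2}
    {M N Z : Matrix ι ι A} (hM : M.IsEvenSuper P par) (hN : N.IsEvenSuper P par)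
    (hZ : ∀ a b, Z a b ∈ P (par a + par b + d)) (h : N * M = 1) :
    ((Matrix.of fun a b => sgn (d * (par a + par b)) • M a b) * Z * N).supertrace par
      = Z.supertrace par := by
  have h1 : ∀ a b c, sgn (par a) • ((sgn (d * (par a + par b)) • M a b) * Z b c * N c a)
      = sgn (par b) • (Z b c * (N c a * M a b)) := by
    intro a b c
    have h2 := hP.comm (hM a b) (hP.mul_mem (hZ b c) (hN c a))
    rw [smul_mul_assoc, smul_mul_assoc, mul_assoc (M a b), h2, smul_smul, smul_smul, ← sgn_add,
      ← sgn_add, mul_assoc]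
    congr 2
    generalize par a = p; generalize par b = q; generalize par c = r
    clear * -; revert p q r d; decide
  simp only [supertrace, Matrix.mul_apply, Finset.sum_mul, Finset.smul_sum, Matrix.of_apply]
  simp only [h1]
  have h3 : ∀ b, ∑ c, ∑ a, sgn (par b) • (Z b c * (N c a * M a b)) = sgn (par b) • Z b b := by
    intro b
    have h4 : ∀ c, ∑ a, sgn (par b) • (Z b c * (N c a * M a b))
        = sgn (par b) • (Z b c * (1 : Matrix ι ι A) c b) := by
      intro c
      rw [← h, Matrix.mul_apply, Finset.mul_sum, Finset.smul_sum]
    rw [Finset.sum_congr rfl fun c _ => h4 c]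
    simp [Matrix.one_apply]
  rw [← Finset.sum_congr rfl fun b _ => h3 b]
  calc _ = ∑ c, ∑ b, ∑ a, sgn (par b) • (Z b c * (N c a * M a b)) := by
        rw [Finset.sum_comm]
        refine Finset.sum_congr rfl fun c _ => Finset.sum_comm
    _ = _ := Finset.sum_comm

/-- δ(MN)(MN)⁻¹ is δM · M⁻¹ plus the conjugate by M, with the sign of δ, of δN · N⁻¹, and the
supertrace is invariant under such conjugation. -/
theorem Matrix.supertrace_logDeriv_mul [DecidableEq ι] (hP : IsSupercommutative P) {par : ι → ZMod 2}
    {d : ZMod 2} {δ : A →ₗ[ℝ] A} (hδ : IsSuperderivation P d δ) {M N M' N' : Matrix ι ι A}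
    (hM : M.IsEvenSuper P par) (hM' : M'.IsEvenSuper P par)
    (hN : N.IsEvenSuper P par) (hN' : N'.IsEvenSuper P par) (h1 : M' * M = 1) (h2 : N * N' = 1) :
    ((M * N).map δ * (N' * M')).supertrace par
      = (M.map δ * M').supertrace par + (N.map δ * N').supertrace par := by
  have h3 : (M * N).map δ = M.map δ * N
      + (Matrix.of fun a b => sgn (d * (par a + par b)) • M a b) * N.map δ := by
    ext a b
    simp only [Matrix.map_apply, Matrix.mul_apply, Matrix.add_apply, map_sum, Matrix.of_apply,
      ← Finset.sum_add_distrib]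
    refine Finset.sum_congr rfl fun c _ => ?_
    rw [hδ.mul _ (hM a c), smul_mul_assoc]
  have h4 := supertrace_conj hP (d := d) hM hM' (Z := N.map δ * N') ?_ h1
  · rw [h3, add_mul, supertrace_add, ← h4]
    congr 2
    · rw [← mul_assoc, mul_assoc (M.map δ), h2, mul_one]
    · simp only [mul_assoc]
  · intro a b
    rw [Matrix.mul_apply]
    refine Submodule.sum_mem _ fun c _ => ?_
    have : par a + par b + d = (par a + par c + d) + (par c + par b) := by
      generalize par a = p; generalize par b = q; generalize par c = r
      clear * -; revert p q r d; decide
    rw [this]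
    exact hP.mul_mem (hδ.mem (hN a c)) (hN' c b)

/-- The logarithmic derivative of the Berezinian. -/
theorem map_berezinian {E : Type*} [CommRing E] {n m : ℕ} (hP : IsSupercommutative P)
    {d : ZMod 2} {δ : A →ₗ[ℝ] A} (hδ : IsSuperderivation P d δ) (φ : E →+* A)
    (hφ : ∀ e, φ e ∈ P 0)
    {M N : Matrix (Fin n ⊕ Fin m) (Fin n ⊕ Fin m) A} (hM : M.IsEvenSuper P coordParity)
    (hMN : M * N = 1) (a a' : Matrix (Fin n) (Fin n) E) (e e' : Matrix (Fin m) (Fin m) E)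
    (ha : a * a' = 1) (he : e * e' = 1) (h22 : M.toBlocks₂₂ = e.map φ)
    (h11 : M.toBlocks₁₁ - M.toBlocks₁₂ * e'.map φ * M.toBlocks₂₁ = a.map φ) :
    δ (φ (a.det * e'.det)) = φ (a.det * e'.det) * (M.map δ * N).supertrace coordParity := by
  have ha' : a' * a = 1 := mul_eq_one_comm.1 ha
  have he' : e' * e = 1 := mul_eq_one_comm.1 he
  have mapmul : ∀ {k : ℕ} (x y : Matrix (Fin k) (Fin k) E), x.map φ * y.map φ = (x * y).map φ :=
    fun x y => (Matrix.map_mul).symm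
  have map1 : ∀ {k : ℕ}, (1 : Matrix (Fin k) (Fin k) E).map φ = 1 := fun {k} =>
    Matrix.map_one φ (map_zero φ) (map_one φ)
  have δ1 : δ 1 = 0 := by simpa using hδ.mul 1 hP.one_mem
  have map1δ : ∀ {k : ℕ}, (1 : Matrix (Fin k) (Fin k) A).map δ = 0 := by
    intro k
    ext i j
    by_cases h : i = j
    · subst h; simp [δ1]
    · simp [h]
  have map0δ : ∀ {k l : ℕ}, (0 : Matrix (Fin k) (Fin l) A).map δ = 0 := by intro k l; ext; simp
  have c0 : ∀ i : Fin n, (coordParity (Sum.inl i : Fin n ⊕ Fin m)) = 0 := fun _ => rfl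
  have c1 : ∀ i : Fin m, (coordParity (Sum.inr i : Fin n ⊕ Fin m)) = 1 := fun _ => rfl
  have h2 : (1 + 1 : ZMod 2) = 0 := by decide
  have one_mem : ∀ {k : ℕ} (i j : Fin k), (1 : Matrix (Fin k) (Fin k) A) i j ∈ P 0 := by
    intro k i j
    rw [Matrix.one_apply]; split_ifs
    exacts [hP.one_mem, Submodule.zero_mem _]
  set u := M.toBlocks₁₂ * e'.map φ with hu
  set l := e'.map φ * M.toBlocks₂₁ with hl
  have hum : ∀ i j, u i j ∈ P 1 := fun i j => by
    rw [hu, Matrix.mul_apply]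
    refine Submodule.sum_mem _ fun c _ => ?_
    have := hP.mul_mem (hM (Sum.inl i) (Sum.inr c)) (hφ (e' c j))
    rw [c0, c1, zero_add, add_zero] at this
    exact this
  have hlm : ∀ i j, l i j ∈ P 1 := fun i j => by
    rw [hl, Matrix.mul_apply]
    refine Submodule.sum_mem _ fun c _ => ?_
    have := hP.mul_mem (hφ (e' i c)) (hM (Sum.inr c) (Sum.inl j))
    rw [c0, c1, zero_add, add_zero] at this
    exact this
  -- The block factorization M = U G L into upper unipotent, block diagonal and lower unipotent
  -- factors reduces the claim to the block diagonal G, whose blocks are the Schur complement `a`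
  -- and the odd-odd block `e`.
  let U : Matrix (Fin n ⊕ Fin m) (Fin n ⊕ Fin m) A := fromBlocks 1 u 0 1
  let U' : Matrix (Fin n ⊕ Fin m) (Fin n ⊕ Fin m) A := fromBlocks 1 (-u) 0 1
  let G : Matrix (Fin n ⊕ Fin m) (Fin n ⊕ Fin m) A := fromBlocks (a.map φ) 0 0 (e.map φ)
  let G' : Matrix (Fin n ⊕ Fin m) (Fin n ⊕ Fin m) A := fromBlocks (a'.map φ) 0 0 (e'.map φ)
  let L : Matrix (Fin n ⊕ Fin m) (Fin n ⊕ Fin m) A := fromBlocks 1 0 l 1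
  let L' : Matrix (Fin n ⊕ Fin m) (Fin n ⊕ Fin m) A := fromBlocks 1 0 (-l) 1
  have ev : ∀ (x : Matrix (Fin n) (Fin n) A) (y : Matrix (Fin n) (Fin m) A)
      (z : Matrix (Fin m) (Fin n) A) (w : Matrix (Fin m) (Fin m) A), (∀ i j, x i j ∈ P 0) →
      (∀ i j, y i j ∈ P 1) → (∀ i j, z i j ∈ P 1) → (∀ i j, w i j ∈ P 0) →
      (fromBlocks x y z w).IsEvenSuper P coordParity := by
    intro x y z w hx hy hz hw i j
    rcases i with i | i <;> rcases j with j | j <;> simp only [c0, c1, h2, add_zero, zero_add,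
      fromBlocks_apply₁₁, fromBlocks_apply₁₂, fromBlocks_apply₂₁, fromBlocks_apply₂₂]
    exacts [hx i j, hy i j, hz i j, hw i j]
  have z0 : ∀ {k k' : ℕ} (p : ZMod 2) (i : Fin k) (j : Fin k'), (0 : Matrix (Fin k) (Fin k') A) i j ∈ P p :=
    fun p i j => Submodule.zero_mem _
  have eU : U.IsEvenSuper P coordParity := ev _ _ _ _ one_mem hum (z0 _) one_mem
  have eU' : U'.IsEvenSuper P coordParity :=
    ev _ _ _ _ one_mem (fun i j => Submodule.neg_mem _ (hum i j)) (z0 _) one_mem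
  have eG : G.IsEvenSuper P coordParity :=
    ev _ _ _ _ (fun i j => hφ _) (z0 _) (z0 _) (fun i j => hφ _)
  have eG' : G'.IsEvenSuper P coordParity :=
    ev _ _ _ _ (fun i j => hφ _) (z0 _) (z0 _) (fun i j => hφ _)
  have eL : L.IsEvenSuper P coordParity := ev _ _ _ _ one_mem (z0 _) hlm one_mem
  have eL' : L'.IsEvenSuper P coordParity :=
    ev _ _ _ _ one_mem (z0 _) (fun i j => Submodule.neg_mem _ (hlm i j)) one_mem
  have iU : U' * U = 1 := by
    simp only [U, U', fromBlocks_multiply, ← fromBlocks_one]; congr 1 <;> simp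
  have iG : G' * G = 1 := by
    simp only [G, G', fromBlocks_multiply, ← fromBlocks_one, mapmul, ha', he', map1]
    congr 1 <;> simp
  have iG2 : G * G' = 1 := by
    simp only [G, G', fromBlocks_multiply, ← fromBlocks_one, mapmul, ha, he, map1]
    congr 1 <;> simp
  have iL : L * L' = 1 := by
    simp only [L, L', fromBlocks_multiply, ← fromBlocks_one]; congr 1 <;> simp
  have hUGL : M = U * (G * L) := by
    rw [← fromBlocks_toBlocks M]
    simp only [U, G, L, fromBlocks_multiply]
    have e1 : e.map φ * l = M.toBlocks₂₁ := by
      rw [hl, ← Matrix.mul_assoc, mapmul, he, map1, Matrix.one_mul]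
    have e2 : u * e.map φ = M.toBlocks₁₂ := by
      rw [hu, Matrix.mul_assoc, mapmul, he', map1, Matrix.mul_one]
    congr 1
    · rw [← h11]; simp [e1]
    · simp [e2]
    · simp [e1]
    · simp [h22]
  have hN : N = L' * G' * U' := by
    have : L' * G' * U' * M = 1 := by
      have iL' : L' * L = 1 := by
        simp only [L, L', fromBlocks_multiply, ← fromBlocks_one]; congr 1 <;> simp
      rw [hUGL]
      calc L' * G' * U' * (U * (G * L)) = L' * (G' * (U' * U) * G) * L := by
            simp only [mul_assoc]
        _ = 1 := by rw [iU, mul_one, iG, mul_one, iL']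
    calc N = (L' * G' * U' * M) * N := by rw [this, one_mul]
      _ = _ := by rw [mul_assoc, hMN, mul_one]
  -- The logarithmic derivative is additive over U, G, L. The unipotent factors contribute nothing,
  -- since δU · U⁻¹ and δL · L⁻¹ have zero diagonal blocks.
  have key : (M.map δ * N).supertrace coordParity = (G.map δ * G').supertrace coordParity := by
    have iGL : G * L * (L' * G') = 1 := by
      calc G * L * (L' * G') = G * (L * L') * G' := by simp only [mul_assoc]
        _ = 1 := by rw [iL, mul_one, iG2]
    rw [hUGL, hN, supertrace_logDeriv_mul hP hδ eU eU' (eG.mul hP eL) (eL'.mul hP eG') iU iGL,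
      supertrace_logDeriv_mul hP hδ eG eG' eL eL' iG iL]
    have t1 : (U.map δ * U').supertrace coordParity = 0 := by
      simp only [U, U', fromBlocks_map, fromBlocks_multiply, map1δ, map0δ, supertrace,
        Fintype.sum_sum_type]
      simp
    have t2 : (L.map δ * L').supertrace coordParity = 0 := by
      simp only [L, L', fromBlocks_map, fromBlocks_multiply, map1δ, map0δ, supertrace,
        Fintype.sum_sum_type]
      simp
    rw [t1, t2, zero_add, add_zero]
  have cen : ∀ (x : E) (y : A), (∃ p, y ∈ P p) → y * φ x = φ x * y := by
    rintro x y ⟨p, hy⟩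
    have := hP.comm hy (hφ x)
    rwa [mul_zero, sgn_zero, one_smul] at this
  have hD : ∀ x y : E, δ (φ (x * y)) = φ x * δ (φ y) + φ y * δ (φ x) := by
    intro x y
    rw [map_mul, hδ.mul _ (hφ x), mul_zero, sgn_zero, one_smul,
      cen y _ ⟨_, hδ.mem (hφ x)⟩, add_comm]
  let D : E →+ A := (δ.toAddMonoidHom).comp φ.toAddMonoidHom
  have j1 : δ (φ a.det) = φ a.det * ∑ i, ∑ j, φ (a' j i) * δ (φ (a i j)) :=
    map_det_of_leibniz φ D hD a a' ha
  have j2 : δ (φ e'.det) = φ e'.det * ∑ i, ∑ j, φ (e j i) * δ (φ (e' i j)) :=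
    map_det_of_leibniz φ D hD e' e he'
  -- Differentiating the trace of e' e = 1 turns the logarithmic derivative of det e' = (det e)⁻¹
  -- into minus that of det e, the sign which the supertrace gives to the odd block.
  have j3 : ∑ i, ∑ j, φ (e j i) * δ (φ (e' i j)) = -∑ i, ∑ j, φ (e' j i) * δ (φ (e i j)) := by
    have : ∑ i, δ (φ (∑ j, e' i j * e j i)) = 0 := by
      refine Finset.sum_eq_zero fun i _ => ?_
      rw [← Matrix.mul_apply, he']; simp [δ1]
    simp only [map_sum, hD, Finset.sum_add_distrib] at this
    rw [Finset.sum_comm] at this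
    rw [eq_neg_iff_add_eq_zero, add_comm]
    convert this using 1
  have hG : (G.map δ * G').supertrace coordParity
      = ∑ i, ∑ j, φ (a' j i) * δ (φ (a i j)) - ∑ i, ∑ j, φ (e' j i) * δ (φ (e i j)) := by
    simp only [G, G', fromBlocks_map, fromBlocks_multiply, map0δ, supertrace,
        Fintype.sum_sum_type]
    simp only [c0, c1, sgn_zero, sgn_one, one_smul, fromBlocks_apply₁₁, fromBlocks_apply₂₂,
      Matrix.mul_apply, Matrix.add_apply, Matrix.map_apply, Matrix.zero_apply, mul_zero,
      Finset.sum_const_zero, add_zero, zero_add, neg_smul, Finset.sum_neg_distrib, sub_eq_add_neg]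
    simp only [cen _ _ ⟨_, hδ.mem (hφ _)⟩]
  rw [hD, j1, j2, j3, key, hG, map_mul]
  have cc : φ a.det * φ e'.det = φ e'.det * φ a.det := by rw [← map_mul, mul_comm, map_mul]
  rw [← mul_assoc, ← mul_assoc, ← cc, mul_sub, mul_neg]
  abel

end

/-! ### Hadamard's lemma -/

-- The integral is the value at 0 of the convolution of the indicator of (0, 1] with s ↦ χ(−s) F(p,
-- −s). The bump χ is 1 on [0, 1] and makes the second factor compactly supported, so smoothness of
-- convolutions with a parameter applies.
open MeasureTheory Topology in
theorem contDiff_parametric_intervalIntegral {E : Type*} [NormedAddCommGroup E] [NormedSpace ℝ E]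
    {F : E → ℝ → ℝ} (hF : ContDiff ℝ ∞ (fun q : E × ℝ => F q.1 q.2)) :
    ContDiff ℝ ∞ (fun p => ∫ t in (0 : ℝ)..1, F p t) := by
  let χ : ContDiffBump (1 / 2 : ℝ) := ⟨1, 2, one_pos, by norm_num⟩
  let f : ℝ → ℝ := Set.indicator (Set.Ioc 0 1) 1
  let g : E → ℝ → ℝ := fun p s => χ (-s) * F p (-s)
  have h := contDiffOn_convolution_right_with_param_comp (𝕜 := ℝ) (μ := volume) (n := ⊤)
    (ContinuousLinearMap.mul ℝ ℝ) (s := Set.univ) (v := fun _ : E => (0 : ℝ)) (f := f) (g := g)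
    (k := Metric.closedBall (-(1 / 2)) 2) contDiffOn_const isOpen_univ
    (isCompact_closedBall _ _) ?_ ?_ ?_
  · rw [contDiffOn_univ] at h
    convert h using 1
    funext p
    rw [convolution_def, intervalIntegral.integral_of_le zero_le_one, ← integral_indicator measurableSet_Ioc]
    refine integral_congr_ae (Filter.Eventually.of_forall fun t => ?_)
    simp only [f, g, ContinuousLinearMap.mul_apply', zero_sub, neg_neg]
    by_cases ht : t ∈ Set.Ioc (0 : ℝ) 1
    · rw [Set.indicator_of_mem ht, Set.indicator_of_mem ht, χ.one_of_mem_closedBall]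
      · simp
      · rw [Metric.mem_closedBall, Real.dist_eq, abs_le]
        constructor <;> linarith [ht.1, ht.2]
    · rw [Set.indicator_of_notMem ht, Set.indicator_of_notMem ht, zero_mul]
  · intro p s _ hs
    simp only [g]
    rw [χ.zero_of_le_dist, zero_mul]
    rw [Metric.mem_closedBall, not_le, Real.dist_eq] at hs
    rw [Real.dist_eq, show -s - 1 / 2 = -(s - -(1 / 2)) by ring, abs_neg]
    exact hs.le
  · exact (integrable_indicator_iff measurableSet_Ioc).2
      (integrableOn_const (by simp)) |>.locallyIntegrable
  · refine ContDiff.contDiffOn ?_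
    change ContDiff ℝ ∞ (fun q : E × ℝ => χ (-q.2) * F q.1 (-q.2))
    exact (χ.contDiff.comp contDiff_snd.neg).mul (hF.comp (contDiff_fst.prodMk contDiff_snd.neg))

-- Hadamard's formula integrates along segments from y₀, which may leave U. Multiplying by a bump
-- function gives a global smooth function with the same germ.
open Topology in
theorem exists_contDiff_eventuallyEq {n : ℕ} {U : Set (Fin n → ℝ)} (hU : IsOpen U)
    {h : (Fin n → ℝ) → ℝ} (hh : ContDiffOn ℝ ∞ h U) {y₀ : Fin n → ℝ} (hy : y₀ ∈ U) :
    ∃ H : (Fin n → ℝ) → ℝ, ContDiff ℝ ∞ H ∧ H =ᶠ[𝓝 y₀] h := by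
  obtain ⟨r, hr, hrU⟩ := Metric.isOpen_iff.1 hU y₀ hy
  let χ : ContDiffBump y₀ := ⟨r / 4, r / 2, by positivity, by linarith⟩
  refine ⟨fun y => χ y * h y, ?_, ?_⟩
  · rw [contDiff_iff_contDiffAt]
    intro y
    by_cases hyU : y ∈ U
    · exact χ.contDiff.contDiffAt.mul (hh.contDiffAt (hU.mem_nhds hyU))
    · have : ∀ᶠ z in 𝓝 y, χ z * h z = 0 := by
        have h1 : y ∈ (Metric.closedBall y₀ (r / 2))ᶜ := fun h2 =>
          hyU (hrU (Metric.closedBall_subset_ball (by linarith) h2))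
        filter_upwards [Metric.isClosed_closedBall.isOpen_compl.mem_nhds h1] with z hz
        rw [χ.zero_of_le_dist, zero_mul]
        have h3 := not_le.1 (fun h => hz (Metric.mem_closedBall.2 h))
        exact h3.le
      exact (contDiffAt_const (c := (0 : ℝ))).congr_of_eventuallyEq this
  · filter_upwards [χ.eventuallyEq_one] with y hy
    simp only [hy, Pi.one_apply, one_mul]

open Topology in
/-- Hadamard's lemma. -/
theorem hadamard_lemma {n : ℕ} {U : Set (Fin n → ℝ)} (hU : IsOpen U)
    {h : (Fin n → ℝ) → ℝ} (hh : ContDiffOn ℝ ∞ h U) {y₀ : Fin n → ℝ} (hy : y₀ ∈ U) :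
    ∃ g : Fin n → (Fin n → ℝ) → ℝ, (∀ a, ContDiff ℝ ∞ (g a)) ∧
      ∀ᶠ y in 𝓝 y₀, h y = h y₀ + ∑ a, (y a - y₀ a) * g a y := by
  obtain ⟨H, hH, hHh⟩ := exists_contDiff_eventuallyEq hU hh hy
  have hfd : ContDiff ℝ ∞ (fderiv ℝ H) := hH.fderiv_right (by simp)
  -- The coefficients are ∫₀¹ ∂_a H(y₀ + t(y − y₀)) dt, from the fundamental theorem of calculus
  -- along the segment.
  refine ⟨fun a y => ∫ t in (0 : ℝ)..1, fderiv ℝ H (y₀ + t • (y - y₀)) (Pi.single a 1),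
    fun a => ?_, ?_⟩
  · apply contDiff_parametric_intervalIntegral
      (F := fun y t => fderiv ℝ H (y₀ + t • (y - y₀)) (Pi.single a 1))
    refine ContDiff.clm_apply (hfd.comp ?_) contDiff_const
    exact contDiff_const.add (contDiff_snd.smul (contDiff_fst.sub contDiff_const))
  · filter_upwards [hHh] with y hyH
    rw [← hyH, ← hHh.self_of_nhds]
    have h1 : ∀ t ∈ Set.uIcc (0 : ℝ) 1, HasDerivAt (fun t : ℝ => H (y₀ + t • (y - y₀)))
        (fderiv ℝ H (y₀ + t • (y - y₀)) (y - y₀)) t := by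
      intro t _
      have h2 : HasDerivAt (fun t : ℝ => y₀ + t • (y - y₀)) (y - y₀) t := by
        simpa using ((hasDerivAt_id t).smul_const (y - y₀)).const_add y₀
      exact ((hH.differentiable (by simp)) _).hasFDerivAt.comp_hasDerivAt t h2
    have hcont : ∀ v, Continuous fun t : ℝ => fderiv ℝ H (y₀ + t • (y - y₀)) v := fun v =>
      (hfd.continuous.comp (by fun_prop)).clm_apply continuous_const
    have h3 := intervalIntegral.integral_eq_sub_of_hasDerivAt h1
      ((hcont _).intervalIntegrable _ _)
    simp only [one_smul, zero_smul, add_zero, add_sub_cancel] at h3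
    rw [← sub_eq_iff_eq_add', ← h3]
    simp only [← intervalIntegral.integral_const_mul]
    rw [← intervalIntegral.integral_finsetSum]
    · refine intervalIntegral.integral_congr fun t _ => ?_
      have h4 : y - y₀ = ∑ a, (y a - y₀ a) • Pi.single (M := fun _ : Fin n => ℝ) a (1 : ℝ) := by
        ext i
        simp [Finset.sum_apply, Pi.single_apply]
      have h5 : ∀ T : (Fin n → ℝ) →L[ℝ] ℝ, T (y - y₀) = ∑ a, (y a - y₀ a) * T (Pi.single a 1) := by
        intro T
        conv_lhs => rw [h4]
        simp only [map_sum, map_smul, smul_eq_mul]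
      exact h5 _
    · intro a _
      exact (continuous_const.mul (hcont _)).intervalIntegrable _ _

/-! ### Calculus of superfunctions -/

namespace Grassmann

variable {n m : ℕ}

/-- A linear functional in terms of the coefficients. -/
theorem linearMap_apply_eq {V : Type*} [AddCommGroup V] [Module ℝ V] (T : Grassmann m →ₗ[ℝ] V)
    (x : Grassmann m) : T x = ∑ I, coeff I x • T (monomials m I) := by
  conv_lhs => rw [← sum_coeff x]
  rw [map_sum]
  simp only [map_smul]

/-- The structure constants of the Grassmann algebra. -/
theorem coeff_mul (K : Finset (Fin m)) (x y : Grassmann m) :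
    coeff K (x * y) = ∑ I, ∑ J, coeff I x * coeff J y * coeff K (monomials m I * monomials m J) := by
  conv_lhs => rw [← sum_coeff x, ← sum_coeff y]
  simp only [Finset.sum_mul_sum, map_sum, smul_mul_smul_comm, map_smul, smul_eq_mul]

/-- The partial derivative of a Grassmann-valued function on `ℝⁿ`. -/
noncomputable def pd (a : Fin n) (F : (Fin n → ℝ) → Grassmann m) (y : Fin n → ℝ) : Grassmann m :=
  ∑ I, fderiv ℝ (fun z => coeff I (F z)) y (Pi.single a 1) • monomials m I

theorem coeff_pd (a : Fin n) (F : (Fin n → ℝ) → Grassmann m) (y : Fin n → ℝ)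
    (I : Finset (Fin m)) :
    coeff I (pd a F y) = fderiv ℝ (fun z => coeff I (F z)) y (Pi.single a 1) := by
  simp [pd, coeff_monomials]

open Topology in
theorem pd_congr {a : Fin n} {F G : (Fin n → ℝ) → Grassmann m} {y : Fin n → ℝ} (h : F =ᶠ[𝓝 y] G) :
    pd a F y = pd a G y := by
  refine ext_coeff fun I => ?_
  rw [coeff_pd, coeff_pd]
  congr 1
  exact Filter.EventuallyEq.fderiv_eq (h.fun_comp (coeff I))

/-- A Grassmann-valued function is smooth at a point. -/
def SmoothAt (F : (Fin n → ℝ) → Grassmann m) (y : Fin n → ℝ) : Prop :=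
  ∀ I, ContDiffAt ℝ ∞ (fun z => coeff I (F z)) y

theorem SmoothAt.linear {F : (Fin n → ℝ) → Grassmann m} {y : Fin n → ℝ} (hF : SmoothAt F y)
    (T : Grassmann m →ₗ[ℝ] ℝ) : ContDiffAt ℝ ∞ (fun z => T (F z)) y := by
  rw [show (fun z => T (F z)) = fun z => ∑ I, coeff I (F z) * T (monomials m I) from
    funext fun z => linearMap_apply_eq T _]
  exact ContDiffAt.sum fun I _ => (hF I).mul contDiffAt_const

theorem SmoothAt.map {m' : ℕ} {F : (Fin n → ℝ) → Grassmann m} {y : Fin n → ℝ} (hF : SmoothAt F y)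
    (T : Grassmann m →ₗ[ℝ] Grassmann m') : SmoothAt (fun z => T (F z)) y :=
  fun I => hF.linear ((coeff I).comp T)

theorem SmoothAt.mul {F G : (Fin n → ℝ) → Grassmann m} {y : Fin n → ℝ} (hF : SmoothAt F y)
    (hG : SmoothAt G y) : SmoothAt (fun z => F z * G z) y := by
  intro K
  rw [show (fun z => coeff K (F z * G z)) = _ from funext fun z => coeff_mul K _ _]
  exact ContDiffAt.sum fun I _ => ContDiffAt.sum fun J _ =>
    ((hF I).mul (hG J)).mul contDiffAt_const

theorem SmoothAt.pd {F : (Fin n → ℝ) → Grassmann m} {y : Fin n → ℝ} (hF : SmoothAt F y)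
    (a : Fin n) : SmoothAt (pd a F) y := by
  intro I
  simp only [coeff_pd]
  exact ((hF I).fderiv_right (by simp)).clm_apply contDiffAt_const

theorem linear_pd {F : (Fin n → ℝ) → Grassmann m} {y : Fin n → ℝ} (hF : SmoothAt F y)
    (a : Fin n) (T : Grassmann m →ₗ[ℝ] ℝ) :
    T (pd a F y) = fderiv ℝ (fun z => T (F z)) y (Pi.single a 1) := by
  have h : HasFDerivAt (fun z => T (F z))
      (∑ I, T (monomials m I) • fderiv ℝ (fun z => coeff I (F z)) y) y := by
    have h1 : (fun z => T (F z)) = fun z => ∑ I, T (monomials m I) * coeff I (F z) := by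
      funext z
      rw [linearMap_apply_eq T]
      simp only [smul_eq_mul, mul_comm]
    rw [h1]
    exact HasFDerivAt.fun_sum fun I _ =>
      (((hF I).differentiableAt (by simp)).hasFDerivAt).const_mul _
  rw [h.fderiv, linearMap_apply_eq T]
  simp only [coeff_pd, sum_apply, smul_apply, smul_eq_mul,
    mul_comm]

theorem pd_map {m' : ℕ} {F : (Fin n → ℝ) → Grassmann m} {y : Fin n → ℝ} (hF : SmoothAt F y)
    (a : Fin n) (T : Grassmann m →ₗ[ℝ] Grassmann m') :
    pd a (fun z => T (F z)) y = T (pd a F y) := by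
  refine ext_coeff fun I => ?_
  rw [coeff_pd]
  exact (linear_pd hF a ((coeff I).comp T)).symm

theorem pd_mul {F G : (Fin n → ℝ) → Grassmann m} {y : Fin n → ℝ} (hF : SmoothAt F y)
    (hG : SmoothAt G y) (a : Fin n) :
    pd a (fun z => F z * G z) y = pd a F y * G y + F y * pd a G y := by
  refine ext_coeff fun K => ?_
  have h : HasFDerivAt (fun z => coeff K (F z * G z))
      (∑ I, ∑ J, coeff K (monomials m I * monomials m J) •
        (coeff I (F y) • fderiv ℝ (fun z => coeff J (G z)) y
          + coeff J (G y) • fderiv ℝ (fun z => coeff I (F z)) y)) y := by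
    rw [show (fun z => coeff K (F z * G z)) = _ from funext fun z => coeff_mul K _ _]
    exact HasFDerivAt.fun_sum fun I _ => HasFDerivAt.fun_sum fun J _ =>
      ((((hF I).differentiableAt (by simp)).hasFDerivAt).mul
        (((hG J).differentiableAt (by simp)).hasFDerivAt)).mul_const _
  rw [coeff_pd, h.fderiv, map_add, coeff_mul, coeff_mul, ← Finset.sum_add_distrib]
  simp only [sum_apply, smul_apply, smul_eq_mul,
    add_apply, coeff_pd, ← Finset.sum_add_distrib]
  refine Finset.sum_congr rfl fun I _ => Finset.sum_congr rfl fun J _ => ?_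
  ring

theorem pd_add {F G : (Fin n → ℝ) → Grassmann m} {y : Fin n → ℝ} (hF : SmoothAt F y)
    (hG : SmoothAt G y) (a : Fin n) :
    pd a (fun z => F z + G z) y = pd a F y + pd a G y := by
  refine ext_coeff fun K => ?_
  rw [map_add, coeff_pd, coeff_pd, coeff_pd]
  simp only [map_add]
  rw [fderiv_fun_add ((hF K).differentiableAt (by simp)) ((hG K).differentiableAt (by simp))]
  rfl

theorem pd_comm {F : (Fin n → ℝ) → Grassmann m} {y : Fin n → ℝ} (hF : SmoothAt F y)
    (a b : Fin n) : pd a (pd b F) y = pd b (pd a F) y := by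
  refine ext_coeff fun K => ?_
  rw [coeff_pd, coeff_pd]
  simp only [coeff_pd]
  have h := (hF K).isSymmSndFDerivAt (by simp; exact WithTop.coe_le_coe.2 le_top)
  have hd : DifferentiableAt ℝ (fderiv ℝ fun z => coeff K (F z)) y :=
    ((hF K).fderiv_right (m := ∞) (by simp)).differentiableAt (by simp)
  rw [fderiv_clm_apply hd (differentiableAt_const _), fderiv_clm_apply hd (differentiableAt_const _)]
  simp only [fderiv_fun_const, ContinuousLinearMap.comp_zero, zero_add, Pi.zero_apply,
    ContinuousLinearMap.flip_apply]
  exact h _ _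

end Grassmann

/-! ### Partial derivatives of superfunctions in a chart. -/

section

open Topology

variable {n m : ℕ} {X : Type u} [TopologicalSpace X] {c : OpenPartialHomeomorph X (Fin n → ℝ)}
  {W W' : TopologicalSpace.Opens X}

open Grassmann (SmoothAt pd)

theorem superDeriv_inl (a : Fin n) (f : X → Grassmann m) (x : X) :
    superDeriv c (Sum.inl a) f x = pd a (fun y => f (c.symm y)) (c x) := rfl

theorem superDeriv_inr (α : Fin m) (f : X → Grassmann m) (x : X) :
    superDeriv c (Sum.inr α) f x = Grassmann.oddDeriv α (f x) := rfl

theorem eventually_comp_symm {x : X} (hx : x ∈ c.source) {p : X → Prop} (h : ∀ᶠ z in 𝓝 x, p z) :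
    ∀ᶠ y in 𝓝 (c x), p (c.symm y) := by
  have := c.continuousAt_symm (c.map_source hx)
  rw [ContinuousAt, c.left_inv hx] at this
  exact this.eventually h

theorem superDeriv_congr {x : X} (hx : x ∈ c.source) {f g : X → Grassmann m} (h : f =ᶠ[𝓝 x] g)
    (A : Fin n ⊕ Fin m) : superDeriv c A f x = superDeriv c A g x := by
  rcases A with a | α
  · exact Grassmann.pd_congr (eventually_comp_symm hx h)
  · rw [superDeriv_inr, superDeriv_inr, h.self_of_nhds]

theorem superDeriv_congr_eventually {x : X} (hx : x ∈ c.source) {f g : X → Grassmann m}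
    (h : f =ᶠ[𝓝 x] g) (A : Fin n ⊕ Fin m) : superDeriv c A f =ᶠ[𝓝 x] superDeriv c A g := by
  filter_upwards [h.eventuallyEq_nhds, c.open_source.mem_nhds hx] with z hz hzs
  exact superDeriv_congr hzs hz A

/-- A Grassmann-valued function is smooth at a point in the chart `c`. -/
def SuperSmoothAt (c : OpenPartialHomeomorph X (Fin n → ℝ)) (f : X → Grassmann m) (x : X) : Prop :=
  SmoothAt (fun y => f (c.symm y)) (c x)

namespace SuperFun

theorem isOpen_region : IsOpen (c.target ∩ c.symm ⁻¹' (W : Set X)) :=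
  c.isOpen_inter_preimage_symm W.isOpen

theorem mem_iff (hW : (W : Set X) ⊆ c.source) {f : W → Grassmann m} :
    f ∈ SuperFun m c W ↔ ∀ x : W, SuperSmoothAt c (extendZero f) x := by
  constructor
  · intro h x I
    refine (h I).contDiffAt (isOpen_region.mem_nhds ⟨c.map_source (hW x.2), ?_⟩)
    rw [Set.mem_preimage, c.left_inv (hW x.2)]
    exact x.2
  · intro h I y hy
    have := h ⟨c.symm y, hy.2⟩ I
    simp only [c.right_inv hy.1] at this
    exact this.contDiffWithinAt

theorem smooth (hW : (W : Set X) ⊆ c.source) (f : SuperFun m c W) {x : X} (hx : x ∈ W) :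
    SuperSmoothAt c (extendZero f.1) x := (mem_iff hW).1 f.2 ⟨x, hx⟩

theorem smoothAt_congr {f g : X → Grassmann m} {x : X} (hx : x ∈ c.source)
    (hf : SuperSmoothAt c f x) (h : f =ᶠ[𝓝 x] g) : SuperSmoothAt c g x := by
  intro I
  refine (hf I).congr_of_eventuallyEq ?_
  filter_upwards [eventually_comp_symm hx h] with y hy
  simp only [hy]

theorem extendZero_of_mem (f : W → Grassmann m) {x : X} (hx : x ∈ W) :
    extendZero f x = f ⟨x, hx⟩ := extendZero_apply f ⟨x, hx⟩

theorem extendZero_of_notMem (f : W → Grassmann m) {x : X} (hx : x ∉ W) :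
    extendZero f x = 0 := by simp [extendZero, hx]

theorem extendZero_eventuallyEq {f : W → Grassmann m} {g : X → Grassmann m} {x : X} (hx : x ∈ W)
    (h : ∀ y : W, f y = g y) : extendZero f =ᶠ[𝓝 x] g := by
  filter_upwards [W.isOpen.mem_nhds hx] with y hy
  rw [extendZero_of_mem f hy, h]

theorem extendZero_mul (f g : W → Grassmann m) :
    extendZero (f * g) = fun x => extendZero f x * extendZero g x := by
  funext x
  by_cases hx : x ∈ W <;> simp [extendZero, hx]

theorem extendZero_add (f g : W → Grassmann m) :
    extendZero (f + g) = fun x => extendZero f x + extendZero g x := by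
  funext x
  by_cases hx : x ∈ W <;> simp [extendZero, hx]

theorem extendZero_smul (r : ℝ) (f : W → Grassmann m) :
    extendZero (r • f) = fun x => r • extendZero f x := by
  funext x
  by_cases hx : x ∈ W <;> simp [extendZero, hx]

theorem extendZero_map (T : Grassmann m →ₗ[ℝ] Grassmann m) (f : W → Grassmann m) :
    extendZero (fun x => T (f x)) = fun x => T (extendZero f x) := by
  funext x
  by_cases hx : x ∈ W <;> simp [extendZero, hx]

/-- A superfunction given by a smooth function on `X`. -/
noncomputable def ofSmooth (hW : (W : Set X) ⊆ c.source) (f : X → Grassmann m)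
    (hf : ∀ x ∈ W, SuperSmoothAt c f x) : SuperFun m c W :=
  ⟨fun x => f x, (mem_iff hW).2 fun x => smoothAt_congr (hW x.2) (hf x x.2)
    (extendZero_eventuallyEq x.2 fun _ => rfl).symm⟩

theorem ext' {f g : SuperFun m c W} (h : ∀ x hx, f.1 ⟨x, hx⟩ = g.1 ⟨x, hx⟩) : f = g :=
  Subtype.ext (funext fun x => h x.1 x.2)

/-- Evaluation at a point. -/
noncomputable def ev (x : W) : SuperFun m c W →ₐ[ℝ] Grassmann m :=
  (Pi.evalAlgHom ℝ (fun _ : W => Grassmann m) x).comp (SuperFun m c W).val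

theorem ev_apply (x : W) (f : SuperFun m c W) : ev x f = f.1 x := rfl

/-- Application of a linear map to the values. -/
noncomputable def mapValues (hW : (W : Set X) ⊆ c.source) (T : Grassmann m →ₗ[ℝ] Grassmann m)
    (f : SuperFun m c W) : SuperFun m c W :=
  ⟨fun x => T (f.1 x), (mem_iff hW).2 fun x => by
    rw [extendZero_map]; exact (smooth hW f x.2).map T⟩

/-- The homogeneous superfunctions. -/
noncomputable def part (m : ℕ) (c : OpenPartialHomeomorph X (Fin n → ℝ))
    (W : TopologicalSpace.Opens X) (p : ZMod 2) : Submodule ℝ (SuperFun m c W) where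
  carrier := {f | ∀ x, f.1 x ∈ Grassmann.part m p}
  add_mem' hf hg x := Submodule.add_mem _ (hf x) (hg x)
  zero_mem' _ := Submodule.zero_mem _
  smul_mem' r _ hf x := Submodule.smul_mem _ r (hf x)

theorem isSupercommutative : IsSupercommutative (part m c W) where
  one_mem _ := Grassmann.one_mem_part
  mul_mem hx hy z := Grassmann.mul_mem_part (hx z) (hy z)
  comm hx hy := ext' fun z hz => Grassmann.mul_comm_of_mem (hx ⟨z, hz⟩) (hy ⟨z, hz⟩)

theorem exists_part_decomp (hW : (W : Set X) ⊆ c.source) (f : SuperFun m c W) :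
    ∃ g ∈ part m c W 0, ∃ h ∈ part m c W 1, f = g + h :=
  ⟨mapValues hW (Grassmann.proj 0) f, fun _ => Grassmann.proj_mem _ _,
    mapValues hW (Grassmann.proj 1) f, fun _ => Grassmann.proj_mem _ _,
    ext' fun _ _ => (Grassmann.proj_add_proj _).symm⟩

end SuperFun

theorem SuperSmoothAt.superDeriv {f : X → Grassmann m} {x : X} (hx : x ∈ c.source)
    (hf : SuperSmoothAt c f x) (A : Fin n ⊕ Fin m) : SuperSmoothAt c (superDeriv c A f) x := by
  rcases A with a | α
  · intro I
    refine (hf.pd a I).congr_of_eventuallyEq ?_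
    filter_upwards [c.open_target.mem_nhds (c.map_source hx)] with y hy
    rw [superDeriv_inl, c.right_inv hy]
  · exact hf.map (Grassmann.oddDeriv α)

theorem superDeriv_mul {f g : X → Grassmann m} {x : X} (hx : x ∈ c.source)
    (hf : SuperSmoothAt c f x) (hg : SuperSmoothAt c g x) (A : Fin n ⊕ Fin m) :
    superDeriv c A (fun z => f z * g z) x
      = superDeriv c A f x * g x + Grassmann.twist (coordParity A) (f x) * superDeriv c A g x := by
  rcases A with a | α
  · rw [superDeriv_inl, Grassmann.pd_mul hf hg, c.left_inv hx]
    simp only [coordParity, Sum.elim_inl, Grassmann.twist_zero]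
    rfl
  · exact Grassmann.oddDeriv_mul α _ _

theorem superDeriv_add {f g : X → Grassmann m} {x : X}
    (hf : SuperSmoothAt c f x) (hg : SuperSmoothAt c g x) (A : Fin n ⊕ Fin m) :
    superDeriv c A (fun z => f z + g z) x = superDeriv c A f x + superDeriv c A g x := by
  rcases A with a | α
  · exact Grassmann.pd_add hf hg a
  · exact map_add _ _ _

theorem superDeriv_smul {f : X → Grassmann m} {x : X}
    (hf : SuperSmoothAt c f x) (A : Fin n ⊕ Fin m) (r : ℝ) :
    superDeriv c A (fun z => r • f z) x = r • superDeriv c A f x := by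
  rcases A with a | α
  · have h := Grassmann.pd_map hf a (r • LinearMap.id)
    simp only [LinearMap.smul_apply, LinearMap.id_apply] at h
    exact h
  · exact map_smul _ _ _

theorem superDeriv_comm {f : X → Grassmann m} {x : X} (hx : x ∈ c.source)
    (hf : SuperSmoothAt c f x) (A B : Fin n ⊕ Fin m) :
    superDeriv c A (superDeriv c B f) x
      = sgn (coordParity A * coordParity B) • superDeriv c B (superDeriv c A f) x := by
  have ht : ∀ᶠ y in 𝓝 (c x), c (c.symm y) = y := by
    filter_upwards [c.open_target.mem_nhds (c.map_source hx)] with y hy using c.right_inv hy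
  have key : ∀ b, (fun y => superDeriv c (Sum.inl b) f (c.symm y))
      =ᶠ[𝓝 (c x)] pd b (fun y => f (c.symm y)) := by
    intro b
    filter_upwards [ht] with y hy
    rw [superDeriv_inl, hy]
  rcases A with a | α <;> rcases B with b | β <;>
    simp only [coordParity, Sum.elim_inl, Sum.elim_inr, mul_zero, zero_mul, sgn_zero, one_smul]
  · rw [superDeriv_inl, superDeriv_inl, Grassmann.pd_congr (key b), Grassmann.pd_congr (key a),
      Grassmann.pd_comm hf]
  · exact Grassmann.pd_map hf a (Grassmann.oddDeriv β)
  · exact (Grassmann.pd_map hf b (Grassmann.oddDeriv α)).symm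
  · rw [mul_one, sgn_one, neg_one_smul]
    exact Grassmann.oddDeriv_anticomm _ _ _

/-- Near `x` the function is fixed by the parity projection, and an even partial derivative commutes
with any constant linear map, so its value is fixed by the projection too. For odd coordinates the
statement is pointwise. -/
theorem superDeriv_mem {f : X → Grassmann m} {x : X} (hx : x ∈ c.source) {p : ZMod 2}
    (hf : SuperSmoothAt c f x) (hp : ∀ᶠ z in 𝓝 x, f z ∈ Grassmann.part m p) (A : Fin n ⊕ Fin m) :
    superDeriv c A f x ∈ Grassmann.part m (p + coordParity A) := by
  rcases A with a | α
  · simp only [coordParity, Sum.elim_inl, add_zero]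
    rw [superDeriv_inl]
    have h := Grassmann.pd_map hf a (Grassmann.proj p)
    rw [Grassmann.pd_congr (G := fun y => f (c.symm y))] at h
    · rw [h]; exact Grassmann.proj_mem _ _
    · filter_upwards [eventually_comp_symm hx hp] with y hy
      exact Grassmann.proj_of_mem hy
  · exact Grassmann.oddDeriv_mem α hp.self_of_nhds

namespace SuperFun

/-- The partial derivatives as operators on superfunctions. -/
noncomputable def D (hW : (W : Set X) ⊆ c.source) (A : Fin n ⊕ Fin m) :
    SuperFun m c W →ₗ[ℝ] SuperFun m c W where
  toFun f := ofSmooth hW (superDeriv c A (extendZero f.1)) fun _ hx =>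
    (smooth hW f hx).superDeriv (hW hx) A
  map_add' f g := ext' fun x hx => by
    change superDeriv c A (extendZero (f.1 + g.1)) x = _
    rw [extendZero_add]
    exact superDeriv_add (smooth hW f hx) (smooth hW g hx) A
  map_smul' r f := ext' fun x hx => by
    change superDeriv c A (extendZero (r • f.1)) x = _
    rw [extendZero_smul]
    exact superDeriv_smul (smooth hW f hx) A r

variable (hW : (W : Set X) ⊆ c.source)

theorem D_apply (A : Fin n ⊕ Fin m) (f : SuperFun m c W) {x : X} (hx : x ∈ W) :
    (D hW A f).1 ⟨x, hx⟩ = superDeriv c A (extendZero f.1) x := rfl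

theorem D_mem (A : Fin n ⊕ Fin m) {p : ZMod 2} {f : SuperFun m c W} (hf : f ∈ part m c W p) :
    D hW A f ∈ part m c W (p + coordParity A) := fun x => by
  refine superDeriv_mem (hW x.2) (smooth hW f x.2) ?_ A
  filter_upwards [W.isOpen.mem_nhds x.2] with z hz
  rw [extendZero_of_mem f.1 hz]
  exact hf ⟨z, hz⟩

theorem D_mul_apply (A : Fin n ⊕ Fin m) (f g : SuperFun m c W) (x : W) :
    (D hW A (f * g)).1 x = (D hW A f).1 x * g.1 x
      + Grassmann.twist (coordParity A) (f.1 x) * (D hW A g).1 x := by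
  change superDeriv c A (extendZero (f.1 * g.1)) x = _
  rw [extendZero_mul]
  have := superDeriv_mul (hW x.2) (smooth hW f x.2) (smooth hW g x.2) A
  rwa [extendZero_apply, extendZero_apply] at this

theorem isSuperderivation_D (A : Fin n ⊕ Fin m) :
    IsSuperderivation (part m c W) (coordParity A) (D hW A) where
  mem hf := D_mem hW A hf
  mul g hf := ext' fun x hx => by
    rw [D_mul_apply, Grassmann.twist_of_mem (hf ⟨x, hx⟩), smul_mul_assoc]
    rfl

theorem D_comm (A B : Fin n ⊕ Fin m) (f : SuperFun m c W) :
    D hW A (D hW B f) = sgn (coordParity A * coordParity B) • D hW B (D hW A f) :=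
  ext' fun x hx => by
    have key : ∀ C, extendZero (D hW C f).1 =ᶠ[𝓝 x] superDeriv c C (extendZero f.1) :=
      fun C => extendZero_eventuallyEq hx fun _ => rfl
    change superDeriv c A (extendZero (D hW B f).1) x
      = sgn _ • superDeriv c B (extendZero (D hW A f).1) x
    rw [superDeriv_congr (hW hx) (key B), superDeriv_congr (hW hx) (key A)]
    exact superDeriv_comm (hW hx) (smooth hW f hx) A B

theorem D_coord (A B : Fin n ⊕ Fin m) : D hW A (coord m c W B) = if A = B then 1 else 0 :=
  ext' fun x hx => by
    rw [D_apply]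
    rcases A with a | α <;> rcases B with b | β
    · rw [superDeriv_inl, Grassmann.pd_congr (G := fun y => algebraMap ℝ _ (y b))]
      · refine Grassmann.ext_coeff fun I => ?_
        rw [Grassmann.coeff_pd]
        have : HasFDerivAt (fun z : Fin n → ℝ => Grassmann.coeff I (algebraMap ℝ (Grassmann m) (z b)))
            (Grassmann.coeff I (1 : Grassmann m) • ContinuousLinearMap.proj (R := ℝ) b) (c x) := by
          simp only [Algebra.algebraMap_eq_smul_one, map_smul, smul_eq_mul]
          have h := (ContinuousLinearMap.proj (R := ℝ) (φ := fun _ : Fin n => ℝ) b).hasFDerivAt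
            (x := c x)
          exact h.mul_const _
        rw [this.fderiv]
        by_cases hab : a = b
        · subst hab; simp
        · simp [hab, Ne.symm hab]
      · filter_upwards [eventually_comp_symm (hW hx) (W.isOpen.mem_nhds hx),
          c.open_target.mem_nhds (c.map_source (hW hx))] with y hy hyt
        have hy : c.symm y ∈ W := hy
        rw [extendZero_of_mem _ hy]
        change algebraMap ℝ _ (c (c.symm y) b) = _
        rw [c.right_inv hyt]
    · rw [superDeriv_inl, Grassmann.pd_congr (G := fun y => Grassmann.xi β)]
      · refine Grassmann.ext_coeff fun I => ?_
        rw [Grassmann.coeff_pd]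
        simp
      · filter_upwards [eventually_comp_symm (hW hx) (W.isOpen.mem_nhds hx)] with y hy
        have hy : c.symm y ∈ W := hy
        rw [extendZero_of_mem _ hy]
        rfl
    · rw [superDeriv_inr, extendZero_of_mem _ hx]
      change Grassmann.oddDeriv α (algebraMap ℝ _ _) = _
      simp
    · rw [superDeriv_inr, extendZero_of_mem _ hx]
      change Grassmann.oddDeriv α (Grassmann.xi β) = _
      rw [Grassmann.oddDeriv_xi]
      by_cases h : α = β
      · subst h; simp
      · simp [h]

theorem coord_mem (A : Fin n ⊕ Fin m) : coord m c W A ∈ part m c W (coordParity A) := by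
  rcases A with a | α
  · exact fun _ => Grassmann.algebraMap_mem_part _
  · exact fun _ => Grassmann.xi_mem_part _

end SuperFun

end

/-! ### Superderivations at a point and invertible superfunctions. -/

section

open Topology

variable {n m : ℕ} {X : Type u} [TopologicalSpace X] {c : OpenPartialHomeomorph X (Fin n → ℝ)}
  {W W' : TopologicalSpace.Opens X}

/-- A scalar function of the even coordinates. -/
noncomputable def scalarFn (m : ℕ) (c : OpenPartialHomeomorph X (Fin n → ℝ)) (h : (Fin n → ℝ) → ℝ) :
    X → Grassmann m := fun x => algebraMap ℝ _ (h (c x))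

theorem superSmoothAt_scalarFn {h : (Fin n → ℝ) → ℝ} {x : X} (hx : x ∈ c.source)
    (hh : ContDiffAt ℝ ∞ h (c x)) : SuperSmoothAt c (scalarFn m c h) x := by
  intro I
  have h1 : ContDiffAt ℝ ∞ (fun y => h y * Grassmann.coeff I (1 : Grassmann m)) (c x) :=
    hh.mul contDiffAt_const
  refine h1.congr_of_eventuallyEq ?_
  filter_upwards [c.open_target.mem_nhds (c.map_source hx)] with y hy
  rw [scalarFn, c.right_inv hy, Algebra.algebraMap_eq_smul_one, map_smul, smul_eq_mul]

theorem superSmoothAt_const (z : Grassmann m) (x : X) : SuperSmoothAt c (fun _ => z) x :=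
  fun I => contDiffAt_const (c := Grassmann.coeff I z)

theorem SuperSmoothAt.mul {f g : X → Grassmann m} {x : X} (hf : SuperSmoothAt c f x)
    (hg : SuperSmoothAt c g x) : SuperSmoothAt c (fun z => f z * g z) x :=
  Grassmann.SmoothAt.mul hf hg

theorem SuperSmoothAt.linear {f : X → Grassmann m} {x : X} (hf : SuperSmoothAt c f x)
    (T : Grassmann m →ₗ[ℝ] ℝ) : ContDiffAt ℝ ∞ (fun y => T (f (c.symm y))) (c x) :=
  Grassmann.SmoothAt.linear hf T

namespace SuperFun

section
variable (hW : (W : Set X) ⊆ c.source)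

/-- A smooth scalar function of the even coordinates as a superfunction. -/
noncomputable def scalar (h : (Fin n → ℝ) → ℝ) (hh : ∀ x ∈ W, ContDiffAt ℝ ∞ h (c x)) :
    SuperFun m c W :=
  ofSmooth hW (scalarFn m c h) fun x hx => superSmoothAt_scalarFn (hW hx) (hh x hx)

/-- Constant superfunctions. -/
noncomputable def const : Grassmann m →ₐ[ℝ] SuperFun m c W where
  toFun z := ofSmooth hW (fun _ => z) fun x _ => superSmoothAt_const z x
  map_one' := rfl
  map_mul' _ _ := rfl
  map_zero' := rfl
  map_add' _ _ := rfl
  commutes' _ := rfl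

theorem eq_sum_scalar_mul_const (f : SuperFun m c W) :
    f = ∑ I, scalar hW (fun y => Grassmann.coeff I (extendZero f.1 (c.symm y)))
      (fun _ hx => (smooth hW f hx).linear _) * const hW (Grassmann.monomials m I) := by
  refine ext' fun x hx => ?_
  rw [← ev_apply ⟨x, hx⟩ (∑ I, _), map_sum]
  have h1 : ∀ I, Grassmann.coeff I (extendZero f.1 (c.symm (c x)))
      = Grassmann.coeff I (f.1 ⟨x, hx⟩) := by
    intro I; rw [c.left_inv (hW hx), extendZero_of_mem _ hx]
  conv_lhs => rw [← Grassmann.sum_coeff (f.1 ⟨x, hx⟩)]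
  refine Finset.sum_congr rfl fun I _ => ?_
  rw [← h1, map_mul, Algebra.smul_def]
  rfl

theorem D_mul (A : Fin n ⊕ Fin m) (f g : SuperFun m c W) :
    D hW A (f * g) = D hW A f * g
      + mapValues hW (Grassmann.twist (coordParity A)).toLinearMap f * D hW A g :=
  ext' fun _ _ => D_mul_apply hW A f g _

theorem map_mapValues_twist (τ : SuperFun m c W →ₐ[ℝ] Grassmann m)
    (hτp : ∀ p, ∀ f ∈ part m c W p, τ f ∈ Grassmann.part m p) (p : ZMod 2) (f : SuperFun m c W) :
    τ (mapValues hW (Grassmann.twist p).toLinearMap f) = Grassmann.twist p (τ f) := by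
  have key : ∀ q, ∀ g ∈ part m c W q,
      mapValues hW (Grassmann.twist p).toLinearMap g = sgn (p * q) • g := fun q g hg =>
    ext' fun x hx => Grassmann.twist_of_mem (hg ⟨x, hx⟩)
  have hadd : ∀ g h : SuperFun m c W, mapValues hW (Grassmann.twist p).toLinearMap (g + h)
      = mapValues hW (Grassmann.twist p).toLinearMap g
        + mapValues hW (Grassmann.twist p).toLinearMap h := fun g h => ext' fun x hx =>
    map_add (Grassmann.twist p).toLinearMap _ _
  obtain ⟨g, hg, h, hh, rfl⟩ := exists_part_decomp hW f
  rw [hadd, key 0 g hg, key 1 h hh, map_add, map_add, map_add, map_smul, map_smul,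
    Grassmann.twist_of_mem (hτp _ _ hg), Grassmann.twist_of_mem (hτp _ _ hh)]

/-- A local superderivation at a point which annihilates the coordinates is zero. -/
theorem pointDerivation_eq_zero (hW : (W : Set X) ⊆ c.source) {x₀ : W}
    (τ : SuperFun m c W →ₐ[ℝ] Grassmann m) (d : ZMod 2) (v : SuperFun m c W →ₗ[ℝ] Grassmann m)
    (hτb : ∀ f, Grassmann.body (τ f) = Grassmann.body (f.1 x₀))
    (hv : ∀ f g, v (f * g) = v f * τ g + Grassmann.twist d (τ f) * v g)
    (hloc : ∀ f : SuperFun m c W, extendZero f.1 =ᶠ[𝓝 x₀.1] 0 → v f = 0)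
    (hcoord : ∀ A, v (coord m c W A) = 0) (f : SuperFun m c W) : v f = 0 := by
  have h1 : v 1 = 0 := by simpa using hv 1 1
  have halg : ∀ r, v (algebraMap ℝ _ r) = 0 := fun r => by
    rw [Algebra.algebraMap_eq_smul_one, map_smul, h1, smul_zero]
  have hconst : ∀ z, v (const hW z) = 0 := by
    intro z
    induction z using ExteriorAlgebra.induction with
    | algebraMap r => rw [AlgHom.commutes, halg]
    | ι w =>
      rw [← Grassmann.sum_smul_xi, map_sum, map_sum]
      refine Finset.sum_eq_zero fun α _ => ?_
      rw [map_smul, map_smul]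
      have : const hW (Grassmann.xi α) = coord m c W (Sum.inr α) := rfl
      rw [this, hcoord, smul_zero]
    | mul a b ha hb => rw [map_mul, hv, ha, hb, zero_mul, mul_zero, add_zero]
    | add a b ha hb => rw [map_add, map_add, ha, hb, add_zero]
  -- Near x₀ Hadamard gives h = h(x₀) + Σ (x^a − x₀^a) g_a. Here `v` kills the first factors, but τ,
  -- which will be evaluation after a change of coordinates, sends them only to elements without
  -- body, not to zero. So each application of the lemma gains one power of the augmentation ideal,
  -- and m + 1 applications suffice.
  have hscalar : ∀ k (h : (Fin n → ℝ) → ℝ) (hh : ∀ x ∈ W, ContDiffAt ℝ ∞ h (c x)),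
      v (scalar hW h hh) ∈ Grassmann.aug m ^ k * ⊤ := by
    intro k
    induction k with
    | zero => intro h hh; rw [pow_zero, one_mul]; trivial
    | succ k ih =>
      intro h hh
      have hreg := isOpen_region (c := c) (W := W)
      have hc : ContDiffOn ℝ ∞ h (c.target ∩ c.symm ⁻¹' (W : Set X)) := fun y hy => by
        have := hh _ hy.2
        rw [c.right_inv hy.1] at this
        exact this.contDiffWithinAt
      have hy0 : c x₀ ∈ c.target ∩ c.symm ⁻¹' (W : Set X) :=
        ⟨c.map_source (hW x₀.2), by rw [Set.mem_preimage, c.left_inv (hW x₀.2)]; exact x₀.2⟩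
      obtain ⟨g, hg, hgh⟩ := hadamard_lemma hreg hc hy0
      let C : Fin n → SuperFun m c W := fun a =>
        coord m c W (Sum.inl a) - algebraMap ℝ _ (c x₀ a)
      let G : Fin n → SuperFun m c W := fun a => scalar hW (g a) fun _ _ => (hg a).contDiffAt
      have hCv : ∀ a, v (C a) = 0 := fun a => by
        simp only [C]; rw [map_sub, hcoord, halg, sub_zero]
      have hCτ : ∀ a, Grassmann.twist d (τ (C a)) ∈ Grassmann.aug m := fun a => by
        rw [Grassmann.mem_aug, Grassmann.body_twist, hτb]
        change Grassmann.body (algebraMap ℝ (Grassmann m) (c x₀ a) - algebraMap ℝ _ (c x₀ a)) = 0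
        rw [sub_self, map_zero]
      have hz := hloc (scalar hW h hh - (algebraMap ℝ _ (h (c x₀)) + ∑ a, C a * G a)) ?_
      · rw [map_sub, map_add, halg, zero_add, sub_eq_zero, map_sum] at hz
        rw [hz]
        refine Submodule.sum_mem _ fun a _ => ?_
        rw [hv, hCv, zero_mul, zero_add, pow_succ', mul_assoc]
        exact Submodule.mul_mem_mul (hCτ a) (ih _ _)
      · filter_upwards [c.continuousAt (hW x₀.2) hgh, W.isOpen.mem_nhds x₀.2] with x hx hxW
        rw [extendZero_of_mem _ hxW]
        rw [Pi.zero_apply, ← ev_apply]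
        rw [map_sub, map_add, map_sum]
        have e1 : ev ⟨x, hxW⟩ (scalar hW h hh) = algebraMap ℝ (Grassmann m) (h (c x)) := rfl
        have e2 : ∀ a, ev ⟨x, hxW⟩ (C a * G a)
            = algebraMap ℝ (Grassmann m) ((c x a - c x₀ a) * g a (c x)) := fun a => by
          rw [map_mul, map_mul, map_sub, map_sub]; rfl
        rw [e1, AlgHom.commutes, Finset.sum_congr rfl fun a _ => e2 a, ← map_sum, ← map_add,
          ← hx, sub_self]
  rw [eq_sum_scalar_mul_const hW f, map_sum]
  refine Finset.sum_eq_zero fun I _ => ?_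
  have h0 := hscalar (m + 1) _ (fun _ hx => (smooth hW f hx).linear (Grassmann.coeff I))
  rw [Grassmann.aug_pow_succ_eq_bot, Submodule.bot_mul, Submodule.mem_bot] at h0
  rw [hv, h0, hconst, zero_mul, mul_zero, add_zero]

/-- A local superderivation at a point is determined by its values on the coordinates. -/
theorem pointDerivation_eq_sum {x₀ : W}
    (τ : SuperFun m c W →ₐ[ℝ] Grassmann m) (d : ZMod 2) (v : SuperFun m c W →ₗ[ℝ] Grassmann m)
    (hτb : ∀ f, Grassmann.body (τ f) = Grassmann.body (f.1 x₀))
    (hτp : ∀ p, ∀ f ∈ part m c W p, τ f ∈ Grassmann.part m p)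
    (hτloc : ∀ f : SuperFun m c W, extendZero f.1 =ᶠ[𝓝 x₀.1] 0 → τ f = 0)
    (hv : ∀ f g, v (f * g) = v f * τ g + Grassmann.twist d (τ f) * v g)
    (hloc : ∀ f : SuperFun m c W, extendZero f.1 =ᶠ[𝓝 x₀.1] 0 → v f = 0)
    (hcoord : ∀ A, v (coord m c W A) ∈ Grassmann.part m (coordParity A + d))
    (f : SuperFun m c W) : v f = ∑ A, v (coord m c W A) * τ (D hW A f) := by
  -- Subtracting the candidate gives a superderivation over the same τ which annihilates the
  -- coordinates; the previous result shows that it is zero.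
  let v' : SuperFun m c W →ₗ[ℝ] Grassmann m := v - ∑ A,
    (LinearMap.mulLeft ℝ (v (coord m c W A))).comp (τ.toLinearMap.comp (D hW A))
  have hv' : ∀ f, v' f = v f - ∑ A, v (coord m c W A) * τ (D hW A f) := fun f => by
    simp only [v', LinearMap.sub_apply, LinearMap.sum_apply]; rfl
  have h := pointDerivation_eq_zero hW τ d v' hτb (x₀ := x₀) ?_ ?_ ?_ f
  · rw [hv', sub_eq_zero] at h; exact h
  · intro f g
    rw [hv', hv', hv', hv]
    have key : ∀ A, v (coord m c W A) * τ (D hW A (f * g))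
        = v (coord m c W A) * τ (D hW A f) * τ g
          + Grassmann.twist d (τ f) * (v (coord m c W A) * τ (D hW A g)) := by
      intro A
      rw [D_mul, map_add, map_mul, map_mul, map_mapValues_twist hW τ hτp, mul_add, ← mul_assoc,
        ← mul_assoc, Grassmann.mul_comm_twist (hcoord A) (Grassmann.twist _ (τ f)), Grassmann.twist_twist]
      have : coordParity A + d + coordParity A = d := by
        generalize coordParity A = p
        clear * -; revert p d; decide
      rw [this, mul_assoc, mul_assoc (Grassmann.twist d (τ f))]
    rw [Finset.sum_congr rfl fun A _ => key A, Finset.sum_add_distrib, sub_mul, mul_sub,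
      Finset.sum_mul, Finset.mul_sum]
    abel
  · intro g hg
    rw [hv', hloc g hg, zero_sub, neg_eq_zero]
    refine Finset.sum_eq_zero fun A _ => ?_
    rw [hτloc, mul_zero]
    have h1 := superDeriv_congr_eventually (hW x₀.2) hg A
    have h2 : ∀ x, superDeriv c A (0 : X → Grassmann m) x = 0 := by
      intro x
      rcases A with a | α
      · refine Grassmann.ext_coeff fun I => ?_
        rw [superDeriv_inl, Grassmann.coeff_pd]
        simp
      · exact map_zero _
    filter_upwards [h1, W.isOpen.mem_nhds x₀.2] with x hx hxW
    rw [extendZero_of_mem _ hxW, D_apply, hx, h2]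
    rfl
  · intro B
    rw [hv', Finset.sum_eq_single B]
    · rw [D_coord, if_pos rfl, map_one, mul_one, sub_self]
    · intro A _ hA
      rw [D_coord, if_neg hA, map_zero, mul_zero]
    · simp

end

/-! #### Invertible superfunctions -/

theorem scalar_comm (hW : (W : Set X) ⊆ c.source) (h : (Fin n → ℝ) → ℝ)
    (hh : ∀ x ∈ W, ContDiffAt ℝ ∞ h (c x)) (f : SuperFun m c W) :
    Commute (scalar hW h hh) f :=
  ext' fun x hx => Algebra.commutes (h (c x)) (f.1 ⟨x, hx⟩)

/-- The superfunction is its body plus a nilpotent of order m + 1. The body is an invertible smooth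
scalar function and is central. -/
theorem isUnit_of_body_ne_zero (hW : (W : Set X) ⊆ c.source) (f : SuperFun m c W)
    (hf : ∀ x, Grassmann.body (f.1 x) ≠ 0) : IsUnit f := by
  let b : (Fin n → ℝ) → ℝ := fun y => Grassmann.body (extendZero f.1 (c.symm y))
  have hb : ∀ x ∈ W, ContDiffAt ℝ ∞ b (c x) := fun x hx =>
    (smooth hW f hx).linear Grassmann.body.toLinearMap
  have hbx : ∀ x (hx : x ∈ W), b (c x) = Grassmann.body (f.1 ⟨x, hx⟩) := fun x hx => by
    simp only [b]; rw [c.left_inv (hW hx), extendZero_of_mem _ hx]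
  have hu : IsUnit (scalar (m := m) hW b hb) := by
    have hi : ∀ x ∈ W, ContDiffAt ℝ ∞ (fun y => (b y)⁻¹) (c x) := fun x hx =>
      (hb x hx).inv (by rw [hbx x hx]; exact hf _)
    have h1 : scalar (m := m) hW b hb * scalar hW _ hi = 1 := ext' fun x hx => by
      change algebraMap ℝ (Grassmann m) (b (c x)) * algebraMap ℝ _ (b (c x))⁻¹ = 1
      rw [← map_mul, mul_inv_cancel₀ (by rw [hbx x hx]; exact hf _), map_one]
    exact ⟨⟨_, _, h1, (scalar_comm hW _ _ _).eq.symm.trans h1⟩, rfl⟩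
  have hn : IsNilpotent (f - scalar hW b hb) := ⟨m + 1, ext' fun x hx => by
    change (f.1 ⟨x, hx⟩ - algebraMap ℝ _ (b (c x))) ^ (m + 1) = 0
    rw [hbx x hx]
    exact Grassmann.pow_succ_eq_zero (Grassmann.mem_aug.1 (Grassmann.sub_body_mem_aug _))⟩
  have := hn.isUnit_add_left_of_commute hu
    (((scalar_comm hW _ _ f).symm).sub_left (Commute.refl _))
  rwa [add_sub_cancel] at this

/-- The commutative algebra of even superfunctions. -/
noncomputable def evenSub (m : ℕ) (c : OpenPartialHomeomorph X (Fin n → ℝ))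
    (W : TopologicalSpace.Opens X) : Subalgebra ℝ (SuperFun m c W) where
  carrier := part m c W 0
  mul_mem' hf hg := by simpa using isSupercommutative.mul_mem hf hg
  add_mem' hf hg := Submodule.add_mem _ hf hg
  algebraMap_mem' r _ := Grassmann.algebraMap_mem_part r

noncomputable instance : CommRing (evenSub m c W) :=
  { (inferInstance : Ring (evenSub m c W)) with
    mul_comm := fun a b => Subtype.ext (by
      have := isSupercommutative.comm a.2 b.2
      rwa [mul_zero, sgn_zero, one_smul] at this) }

/-- Even superfunctions. -/
def EvenFun (m : ℕ) (c : OpenPartialHomeomorph X (Fin n → ℝ))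
    (W : TopologicalSpace.Opens X) : Type u := evenSub m c W

noncomputable instance : CommRing (EvenFun m c W) := inferInstanceAs (CommRing (evenSub m c W))

noncomputable instance : Algebra ℝ (EvenFun m c W) := inferInstanceAs (Algebra ℝ (evenSub m c W))

/-- The inclusion of the even superfunctions. -/
noncomputable def evenIncl : EvenFun m c W →ₐ[ℝ] SuperFun m c W where
  toFun f := f.1
  map_one' := rfl
  map_mul' _ _ := rfl
  map_zero' := rfl
  map_add' _ _ := rfl
  commutes' _ := rfl

theorem evenIncl_mem (f : EvenFun m c W) : evenIncl f ∈ part m c W 0 := f.2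

/-- Evaluation of even superfunctions. -/
noncomputable def evEven (x : W) : EvenFun m c W →+* Grassmann.Even m where
  toFun f := ⟨f.1.1 x, f.2 x⟩
  map_one' := rfl
  map_mul' _ _ := rfl
  map_zero' := rfl
  map_add' _ _ := rfl

theorem isUnit_even_of_body_ne_zero (hW : (W : Set X) ⊆ c.source) (f : EvenFun m c W)
    (hf : ∀ x, Grassmann.body (f.1.1 x) ≠ 0) : IsUnit f := by
  obtain ⟨g, hg⟩ := (isUnit_of_body_ne_zero hW f.1 hf).exists_right_inv
  -- The parity involution fixes `f`, so it carries the inverse of `f` to an inverse of `f`; by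
  -- uniqueness of inverses `g` is fixed and hence even.
  have hge : g ∈ part m c W 0 := by
    intro x
    have h1 : f.1.1 x * g.1 x = 1 := congrFun (congrArg Subtype.val hg) x
    have h2 : Grassmann.twist 1 (f.1.1 x) = f.1.1 x := by
      rw [Grassmann.twist_of_mem (f.2 x), mul_zero, sgn_zero, one_smul]
    have h3 : f.1.1 x * Grassmann.twist 1 (g.1 x) = 1 := by
      rw [← h2, ← map_mul, h1, map_one]
    have h4 : g.1 x * f.1.1 x = 1 := by rw [← (Grassmann.even_comm (f.2 x) _).eq, h1]
    rw [Grassmann.mem_part_iff, sgn_zero, one_smul]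
    calc Grassmann.twist 1 (g.1 x) = g.1 x * f.1.1 x * Grassmann.twist 1 (g.1 x) := by
          rw [h4, one_mul]
      _ = g.1 x := by rw [mul_assoc, h3, mul_one]
  let g' : EvenFun m c W := ⟨g, hge⟩
  have h5 : f * g' = 1 := Subtype.ext hg
  exact ⟨⟨f, g', h5, by rw [mul_comm]; exact h5⟩, rfl⟩

end SuperFun

end

/-! ### Real powers of even elements -/

section

variable {E A : Type*} [CommRing E] [Algebra ℝ E] [AddCommGroup A] [Module ℝ A] [Module E A]

/-- The logarithmic series `log (1 + ν)` of a nilpotent element. -/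
noncomputable def logSeries (m : ℕ) (ν : E) : E :=
  ∑ k ∈ Finset.Icc 1 m, ((-1 : ℝ) ^ (k + 1) / (k : ℝ)) • ν ^ k

/-- The exponential series of a nilpotent element. -/
noncomputable def expSeries (m : ℕ) (t : E) : E :=
  ∑ k ∈ Finset.range (m + 1), ((k.factorial : ℝ)⁻¹) • t ^ k

/-- Differentiating t^(m+1) = 0 gives (m + 1) t^m D t = 0. Because of this the truncated logarithm
and exponential satisfy their differential equations exactly. -/
theorem pow_smul_derivation [IsScalarTower ℝ E A] (D : Derivation ℝ E A) {m : ℕ} {t : E}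
    (ht : t ^ (m + 1) = 0) : t ^ m • D t = 0 := by
  have h := D.leibniz_pow t (m + 1)
  rw [ht, map_zero, Nat.add_sub_cancel, ← Nat.cast_smul_eq_nsmul ℝ] at h
  exact ((smul_eq_zero_iff_right (by positivity)).1 h.symm)

/-- The derivative of the truncated logarithm is a finite geometric sum times D ν. Multiplied by 1 +
ν it telescopes to 1 − (−ν)^m, and the last power annihilates D ν. -/
theorem derivation_logSeries [IsScalarTower ℝ E A] (D : Derivation ℝ E A) {m : ℕ} {ν : E}
    (hν : ν ^ (m + 1) = 0) : (1 + ν) • D (logSeries m ν) = D ν := by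
  have h1 : D (logSeries m ν) = (∑ k ∈ Finset.range m, (-ν) ^ k) • D ν := by
    rw [logSeries, map_sum, Finset.sum_smul, Finset.range_eq_Ico,
      show Finset.Icc 1 m = Finset.Ico (0 + 1) (m + 1) from by ext; simp,
      ← Finset.sum_Ico_add']
    refine Finset.sum_congr rfl fun k _ => ?_
    rw [D.map_smul, D.leibniz_pow, Nat.add_sub_cancel, ← Nat.cast_smul_eq_nsmul ℝ, smul_smul,
      ← smul_assoc]
    congr 1
    rw [div_mul_cancel₀ _ (by positivity), neg_pow ν, Algebra.smul_def]
    simp [pow_succ]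
  rw [h1, smul_smul]
  have h2 : (1 + ν) * ∑ k ∈ Finset.range m, (-ν) ^ k = 1 - (-ν) ^ m := by
    rw [← mul_neg_geom_sum]; ring
  rw [h2, sub_smul, one_smul, neg_pow, mul_smul, pow_smul_derivation D hν, smul_zero, sub_zero]

theorem derivation_expSeries [IsScalarTower ℝ E A] (D : Derivation ℝ E A) {m : ℕ} {t : E}
    (ht : t ^ (m + 1) = 0) : D (expSeries m t) = expSeries m t • D t := by
  rw [expSeries, map_sum, Finset.sum_range_succ', Finset.sum_range_succ, add_smul, Finset.sum_smul,
    smul_assoc, pow_smul_derivation D ht, smul_zero, add_zero]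
  rw [D.map_smul, pow_zero, D.map_one_eq_zero, smul_zero, add_zero]
  refine Finset.sum_congr rfl fun k _ => ?_
  rw [D.map_smul, D.leibniz_pow, Nat.add_sub_cancel, ← Nat.cast_smul_eq_nsmul ℝ, smul_smul,
    smul_assoc, Nat.factorial_succ]
  congr 1
  have : (k.factorial : ℝ) ≠ 0 := by positivity
  push_cast
  field_simp

end

namespace Grassmann

variable {m : ℕ}

/-- The left derivatives on even elements. -/
noncomputable def evenDerivation (α : Fin m) : Derivation ℝ (Even m) (Grassmann m) where
  toLinearMap := (oddDeriv α).comp (Subalgebra.val _).toLinearMap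
  map_one_eq_zero' := oddDeriv_one α
  leibniz' a b := by
    change oddDeriv α (a.1 * b.1) = a.1 * oddDeriv α b.1 + b.1 * oddDeriv α a.1
    rw [oddDeriv_mul, twist_of_mem a.2, mul_zero, sgn_zero, one_smul, (even_comm b.2 _).eq, add_comm]

/-- The body of an even element. -/
noncomputable def evenBody : Even m →ₐ[ℝ] ℝ := body.comp (Subalgebra.val _)

theorem even_pow_eq_zero {x : Even m} (hx : evenBody x = 0) : x ^ (m + 1) = 0 :=
  Subtype.ext (pow_succ_eq_zero hx)

theorem body_soul (x : Even m) : body (soul x : Grassmann m) = 0 := by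
  change body (x.1 - algebraMap ℝ _ (body x.1)) = 0
  rw [map_sub, body_algebraMap, sub_self]

theorem evenBody_logSeries {ν : Even m} (hν : evenBody ν = 0) (k : ℕ) :
    evenBody (logSeries k ν) = 0 := by
  rw [logSeries, map_sum]
  refine Finset.sum_eq_zero fun j hj => ?_
  rw [map_smul, map_pow, hν, zero_pow (by have := (Finset.mem_Icc.1 hj).1; omega), smul_zero]

theorem evenBody_expSeries {t : Even m} (ht : evenBody t = 0) (k : ℕ) :
    evenBody (expSeries k t) = 1 := by
  rw [expSeries, map_sum, Finset.sum_range_succ', Finset.sum_eq_zero]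
  · simp
  · intro j _
    rw [map_smul, map_pow, ht, zero_pow (by omega), smul_zero]

/-- The exponential of a nilpotent is a sum whose length depends on the element. All elements
without body satisfy t^(m+1) = 0, so the length m + 1 serves everywhere and the formula can be read
over superfunctions. -/
theorem pow_eq (x : Even m) (w : ℝ) : pow x w = Real.exp (w * Real.log (body (x : Grassmann m))) •
    expSeries m (w • logSeries m ((body (x : Grassmann m))⁻¹ • soul x)) := by
  have h1 : evenBody (w • logSoul x) = 0 := by
    rw [map_smul, show logSoul x = logSeries m ((body (x : Grassmann m))⁻¹ • soul x) from rfl,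
      evenBody_logSeries, smul_zero]
    rw [map_smul, show evenBody (soul x) = 0 from body_soul x, smul_zero]
  rw [pow, IsNilpotent.exp_eq_sum (k := m + 1) (even_pow_eq_zero h1)]
  congr 1
  refine Finset.sum_congr rfl fun k _ => ?_
  change (algebraMap ℚ ℝ (k.factorial : ℚ)⁻¹) • ((w • logSoul x) ^ k : Even m) = _
  simp
  rfl

theorem body_pow (x : Even m) (w : ℝ) :
    body (pow x w : Grassmann m) = Real.exp (w * Real.log (body (x : Grassmann m))) := by
  change evenBody (pow x w) = _
  rw [pow_eq, map_smul, evenBody_expSeries, smul_eq_mul, mul_one]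
  rw [map_smul, evenBody_logSeries, smul_zero]
  rw [map_smul, show evenBody (soul x) = 0 from body_soul x, smul_zero]

theorem isUnit_even {x : Even m} (hx : body (x : Grassmann m) ≠ 0) : IsUnit x := by
  have h : IsUnit (algebraMap ℝ (Even m) (body (x : Grassmann m))) :=
    (isUnit_iff_ne_zero.2 hx).map _
  have := (soul_nilpotent x).isUnit_add_left_of_commute h (Commute.all _ _)
  rwa [soul, add_sub_cancel] at this

/-- The equation x D(x^w) = w x^w D x avoids division by x. Odd derivatives do not see the scalar
body, so only the logarithm and exponential series contribute. -/
theorem derivation_pow (α : Fin m) {x : Even m} (hx : 0 < body (x : Grassmann m)) (w : ℝ) :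
    x • evenDerivation α (pow x w) = w • pow x w • evenDerivation α x := by
  set b := body (x : Grassmann m) with hb
  set ν : Even m := b⁻¹ • soul x with hν
  have hν0 : evenBody ν = 0 := by
    rw [hν, map_smul, show evenBody (soul x) = 0 from body_soul x, smul_zero]
  have hL0 : evenBody (w • logSeries m ν) = 0 := by
    rw [map_smul, evenBody_logSeries hν0, smul_zero]
  have h1 : x = b • (1 + ν) := by
    rw [hν, smul_add, smul_smul, mul_inv_cancel₀ hx.ne', one_smul, soul,
      ← Algebra.algebraMap_eq_smul_one, ← hb]
    exact (add_sub_cancel _ _).symm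
  have h2 : evenDerivation α x = b • evenDerivation α ν := by
    rw [h1, Derivation.map_smul, Derivation.map_add, Derivation.map_one_eq_zero, zero_add]
  rw [pow_eq, ← hb, ← hν, Derivation.map_smul, derivation_expSeries _ (even_pow_eq_zero hL0),
    Derivation.map_smul, h2, ← derivation_logSeries _ (even_pow_eq_zero hν0), h1]
  simp only [smul_assoc]
  generalize evenDerivation α (logSeries m ν) = z
  generalize expSeries m (w • logSeries m ν) = e
  generalize Real.exp (w * Real.log b) = r
  rw [smul_comm (1 + ν) r, smul_comm (1 + ν) e, smul_comm (1 + ν) w, smul_comm e w, smul_comm r w,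
    smul_comm b w, smul_comm e b, smul_comm r b]

/-- A real power is characterized by its body and its logarithmic derivative. -/
theorem eq_pow {x u : Even m} (hx : 0 < body (x : Grassmann m)) (w : ℝ)
    (hu : body (u : Grassmann m) = Real.exp (w * Real.log (body (x : Grassmann m))))
    (hd : ∀ α, x • evenDerivation α u = w • u • evenDerivation α x) : u = pow x w := by
  -- The logarithmic derivatives of u and x^(−w) cancel. A product with vanishing odd derivatives is
  -- a scalar, and comparing bodies shows that it is 1.
  have h1 : ∀ α, evenDerivation α (u * pow x (-w)) = 0 := by
    intro α
    obtain ⟨y, hy⟩ := (isUnit_even hx.ne').exists_left_inv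
    have h2 : x • evenDerivation α (u * pow x (-w)) = 0 := by
      rw [Derivation.leibniz, smul_add, smul_comm x u, derivation_pow α hx, smul_comm x (pow x (-w)),
        hd, smul_comm u (-w), smul_comm (pow x (-w)) w, smul_comm u (pow x (-w)), neg_smul]
      exact neg_add_cancel _
    rw [← one_smul (Even m) (evenDerivation α _), ← hy, mul_smul, h2, smul_zero]
  have h3 := eq_algebraMap_of_oddDeriv_eq_zero (x := ((u * pow x (-w) : Even m) : Grassmann m)) h1
  have h4 : body ((u * pow x (-w) : Even m) : Grassmann m) = 1 := by
    change body (u.1 * (pow x (-w)).1) = 1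
    rw [map_mul, hu, body_pow, ← Real.exp_add]
    simp
  rw [h4, map_one] at h3
  have h5 : u * pow x (-w) = 1 := Subtype.ext h3
  have h6 : pow x (-w) * pow x w = 1 := by rw [← pow_add', neg_add_cancel, pow_zero']
  calc u = u * (pow x (-w) * pow x w) := by rw [h6, mul_one]
    _ = pow x w := by rw [← mul_assoc, h5, one_mul]

theorem pow_one' {x : Even m} (hx : 0 < body (x : Grassmann m)) : pow x 1 = x := by
  refine (eq_pow hx 1 ?_ fun α => ?_).symm
  · rw [one_mul, Real.exp_log hx]
  · rw [one_smul]

/-- Both sides have the same body, and their logarithmic derivatives add up in the same way, so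
`eq_pow` applies; no manipulation of the series is needed. -/
theorem mul_pow' {x y : Even m} (hx : 0 < body (x : Grassmann m)) (hy : 0 < body (y : Grassmann m))
    (w : ℝ) : pow (x * y) w = pow x w * pow y w := by
  have hxy : body ((x * y : Even m) : Grassmann m)
      = body (x : Grassmann m) * body (y : Grassmann m) := map_mul _ _ _
  refine (eq_pow (hxy ▸ mul_pos hx hy) w ?_ fun α => ?_).symm
  · change body ((pow x w).1 * (pow y w).1) = _
    rw [map_mul, body_pow, body_pow, hxy, Real.log_mul hx.ne' hy.ne', mul_add, Real.exp_add]
  · have h1 := derivation_pow α hx w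
    have h2 := derivation_pow α hy w
    rw [Derivation.leibniz, Derivation.leibniz, smul_add, smul_add, smul_add]
    congr 1
    · calc (x * y) • pow x w • evenDerivation α (pow y w)
          = x • pow x w • y • evenDerivation α (pow y w) := by
            simp only [smul_smul]; congr 1; ring
        _ = _ := by
          rw [h2]; simp only [smul_smul, smul_comm _ w]; congr 2; ring
    · calc (x * y) • pow y w • evenDerivation α (pow x w)
          = y • pow y w • x • evenDerivation α (pow x w) := by
            simp only [smul_smul]; congr 1; ring
        _ = _ := by
          rw [h1]; simp only [smul_smul, smul_comm _ w]; congr 2; ring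

theorem one_pow' (w : ℝ) : pow (1 : Even m) w = 1 := by
  have h1 : body ((1 : Even m) : Grassmann m) = 1 := map_one _
  refine (eq_pow (by rw [h1]; exact one_pos) w ?_ fun α => ?_).symm
  · rw [h1]; simp
  · simp

end Grassmann

/-- This is the equation f D(f^w) = w f^w D f for f = b(1 + ν), where b is now the body function and
may itself have a nonzero derivative. The element `e` stands for b^w and `bi` for b⁻¹, and `he` is
the equation for b^w. -/
theorem derivation_powSeries {E A : Type*} [CommRing E] [Algebra ℝ E] [AddCommGroup A] [Module ℝ A]
    [Module E A] [IsScalarTower ℝ E A] (d : Derivation ℝ E A) {m : ℕ} {w : ℝ} {f b bi e : E}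
    (hbbi : bi * b = 1) (he : d e = w • (e * bi) • d b) (hν : (bi * (f - b)) ^ (m + 1) = 0)
    (hL : (w • logSeries m (bi * (f - b))) ^ (m + 1) = 0) :
    f • d (e * expSeries m (w • logSeries m (bi * (f - b))))
      = w • (e * expSeries m (w • logSeries m (bi * (f - b)))) • d f := by
  have hbi : b • d bi + bi • d b = 0 := by
    rw [add_comm, ← d.leibniz, hbbi, d.map_one_eq_zero]
  have hν1 : 1 + bi * (f - b) = bi * f := by rw [mul_sub, hbbi]; ring
  have hdν : d (bi * (f - b)) = bi • d f + f • d bi := by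
    rw [← d.leibniz, ← hν1, d.map_add, d.map_one_eq_zero, zero_add]
  have hL1 := derivation_logSeries d hν
  rw [hν1, hdν] at hL1
  have hL2 : f • d (logSeries m (bi * (f - b))) = d f - (bi * f) • d b := by
    have h3 : f • d (logSeries m (bi * (f - b))) = b • (bi * f) • d (logSeries m (bi * (f - b))) := by
      rw [smul_smul, ← mul_assoc, mul_comm b, hbbi, one_mul]
    have h4 : b • d bi = -(bi • d b) := eq_neg_of_add_eq_zero_left hbi
    rw [h3, hL1, smul_add, smul_smul, mul_comm b, hbbi, one_smul, smul_comm b f, h4, smul_neg,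
      smul_smul, mul_comm f, sub_eq_add_neg]
  rw [d.leibniz, derivation_expSeries d hL, he, d.map_smul]
  set ex := expSeries m (w • logSeries m (bi * (f - b)))
  have h5 : f • (e • ex • w • d (logSeries m (bi * (f - b))) + ex • w • (e * bi) • d b)
      = w • (e * ex) • (f • d (logSeries m (bi * (f - b)))) + w • (e * ex) • (bi * f) • d b := by
    rw [smul_add]
    simp only [smul_comm _ w, smul_smul, ← smul_add]
    congr 3 <;> ring
  rw [h5, hL2, smul_sub, smul_sub, sub_add_cancel]

/-- The superalgebra `A` becomes a module over the even elements by left multiplication through `ι`.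
In this way a derivative of any parity, restricted to even elements, is an ordinary derivation. -/
theorem superalgebra_powSeries {E A : Type*} [CommRing E] [Algebra ℝ E] [Ring A] [Algebra ℝ A]
    (ι : E →ₐ[ℝ] A) (d : E →ₗ[ℝ] A) (hd : ∀ a b, d (a * b) = ι a * d b + ι b * d a)
    {m : ℕ} {w : ℝ} {f b bi e : E} (hbbi : bi * b = 1) (he : d e = w • (ι (e * bi) * d b))
    (hν : (bi * (f - b)) ^ (m + 1) = 0)
    (hL : (w • logSeries m (bi * (f - b))) ^ (m + 1) = 0) :
    ι f * d (e * expSeries m (w • logSeries m (bi * (f - b))))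
      = w • (ι (e * expSeries m (w • logSeries m (bi * (f - b)))) * d f) := by
  let _ : Module E A := Module.compHom A ι.toRingHom
  have : IsScalarTower ℝ E A := ⟨fun r x y => by
    change ι (r • x) * y = r • (ι x * y)
    rw [map_smul, smul_mul_assoc]⟩
  let D : Derivation ℝ E A :=
    { toLinearMap := d
      map_one_eq_zero' := by simpa using hd 1 1
      leibniz' := hd }
  exact derivation_powSeries D hbbi he hν hL

/-! #### Powers of even superfunctions -/

section

open Topology

variable {n m : ℕ} {X : Type u} [TopologicalSpace X] {c : OpenPartialHomeomorph X (Fin n → ℝ)}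
  {W : TopologicalSpace.Opens X}

namespace SuperFun

variable (hW : (W : Set X) ⊆ c.source)

theorem D_evenSub_mul (A : Fin n ⊕ Fin m) (a b : EvenFun m c W) :
    D hW A (a * b).1 = a.1 * D hW A b.1 + b.1 * D hW A a.1 := by
  change D hW A (a.1 * b.1) = _
  rw [(isSuperderivation_D hW A).mul _ a.2, mul_zero, sgn_zero, one_smul, add_comm]
  congr 1
  exact ext' fun x hx => (Grassmann.even_comm (b.2 ⟨x, hx⟩) _).eq.symm

theorem D_scalar_inr (α : Fin m) (h : (Fin n → ℝ) → ℝ) (hh : ∀ x ∈ W, ContDiffAt ℝ ∞ h (c x)) :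
    D hW (Sum.inr α) (scalar (m := m) hW h hh) = 0 := ext' fun x hx => by
  rw [D_apply, superDeriv_inr, extendZero_of_mem _ hx]
  exact Grassmann.oddDeriv_algebraMap α _

theorem D_scalar_inl (a : Fin n) (h : (Fin n → ℝ) → ℝ) (hh : ∀ x ∈ W, ContDiffAt ℝ ∞ h (c x))
    {x : X} (hx : x ∈ W) :
    (D hW (Sum.inl a) (scalar (m := m) hW h hh)).1 ⟨x, hx⟩
      = algebraMap ℝ _ (fderiv ℝ h (c x) (Pi.single a 1)) := by
  rw [D_apply, superDeriv_inl, Grassmann.pd_congr (G := fun y => h y • (1 : Grassmann m))]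
  · refine Grassmann.ext_coeff fun I => ?_
    rw [Grassmann.coeff_pd]
    simp only [map_smul, smul_eq_mul, Algebra.algebraMap_eq_smul_one]
    have := ((hh x hx).differentiableAt (by simp)).hasFDerivAt.mul_const
      (Grassmann.coeff I (1 : Grassmann m))
    rw [this.fderiv]
    simp [mul_comm]
  · filter_upwards [eventually_comp_symm (hW hx) (W.isOpen.mem_nhds hx),
      c.open_target.mem_nhds (c.map_source (hW hx))] with y hy hyt
    have hy : c.symm y ∈ W := hy
    rw [extendZero_of_mem _ hy]
    change algebraMap ℝ _ (h (c (c.symm y))) = _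
    rw [c.right_inv hyt, Algebra.algebraMap_eq_smul_one]

/-- Scalar functions as even superfunctions. -/
noncomputable def evenScalar (h : (Fin n → ℝ) → ℝ) (hh : ∀ x ∈ W, ContDiffAt ℝ ∞ h (c x)) :
    EvenFun m c W := ⟨scalar hW h hh, fun _ => Grassmann.algebraMap_mem_part _⟩

/-- The body of a superfunction, as a function of the even coordinates. -/
noncomputable def bodyFn (f : SuperFun m c W) (y : Fin n → ℝ) : ℝ :=
  Grassmann.body (extendZero f.1 (c.symm y))

theorem contDiffAt_bodyFn (hW : (W : Set X) ⊆ c.source) (f : SuperFun m c W) {x : X} (hx : x ∈ W) :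
    ContDiffAt ℝ ∞ (bodyFn f) (c x) :=
  (smooth hW f hx).linear Grassmann.body.toLinearMap

theorem bodyFn_apply (hW : (W : Set X) ⊆ c.source) (f : SuperFun m c W) {x : X} (hx : x ∈ W) :
    bodyFn f (c x) = Grassmann.body (f.1 ⟨x, hx⟩) := by
  rw [bodyFn, c.left_inv (hW hx), extendZero_of_mem _ hx]

/-- The pointwise real powers of an even superfunction are assembled from smooth scalar functions
and finite series, so they form a superfunction. Its differential equation holds for even as well as
odd coordinates. -/
theorem exists_powFun (f : EvenFun m c W) (hf : ∀ x, 0 < Grassmann.body (f.1.1 x)) (w : ℝ) :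
    ∃ g : EvenFun m c W, (∀ x, evEven x g = Grassmann.pow (evEven x f) w) ∧
      ∀ A, f.1 * D hW A g.1 = w • (g.1 * D hW A f.1) := by
  have hb := fun x (hx : x ∈ W) => contDiffAt_bodyFn hW f.1 hx
  have hb0 : ∀ x (hx : x ∈ W), 0 < bodyFn f.1 (c x) := fun x hx => by
    rw [bodyFn_apply hW f.1 hx]; exact hf _
  let b : EvenFun m c W := evenScalar hW (bodyFn f.1) hb
  let bi : EvenFun m c W := evenScalar hW (fun y => (bodyFn f.1 y)⁻¹)
    fun x hx => (hb x hx).inv (hb0 x hx).ne'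
  have he0 : ∀ x ∈ W, ContDiffAt ℝ ∞ (fun y => Real.exp (w * Real.log (bodyFn f.1 y))) (c x) :=
    fun x hx => (contDiffAt_const.mul ((hb x hx).log (hb0 x hx).ne')).exp
  let e : EvenFun m c W := evenScalar hW (fun y => Real.exp (w * Real.log (bodyFn f.1 y))) he0
  let ν : EvenFun m c W := bi * (f - b)
  have hν : ∀ x, evEven x ν = (Grassmann.body (f.1.1 x))⁻¹ • Grassmann.soul (evEven x f) := by
    intro x
    rw [map_mul, map_sub, Algebra.smul_def]
    refine Subtype.ext ?_
    change algebraMap ℝ (Grassmann m) (bodyFn f.1 (c x))⁻¹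
      * (f.1.1 x - algebraMap ℝ _ (bodyFn f.1 (c x))) = _
    rw [bodyFn_apply hW f.1 x.2]
    rfl
  have ext_ev : ∀ g h : EvenFun m c W, (∀ x, evEven x g = evEven x h) → g = h := fun g h hgh =>
    Subtype.ext (Subtype.ext (funext fun x => congrArg Subtype.val (hgh x)))
  have ev_smul : ∀ x (r : ℝ) (g : EvenFun m c W), evEven x (r • g) = r • evEven x g :=
    fun _ _ _ => rfl
  have ev_log : ∀ x (g : EvenFun m c W), evEven x (logSeries m g) = logSeries m (evEven x g) := by
    intro x g
    simp only [logSeries, map_sum, ev_smul, map_pow]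
  have ev_exp : ∀ x (g : EvenFun m c W), evEven x (expSeries m g) = expSeries m (evEven x g) := by
    intro x g
    simp only [expSeries, map_sum, ev_smul, map_pow]
  have hν0 : ∀ x, Grassmann.evenBody (evEven x ν) = 0 := fun x => by
    rw [hν, map_smul, show Grassmann.evenBody (Grassmann.soul (evEven x f)) = 0 from
      Grassmann.body_soul _, smul_zero]
  have hνn : ν ^ (m + 1) = 0 := ext_ev _ _ fun x => by
    rw [map_pow, map_zero]; exact Grassmann.even_pow_eq_zero (hν0 x)
  have hLn : (w • logSeries m ν) ^ (m + 1) = 0 := ext_ev _ _ fun x => by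
    rw [map_pow, map_zero, ev_smul, ev_log]
    refine Grassmann.even_pow_eq_zero ?_
    rw [map_smul, Grassmann.evenBody_logSeries (hν0 x), smul_zero]
  have hbbi : bi * b = 1 := ext_ev _ _ fun x => Subtype.ext (by
    change algebraMap ℝ (Grassmann m) (bodyFn f.1 (c x))⁻¹ * algebraMap ℝ _ (bodyFn f.1 (c x)) = 1
    rw [← map_mul, inv_mul_cancel₀ (hb0 x x.2).ne', map_one])
  refine ⟨e * expSeries m (w • logSeries m ν), fun x => ?_, fun A => ?_⟩
  · rw [map_mul, ev_exp, ev_smul, ev_log, hν, Grassmann.pow_eq,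
      Algebra.smul_def (Real.exp (w * Real.log (Grassmann.body ((evEven x f).1))))]
    congr 1
    refine Subtype.ext ?_
    change algebraMap ℝ (Grassmann m) (Real.exp (w * Real.log (bodyFn f.1 (c x)))) = _
    rw [bodyFn_apply hW f.1 x.2]
    rfl
  · have he : D hW A e.1 = w • ((e * bi).1 * D hW A b.1) := by
      rcases A with a | α
      · refine ext' fun x hx => ?_
        change _ = w • ((e * bi).1.1 ⟨x, hx⟩ * (D hW (Sum.inl a) (scalar hW _ hb)).1 ⟨x, hx⟩)
        change (D hW (Sum.inl a) (scalar hW _ he0)).1 ⟨x, hx⟩ = _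
        rw [D_scalar_inl, D_scalar_inl]
        have h1 := ((hb x hx).differentiableAt (by simp)).hasFDerivAt
        have h2 := ((h1.log (hb0 x hx).ne').const_mul w).exp
        rw [h2.fderiv]
        change _ = w • (algebraMap ℝ (Grassmann m) (Real.exp (w * Real.log (bodyFn f.1 (c x))))
          * algebraMap ℝ _ (bodyFn f.1 (c x))⁻¹ * _)
        rw [← map_mul, ← map_mul, Algebra.smul_def, ← map_mul]
        congr 1
        simp
        ring
      · change D hW _ (scalar hW _ he0) = w • ((e * bi).1 * D hW _ (scalar hW _ hb))
        rw [D_scalar_inr, D_scalar_inr, mul_zero, smul_zero]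
    exact superalgebra_powSeries evenIncl
      ((D hW A).comp (evenIncl (m := m) (c := c) (W := W)).toLinearMap) (D_evenSub_mul hW A) hbbi he hνn hLn

end SuperFun

end

/-! ### Changes of coordinates -/

namespace SuperFun

variable {n m : ℕ} {X : Type u} [TopologicalSpace X] {c : OpenPartialHomeomorph X (Fin n → ℝ)}
  {W : TopologicalSpace.Opens X}

theorem even_comm {f : SuperFun m c W} (hf : f ∈ part m c W 0) (g : SuperFun m c W) :
    f * g = g * f :=
  ext' fun x hx => (Grassmann.even_comm (hf ⟨x, hx⟩) _).eq

theorem isOpen_setOf_body_ne_zero (hW : (W : Set X) ⊆ c.source) (f : SuperFun m c W) {x : X}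
    (hx : x ∈ W) (h : Grassmann.body (f.1 ⟨x, hx⟩) ≠ 0) :
    ∀ᶠ z in nhds x, Grassmann.body (extendZero f.1 z) ≠ 0 := by
  have h1 := (contDiffAt_bodyFn hW f hx).continuousAt.comp (c.continuousAt (hW hx))
  have h2 : (bodyFn f ∘ c) x ≠ 0 := by rw [Function.comp_apply, bodyFn_apply hW f hx]; exact h
  filter_upwards [h1.eventually_ne h2, W.isOpen.mem_nhds hx] with z hz hzW
  rwa [Function.comp_apply, bodyFn_apply hW f hzW, ← extendZero_of_mem f.1 hzW] at hz

end SuperFun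

namespace SuperManifold

open SuperFun Topology

variable {n m : ℕ} {X : Type u} [TopologicalSpace X] (M : SuperManifold.{u, v} n m X)

section

variable {i j k : M.Index} {W W' : TopologicalSpace.Opens X} (hi : (W : Set X) ⊆ (M.chart i).source)
  (hj : (W : Set X) ⊆ (M.chart j).source) (hk : (W : Set X) ⊆ (M.chart k).source)

/-- Compatibility with restriction makes a change of coordinates local: the value at a point depends
only on the germ there. -/
theorem trans_congr (hi' : (W' : Set X) ⊆ (M.chart i).source)
    (hj' : (W' : Set X) ⊆ (M.chart j).source) {f : SuperFun m (M.chart i) W}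
    {g : SuperFun m (M.chart i) W'} {x : X} (hx : x ∈ W) (hx' : x ∈ W')
    (h : extendZero f.1 =ᶠ[𝓝 x] extendZero g.1) :
    (M.trans i j W hi hj f).1 ⟨x, hx⟩ = (M.trans i j W' hi' hj' g).1 ⟨x, hx'⟩ := by
  obtain ⟨U, hU, hUo, hxU⟩ := eventually_nhds_iff.1 h
  let V : TopologicalSpace.Opens X := W ⊓ W' ⊓ ⟨U, hUo⟩
  have hVW : V ≤ W := fun _ h => h.1.1
  have hVW' : V ≤ W' := fun _ h => h.1.2
  have hxV : x ∈ V := ⟨⟨hx, hx'⟩, hxU⟩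
  have h1 : res hVW f = res hVW' g := ext' fun z hz => by
    have := hU z hz.2
    rwa [extendZero_of_mem _ (hVW hz), extendZero_of_mem _ (hVW' hz)] at this
  have h2 := M.trans_res i j W V hVW hi hj (fun _ h => hi (hVW h)) (fun _ h => hj (hVW h)) f
  have h3 := M.trans_res i j W' V hVW' hi' hj' (fun _ h => hi (hVW h)) (fun _ h => hj (hVW h)) g
  rw [h1, ← h3] at h2
  exact congrFun (congrArg Subtype.val h2) ⟨x, hxV⟩

/-- If the body s of the image at x differed from the body of f at x, then f − s would be invertible
near x, and so would its image. But the body of that image at x is s − s = 0. -/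
theorem body_trans (f : SuperFun m (M.chart i) W) (x : W) :
    Grassmann.body ((M.trans i j W hi hj f).1 x) = Grassmann.body (f.1 x) := by
  by_contra hne
  set s := Grassmann.body ((M.trans i j W hi hj f).1 x) with hs
  let g : SuperFun m (M.chart i) W := f - algebraMap ℝ _ s
  have hg : Grassmann.body (g.1 ⟨x.1, x.2⟩) ≠ 0 := by
    change Grassmann.body (f.1 x - algebraMap ℝ _ s) ≠ 0
    rw [map_sub, Grassmann.body_algebraMap]
    exact sub_ne_zero.2 (Ne.symm hne)
  obtain ⟨U, hU, hUo, hxU⟩ := eventually_nhds_iff.1 (isOpen_setOf_body_ne_zero hi g x.2 hg)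
  let V : TopologicalSpace.Opens X := W ⊓ ⟨U, hUo⟩
  have hVW : V ≤ W := fun _ h => h.1
  have hu : IsUnit (res hVW g) := isUnit_of_body_ne_zero (fun _ h => hi (hVW h)) _ fun z => by
    have := hU z.1 z.2.2
    rwa [extendZero_of_mem _ (hVW z.2)] at this
  have h2 := M.trans_res i j W V hVW hi hj (fun _ h => hi (hVW h)) (fun _ h => hj (hVW h)) g
  have h3 := ((hu.map (M.trans i j V (fun _ h => hi (hVW h)) (fun _ h => hj (hVW h)))).map
    (ev (⟨x.1, x.2, hxU⟩ : V))).map Grassmann.body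
  rw [← h2] at h3
  refine h3.ne_zero ?_
  change Grassmann.body ((M.trans i j W hi hj (f - algebraMap ℝ _ s)).1 x) = 0
  rw [map_sub, AlgHom.commutes]
  change Grassmann.body ((M.trans i j W hi hj f).1 x - algebraMap ℝ _ s) = 0
  rw [map_sub, Grassmann.body_algebraMap, ← hs, sub_self]

theorem trans_mem {p : ZMod 2} {f : SuperFun m (M.chart i) W}
    (hf : f ∈ SuperFun.part m (M.chart i) W p) :
    M.trans i j W hi hj f ∈ SuperFun.part m (M.chart j) W p :=
  M.trans_parity i j W hi hj p f hf

theorem trans_eq_zero {f : SuperFun m (M.chart i) W} {x : X} (hx : x ∈ W)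
    (h : extendZero f.1 =ᶠ[𝓝 x] 0) : (M.trans i j W hi hj f).1 ⟨x, hx⟩ = 0 := by
  rw [M.trans_congr hi hj hi hj (g := 0) hx hx, map_zero]
  · rfl
  · filter_upwards [h] with z hz
    rw [hz]
    by_cases hzW : z ∈ W
    · rw [extendZero_of_mem _ hzW]; rfl
    · rw [extendZero_of_notMem _ hzW]; rfl

/-- The chain rule. -/
theorem D_trans (B : Fin n ⊕ Fin m) (f : SuperFun m (M.chart i) W) :
    D hj B (M.trans i j W hi hj f) = ∑ C, D hj B (M.trans i j W hi hj (coord m (M.chart i) W C)) *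
      M.trans i j W hi hj (D hi C f) := by
  refine ext' fun x hx => ?_
  rw [← ev_apply ⟨x, hx⟩ (∑ C, _), map_sum]
  -- Both ∂_B ∘ trans and evaluation ∘ trans live at the point x, and the former is a
  -- superderivation over the latter, hence determined by its values on the coordinates.
  refine pointDerivation_eq_sum hi ((ev ⟨x, hx⟩).comp (M.trans i j W hi hj)) (coordParity B)
    ((ev ⟨x, hx⟩).toLinearMap.comp ((D hj B).comp (M.trans i j W hi hj).toLinearMap))
    (x₀ := ⟨x, hx⟩) (fun f => M.body_trans hi hj f _) (fun p f hf => M.trans_mem hi hj hf _)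
    (fun f hf => M.trans_eq_zero hi hj hx hf) ?_ ?_ ?_ f
  · intro f g
    change (D hj B (M.trans i j W hi hj (f * g))).1 ⟨x, hx⟩ = _
    rw [map_mul, D_mul_apply]
    rfl
  · intro f hf
    change superDeriv _ _ _ _ = _
    rw [superDeriv_congr (g := fun _ => 0) (hj hx)]
    · rcases B with b | β
      · refine Grassmann.ext_coeff fun I => ?_
        rw [superDeriv_inl, Grassmann.coeff_pd]
        simp
      · exact map_zero _
    · filter_upwards [hf.eventuallyEq_nhds, W.isOpen.mem_nhds hx] with z hz hzW
      rw [extendZero_of_mem _ hzW]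
      exact M.trans_eq_zero hi hj hzW hz
  · intro A
    exact D_mem hj B (M.trans_mem hi hj (coord_mem A)) _

/-- The Jacobi matrix as a matrix of superfunctions. -/
noncomputable def jac : Matrix (Fin n ⊕ Fin m) (Fin n ⊕ Fin m) (SuperFun m (M.chart j) W) :=
  Matrix.of fun A B => D hj A (M.trans i j W hi hj (coord m (M.chart i) W B))

theorem jac_apply (A B : Fin n ⊕ Fin m) :
    M.jac hi hj A B = D hj A (M.trans i j W hi hj (coord m (M.chart i) W B)) := rfl

theorem jac_isEvenSuper :
    (M.jac hi hj).IsEvenSuper (SuperFun.part m (M.chart j) W) coordParity := fun A B => by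
  rw [add_comm]; exact D_mem hj A (M.trans_mem hi hj (coord_mem B))

theorem jacobiMatrix_apply {x : X} (hx : x ∈ W) (A B : Fin n ⊕ Fin m) :
    M.jacobiMatrix i j x A B = (M.jac hi hj A B).1 ⟨x, hx⟩ := by
  refine superDeriv_congr (hj hx) ?_ A
  filter_upwards [W.isOpen.mem_nhds hx] with z hz
  rw [extendZero_of_mem _ hz, extendZero_of_mem _ (show z ∈ M.dom i ⊓ M.dom j from ⟨hi hz, hj hz⟩)]
  refine M.trans_congr _ _ hi hj _ hz ?_
  filter_upwards [W.isOpen.mem_nhds hz] with y hy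
  rw [extendZero_of_mem _ hy, extendZero_of_mem _ (show y ∈ M.dom i ⊓ M.dom j from ⟨hi hy, hj hy⟩)]
  rcases B with b | β <;> rfl

/-- This is the chain rule in matrix form. With left derivatives the derivative of the intermediate
coordinates stands on the left. -/
theorem jac_trans : M.jac hi hk = M.jac hj hk * (M.jac hi hj).map (M.trans j k W hj hk) := by
  ext1 A B
  rw [jac_apply, ← M.trans_trans i j k W hi hj hk, D_trans, Matrix.mul_apply]
  rfl

theorem jac_self (h h' : (W : Set X) ⊆ (M.chart i).source) : M.jac h h' = 1 := by
  ext1 A B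
  rw [jac_apply, M.trans_self, D_coord]
  rfl

/-- The inverse of the Jacobi matrix. -/
noncomputable def jacInv : Matrix (Fin n ⊕ Fin m) (Fin n ⊕ Fin m) (SuperFun m (M.chart j) W) :=
  (M.jac hj hi).map (M.trans i j W hi hj)

theorem jacInv_isEvenSuper :
    (M.jacInv hi hj).IsEvenSuper (SuperFun.part m (M.chart j) W) coordParity := fun A B =>
  M.trans_mem hi hj (M.jac_isEvenSuper hj hi A B)

theorem jac_mul_jacInv : M.jac hi hj * M.jacInv hi hj = 1 := by
  rw [jacInv, ← M.jac_trans hj hi hj, jac_self]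

/-- Over a noncommutative ring the other product has to be checked separately. Writing the Jacobi
matrix as an image from the i-th chart reduces it to the chain rule for i → j → i. -/
theorem jacInv_mul_jac : M.jacInv hi hj * M.jac hi hj = 1 := by
  have h1 : M.jac hi hj = ((M.jac hi hj).map (M.trans j i W hj hi)).map (M.trans i j W hi hj) := by
    ext1 A B
    rw [Matrix.map_apply, Matrix.map_apply, M.trans_trans, M.trans_self]
  conv_lhs => rw [h1, jacInv]
  rw [← Matrix.map_mul (f := (M.trans i j W hi hj)), ← M.jac_trans hi hj hi, jac_self]
  exact Matrix.map_one _ (map_zero _) (map_one _)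

end

end SuperManifold

/-! ### The Berezinian in terms of block inverses. -/

namespace Grassmann

variable {m : ℕ}

theorem evenPart_of_mem {x : Grassmann m} (hx : x ∈ part m 0) : evenPart x = ⟨x, hx⟩ := by
  refine Subtype.ext ?_
  change ((DirectSum.decompose (CliffordAlgebra.evenOdd (0 : QuadraticForm ℝ (Fin m → ℝ))) x 0 :
    Grassmann m)) = x
  exact DirectSum.decompose_of_mem_same _ hx

theorem ring_inverse_eq {E : Type*} [CommRing E] {x y : E} (h : x * y = 1) : Ring.inverse x = y := by
  have hu : IsUnit x := IsUnit.of_mul_eq_one _ h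
  calc Ring.inverse x = Ring.inverse x * (x * y) := by rw [h, mul_one]
    _ = y := by rw [← mul_assoc, Ring.inverse_mul_cancel _ hu, one_mul]

/-- The Berezinian in terms of given block inverses. -/
theorem berezinian_eq {n : ℕ} {M : Matrix (Fin n ⊕ Fin m) (Fin n ⊕ Fin m) (Grassmann m)}
    {a : Matrix (Fin n) (Fin n) (Even m)} {e e' : Matrix (Fin m) (Fin m) (Even m)}
    (he : e * e' = 1) (h22 : M.toBlocks₂₂ = e.map Subtype.val)
    (h11 : M.toBlocks₁₁ - M.toBlocks₁₂ * e'.map Subtype.val * M.toBlocks₂₁ = a.map Subtype.val) :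
    berezinian M = a.det * e'.det := by
  have hev : ∀ {k : ℕ} (z : Matrix (Fin k) (Fin k) (Even m)),
      (z.map Subtype.val).map evenPart = z := fun z => by
    ext1 p q
    exact evenPart_of_mem (z p q).2
  have h1 : (M.toBlocks₂₂.map evenPart) = e := by rw [h22, hev]
  have h2 : e⁻¹ = e' := Matrix.inv_eq_right_inv he
  have h3 : Ring.inverse e.det = e'.det := ring_inverse_eq (by rw [← Matrix.det_mul, he, Matrix.det_one])
  rw [berezinian, h1, h2, h3, h11, hev]

/-- `Ring.inverse` of a non-unit is 0, so a singular odd block makes the Berezinian vanish.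
Positivity of the Jacobians therefore forces the odd block to be invertible. -/
theorem isUnit_det_of_berezinian_ne_zero {n : ℕ}
    {M : Matrix (Fin n ⊕ Fin m) (Fin n ⊕ Fin m) (Grassmann m)} (h : berezinian M ≠ 0) :
    IsUnit (M.toBlocks₂₂.map evenPart).det := by
  by_contra hn
  exact h (by rw [berezinian, Ring.inverse_non_unit _ hn, mul_zero])

end Grassmann

theorem Grassmann.body_ne_zero_of_isUnit {m : ℕ} {x : Grassmann.Even m} (h : IsUnit x) :
    Grassmann.body (x : Grassmann m) ≠ 0 := by
  obtain ⟨y, hy⟩ := h.exists_right_inv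
  have h1 : Grassmann.body (x : Grassmann m) * Grassmann.body (y : Grassmann m) = 1 := by
    rw [← map_mul]
    exact (congrArg (fun z : Grassmann.Even m => Grassmann.body (z : Grassmann m)) hy).trans
      (map_one _)
  exact left_ne_zero_of_mul_eq_one h1

/-- The value of the body of an even superfunction. -/
noncomputable def SuperFun.bodyEven {n m : ℕ} {X : Type u} [TopologicalSpace X]
    {c : OpenPartialHomeomorph X (Fin n → ℝ)} {W : TopologicalSpace.Opens X} (x : W) :
    EvenFun m c W →+* ℝ where
  toFun f := Grassmann.body (f.1.1 x)
  map_one' := map_one Grassmann.body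
  map_mul' f g := map_mul Grassmann.body (f.1.1 x) (g.1.1 x)
  map_zero' := map_zero Grassmann.body
  map_add' f g := map_add Grassmann.body (f.1.1 x) (g.1.1 x)

namespace SuperFun

variable {n m : ℕ} {X : Type u} [TopologicalSpace X] {c : OpenPartialHomeomorph X (Fin n → ℝ)}
  {W : TopologicalSpace.Opens X} {k : ℕ}

theorem det_map_bodyEven (z : Matrix (Fin k) (Fin k) (EvenFun m c W)) (x : W) :
    (z.map (bodyEven x)).det = bodyEven x z.det :=
  (RingHom.map_det (bodyEven x) z).symm

theorem det_map_evEven (z : Matrix (Fin k) (Fin k) (EvenFun m c W)) (x : W) :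
    (z.map (evEven x)).det = evEven x z.det :=
  (RingHom.map_det (evEven x) z).symm

theorem map_evEven_mul_eq_one {e e' : Matrix (Fin k) (Fin k) (EvenFun m c W)} (h : e * e' = 1)
    (x : W) : e.map (evEven x) * e'.map (evEven x) = 1 := by
  rw [← Matrix.map_mul, h]
  exact Matrix.map_one _ (map_zero _) (map_one _)

end SuperFun

/-! ### The Jacobian as a smooth superfunction. -/

namespace SuperManifold

open SuperFun Topology

variable {n m : ℕ} {X : Type u} [TopologicalSpace X] (M : SuperManifold.{u, v} n m X)

section

variable {i j k : M.Index} {W W' : TopologicalSpace.Opens X} (hi : (W : Set X) ⊆ (M.chart i).source)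
  (hj : (W : Set X) ⊆ (M.chart j).source) (hk : (W : Set X) ⊆ (M.chart k).source)

/-- The body of the Jacobi matrix. -/
noncomputable def jacBody (i j : M.Index) (x : X) : Matrix (Fin n ⊕ Fin m) (Fin n ⊕ Fin m) ℝ :=
  (M.jacobiMatrix i j x).map Grassmann.body

theorem jacobiMatrix_eq (x : W) :
    M.jacobiMatrix i j x = (M.jac hi hj).map (fun f => f.1 x) := by
  ext1 A B
  exact M.jacobiMatrix_apply hi hj x.2 A B

/-- The pointwise Berezinian is the determinant of matrices of even superfunctions, once the blocks
are inverted over superfunctions; positivity guarantees that they can be. The three conclusions are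
agreement with the pointwise definition, the logarithmic derivative, and the comparison of bodies
which is used in the cocycle property and in the change of variables. -/
theorem exists_jacobian (hM : M.PositiveJacobians) :
    ∃ J : EvenFun m (M.chart j) W, (∀ x, evEven x J = M.jacobian i j x) ∧
      (∀ A, D hj A J.1 = J.1 * ((M.jac hi hj).map (D hj A) * M.jacInv hi hj).supertrace coordParity) ∧
      ∀ x, Grassmann.body (J.1.1 x) * (M.jacBody i j x).toBlocks₂₂.det
        = |(M.jacBody i j x).toBlocks₁₁.det| ∧ (M.jacBody i j x).toBlocks₂₂.det ≠ 0 := by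
  have hpar := M.jac_isEvenSuper hi hj
  have h22p : ∀ α β, (M.jac hi hj) (Sum.inr α) (Sum.inr β) ∈ SuperFun.part m (M.chart j) W 0 :=
    fun α β => by
      have h1 := hpar (Sum.inr α) (Sum.inr β)
      rwa [show coordParity (Sum.inr α : Fin n ⊕ Fin m) + coordParity (Sum.inr β : Fin n ⊕ Fin m)
        = 0 from show (1 : ZMod 2) + 1 = 0 by decide] at h1
  let e : Matrix (Fin m) (Fin m) (EvenFun m (M.chart j) W) := Matrix.of fun α β => ⟨_, h22p α β⟩
  have he22 : (M.jac hi hj).toBlocks₂₂ = e.map evenIncl := by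
    ext1 α β; rfl
  have hbe : ∀ x, (M.jacBody i j x.1).toBlocks₂₂
      = e.map (bodyEven x) := by
    intro x
    ext1 α β
    change Grassmann.body (M.jacobiMatrix i j x _ _) = _
    rw [M.jacobiMatrix_apply hi hj x.2]
    rfl
  have hber : ∀ x : W, Grassmann.berezinian (M.jacobiMatrix i j x) ≠ 0 := fun x h0 => by
    have := hM i j x (hi x.2) (hj x.2)
    rw [jacobian, Grassmann.orientedBerezinian, h0, smul_zero] at this
    exact absurd this (by simp)
  have hedet : IsUnit e.det := isUnit_even_of_body_ne_zero hj _ fun x => by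
    have h1 := Grassmann.isUnit_det_of_berezinian_ne_zero (hber x)
    have h2 : (M.jacobiMatrix i j x).toBlocks₂₂.map Grassmann.evenPart = e.map (evEven x) := by
      ext1 α β
      rw [Matrix.map_apply, M.jacobiMatrix_eq hi hj]
      exact Grassmann.evenPart_of_mem (h22p α β x)
    have h3 : (e.map (evEven x)).det = evEven x e.det := (RingHom.map_det _ _).symm
    rw [h2, h3] at h1
    exact Grassmann.body_ne_zero_of_isUnit h1
  set e' := e⁻¹ with he'
  have hee : e * e' = 1 := Matrix.mul_nonsing_inv _ hedet
  have hA : ∀ a b, ((M.jac hi hj).toBlocks₁₁ - (M.jac hi hj).toBlocks₁₂ * e'.map evenIncl *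
      (M.jac hi hj).toBlocks₂₁) a b ∈ SuperFun.part m (M.chart j) W 0 := by
    intro a b
    have c0 : coordParity (Sum.inl a : Fin n ⊕ Fin m) + coordParity (Sum.inl b : Fin n ⊕ Fin m)
        = 0 := show (0 : ZMod 2) + 0 = 0 by decide
    have c1 : ∀ α β : Fin m, coordParity (Sum.inl a : Fin n ⊕ Fin m) +
        coordParity (Sum.inr α : Fin n ⊕ Fin m) + 0 + (coordParity (Sum.inr β : Fin n ⊕ Fin m) + coordParity (Sum.inl b : Fin n ⊕ Fin m)) = 0 := fun _ _ =>
      show (0 : ZMod 2) + 1 + 0 + (1 + 0) = 0 by decide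
    have h0 := hpar (Sum.inl a) (Sum.inl b)
    rw [c0] at h0
    refine Submodule.sub_mem _ h0 ?_
    rw [Matrix.mul_apply]
    refine Submodule.sum_mem _ fun β _ => ?_
    rw [Matrix.mul_apply, Finset.sum_mul]
    refine Submodule.sum_mem _ fun α _ => ?_
    have h1 := isSupercommutative.mul_mem (isSupercommutative.mul_mem (hpar (Sum.inl a) (Sum.inr α))
      (evenIncl_mem (e' α β))) (hpar (Sum.inr β) (Sum.inl b))
    rw [c1] at h1
    exact h1
  let a : Matrix (Fin n) (Fin n) (EvenFun m (M.chart j) W) := Matrix.of fun p q => ⟨_, hA p q⟩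
  have ha11 : (M.jac hi hj).toBlocks₁₁ - (M.jac hi hj).toBlocks₁₂ * e'.map evenIncl *
      (M.jac hi hj).toBlocks₂₁ = a.map evenIncl := by
    ext1 p q; rfl
  have hbody_odd : ∀ A B, coordParity A + coordParity B = (1 : ZMod 2) → ∀ x,
      Grassmann.body ((M.jac hi hj A B).1 x) = 0 := fun A B h x => by
    have := hpar A B x
    rw [h] at this
    exact Grassmann.body_of_odd this
  -- The correction term of the Schur complement contains entries of the odd blocks, which have no
  -- body. So the Schur complement and the even-even block have the same body.
  have hba : ∀ x, (M.jacBody i j x.1).toBlocks₁₁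
      = a.map (bodyEven x) := by
    intro x
    ext1 p q
    change Grassmann.body (M.jacobiMatrix i j x _ _) = Grassmann.body (ev x
      (((M.jac hi hj).toBlocks₁₁ - (M.jac hi hj).toBlocks₁₂ * e'.map evenIncl *
      (M.jac hi hj).toBlocks₂₁) p q))
    rw [Matrix.sub_apply, Matrix.mul_apply, map_sub, map_sub, map_sum, map_sum, Finset.sum_eq_zero,
      sub_zero, M.jacobiMatrix_apply hi hj x.2]
    · rfl
    · intro β _
      rw [map_mul, map_mul, ev_apply _ ((M.jac hi hj).toBlocks₂₁ β q)]
      have h1 := hbody_odd (Sum.inr β) (Sum.inl q) (by simp [coordParity]) x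
      change _ * Grassmann.body ((M.jac hi hj (Sum.inr β) (Sum.inl q)).1 x) = 0
      rw [h1, mul_zero]
  have hbereq : ∀ x : W, Grassmann.berezinian (M.jacobiMatrix i j x)
      = evEven x (a.det * e'.det) := by
    intro x
    rw [Grassmann.berezinian_eq (a := a.map (evEven x)) (e := e.map (evEven x))
      (e' := e'.map (evEven x)) (map_evEven_mul_eq_one hee x), map_mul, det_map_evEven,
      det_map_evEven]
    · rw [M.jacobiMatrix_eq hi hj]; rfl
    · rw [M.jacobiMatrix_eq hi hj]
      ext1 p q
      change _ = ev x (((M.jac hi hj).toBlocks₁₁ - (M.jac hi hj).toBlocks₁₂ * e'.map evenIncl *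
      (M.jac hi hj).toBlocks₂₁) p q)
      simp only [Matrix.sub_apply, Matrix.mul_apply, map_sub, map_sum, map_mul]
      rfl
  have hadet0 : ∀ x : W, bodyEven x a.det ≠ 0 := fun x h0 => by
    have h1 := hM i j x (hi x.2) (hj x.2)
    rw [jacobian, Grassmann.orientedBerezinian, hbereq] at h1
    change 0 < Grassmann.body (_ • (a.det * e'.det).1.1 x) at h1
    rw [map_smul, show Grassmann.body ((a.det * e'.det).1.1 x) = bodyEven x (a.det * e'.det) from rfl,
      map_mul, h0] at h1
    simp at h1
  have hadet : IsUnit a.det := isUnit_even_of_body_ne_zero hj _ fun x => hadet0 x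
  have haa : a * a⁻¹ = 1 := Matrix.mul_nonsing_inv _ hadet
  -- The determinant of the even block does not vanish, so its sign is locally constant: it is
  -- smooth and does not affect the logarithmic derivative.
  have hsg : ∀ x ∈ W, ContDiffAt ℝ ∞ (fun y => Real.sign (bodyFn a.det.1 y)) (M.chart j x) ∧
      fderiv ℝ (fun y => Real.sign (bodyFn a.det.1 y)) (M.chart j x) = 0 := by
    intro x hx
    have hc := (contDiffAt_bodyFn hj a.det.1 hx).continuousAt
    have h0 : bodyFn a.det.1 (M.chart j x) ≠ 0 := by
      rw [bodyFn_apply hj _ hx]; exact hadet0 ⟨x, hx⟩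
    have hev : ∃ r : ℝ, (fun y => Real.sign (bodyFn a.det.1 y)) =ᶠ[𝓝 (M.chart j x)] fun _ => r := by
      rcases lt_or_gt_of_ne h0 with h | h
      · exact ⟨-1, (hc.eventually_lt_const h).mono fun y hy => Real.sign_of_neg hy⟩
      · exact ⟨1, (hc.eventually_const_lt h).mono fun y hy => Real.sign_of_pos hy⟩
    obtain ⟨r, hr⟩ := hev
    exact ⟨contDiffAt_const.congr_of_eventuallyEq hr, by rw [hr.fderiv_eq]; simp⟩
  have hDs : ∀ A, D hj A (scalar (m := m) hj _ fun x hx => (hsg x hx).1) = 0 := by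
    rintro (p | α)
    · refine ext' fun x hx => ?_
      rw [D_scalar_inl, (hsg x hx).2]
      simp
    · exact D_scalar_inr hj α _ _
  let s : EvenFun m (M.chart j) W := evenScalar hj _ fun x hx => (hsg x hx).1
  have hJ : ∀ x, evEven x (s * (a.det * e'.det)) = M.jacobian i j x := by
    intro x
    rw [jacobian, Grassmann.orientedBerezinian, hbereq, map_mul]
    have h1 : ((M.jacobiMatrix i j x).toBlocks₁₁.map Grassmann.body).det
        = bodyFn a.det.1 (M.chart j x) := by
      rw [bodyFn_apply hj _ x.2]
      change (M.jacBody i j x).toBlocks₁₁.det = _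
      rw [hba, det_map_bodyEven]
      rfl
    rw [h1, Algebra.smul_def]
    rfl
  refine ⟨s * (a.det * e'.det), hJ, fun A => ?_, fun x => ?_⟩
  · rw [D_evenSub_mul]
    change s.1 * D hj A (evenIncl (a.det * e'.det)) +
      _ * D hj A (scalar (m := m) hj _ fun x hx => (hsg x hx).1) = _
    have hber2 : D hj A (evenIncl (a.det * e'.det)) = evenIncl (a.det * e'.det) *
        ((M.jac hi hj).map (D hj A) * M.jacInv hi hj).supertrace coordParity :=
      map_berezinian isSupercommutative (isSuperderivation_D hj A)
        (evenIncl (m := m) (c := M.chart j) (W := W)).toRingHom (fun e => evenIncl_mem e) hpar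
        (M.jac_mul_jacInv hi hj) a a⁻¹ e e' haa hee he22 ha11
    rw [hDs, mul_zero, add_zero, hber2, ← mul_assoc]
    rfl
  · have he0 : (M.jacBody i j x).toBlocks₂₂.det ≠ 0 := by
      rw [hbe, det_map_bodyEven]
      exact (hedet.map (bodyEven x)).ne_zero
    refine ⟨?_, he0⟩
    rw [hbe, det_map_bodyEven, hba, det_map_bodyEven]
    change bodyEven x (s * (a.det * e'.det)) * _ = _
    rw [map_mul, map_mul, mul_assoc, mul_assoc, ← map_mul, mul_comm e'.det,
      ← Matrix.det_mul, hee, Matrix.det_one, map_one, mul_one]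
    have h2 : bodyEven x s
        = Real.sign (bodyEven x a.det) := by
      change Grassmann.body (algebraMap ℝ (Grassmann m)
        (Real.sign (bodyFn a.det.1 (M.chart j x)))) = _
      rw [Grassmann.body_algebraMap, bodyFn_apply hj _ x.2]
      rfl
    rw [h2]
    rcases lt_trichotomy (bodyEven x a.det) 0 with h | h | h
    · rw [Real.sign_of_neg h, abs_of_neg h]; ring
    · rw [h]; simp
    · rw [Real.sign_of_pos h, abs_of_pos h]; ring

end

end SuperManifold

theorem SuperFun.D_inr_apply {n m : ℕ} {X : Type u} [TopologicalSpace X]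
    {c : OpenPartialHomeomorph X (Fin n → ℝ)} {W : TopologicalSpace.Opens X}
    (hW : (W : Set X) ⊆ c.source) (α : Fin m) (f : SuperFun m c W) (x : W) :
    (D hW (Sum.inr α) f).1 x = Grassmann.oddDeriv α (f.1 x) := by
  change superDeriv c (Sum.inr α) (extendZero f.1) x.1 = _
  rw [superDeriv_inr, extendZero_apply]

/-! ### The cocycle property of the Jacobian and of its real powers. -/

namespace SuperManifold

open SuperFun Topology

variable {n m : ℕ} {X : Type u} [TopologicalSpace X] {M : SuperManifold.{u, v} n m X}
  (hM : M.PositiveJacobians)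

section

variable {i j k : M.Index} {W W' : TopologicalSpace.Opens X} (hi : (W : Set X) ⊆ (M.chart i).source)
  (hj : (W : Set X) ⊆ (M.chart j).source) (hk : (W : Set X) ⊆ (M.chart k).source)

/-- The factor `Dx_i / Dx_j` as a superfunction. -/
noncomputable def jacFun : EvenFun m (M.chart j) W := (M.exists_jacobian hi hj hM).choose

theorem evEven_jacFun (x : W) : evEven x (jacFun hM hi hj) = M.jacobian i j x :=
  (M.exists_jacobian hi hj hM).choose_spec.1 x

theorem D_jacFun (A : Fin n ⊕ Fin m) : D hj A (jacFun hM hi hj).1 = (jacFun hM hi hj).1 *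
    ((M.jac hi hj).map (D hj A) * M.jacInv hi hj).supertrace coordParity :=
  (M.exists_jacobian hi hj hM).choose_spec.2.1 A

theorem body_jacFun_pos (x : W) : 0 < Grassmann.body ((jacFun hM hi hj).1.1 x) := by
  have h1 := hM i j x (hi x.2) (hj x.2)
  rwa [← evEven_jacFun hM hi hj] at h1

theorem body_jacobian_mul_det (hM : M.PositiveJacobians) {x : X} (hi : x ∈ M.dom i) (hj : x ∈ M.dom j) :
    Grassmann.body (M.jacobian i j x : Grassmann m) * (M.jacBody i j x).toBlocks₂₂.det
        = |(M.jacBody i j x).toBlocks₁₁.det| ∧ (M.jacBody i j x).toBlocks₂₂.det ≠ 0 := by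
  have hi' : ((M.dom i ⊓ M.dom j : TopologicalSpace.Opens X) : Set X) ⊆ (M.chart i).source :=
    fun _ h => h.1
  have hj' : ((M.dom i ⊓ M.dom j : TopologicalSpace.Opens X) : Set X) ⊆ (M.chart j).source :=
    fun _ h => h.2
  have h1 := (M.exists_jacobian hi' hj' hM).choose_spec.2.2 ⟨x, hi, hj⟩
  have h2 := evEven_jacFun hM hi' hj' ⟨x, hi, hj⟩
  rw [← h2]
  exact h1

theorem jacBody_trans (hi : (W : Set X) ⊆ (M.chart i).source) 
    (hj : (W : Set X) ⊆ (M.chart j).source) 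
    (hk : (W : Set X) ⊆ (M.chart k).source) (x : W) : M.jacBody i k x = M.jacBody j k x * M.jacBody i j x := by
  rw [jacBody, jacBody, jacBody, M.jacobiMatrix_eq hi hk, M.jacobiMatrix_eq hj hk,
    M.jacobiMatrix_eq hi hj, M.jac_trans hi hj hk]
  ext1 A B
  simp only [Matrix.map_apply, Matrix.mul_apply]
  change Grassmann.body (ev x (∑ C, _)) = _
  rw [map_sum, map_sum]
  refine Finset.sum_congr rfl fun C _ => ?_
  rw [map_mul, map_mul]
  exact congrArg₂ (· * ·) rfl (M.body_trans hj hk _ x)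

theorem jacBody_apply_eq_zero (hi : (W : Set X) ⊆ (M.chart i).source) 
    (hj : (W : Set X) ⊆ (M.chart j).source) (x : W) {A B : Fin n ⊕ Fin m}
    (h : coordParity A + coordParity B = 1) : M.jacBody i j x A B = 0 := by
  rw [jacBody, Matrix.map_apply, M.jacobiMatrix_eq hi hj]
  have := M.jac_isEvenSuper hi hj A B x
  rw [h] at this
  exact Grassmann.body_of_odd this

theorem jacBody_blocks (hi : (W : Set X) ⊆ (M.chart i).source) 
    (hj : (W : Set X) ⊆ (M.chart j).source) 
    (hk : (W : Set X) ⊆ (M.chart k).source) (x : W) :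
    (M.jacBody i k x).toBlocks₁₁ = (M.jacBody j k x).toBlocks₁₁ * (M.jacBody i j x).toBlocks₁₁ ∧
    (M.jacBody i k x).toBlocks₂₂ = (M.jacBody j k x).toBlocks₂₂ * (M.jacBody i j x).toBlocks₂₂ := by
  rw [jacBody_trans hi hj hk]
  constructor
  · ext1 a b
    have h0 : ∀ α, M.jacBody j k x (Sum.inl a) (Sum.inr α) = 0 := fun α =>
      jacBody_apply_eq_zero hj hk x (by simp [coordParity])
    simp [Matrix.toBlocks₁₁, Matrix.mul_apply, h0]
  · ext1 α β
    have h0 : ∀ a, M.jacBody j k x (Sum.inr α) (Sum.inl a) = 0 := fun α =>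
      jacBody_apply_eq_zero hj hk x (by simp [coordParity])
    simp [Matrix.toBlocks₂₂, Matrix.mul_apply, h0]

/-- This is the uniqueness of real powers with exponent 1. It reduces identities between Berezinians
to bodies and supertraces, so multiplicativity of the Berezinian never has to be proved from its
formula. -/
theorem even_eq_of_logDeriv {x y : Grassmann.Even m} (hy : 0 < Grassmann.body (y : Grassmann m))
    (hb : Grassmann.body (x : Grassmann m) = Grassmann.body (y : Grassmann m))
    (T : Fin m → Grassmann m) (hx : ∀ α, Grassmann.oddDeriv α x = x.1 * T α)
    (hyd : ∀ α, Grassmann.oddDeriv α y = y.1 * T α) : x = y := by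
  rw [Grassmann.eq_pow hy 1 (u := x), Grassmann.pow_one' hy]
  · rw [one_mul, Real.exp_log hy, hb]
  · intro α
    rw [one_smul]
    change y.1 * Grassmann.oddDeriv α x.1 = x.1 * Grassmann.oddDeriv α y.1
    rw [hx, hyd, ← mul_assoc, ← mul_assoc, (Grassmann.even_comm y.2 x.1).eq]

/-- The factors `Dx_i / Dx_j` form a cocycle. -/
theorem jacFun_trans : (jacFun hM hi hk).1
    = M.trans j k W hj hk (jacFun hM hi hj).1 * (jacFun hM hj hk).1 := by
  have hev : M.trans j k W hj hk (jacFun hM hi hj).1 * (jacFun hM hj hk).1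
      ∈ SuperFun.part m (M.chart k) W 0 := by
    have := isSupercommutative.mul_mem (M.trans_mem hj hk (jacFun hM hi hj).2) (jacFun hM hj hk).2
    rwa [add_zero] at this
  let K : EvenFun m (M.chart k) W := ⟨_, hev⟩
  -- The product of Jacobians satisfies the logarithmic derivative equation of the composite one:
  -- the supertrace of the chain rule product splits, and the chain rule moves ∂_A through the
  -- change of coordinates.
  have hK : ∀ A, D hk A K.1 = K.1 *
      ((M.jac hi hk).map (D hk A) * M.jacInv hi hk).supertrace coordParity := by
    intro A
    have h1 : ((M.jac hi hk).map (D hk A) * M.jacInv hi hk).supertrace coordParity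
        = ((M.jac hj hk).map (D hk A) * M.jacInv hj hk).supertrace coordParity
        + (((M.jac hi hj).map (M.trans j k W hj hk)).map (D hk A)
          * (M.jacInv hi hj).map (M.trans j k W hj hk)).supertrace coordParity := by
      have hP : ((M.jac hi hj).map (M.trans j k W hj hk)).IsEvenSuper
          (SuperFun.part m (M.chart k) W) coordParity := fun A B =>
        M.trans_mem hj hk (M.jac_isEvenSuper hi hj A B)
      have hP' : ((M.jacInv hi hj).map (M.trans j k W hj hk)).IsEvenSuper
          (SuperFun.part m (M.chart k) W) coordParity := fun A B =>
        M.trans_mem hj hk (M.jacInv_isEvenSuper hi hj A B)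
      have hPP : (M.jac hi hj).map (M.trans j k W hj hk)
          * (M.jacInv hi hj).map (M.trans j k W hj hk) = 1 := by
        rw [← Matrix.map_mul, M.jac_mul_jacInv]
        exact Matrix.map_one _ (map_zero _) (map_one _)
      have h2 := Matrix.supertrace_logDeriv_mul isSupercommutative (isSuperderivation_D hk A)
        (M.jac_isEvenSuper hj hk) (M.jacInv_isEvenSuper hj hk) hP hP' (M.jacInv_mul_jac hj hk) hPP
      rw [← h2, ← M.jac_trans hi hj hk]
      congr 2
      have h3 : (M.jacInv hi hj).map (M.trans j k W hj hk) * M.jacInv hj hk * M.jac hi hk = 1 := by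
        rw [M.jac_trans hi hj hk, mul_assoc, ← mul_assoc (M.jacInv hj hk), M.jacInv_mul_jac, one_mul,
          ← Matrix.map_mul, M.jacInv_mul_jac]
        exact Matrix.map_one _ (map_zero _) (map_one _)
      calc M.jacInv hi hk = (M.jacInv hi hj).map (M.trans j k W hj hk) * M.jacInv hj hk *
            M.jac hi hk * M.jacInv hi hk := by rw [h3, one_mul]
        _ = _ := by rw [mul_assoc, M.jac_mul_jacInv, mul_one]
    have h4 : (((M.jac hi hj).map (M.trans j k W hj hk)).map (D hk A)
          * (M.jacInv hi hj).map (M.trans j k W hj hk)).supertrace coordParity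
        = ∑ C, M.jac hj hk A C * M.trans j k W hj hk
          (((M.jac hi hj).map (D hj C) * M.jacInv hi hj).supertrace coordParity) := by
      simp only [Matrix.supertrace, Matrix.mul_apply, Matrix.map_apply, map_sum, map_smul, map_mul,
        Finset.mul_sum, Finset.smul_sum]
      conv_rhs => rw [Finset.sum_comm]
      refine Finset.sum_congr rfl fun a _ => ?_
      conv_rhs => rw [Finset.sum_comm]
      refine Finset.sum_congr rfl fun b _ => ?_
      rw [M.D_trans hj hk, Finset.sum_mul, Finset.smul_sum]
      refine Finset.sum_congr rfl fun c _ => ?_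
      rw [mul_smul_comm, mul_assoc]
      rfl
    change D hk A (M.trans j k W hj hk (jacFun hM hi hj).1 * (jacFun hM hj hk).1) = _
    have h5 := (isSuperderivation_D hk A).mul (jacFun hM hj hk).1
      (M.trans_mem hj hk (jacFun hM hi hj).2)
    rw [h5, mul_zero, sgn_zero, one_smul, M.D_trans hj hk, h1, h4, D_jacFun, mul_add, add_comm,
      ← mul_assoc]
    congr 1
    simp only [D_jacFun, map_mul]
    rw [← SuperFun.even_comm (jacFun hM hj hk).2, Finset.mul_sum, Finset.mul_sum]
    refine Finset.sum_congr rfl fun C _ => ?_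
    change _ = M.trans j k W hj hk (jacFun hM hi hj).1 * (jacFun hM hj hk).1 * _
    rw [← mul_assoc (D hk A _), ← SuperFun.even_comm (M.trans_mem hj hk (jacFun hM hi hj).2),
      ← SuperFun.even_comm (jacFun hM hj hk).2]
    simp only [mul_assoc]
    rfl
  refine ext' fun x hx => ?_
  -- The bodies are compared at every point, so the odd derivatives are enough to identify the two
  -- sides.
  have h6 := even_eq_of_logDeriv (x := evEven ⟨x, hx⟩ (jacFun hM hi hk)) (y := evEven ⟨x, hx⟩ K) ?_ ?_
    (fun α => (((M.jac hi hk).map (D hk (Sum.inr α)) * M.jacInv hi hk).supertrace coordParity).1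
      ⟨x, hx⟩) ?_ ?_
  · exact congrArg Subtype.val h6
  · change 0 < Grassmann.body ((M.trans j k W hj hk (jacFun hM hi hj).1).1 ⟨x, hx⟩ * _)
    rw [map_mul, M.body_trans]
    exact mul_pos (body_jacFun_pos hM hi hj _) (body_jacFun_pos hM hj hk _)
  · change _ = Grassmann.body ((M.trans j k W hj hk (jacFun hM hi hj).1).1 ⟨x, hx⟩
      * (jacFun hM hj hk).1.1 ⟨x, hx⟩)
    rw [map_mul, M.body_trans, evEven_jacFun]
    have e1 : (jacFun hM hi hj).1.1 ⟨x, hx⟩ = (M.jacobian i j x).1 := by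
      rw [← evEven_jacFun hM hi hj ⟨x, hx⟩]; rfl
    have e2 : (jacFun hM hj hk).1.1 ⟨x, hx⟩ = (M.jacobian j k x).1 := by
      rw [← evEven_jacFun hM hj hk ⟨x, hx⟩]; rfl
    rw [e1, e2]
    obtain ⟨a1, a2⟩ := body_jacobian_mul_det hM (hi hx) (hk hx)
    obtain ⟨b1, b2⟩ := body_jacobian_mul_det hM (hi hx) (hj hx)
    obtain ⟨c1, c2⟩ := body_jacobian_mul_det hM (hj hx) (hk hx)
    obtain ⟨d1, d2⟩ := jacBody_blocks hi hj hk ⟨x, hx⟩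
    -- After multiplication by the determinant of the odd block the bodies become absolute values of
    -- determinants of the even blocks, which are multiplicative.
    refine mul_right_cancel₀ a2 ?_
    rw [a1, d1, d2, Matrix.det_mul, Matrix.det_mul, abs_mul, ← b1, ← c1]
    ring
  · intro α
    have h7 := congrArg (fun f => f.1 ⟨x, hx⟩) (D_jacFun hM hi hk (Sum.inr α))
    rw [D_inr_apply] at h7
    exact h7
  · intro α
    have h7 := congrArg (fun f => f.1 ⟨x, hx⟩) (hK (Sum.inr α))
    rw [D_inr_apply] at h7
    exact h7

/-- Changes of coordinates commute with real powers. -/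
theorem trans_pow (f g : EvenFun m (M.chart i) W) (hf : ∀ x, 0 < Grassmann.body (f.1.1 x)) (w : ℝ)
    (hg : ∀ x, evEven x g = Grassmann.pow (evEven x f) w)
    (hd : ∀ A, f.1 * D hi A g.1 = w • (g.1 * D hi A f.1)) (x : W) :
    (M.trans i j W hi hj g.1).1 x = (Grassmann.pow ⟨(M.trans i j W hi hj f.1).1 x,
      M.trans_mem hi hj f.2 x⟩ w : Grassmann m) := by
  have hb : 0 < Grassmann.body ((M.trans i j W hi hj f.1).1 x) := by
    rw [M.body_trans]; exact hf x
  have h1 := Grassmann.eq_pow (x := ⟨(M.trans i j W hi hj f.1).1 x, M.trans_mem hi hj f.2 x⟩)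
    (u := ⟨(M.trans i j W hi hj g.1).1 x, M.trans_mem hi hj g.2 x⟩) hb w ?_ ?_
  · exact congrArg Subtype.val h1
  · change Grassmann.body ((M.trans i j W hi hj g.1).1 x) = Real.exp (w * Real.log
      (Grassmann.body ((M.trans i j W hi hj f.1).1 x)))
    rw [M.body_trans, M.body_trans]
    have h2 := Grassmann.body_pow (evEven x f) w
    rw [← hg] at h2
    exact h2
  · intro α
    -- By the chain rule the equation f ∂g = w g ∂f in the i-th chart passes to the images in the
    -- j-th chart, where it characterizes the power.
    have h3 : M.trans i j W hi hj f.1 * D hj (Sum.inr α) (M.trans i j W hi hj g.1)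
        = w • (M.trans i j W hi hj g.1 * D hj (Sum.inr α) (M.trans i j W hi hj f.1)) := by
      rw [M.D_trans hi hj, M.D_trans hi hj (Sum.inr α) f.1, Finset.mul_sum, Finset.mul_sum,
        Finset.smul_sum]
      refine Finset.sum_congr rfl fun C _ => ?_
      rw [← mul_assoc, SuperFun.even_comm (M.trans_mem hi hj f.2), mul_assoc, ← map_mul, hd, map_smul,
        map_mul, ← mul_assoc (M.trans i j W hi hj g.1),
        SuperFun.even_comm (M.trans_mem hi hj g.2) (D hj _ _), mul_smul_comm, mul_assoc]
    have h4 := congrArg (fun f => f.1 x) h3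
    change _ * (D hj (Sum.inr α) _).1 x = w • (_ * (D hj (Sum.inr α) _).1 x) at h4
    rw [D_inr_apply, D_inr_apply] at h4
    exact h4

end

end SuperManifold

/-! ### Densities -/

namespace SuperManifold

open SuperFun Topology

variable {n m : ℕ} {X : Type u} [TopologicalSpace X] {M : SuperManifold.{u, v} n m X}

theorem dom_subset (i : M.Index) : (M.dom i : Set X) ⊆ (M.chart i).source := fun _ h => h

theorem component_apply (ψ : M.Densities) {i : M.Index} (w : ℝ) {x : X} (hx : x ∈ M.dom i) :
    component ψ i w x = ((ψ.1 i).coeff w).1 ⟨x, hx⟩ := extendZero_of_mem _ hx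

theorem component_of_notMem (ψ : M.Densities) {i : M.Index} (w : ℝ) {x : X} (hx : x ∉ M.dom i) :
    component ψ i w x = 0 := extendZero_of_notMem _ hx

/-- The coefficient of a density in a chart, as a linear map. -/
noncomputable def componentₗ (i : M.Index) (w : ℝ) (x : X) : M.Densities →ₗ[ℝ] Grassmann m where
  toFun ψ := component ψ i w x
  map_add' ψ χ := congrFun (extendZero_add ((ψ.1 i).coeff w).1 ((χ.1 i).coeff w).1) x
  map_smul' r ψ := congrFun (extendZero_smul r ((ψ.1 i).coeff w).1) x

theorem component_add (ψ χ : M.Densities) (i : M.Index) (w : ℝ) (x : X) :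
    component (ψ + χ) i w x = component ψ i w x + component χ i w x := map_add (componentₗ i w x) ψ χ

theorem component_sub (ψ χ : M.Densities) (i : M.Index) (w : ℝ) (x : X) :
    component (ψ - χ) i w x = component ψ i w x - component χ i w x := map_sub (componentₗ i w x) ψ χ

theorem component_smul (r : ℝ) (ψ : M.Densities) (i : M.Index) (w : ℝ) (x : X) :
    component (r • ψ) i w x = r • component ψ i w x := map_smul (componentₗ i w x) r ψ

theorem component_zero (i : M.Index) (w : ℝ) (x : X) :
    component (0 : M.Densities) i w x = 0 := map_zero (componentₗ i w x)

theorem component_sum {ι : Type*} (s : Finset ι) (f : ι → M.Densities) (i : M.Index) (w : ℝ) (x : X) :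
    component (∑ k ∈ s, f k) i w x = ∑ k ∈ s, component (f k) i w x := map_sum (componentₗ i w x) f s

theorem densities_ext {ψ χ : M.Densities}
    (h : ∀ i w, ∀ x ∈ M.dom i, component ψ i w x = component χ i w x) : ψ = χ := by
  refine Subtype.ext (funext fun i => AddMonoidAlgebra.ext (Finsupp.ext fun w => ?_))
  refine ext' fun x hx => ?_
  rw [← component_apply ψ w hx, ← component_apply χ w hx, h i w x hx]

theorem component_smooth (ψ : M.Densities) {i : M.Index} (w : ℝ) {x : X} (hx : x ∈ M.dom i) :
    SuperSmoothAt (M.chart i) (component ψ i w) x := smooth (dom_subset i) _ hx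

theorem HasWeight.component_eq_zero {ψ : M.Densities} {w w' : ℝ} (h : HasWeight ψ w) (hw : w' ≠ w)
    (i : M.Index) (x : X) : component ψ i w' x = 0 := by
  have h1 : (ψ.1 i).coeff w' = 0 := by
    by_contra hn
    exact hw (by simpa using h i (Finsupp.mem_support_iff.2 hn))
  rw [component, h1]
  by_cases hx : x ∈ M.dom i
  · rw [extendZero_of_mem _ hx]; rfl
  · rw [extendZero_of_notMem _ hx]

theorem hasWeight_iff {ψ : M.Densities} {w : ℝ} :
    HasWeight ψ w ↔ ∀ i w', w' ≠ w → ∀ x ∈ M.dom i, component ψ i w' x = 0 := by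
  refine ⟨fun h i w' hw x _ => h.component_eq_zero hw i x, fun h i w' hw' => ?_⟩
  by_contra hn
  refine Finsupp.mem_support_iff.1 hw' (ext' fun x hx => ?_)
  rw [← component_apply ψ w' hx, h i w' (by simpa using hn) x hx]
  rfl

theorem HasWeight.add {ψ χ : M.Densities} {w : ℝ} (h : HasWeight ψ w) (h' : HasWeight χ w) :
    HasWeight (ψ + χ) w := hasWeight_iff.2 fun i w' hw x _ => by
  rw [component_add, h.component_eq_zero hw, h'.component_eq_zero hw, add_zero]

theorem HasWeight.smul {ψ : M.Densities} {w : ℝ} (h : HasWeight ψ w) (r : ℝ) :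
    HasWeight (r • ψ) w := hasWeight_iff.2 fun i w' hw x _ => by
  rw [component_smul, h.component_eq_zero hw, smul_zero]

theorem hasWeight_zero (w : ℝ) : HasWeight (0 : M.Densities) w := hasWeight_iff.2 fun i w' _ x _ =>
  component_zero i w' x

theorem HasWeight.ext {ψ χ : M.Densities} {w : ℝ} (h : HasWeight ψ w) (h' : HasWeight χ w)
    (hc : ∀ i, ∀ x ∈ M.dom i, component ψ i w x = component χ i w x) : ψ = χ :=
  densities_ext fun i w' x hx => by
    by_cases hw : w' = w
    · subst hw; exact hc i x hx
    · rw [h.component_eq_zero hw, h'.component_eq_zero hw]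

theorem HasWeight.component_mul {ψ : M.Densities} {w : ℝ} (h : HasWeight ψ w) (χ : M.Densities)
    (i : M.Index) (w' : ℝ) (x : X) :
    component (ψ * χ) i (w + w') x = component ψ i w x * component χ i w' x := by
  by_cases hx : x ∈ M.dom i
  · rw [component_apply _ _ hx, component_apply _ _ hx, component_apply _ _ hx]
    change ((ψ.1 i * χ.1 i).coeff (w + w')).1 ⟨x, hx⟩ = _
    rw [coeff_mul_of_subset _ _ (h i) (subset_refl _), Finset.sum_singleton]
    by_cases hw : w' ∈ (χ.1 i).coeff.support
    · rw [Finset.sum_eq_single_of_mem w' hw, if_pos rfl]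
      · rfl
      · intro b _ hb
        rw [if_neg (by simpa using hb)]
    · rw [Finset.sum_eq_zero, Finsupp.notMem_support_iff.1 hw]
      · exact (mul_zero _).symm
      · intro b hb
        rw [if_neg]
        intro hbw
        exact hw (by rwa [add_left_cancel hbw] at hb)
  · rw [component_of_notMem _ _ hx, component_of_notMem _ _ hx, zero_mul]

theorem HasWeight.component_mul' {ψ : M.Densities} {w : ℝ} (h : HasWeight ψ w) (χ : M.Densities)
    (i : M.Index) (w' : ℝ) (x : X) :
    component (ψ * χ) i w' x = component ψ i w x * component χ i (w' - w) x := by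
  rw [← h.component_mul, add_sub_cancel]

theorem HasWeight.mul {ψ χ : M.Densities} {w w' : ℝ} (h : HasWeight ψ w) (h' : HasWeight χ w') :
    HasWeight (ψ * χ) (w + w') := hasWeight_iff.2 fun i w'' hw x _ => by
  rw [h.component_mul', h'.component_eq_zero (fun h => hw (by rw [← h]; ring)), mul_zero]

theorem hasWeight_one : HasWeight (1 : M.Densities) 0 := by
  intro i w hw
  by_contra hn
  refine Finsupp.mem_support_iff.1 hw ?_
  change (1 : AddMonoidAlgebra (M.Fn i) ℝ).coeff w = 0
  rw [AddMonoidAlgebra.one_def, AddMonoidAlgebra.coeff_single]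
  exact Finsupp.single_eq_of_ne (by simpa using hn)

theorem component_one {i : M.Index} {x : X} (hx : x ∈ M.dom i) :
    component (1 : M.Densities) i 0 x = 1 := by
  rw [component_apply _ _ hx]
  change ((1 : AddMonoidAlgebra (M.Fn i) ℝ).coeff 0).1 ⟨x, hx⟩ = 1
  rw [AddMonoidAlgebra.one_def, AddMonoidAlgebra.coeff_single, Finsupp.single_eq_same]
  rfl

theorem HasParity.add {ψ χ : M.Densities} {p : ZMod 2} (h : HasParity ψ p) (h' : HasParity χ p) :
    HasParity (ψ + χ) p := fun i w x => by
  rw [component_add]; exact Submodule.add_mem _ (h i w x) (h' i w x)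

theorem HasParity.smul {ψ : M.Densities} {p : ZMod 2} (h : HasParity ψ p) (r : ℝ) :
    HasParity (r • ψ) p := fun i w x => by
  rw [component_smul]; exact Submodule.smul_mem _ _ (h i w x)

theorem hasParity_zero (p : ZMod 2) : HasParity (0 : M.Densities) p := fun i w x => by
  rw [component_zero]; exact Submodule.zero_mem _

theorem HasParity.sum {ι : Type*} {s : Finset ι} {f : ι → M.Densities} {p : ZMod 2}
    (h : ∀ k ∈ s, HasParity (f k) p) : HasParity (∑ k ∈ s, f k) p := fun i w x => by
  rw [component_sum]; exact Submodule.sum_mem _ fun k hk => h k hk i w x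

theorem hasParity_one : HasParity (1 : M.Densities) 0 := fun i w x => by
  by_cases hx : x ∈ M.dom i
  · by_cases hw : w = 0
    · subst hw; rw [component_one hx]; exact Grassmann.one_mem_part
    · rw [hasWeight_one.component_eq_zero hw]; exact Submodule.zero_mem _
  · rw [component_of_notMem _ _ hx]; exact Submodule.zero_mem _

/-! #### Compatibility -/

theorem component_eq_trans (ψ : M.Densities) {i j : M.Index} {W : TopologicalSpace.Opens X}
    (hi : (W : Set X) ⊆ (M.chart i).source) (hj : (W : Set X) ⊆ (M.chart j).source) (w : ℝ) {x : X}
    (hx : x ∈ W) {f : SuperFun m (M.chart i) W} (h : extendZero f.1 =ᶠ[𝓝 x] component ψ i w) :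
    component ψ j w x = (M.trans i j W hi hj f).1 ⟨x, hx⟩
      * (Grassmann.pow (M.jacobian i j x) w : Grassmann m) := by
  have h1 := ψ.2.1 i j w x (hi hx) (hj hx)
  rw [component_apply ψ w (show x ∈ M.dom j from hj hx), h1, change]
  congr 1
  refine M.trans_congr _ _ hi hj _ hx ?_
  filter_upwards [h, W.isOpen.mem_nhds hx] with z hz hzW
  rw [hz, extendZero_of_mem _ (show z ∈ M.dom i ⊓ M.dom j from ⟨hi hzW, hj hzW⟩),
    component_apply ψ w (show z ∈ M.dom i from hi hzW)]
  rfl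

/-- The restriction of the coefficient of a density. -/
noncomputable def componentOn (ψ : M.Densities) (i : M.Index) (w : ℝ) {W : TopologicalSpace.Opens X}
    (hi : (W : Set X) ⊆ (M.chart i).source) : SuperFun m (M.chart i) W :=
  SuperFun.res (W := M.dom i) hi ((ψ.1 i).coeff w)

theorem componentOn_apply (ψ : M.Densities) (i : M.Index) (w : ℝ) {W : TopologicalSpace.Opens X}
    (hi : (W : Set X) ⊆ (M.chart i).source) {x : X} (hx : x ∈ W) :
    (componentOn ψ i w hi).1 ⟨x, hx⟩ = component ψ i w x :=
  (component_apply ψ w (show x ∈ M.dom i from hi hx)).symm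

theorem componentOn_eventuallyEq (ψ : M.Densities) (i : M.Index) (w : ℝ)
    {W : TopologicalSpace.Opens X} (hi : (W : Set X) ⊆ (M.chart i).source) {x : X} (hx : x ∈ W) :
    extendZero (componentOn ψ i w hi).1 =ᶠ[𝓝 x] component ψ i w :=
  extendZero_eventuallyEq hx fun y => componentOn_apply ψ i w hi y.2

theorem component_trans (ψ : M.Densities) {i j : M.Index} {W : TopologicalSpace.Opens X}
    (hi : (W : Set X) ⊆ (M.chart i).source) (hj : (W : Set X) ⊆ (M.chart j).source) (w : ℝ) {x : X}
    (hx : x ∈ W) : component ψ j w x = (M.trans i j W hi hj (componentOn ψ i w hi)).1 ⟨x, hx⟩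
      * (Grassmann.pow (M.jacobian i j x) w : Grassmann m) :=
  component_eq_trans ψ hi hj w hx (componentOn_eventuallyEq ψ i w hi hx)

/-- Locality of the transformation law. -/
theorem component_congr_chart {ψ χ : M.Densities} {i j : M.Index} {w : ℝ} {x : X}
    (hi : x ∈ M.dom i) (hj : x ∈ M.dom j) (h : component ψ i w =ᶠ[𝓝 x] component χ i w) :
    component ψ j w x = component χ j w x := by
  have hi' : ((M.dom i ⊓ M.dom j : TopologicalSpace.Opens X) : Set X) ⊆ (M.chart i).source :=
    fun _ h => h.1
  have hj' : ((M.dom i ⊓ M.dom j : TopologicalSpace.Opens X) : Set X) ⊆ (M.chart j).source :=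
    fun _ h => h.2
  rw [component_trans ψ hi' hj' w ⟨hi, hj⟩, component_eq_trans χ hi' hj' w ⟨hi, hj⟩
    ((componentOn_eventuallyEq ψ i w hi' ⟨hi, hj⟩).trans h)]

/-- A density given by a compatible family of coefficients of finitely many weights. -/
noncomputable def ofFamily (s : Finset ℝ) (f : ∀ i, ℝ → M.Fn i) (hs : ∀ i, ∀ w ∉ s, f i w = 0)
    (hf : ∀ i j w x (hi : x ∈ M.dom i) (hj : x ∈ M.dom j), (f j w).1 ⟨x, hj⟩ =
      (M.change i j (SuperFun.res inf_le_left (f i w))).1 ⟨x, hi, hj⟩ *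
        (Grassmann.pow (M.jacobian i j x) w : Grassmann m)) : M.Densities :=
  ⟨fun i => AddMonoidAlgebra.ofCoeff (Finsupp.onFinset s (f i) fun w =>
      not_imp_comm.1 (hs i w)),
    fun i j w x hi hj => hf i j w x hi hj, s, fun i => Finsupp.support_onFinset_subset (hf := fun w =>
      not_imp_comm.1 (hs i w))⟩

theorem component_ofFamily {s : Finset ℝ} {f : ∀ i, ℝ → M.Fn i} {hs : ∀ i, ∀ w ∉ s, f i w = 0}
    {hf : ∀ i j w x (hi : x ∈ M.dom i) (hj : x ∈ M.dom j), (f j w).1 ⟨x, hj⟩ =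
      (M.change i j (SuperFun.res inf_le_left (f i w))).1 ⟨x, hi, hj⟩ *
        (Grassmann.pow (M.jacobian i j x) w : Grassmann m)} (i : M.Index) (w : ℝ) {x : X}
    (hx : x ∈ M.dom i) : component (ofFamily s f hs hf) i w x = (f i w).1 ⟨x, hx⟩ :=
  component_apply _ _ hx

/-- The homogeneous part of weight `w`. -/
noncomputable def weightPart (w : ℝ) (ψ : M.Densities) : M.Densities := by
  classical
  exact ofFamily {w} (fun i w' => if w' = w then (ψ.1 i).coeff w' else 0)
    (fun i w' hw => if_neg (by simpa using hw)) (fun i j w' x hi hj => by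
      by_cases hw : w' = w
      · simp only [if_pos hw]; exact ψ.2.1 i j w' x hi hj
      · simp only [if_neg hw, map_zero]; exact (zero_mul _).symm)

theorem component_weightPart (w : ℝ) (ψ : M.Densities) (i : M.Index) (x : X) :
    component (weightPart w ψ) i w x = component ψ i w x := by
  by_cases hx : x ∈ M.dom i
  · rw [weightPart, component_ofFamily _ _ hx, if_pos rfl, component_apply _ _ hx]
  · rw [component_of_notMem _ _ hx, component_of_notMem _ _ hx]

theorem hasWeight_weightPart (w : ℝ) (ψ : M.Densities) : HasWeight (weightPart w ψ) w :=
  hasWeight_iff.2 fun i w' hw x hx => by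
    rw [weightPart, component_ofFamily _ _ hx, if_neg hw]; rfl

theorem exists_eq_sum_weightPart (ψ : M.Densities) : ∃ s : Finset ℝ, ψ = ∑ w ∈ s, weightPart w ψ := by
  obtain ⟨-, s, hs⟩ := ψ.2
  refine ⟨s, densities_ext fun i w x hx => ?_⟩
  rw [component_sum]
  by_cases hw : w ∈ s
  · rw [Finset.sum_eq_single_of_mem w hw, component_weightPart]
    intro b _ hb
    exact (hasWeight_weightPart b ψ).component_eq_zero hb.symm i x
  · have h1 : (ψ.1 i).coeff w = 0 := Finsupp.notMem_support_iff.1 fun h => hw (hs i h)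
    rw [component_apply _ _ hx, h1, Finset.sum_eq_zero]
    · rfl
    · intro b hb
      exact (hasWeight_weightPart b ψ).component_eq_zero (fun h => hw (by rw [h]; exact hb)) i x

theorem HasParity.weightPart {ψ : M.Densities} {p : ZMod 2} (h : HasParity ψ p) (w : ℝ) :
    HasParity (weightPart w ψ) p := fun i w' x => by
  by_cases hw : w' = w
  · subst hw; rw [component_weightPart]; exact h _ _ _
  · rw [(hasWeight_weightPart w ψ).component_eq_zero hw]; exact Submodule.zero_mem _

/-- A change of coordinates preserves parity, so it commutes with the parity projections. Hence the
parity components of a density form densities. -/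
theorem trans_mapValues_proj {i j : M.Index} {W : TopologicalSpace.Opens X}
    (hi : (W : Set X) ⊆ (M.chart i).source) (hj : (W : Set X) ⊆ (M.chart j).source)
    (f : SuperFun m (M.chart i) W) (p : ZMod 2) :
    M.trans i j W hi hj (mapValues hi (Grassmann.proj p) f)
      = mapValues hj (Grassmann.proj p) (M.trans i j W hi hj f) := by
  have hp : ∀ q, mapValues hi (Grassmann.proj q) f ∈ SuperFun.part m (M.chart i) W q := fun q x =>
    Grassmann.proj_mem _ _
  have h1 : f = mapValues hi (Grassmann.proj p) f + mapValues hi (Grassmann.proj (p + 1)) f := by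
    refine ext' fun x hx => ?_
    have h2 := (Grassmann.proj_add_proj (f.1 ⟨x, hx⟩)).symm
    rcases zmod_two_cases p with rfl | rfl
    · exact h2
    · exact h2.trans (add_comm _ _)
  refine ext' fun x hx => ?_
  conv_rhs => rw [h1, map_add]
  change _ = Grassmann.proj p ((M.trans i j W hi hj _).1 ⟨x, hx⟩ + (M.trans i j W hi hj _).1 ⟨x, hx⟩)
  rw [map_add, Grassmann.proj_of_mem (M.trans_mem hi hj (hp p) _),
    Grassmann.proj_of_mem_ne (M.trans_mem hi hj (hp (p + 1)) _), add_zero]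
  clear * -; revert p; decide

theorem proj_mul_even {x y : Grassmann m} (hy : y ∈ Grassmann.part m 0) (p : ZMod 2) :
    Grassmann.proj p (x * y) = Grassmann.proj p x * y := by
  rw [Grassmann.proj_apply, Grassmann.proj_apply, map_mul, Grassmann.twist_of_mem hy, mul_zero,
    sgn_zero, one_smul, smul_mul_assoc, add_mul, smul_mul_assoc]

/-- The part of parity `p`. -/
noncomputable def parityPart (p : ZMod 2) (ψ : M.Densities) : M.Densities :=
  ofFamily ψ.2.2.choose (fun i w => mapValues (dom_subset i) (Grassmann.proj p) ((ψ.1 i).coeff w))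
    (fun i w hw => by
      have h1 : (ψ.1 i).coeff w = 0 :=
        Finsupp.notMem_support_iff.1 fun h => hw (ψ.2.2.choose_spec i h)
      rw [h1]
      exact ext' fun x hx => map_zero _)
    (fun i j w x hi hj => by
      change Grassmann.proj p (((ψ.1 j).coeff w).1 ⟨x, hj⟩) = _
      rw [ψ.2.1 i j w x hi hj, proj_mul_even (Grassmann.pow _ w).2]
      congr 1
      have h1 := congrArg (fun g => g.1 ⟨x, hi, hj⟩) (trans_mapValues_proj (M := M) (i := i) (j := j)
        (W := M.dom i ⊓ M.dom j) (fun _ h => h.1) (fun _ h => h.2)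
        (SuperFun.res inf_le_left ((ψ.1 i).coeff w)) p)
      exact h1.symm)

theorem component_parityPart (p : ZMod 2) (ψ : M.Densities) (i : M.Index) (w : ℝ) (x : X) :
    component (parityPart p ψ) i w x = Grassmann.proj p (component ψ i w x) := by
  by_cases hx : x ∈ M.dom i
  · rw [parityPart, component_ofFamily _ _ hx, component_apply _ _ hx]; rfl
  · rw [component_of_notMem _ _ hx, component_of_notMem _ _ hx, map_zero]

theorem hasParity_parityPart (p : ZMod 2) (ψ : M.Densities) : HasParity (parityPart p ψ) p :=
  fun i w x => by rw [component_parityPart]; exact Grassmann.proj_mem _ _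

theorem eq_parityPart_add (ψ : M.Densities) : ψ = parityPart 0 ψ + parityPart 1 ψ :=
  densities_ext fun i w x _ => by
    rw [component_add, component_parityPart, component_parityPart, Grassmann.proj_add_proj]

theorem HasWeight.parityPart {ψ : M.Densities} {w : ℝ} (h : HasWeight ψ w) (p : ZMod 2) :
    HasWeight (parityPart p ψ) w := hasWeight_iff.2 fun i w' hw x _ => by
  rw [component_parityPart, h.component_eq_zero hw, map_zero]

/-- Densities form a supercommutative superalgebra. -/
theorem HasParity.mul {ψ χ : M.Densities} {p q : ZMod 2} (h : HasParity ψ p) (h' : HasParity χ q) :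
    HasParity (ψ * χ) (p + q) := by
  obtain ⟨s, hs⟩ := exists_eq_sum_weightPart ψ
  rw [hs, Finset.sum_mul]
  refine HasParity.sum fun w _ i w' x => ?_
  rw [(hasWeight_weightPart w ψ).component_mul']
  exact Grassmann.mul_mem_part (h.weightPart w i w x) (h' _ _ _)

theorem HasParity.mul_comm {ψ χ : M.Densities} {p q : ZMod 2} (h : HasParity ψ p)
    (h' : HasParity χ q) : ψ * χ = sgn (p * q) • (χ * ψ) := by
  obtain ⟨s, hs⟩ := exists_eq_sum_weightPart ψ
  obtain ⟨t, ht⟩ := exists_eq_sum_weightPart χ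
  rw [hs, ht, Finset.sum_mul_sum, Finset.sum_mul_sum, Finset.sum_comm, Finset.smul_sum]
  refine Finset.sum_congr rfl fun w _ => ?_
  rw [Finset.smul_sum]
  refine Finset.sum_congr rfl fun w' _ => ?_
  have h1 := hasWeight_weightPart w χ
  have h2 := hasWeight_weightPart w' ψ
  refine (h2.mul h1).ext (w := w' + w) ?_ fun i x _ => ?_
  · rw [add_comm]; exact (h1.mul h2).smul _
  · rw [component_smul, h2.component_mul, add_comm, h1.component_mul]
    exact Grassmann.mul_comm_of_mem (h.weightPart w' i w' x) (h'.weightPart w i w x)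

end SuperManifold

/-! ### Construction of densities from local data. -/

namespace SuperManifold

open SuperFun Topology

variable {n m : ℕ} {X : Type u} [TopologicalSpace X] {M : SuperManifold.{u, v} n m X}

/-- The cocycle property gives J = J · J, and J is invertible. -/
theorem jacobian_self (hM : M.PositiveJacobians) {i : M.Index} {x : X} (hx : x ∈ M.dom i) :
    M.jacobian i i x = 1 := by
  have h := dom_subset (M := M) i
  have h1 := jacFun_trans hM h h h
  rw [M.trans_self] at h1
  have h2 := isUnit_of_body_ne_zero h (jacFun hM h h).1 fun z => (body_jacFun_pos hM h h z).ne'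
  have h3 : (jacFun hM h h).1 = 1 := h2.mul_left_cancel (by rw [mul_one, ← h1])
  rw [← evEven_jacFun hM h h ⟨x, hx⟩]
  refine Subtype.ext ?_
  change (jacFun hM h h).1.1 ⟨x, hx⟩ = 1
  rw [h3]
  rfl

/-- The smoothness of x ↦ J^w and the cocycle identity for powers are what is needed for extending a
coefficient from one chart to a density. The identity combines `trans_pow`, `mul_pow'` and the
cocycle of J. -/
theorem exists_jacPow (hM : M.PositiveJacobians) {i j : M.Index} {W : TopologicalSpace.Opens X}
    (hi : (W : Set X) ⊆ (M.chart i).source) (hj : (W : Set X) ⊆ (M.chart j).source) (w : ℝ) :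
    ∃ P : EvenFun m (M.chart j) W,
      (∀ x : W, P.1.1 x = (Grassmann.pow (M.jacobian i j x) w : Grassmann m)) ∧
      ∀ {k : M.Index} (hk : (W : Set X) ⊆ (M.chart k).source) (x : W),
        (M.trans j k W hj hk P.1).1 x * (Grassmann.pow (M.jacobian j k x) w : Grassmann m)
          = (Grassmann.pow (M.jacobian i k x) w : Grassmann m) := by
  obtain ⟨P, hP, hd⟩ := exists_powFun hj (jacFun hM hi hj) (body_jacFun_pos hM hi hj) w
  refine ⟨P, fun x => ?_, fun {k} hk x => ?_⟩
  · rw [← evEven_jacFun hM hi hj, ← hP]; rfl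
  · rw [M.trans_pow hj hk (jacFun hM hi hj) P (body_jacFun_pos hM hi hj) w hP hd]
    have h1 : 0 < Grassmann.body ((M.trans j k W hj hk (jacFun hM hi hj).1).1 x) := by
      rw [M.body_trans]; exact body_jacFun_pos hM hi hj x
    have h2 := Grassmann.mul_pow' (x := ⟨(M.trans j k W hj hk (jacFun hM hi hj).1).1 x,
      M.trans_mem hj hk (jacFun hM hi hj).2 x⟩) (y := M.jacobian j k x) h1
      (hM j k x (hj x.2) (hk x.2)) w
    refine (congrArg Subtype.val h2).symm.trans ?_
    congr 2
    rw [← evEven_jacFun hM hi hk, ← evEven_jacFun hM hj hk]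
    refine Subtype.ext ?_
    exact (congrArg (fun f => f.1 x) (jacFun_trans hM hi hj hk)).symm

/-- A compactly supported density given by its coefficient in a chart. -/
theorem exists_ofChart [T2Space X] (hM : M.PositiveJacobians) (i : M.Index) (w : ℝ)
    {f : X → Grassmann m} {K : Set X} (hK : IsCompact K) (hKi : K ⊆ M.dom i)
    (hf : ∀ x ∈ M.dom i, SuperSmoothAt (M.chart i) f x) (hfK : ∀ x ∉ K, f x = 0) :
    ∃ χ : M.Densities, HasWeight χ w ∧ VanishesOutside χ K ∧ (∀ x, component χ i w x = f x) ∧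
      ∀ p, (∀ x, f x ∈ Grassmann.part m p) → HasParity χ p := by
  classical
  have hi : ∀ j, ((M.dom i ⊓ M.dom j : TopologicalSpace.Opens X) : Set X) ⊆ (M.chart i).source :=
    fun j _ h => h.1
  have hj : ∀ j, ((M.dom i ⊓ M.dom j : TopologicalSpace.Opens X) : Set X) ⊆ (M.chart j).source :=
    fun j _ h => h.2
  let F : ∀ W : TopologicalSpace.Opens X, (W : Set X) ⊆ (M.chart i).source →
    SuperFun m (M.chart i) W := fun W hW => ofSmooth hW f fun x hx => hf x (hW hx)
  have hF : ∀ W hW {x : X}, x ∈ W → extendZero (F W hW).1 =ᶠ[𝓝 x] f := fun W hW x hx =>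
    extendZero_eventuallyEq hx fun _ => rfl
  -- In the j-th chart the coefficient is transported on the overlap with the i-th chart and is zero
  -- elsewhere. It is smooth across the boundary of the overlap because its support lies in K, which
  -- is closed in the Hausdorff space.
  let g : M.Index → X → Grassmann m := fun j x => if h : x ∈ M.dom i ⊓ M.dom j then
    (M.trans i j _ (hi j) (hj j) (F _ (hi j))).1 ⟨x, h⟩
      * (Grassmann.pow (M.jacobian i j x) w : Grassmann m) else 0
  have hKo : ∀ x ∉ K, ∀ᶠ z in 𝓝 x, z ∉ K := fun x hx => hK.isClosed.isOpen_compl.mem_nhds hx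
  have hf0 : ∀ x ∉ K, f =ᶠ[𝓝 x] 0 := fun x hx => (hKo x hx).mono fun z hz => hfK z hz
  have hgK : ∀ j, ∀ x ∉ K, g j x = 0 := by
    intro j x hx
    by_cases h : x ∈ M.dom i ⊓ M.dom j
    · simp only [g, dif_pos h]
      rw [M.trans_eq_zero _ _ h ((hF _ _ h).trans (hf0 x hx)), zero_mul]
    · exact dif_neg h
  have hg : ∀ j {W : TopologicalSpace.Opens X} (hWi : (W : Set X) ⊆ (M.chart i).source)
      (hWj : (W : Set X) ⊆ (M.chart j).source) {x : X} (hx : x ∈ W), g j x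
        = (M.trans i j W hWi hWj (F W hWi)).1 ⟨x, hx⟩
          * (Grassmann.pow (M.jacobian i j x) w : Grassmann m) := by
    intro j W hWi hWj x hx
    have h : x ∈ M.dom i ⊓ M.dom j := ⟨hWi hx, hWj hx⟩
    simp only [g, dif_pos h]
    rw [M.trans_congr _ _ hWi hWj h hx ((hF _ _ h).trans (hF _ _ hx).symm)]
  have hsm : ∀ j, ∀ x ∈ M.dom j, SuperSmoothAt (M.chart j) (g j) x := by
    intro j x hx
    by_cases h : x ∈ M.dom i
    · obtain ⟨P, hP, -⟩ := exists_jacPow hM (hi j) (hj j) w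
      refine smoothAt_congr hx (smooth (hj j) (M.trans i j _ (hi j) (hj j) (F _ (hi j)) * P.1)
        (x := x) ⟨h, hx⟩) (extendZero_eventuallyEq ⟨h, hx⟩ fun y => ?_)
      rw [hg j (hi j) (hj j) y.2, ← hP]
      rfl
    · have h1 : (fun _ => 0) =ᶠ[𝓝 x] g j :=
        (hKo x fun hn => h (hKi hn)).mono fun z hz => (hgK j z hz).symm
      exact smoothAt_congr hx (superSmoothAt_const 0 x) h1
  let G : ∀ j, M.Fn j := fun j => ofSmooth (dom_subset j) (g j) (hsm j)
  have hGext : ∀ j {x : X}, x ∈ M.dom j → extendZero (G j).1 =ᶠ[𝓝 x] g j := fun j x hx =>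
    extendZero_eventuallyEq hx fun _ => rfl
  have hres : ∀ j k {x : X} (hx : x ∈ M.dom j ⊓ M.dom k), extendZero (SuperFun.res
      (inf_le_left : M.dom j ⊓ M.dom k ≤ M.dom j) (G j)).1 =ᶠ[𝓝 x] g j := fun j k x hx =>
    extendZero_eventuallyEq hx fun _ => rfl
  have hcomp : ∀ j k x (hxj : x ∈ M.dom j) (hxk : x ∈ M.dom k), g k x =
      (M.change j k (SuperFun.res inf_le_left (G j))).1 ⟨x, hxj, hxk⟩ *
        (Grassmann.pow (M.jacobian j k x) w : Grassmann m) := by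
    intro j k x hxj hxk
    by_cases h : x ∈ M.dom i
    · let W : TopologicalSpace.Opens X := M.dom i ⊓ M.dom j ⊓ M.dom k
      have hWi : (W : Set X) ⊆ (M.chart i).source := fun _ h => h.1.1
      have hWj : (W : Set X) ⊆ (M.chart j).source := fun _ h => h.1.2
      have hWk : (W : Set X) ⊆ (M.chart k).source := fun _ h => h.2
      have hxW : x ∈ W := ⟨⟨h, hxj⟩, hxk⟩
      obtain ⟨P, hP, hP2⟩ := exists_jacPow hM hWi hWj w
      have h1 : extendZero (M.trans i j W hWi hWj (F W hWi) * P.1).1 =ᶠ[𝓝 x] g j :=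
        extendZero_eventuallyEq hxW fun y => by
          rw [hg j hWi hWj y.2, ← hP]; rfl
      have h2 : (M.change j k (SuperFun.res inf_le_left (G j))).1 ⟨x, hxj, hxk⟩
          = (M.trans j k W hWj hWk (M.trans i j W hWi hWj (F W hWi) * P.1)).1 ⟨x, hxW⟩ :=
        M.trans_congr (W := M.dom j ⊓ M.dom k) (fun _ h => h.1) (fun _ h => h.2) hWj hWk ⟨hxj, hxk⟩
          hxW ((hres j k ⟨hxj, hxk⟩).trans h1.symm)
      rw [h2, map_mul,
        M.trans_trans, hg k hWi hWk hxW, ← hP2 hWk ⟨x, hxW⟩, ← mul_assoc]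
      rfl
    · have hxK : x ∉ K := fun hn => h (hKi hn)
      have h2 : (M.change j k (SuperFun.res inf_le_left (G j))).1 ⟨x, hxj, hxk⟩ = 0 :=
        M.trans_eq_zero (W := M.dom j ⊓ M.dom k) (fun _ h => h.1) (fun _ h => h.2) ⟨hxj, hxk⟩
          ((hres j k ⟨hxj, hxk⟩).trans ((hKo x hxK).mono fun z hz => hgK j z hz))
      rw [hgK k x hxK, h2, zero_mul]
  let χ : M.Densities := ofFamily {w} (fun j w' => if w' = w then G j else 0)
    (fun j w' hw => if_neg (by simpa using hw)) (fun j k w' x hxj hxk => by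
      by_cases hw : w' = w
      · simp only [if_pos hw]; rw [hw]; exact hcomp j k x hxj hxk
      · simp only [if_neg hw, map_zero]; exact (zero_mul _).symm)
  have hχ : ∀ j, ∀ x ∈ M.dom j, component χ j w x = g j x := fun j x hx => by
    rw [component_ofFamily _ _ hx, if_pos rfl]; rfl
  have hχw : HasWeight χ w := hasWeight_iff.2 fun j w' hw x hx => by
    rw [component_ofFamily _ _ hx, if_neg hw]; rfl
  refine ⟨χ, hχw, fun j w' x hx => ?_, fun x => ?_, fun p hp j w' x => ?_⟩
  · by_cases hxj : x ∈ M.dom j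
    · by_cases hw : w' = w
      · rw [hw, hχ j x hxj, hgK j x hx]
      · exact hχw.component_eq_zero hw j x
    · exact component_of_notMem _ _ hxj
  · by_cases hx : x ∈ M.dom i
    · rw [hχ i x hx, hg i (dom_subset i) (dom_subset i) hx, M.trans_self, jacobian_self hM hx,
        Grassmann.one_pow']
      exact mul_one _
    · rw [component_of_notMem _ _ hx, hfK x fun h => hx (hKi h)]
  · by_cases hxj : x ∈ M.dom j
    · by_cases hw : w' = w
      · rw [hw, hχ j x hxj]
        by_cases h : x ∈ M.dom i ⊓ M.dom j
        · rw [hg j (hi j) (hj j) h, ← add_zero p]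
          exact Grassmann.mul_mem_part (M.trans_mem _ _ (fun z => hp z.1) _) (Grassmann.pow _ w).2
        · simp only [g, dif_neg h]; exact Submodule.zero_mem _
      · rw [hχw.component_eq_zero hw j x]; exact Submodule.zero_mem _
    · rw [component_of_notMem _ _ hxj]; exact Submodule.zero_mem _

/-- Bump functions. -/
theorem exists_bump [T2Space X] {i : M.Index} {x : X} (hx : x ∈ M.dom i)
    {U : Set X} (hU : U ∈ 𝓝 x) : ∃ (b : X → ℝ) (K : Set X), IsCompact K ∧ K ⊆ M.dom i ∧ K ⊆ U ∧
      (∀ z ∉ K, b z = 0) ∧ (∀ᶠ z in 𝓝 x, b z = 1) ∧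
      ∀ z ∈ M.dom i, SuperSmoothAt (M.chart i) (fun z => algebraMap ℝ (Grassmann m) (b z)) z := by
  let c := M.chart i
  have hV : c.target ∩ c.symm ⁻¹' (interior U) ∈ 𝓝 (c x) :=
    (c.isOpen_inter_preimage_symm isOpen_interior).mem_nhds ⟨c.map_source hx, by
      rw [Set.mem_preimage, c.left_inv hx]; exact mem_interior_iff_mem_nhds.2 hU⟩
  obtain ⟨r, hr, hrV⟩ := Metric.nhds_basis_closedBall.mem_iff.1 hV
  let β : ContDiffBump (c x) := ⟨r / 2, r, by linarith, by linarith⟩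
  have hKc : IsCompact (c.symm '' Metric.closedBall (c x) r) :=
    (isCompact_closedBall _ _).image_of_continuousOn
      (c.continuousOn_symm.mono fun y hy => (hrV hy).1)
  have hKi : c.symm '' Metric.closedBall (c x) r ⊆ M.dom i := by
    rintro _ ⟨y, hy, rfl⟩; exact c.map_target (hrV hy).1
  classical
  let b : X → ℝ := fun z => if z ∈ c.source then β (c z) else 0
  have hb0 : ∀ z ∉ c.symm '' Metric.closedBall (c x) r, b z = 0 := by
    intro z hz
    by_cases hzs : z ∈ c.source
    · simp only [b, if_pos hzs]
      refine β.zero_of_le_dist ?_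
      by_contra hlt
      exact hz ⟨c z, Metric.mem_closedBall.2 (not_le.1 hlt).le, c.left_inv hzs⟩
    · exact if_neg hzs
  refine ⟨b, _, hKc, hKi, ?_, hb0, ?_, fun z hz => ?_⟩
  · rintro _ ⟨y, hy, rfl⟩; exact interior_subset (hrV hy).2
  · have h1 := (c.continuousAt hx).eventually β.eventuallyEq_one
    filter_upwards [h1, c.open_source.mem_nhds hx] with z hz hzs
    simp only [b, if_pos hzs]
    exact hz
  · refine smoothAt_congr hz (superSmoothAt_scalarFn (h := β) hz β.contDiff.contDiffAt) ?_
    filter_upwards [c.open_source.mem_nhds hz] with y hy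
    simp only [b, if_pos hy]
    rfl

/-- Densities of weight zero that are equal to one near a point. -/
theorem exists_bump_density [T2Space X] (hM : M.PositiveJacobians) {i : M.Index} {x : X}
    (hx : x ∈ M.dom i) {U : Set X} (hU : U ∈ 𝓝 x) :
    ∃ (ρ : M.Densities) (K : Set X), IsCompact K ∧ K ⊆ M.dom i ∧ K ⊆ U ∧ VanishesOutside ρ K ∧
      HasWeight ρ 0 ∧ HasParity ρ 0 ∧ ∀ᶠ z in 𝓝 x, component ρ i 0 z = 1 := by
  obtain ⟨b, K, hK, hKi, hKU, hb0, hb1, hbs⟩ := exists_bump (M := M) hx hU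
  obtain ⟨ρ, hρw, hρK, hρ, hρp⟩ := exists_ofChart hM i 0 hK hKi hbs
    (fun z hz => by rw [hb0 z hz, map_zero])
  refine ⟨ρ, K, hK, hKi, hKU, hρK, hρw, hρp 0 fun z => Grassmann.algebraMap_mem_part _, ?_⟩
  filter_upwards [hb1] with z hz
  rw [hρ, hz, map_one]

/-- Densities with a given coefficient near a point. -/
theorem exists_density_eventuallyEq [T2Space X] (hM : M.PositiveJacobians) {i : M.Index} {x : X}
    (hx : x ∈ M.dom i) (w : ℝ) {f : X → Grassmann m}
    (hf : ∀ z ∈ M.dom i, SuperSmoothAt (M.chart i) f z) {U : Set X} (hU : U ∈ 𝓝 x) :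
    ∃ (χ : M.Densities) (K : Set X), IsCompact K ∧ K ⊆ M.dom i ∧ K ⊆ U ∧ VanishesOutside χ K ∧
      HasWeight χ w ∧ component χ i w =ᶠ[𝓝 x] f ∧
      ∀ p, (∀ z, f z ∈ Grassmann.part m p) → HasParity χ p := by
  obtain ⟨b, K, hK, hKi, hKU, hb0, hb1, hbs⟩ := exists_bump (M := M) hx hU
  obtain ⟨ρ, hρw, hρK, hρ, hρp⟩ := exists_ofChart hM i w (f := fun z => algebraMap ℝ _ (b z) * f z)
    hK hKi (fun z hz => (hbs z hz).mul (hf z hz))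
    (fun z hz => by rw [hb0 z hz, map_zero, zero_mul])
  refine ⟨ρ, K, hK, hKi, hKU, hρK, hρw, ?_, fun p hp => hρp p fun z => ?_⟩
  · filter_upwards [hb1] with z hz
    rw [hρ, hz, map_one, one_mul]
  · rw [← Algebra.smul_def]; exact Submodule.smul_mem _ _ (hp z)

end SuperManifold

/-! ### The Berezin integral in a chart -/

section

open Topology MeasureTheory

variable {n m : ℕ} {X : Type u} [TopologicalSpace X] {c : OpenPartialHomeomorph X (Fin n → ℝ)}

/-- Smooth Grassmann-valued functions with compact support in the domain of a chart. -/
structure CompactSmooth (c : OpenPartialHomeomorph X (Fin n → ℝ)) (f : X → Grassmann m) : Prop where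
  smooth : ∀ x ∈ c.source, SuperSmoothAt c f x
  exists_support : ∃ K, IsCompact K ∧ K ⊆ c.source ∧ ∀ x ∉ K, f x = 0

/-- The Berezin integral in the chart `c`. -/
noncomputable def chartInt (c : OpenPartialHomeomorph X (Fin n → ℝ)) (f : X → Grassmann m) : ℝ :=
  ∫ y in c.target, Grassmann.top (f (c.symm y))

theorem SuperSmoothAt.add {f g : X → Grassmann m} {x : X} (hf : SuperSmoothAt c f x)
    (hg : SuperSmoothAt c g x) : SuperSmoothAt c (fun z => f z + g z) x := fun I => by
  simp only [map_add]; exact (hf I).add (hg I)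

theorem SuperSmoothAt.mapLinear {f : X → Grassmann m} {x : X} (hf : SuperSmoothAt c f x)
    (T : Grassmann m →ₗ[ℝ] Grassmann m) : SuperSmoothAt c (fun z => T (f z)) x :=
  Grassmann.SmoothAt.map hf T

namespace CompactSmooth

variable {f g : X → Grassmann m}

theorem add (hf : CompactSmooth c f) (hg : CompactSmooth c g) :
    CompactSmooth c (fun x => f x + g x) := by
  obtain ⟨K, hK, hKs, hK0⟩ := hf.exists_support
  obtain ⟨L, hL, hLs, hL0⟩ := hg.exists_support
  refine ⟨fun x hx => (hf.smooth x hx).add (hg.smooth x hx), K ∪ L, hK.union hL,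
    Set.union_subset hKs hLs, fun x hx => ?_⟩
  rw [hK0 x fun h => hx (Or.inl h), hL0 x fun h => hx (Or.inr h), add_zero]

theorem mapLinear (hf : CompactSmooth c f) (T : Grassmann m →ₗ[ℝ] Grassmann m) :
    CompactSmooth c (fun x => T (f x)) := by
  obtain ⟨K, hK, hKs, hK0⟩ := hf.exists_support
  exact ⟨fun x hx => (hf.smooth x hx).mapLinear T, K, hK, hKs, fun x hx => by
    rw [hK0 x hx, map_zero]⟩

theorem const_zero : CompactSmooth c (fun _ => (0 : Grassmann m)) :=
  ⟨fun x _ => superSmoothAt_const 0 x, ∅, isCompact_empty, Set.empty_subset _, fun _ _ => rfl⟩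

theorem sum {ι : Type*} (s : Finset ι) {f : ι → X → Grassmann m}
    (hf : ∀ k ∈ s, CompactSmooth c (f k)) : CompactSmooth c (fun x => ∑ k ∈ s, f k x) := by
  classical
  induction s using Finset.induction_on with
  | empty => simpa using const_zero
  | insert a s ha ih =>
    simp only [Finset.sum_insert ha]
    exact (hf a (Finset.mem_insert_self _ _)).add
      (ih fun k hk => hf k (Finset.mem_insert_of_mem hk))

/-- The image of the compact support is closed in the whole of ℝⁿ, so extension by zero from the
chart target stays smooth. Integration theory on ℝⁿ then applies. -/
theorem contDiff_indicator [T2Space X] (hf : CompactSmooth c f) (T : Grassmann m →ₗ[ℝ] ℝ) :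
    ContDiff ℝ ∞ (c.target.indicator fun y => T (f (c.symm y))) ∧
      HasCompactSupport (c.target.indicator fun y => T (f (c.symm y))) := by
  obtain ⟨K, hK, hKs, hK0⟩ := hf.exists_support
  have hL : IsCompact (c '' K) := hK.image_of_continuousOn (c.continuousOn.mono hKs)
  have h0 : ∀ y ∉ c '' K, c.target.indicator (fun y => T (f (c.symm y))) y = 0 := by
    intro y hy
    by_cases hyt : y ∈ c.target
    · rw [Set.indicator_of_mem hyt, hK0, map_zero]
      exact fun h => hy ⟨_, h, c.right_inv hyt⟩
    · exact Set.indicator_of_notMem hyt _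
  refine ⟨contDiff_iff_contDiffAt.2 fun y => ?_, HasCompactSupport.intro hL h0⟩
  by_cases hyt : y ∈ c.target
  · have h1 := (hf.smooth _ (c.map_target hyt)).linear T
    rw [c.right_inv hyt] at h1
    refine h1.congr_of_eventuallyEq ?_
    filter_upwards [c.open_target.mem_nhds hyt] with z hz
    rw [Set.indicator_of_mem hz]
  · refine contDiffAt_const (c := (0 : ℝ)) |>.congr_of_eventuallyEq ?_
    have hy : y ∉ c '' K := by
      rintro ⟨x, hx, rfl⟩; exact hyt (c.map_source (hKs hx))
    filter_upwards [hL.isClosed.isOpen_compl.mem_nhds hy] with z hz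
    exact h0 z hz

theorem integrableOn [T2Space X] (hf : CompactSmooth c f) :
    IntegrableOn (fun y => Grassmann.top (f (c.symm y))) c.target := by
  obtain ⟨h1, h2⟩ := hf.contDiff_indicator (Grassmann.coeff Finset.univ)
  exact (integrable_indicator_iff c.open_target.measurableSet).1
    (h1.continuous.integrable_of_hasCompactSupport h2)

theorem chartInt_add [T2Space X] (hf : CompactSmooth c f) (hg : CompactSmooth c g) :
    chartInt c (fun x => f x + g x) = chartInt c f + chartInt c g := by
  rw [chartInt, chartInt, chartInt, ← integral_add hf.integrableOn hg.integrableOn]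
  exact integral_congr_ae (Filter.Eventually.of_forall fun y => map_add (Grassmann.coeff _) _ _)

theorem chartInt_sum [T2Space X] {ι : Type*} (s : Finset ι) {f : ι → X → Grassmann m}
    (hf : ∀ k ∈ s, CompactSmooth c (f k)) :
    chartInt c (fun x => ∑ k ∈ s, f k x) = ∑ k ∈ s, chartInt c (f k) := by
  simp only [chartInt]
  rw [← integral_finsetSum _ fun k hk => (hf k hk).integrableOn]
  exact integral_congr_ae (Filter.Eventually.of_forall fun y => map_sum (Grassmann.coeff _) _ _)

theorem chartInt_smul (r : ℝ) (f : X → Grassmann m) :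
    chartInt c (fun x => r • f x) = r * chartInt c f := by
  rw [chartInt, chartInt, ← integral_const_mul]
  exact integral_congr_ae (Filter.Eventually.of_forall fun y => map_smul (Grassmann.coeff _) _ _)

/-- Integration by parts. -/
theorem chartInt_superDeriv [T2Space X] (hf : CompactSmooth c f) (A : Fin n ⊕ Fin m) :
    chartInt c (_root_.superDeriv c A f) = 0 := by
  rcases A with a | α
  · obtain ⟨h1, h2⟩ := hf.contDiff_indicator (Grassmann.coeff Finset.univ)
    set G := c.target.indicator fun y => Grassmann.coeff Finset.univ (f (c.symm y)) with hG
    have h3 : chartInt c (_root_.superDeriv c (Sum.inl a) f)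
        = ∫ y in c.target, fderiv ℝ G y (Pi.single a 1) := by
      refine setIntegral_congr_fun c.open_target.measurableSet fun y hy => ?_
      change Grassmann.coeff Finset.univ _ = _
      have hs := hf.smooth _ (c.map_target hy)
      rw [superDeriv_inl, Grassmann.linear_pd hs, c.right_inv hy]
      congr 1
      refine Filter.EventuallyEq.fderiv_eq ?_
      filter_upwards [c.open_target.mem_nhds hy] with z hz
      rw [hG, Set.indicator_of_mem hz]
    have h4 : ∫ y in c.target, fderiv ℝ G y (Pi.single a 1) = ∫ y, fderiv ℝ G y (Pi.single a 1) := by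
      obtain ⟨K, hK, hKs, hK0⟩ := hf.exists_support
      have hL : IsCompact (c '' K) := hK.image_of_continuousOn (c.continuousOn.mono hKs)
      refine setIntegral_eq_integral_of_forall_compl_eq_zero fun y hy => ?_
      have hy' : y ∉ c '' K := by
        rintro ⟨x, hx, rfl⟩; exact hy (c.map_source (hKs hx))
      have h5 : G =ᶠ[𝓝 y] fun _ => 0 := by
        filter_upwards [hL.isClosed.isOpen_compl.mem_nhds hy'] with z hz
        by_cases hzt : z ∈ c.target
        · rw [hG, Set.indicator_of_mem hzt, hK0, map_zero]
          exact fun h => hz ⟨_, h, c.right_inv hzt⟩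
        · exact Set.indicator_of_notMem hzt _
      rw [h5.fderiv_eq]
      simp
    have h6 : Continuous fun y => fderiv ℝ G y (Pi.single a 1) :=
      (h1.continuous_fderiv (by simp)).clm_apply continuous_const
    have h7 : HasCompactSupport fun y => fderiv ℝ G y (Pi.single a 1) :=
      (h2.fderiv ℝ).comp_left (g := fun L : (Fin n → ℝ) →L[ℝ] ℝ => L (Pi.single a 1)) rfl
    -- Integration by parts against the constant function 1 shows that the integral of a partial
    -- derivative vanishes.
    have h8 := integral_mul_fderiv_eq_neg_fderiv_mul_of_integrable (μ := volume) (𝕜 := ℝ)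
      (f := fun _ : Fin n → ℝ => (1 : ℝ)) (g := G) (v := Pi.single a 1) (by simp)
      (by simpa using h6.integrable_of_hasCompactSupport h7)
      (by simpa using h1.continuous.integrable_of_hasCompactSupport h2)
      (fun _ _ => differentiableAt_const _) (fun y _ => h1.contDiffAt.differentiableAt (by simp))
    rw [h3, h4]
    simpa using h8
  · rw [chartInt]
    refine integral_eq_zero_of_ae (Filter.Eventually.of_forall fun y => ?_)
    exact Grassmann.top_oddDeriv α _

end CompactSmooth

/-- Superfunctions on an open set which vanish outside a compact subset. -/
theorem compactSmooth_extendZero [T2Space X] {W : TopologicalSpace.Opens X}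
    (hW : (W : Set X) ⊆ c.source) {f : W → Grassmann m} (hf : f ∈ SuperFun m c W) {K : Set X}
    (hK : IsCompact K) (hKW : K ⊆ W) (h0 : ∀ x : W, x.1 ∉ K → f x = 0) :
    CompactSmooth c (extendZero f) := by
  have h1 : ∀ x ∉ K, extendZero f x = 0 := fun x hx => by
    by_cases hxW : x ∈ W
    · rw [SuperFun.extendZero_of_mem _ hxW, h0 _ hx]
    · rw [SuperFun.extendZero_of_notMem _ hxW]
  refine ⟨fun x hx => ?_, K, hK, hKW.trans hW, h1⟩
  by_cases hxW : x ∈ W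
  · exact (SuperFun.mem_iff hW).1 hf ⟨x, hxW⟩
  · refine SuperFun.smoothAt_congr hx (superSmoothAt_const 0 x) ?_
    filter_upwards [hK.isClosed.isOpen_compl.mem_nhds fun h => hxW (hKW h)] with z hz
    rw [h1 z hz]

theorem chartInt_congr {f g : X → Grassmann m} (h : ∀ x ∈ c.source, f x = g x) :
    chartInt c f = chartInt c g :=
  MeasureTheory.setIntegral_congr_fun c.open_target.measurableSet fun y hy => by
    simp only [h _ (c.map_target hy)]

/-- Integration by parts for superfunctions with compact support. -/
theorem chartInt_D [T2Space X] {W : TopologicalSpace.Opens X} (hW : (W : Set X) ⊆ c.source)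
    (f : SuperFun m c W) {K : Set X} (hK : IsCompact K) (hKW : K ⊆ W)
    (h0 : ∀ x : W, x.1 ∉ K → f.1 x = 0) (A : Fin n ⊕ Fin m) :
    chartInt c (extendZero (SuperFun.D hW A f).1) = 0 := by
  have h1 := compactSmooth_extendZero hW f.2 hK hKW h0
  rw [← h1.chartInt_superDeriv A]
  refine chartInt_congr fun x hx => ?_
  by_cases hxW : x ∈ W
  · rw [SuperFun.extendZero_of_mem _ hxW]; rfl
  · rw [SuperFun.extendZero_of_notMem _ hxW]
    have h2 : extendZero f.1 =ᶠ[𝓝 x] fun _ => 0 := by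
      filter_upwards [hK.isClosed.isOpen_compl.mem_nhds fun h => hxW (hKW h)] with z hz
      by_cases hzW : z ∈ W
      · rw [SuperFun.extendZero_of_mem _ hzW, h0 ⟨z, hzW⟩ hz]
      · rw [SuperFun.extendZero_of_notMem _ hzW]
    rw [superDeriv_congr hx h2]
    rcases A with a | α
    · refine Grassmann.ext_coeff fun I => ?_
      rw [superDeriv_inl, Grassmann.coeff_pd]
      simp
    · exact (map_zero (Grassmann.oddDeriv α)).symm

end

/-! ### Piola's identity. -/

namespace SuperManifold

open SuperFun Topology

variable {n m : ℕ} {X : Type u} [TopologicalSpace X] {M : SuperManifold.{u, v} n m X}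

section

variable {i j : M.Index} {W : TopologicalSpace.Opens X} (hi : (W : Set X) ⊆ (M.chart i).source)
  (hj : (W : Set X) ⊆ (M.chart j).source)

/-- This is the super version of ∂(K) = −K (∂M) K for K = M⁻¹: differentiate K M = 1 and multiply by
K on the right. The sign comes from carrying ∂_B past the entry of K. -/
theorem D_jacInv (A B C : Fin n ⊕ Fin m) : D hj B (M.jacInv hi hj A C)
    = -∑ E, sgn (coordParity B * (coordParity A + coordParity E)) •
      (M.jacInv hi hj A E * ((M.jac hi hj).map (D hj B) * M.jacInv hi hj) E C) := by
  have h1 : ∀ F, ∑ E, D hj B (M.jacInv hi hj A E) * M.jac hi hj E F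
      + ∑ E, sgn (coordParity B * (coordParity A + coordParity E)) •
        (M.jacInv hi hj A E * D hj B (M.jac hi hj E F)) = 0 := by
    intro F
    have h2 := congrArg (D hj B) (congrFun (congrFun (M.jacInv_mul_jac hi hj) A) F)
    rw [Matrix.mul_apply, map_sum] at h2
    rw [← Finset.sum_add_distrib]
    refine Eq.trans (Finset.sum_congr rfl fun E _ =>
      ((isSuperderivation_D hj B).mul _ (M.jacInv_isEvenSuper hi hj A E)).symm) (h2.trans ?_)
    have h3 : D hj B (1 : SuperFun m (M.chart j) W) = 0 := by
      simpa using (isSuperderivation_D hj B).mul (1 : SuperFun m (M.chart j) W)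
        (isSupercommutative (m := m) (c := M.chart j) (W := W)).one_mem
    by_cases h : A = F
    · rw [h, Matrix.one_apply_eq, h3]
    · rw [Matrix.one_apply_ne h, map_zero]
  have h4 : D hj B (M.jacInv hi hj A C) = ∑ F, (∑ E, D hj B (M.jacInv hi hj A E) *
      M.jac hi hj E F) * M.jacInv hi hj F C := by
    have h5 : ∀ E, ∑ F, D hj B (M.jacInv hi hj A E) * M.jac hi hj E F * M.jacInv hi hj F C
        = D hj B (M.jacInv hi hj A E) * (1 : Matrix (Fin n ⊕ Fin m) (Fin n ⊕ Fin m) _) E C := by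
      intro E
      rw [← M.jac_mul_jacInv hi hj, Matrix.mul_apply, Finset.mul_sum]
      simp only [mul_assoc]
    simp only [Finset.sum_mul]
    rw [Finset.sum_comm, Finset.sum_congr rfl fun E _ => h5 E]
    simp [Matrix.one_apply]
  rw [h4, eq_neg_iff_add_eq_zero]
  simp only [Matrix.mul_apply, Finset.mul_sum, Finset.smul_sum]
  rw [Finset.sum_comm (γ := Fin n ⊕ Fin m), ← Finset.sum_add_distrib]
  refine Finset.sum_eq_zero fun F _ => ?_
  have h6 : ∑ E, sgn (coordParity B * (coordParity A + coordParity E)) •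
      (M.jacInv hi hj A E * (D hj B (M.jac hi hj E F) * M.jacInv hi hj F C))
      = (∑ E, sgn (coordParity B * (coordParity A + coordParity E)) •
        (M.jacInv hi hj A E * D hj B (M.jac hi hj E F))) * M.jacInv hi hj F C := by
    rw [Finset.sum_mul]
    refine Finset.sum_congr rfl fun E _ => ?_
    rw [smul_mul_assoc, mul_assoc]
  refine Eq.trans (congrArg₂ (· + ·) rfl h6) ?_
  rw [← add_mul, h1 F, zero_mul]

/-- The super version of Piola's identity. -/
theorem piola (hM : M.PositiveJacobians) (A : Fin n ⊕ Fin m) :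
    ∑ B, sgn (coordParity B * (coordParity A + coordParity B)) •
      D hj B ((jacFun hM hi hj).1 * M.jacInv hi hj A B) = 0 := by
  set J := jacFun hM hi hj
  set S : Fin n ⊕ Fin m → SuperFun m (M.chart j) W := fun B =>
    ((M.jac hi hj).map (D hj B) * M.jacInv hi hj).supertrace coordParity with hS
  have hSp : ∀ B, S B ∈ SuperFun.part m (M.chart j) W (coordParity B) := by
    intro B
    refine Submodule.sum_mem _ fun C _ => Submodule.smul_mem _ _ ?_
    rw [Matrix.mul_apply]
    refine Submodule.sum_mem _ fun E _ => ?_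
    have h1 := isSupercommutative.mul_mem (D_mem hj B (M.jac_isEvenSuper hi hj C E))
      (M.jacInv_isEvenSuper hi hj E C)
    have h2 : coordParity C + coordParity E + coordParity B + (coordParity E + coordParity C)
        = coordParity B := by
      generalize coordParity C = p; generalize coordParity E = q; generalize coordParity B = r
      clear * -; revert p q r; decide
    rw [h2] at h1
    exact h1
  have hDJ : ∀ B, D hj B (J.1 * M.jacInv hi hj A B)
      = J.1 * (S B * M.jacInv hi hj A B) + J.1 * D hj B (M.jacInv hi hj A B) := by
    intro B
    rw [(isSuperderivation_D hj B).mul _ J.2, mul_zero, sgn_zero, one_smul, D_jacFun, mul_assoc]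
  -- Entries of the Jacobi matrix are first derivatives of the same coordinates, so their
  -- derivatives are second derivatives and symmetric up to sign.
  have hsymm : ∀ B E F, D hj B (M.jac hi hj E F)
      = sgn (coordParity B * coordParity E) • D hj E (M.jac hi hj B F) := fun B E F => by
    rw [M.jac_apply, D_comm]; rfl
  -- By this symmetry the divergence of a row of the inverse matrix becomes a supertrace of ∂M ·
  -- M⁻¹, which cancels against the logarithmic derivative of J.
  have h1 : ∑ B, sgn (coordParity B * (coordParity A + coordParity B)) •
      D hj B (M.jacInv hi hj A B) = -∑ E, M.jacInv hi hj A E * S E := by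
    simp only [D_jacInv hi hj, smul_neg, Finset.sum_neg_distrib]
    congr 1
    simp only [Finset.smul_sum, smul_smul]
    rw [Finset.sum_comm]
    refine Finset.sum_congr rfl fun E _ => ?_
    simp only [hS]
    unfold Matrix.supertrace
    rw [Finset.mul_sum]
    refine Finset.sum_congr rfl fun B _ => ?_
    rw [Matrix.mul_apply, Matrix.mul_apply, mul_smul_comm, Finset.mul_sum, Finset.mul_sum,
      Finset.smul_sum, Finset.smul_sum]
    refine Finset.sum_congr rfl fun F _ => ?_
    rw [Matrix.map_apply, Matrix.map_apply, hsymm B E F, smul_mul_assoc, mul_smul_comm, smul_smul,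
      ← sgn_add, ← sgn_add]
    congr 2
    generalize coordParity A = p; generalize coordParity E = q; generalize coordParity B = r
    clear * -; revert p q r; decide
  have h2 : ∀ B, sgn (coordParity B * (coordParity A + coordParity B)) •
      (S B * M.jacInv hi hj A B) = M.jacInv hi hj A B * S B := fun B => by
    rw [isSupercommutative.comm (M.jacInv_isEvenSuper hi hj A B) (hSp B), mul_comm (coordParity B)]
  calc _ = J.1 * (∑ B, sgn (coordParity B * (coordParity A + coordParity B)) •
        (S B * M.jacInv hi hj A B) + ∑ B, sgn (coordParity B * (coordParity A + coordParity B)) •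
        D hj B (M.jacInv hi hj A B)) := by
        rw [← Finset.sum_add_distrib, Finset.mul_sum]
        refine Finset.sum_congr rfl fun B _ => ?_
        rw [hDJ, ← smul_add, mul_smul_comm, ← mul_add]
    _ = 0 := by
        rw [h1, Finset.sum_congr rfl fun B _ => h2 B, add_neg_cancel, mul_zero]

/-- The transformed derivative times the Jacobian is a divergence. -/
theorem trans_D_mul_jac (hM : M.PositiveJacobians) (A : Fin n ⊕ Fin m)
    (h : SuperFun m (M.chart i) W) :
    M.trans i j W hi hj (D hi A h) * (jacFun hM hi hj).1
      = ∑ B, sgn (coordParity B * (coordParity A + coordParity B)) •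
        D hj B ((jacFun hM hi hj).1 * M.jacInv hi hj A B * M.trans i j W hi hj h) := by
  have h1 : ∀ B, D hj B ((jacFun hM hi hj).1 * M.jacInv hi hj A B * M.trans i j W hi hj h)
      = D hj B ((jacFun hM hi hj).1 * M.jacInv hi hj A B) * M.trans i j W hi hj h
        + sgn (coordParity B * (coordParity A + coordParity B)) •
          ((jacFun hM hi hj).1 * M.jacInv hi hj A B * D hj B (M.trans i j W hi hj h)) := by
    intro B
    have h2 := isSupercommutative.mul_mem (jacFun hM hi hj).2 (M.jacInv_isEvenSuper hi hj A B)
    rw [zero_add] at h2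
    exact (isSuperderivation_D hj B).mul _ h2
  have h3 : M.trans i j W hi hj (D hi A h)
      = ∑ B, M.jacInv hi hj A B * D hj B (M.trans i j W hi hj h) := by
    simp only [M.D_trans hi hj _ h, Finset.mul_sum, ← mul_assoc]
    rw [Finset.sum_comm]
    have h4 : ∀ C, ∑ B, M.jacInv hi hj A B * D hj B (M.trans i j W hi hj (coord m (M.chart i) W C)) *
        M.trans i j W hi hj (D hi C h)
        = (1 : Matrix (Fin n ⊕ Fin m) (Fin n ⊕ Fin m) _) A C * M.trans i j W hi hj (D hi C h) := by
      intro C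
      rw [← M.jacInv_mul_jac hi hj, Matrix.mul_apply, Finset.sum_mul]
      rfl
    rw [Finset.sum_congr rfl fun C _ => h4 C]
    simp [Matrix.one_apply]
  simp only [h1, smul_add, Finset.sum_add_distrib, smul_smul, sgn_mul_self, one_smul]
  rw [← Finset.sum_congr rfl fun B _ => smul_mul_assoc _ _ _, ← Finset.sum_mul, piola hi hj hM,
    zero_mul, zero_add, h3, ← SuperFun.even_comm (jacFun hM hi hj).2, Finset.mul_sum]
  simp only [mul_assoc]

end

end SuperManifold

/-! ### Change of variables in the Berezin integral -/

namespace SuperManifold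

open SuperFun Topology MeasureTheory

variable {n m : ℕ} {X : Type u} [TopologicalSpace X] [T2Space X] {M : SuperManifold.{u, v} n m X}
  {i j : M.Index} {W : TopologicalSpace.Opens X} (hi : (W : Set X) ⊆ (M.chart i).source)
  (hj : (W : Set X) ⊆ (M.chart j).source)

theorem extendZero_eventually_zero {f : W → Grassmann m} {K : Set X} (hK : IsCompact K)
    (h0 : ∀ x : W, x.1 ∉ K → f x = 0) {x : X} (hx : x ∉ K) :
    extendZero f =ᶠ[𝓝 x] 0 := by
  filter_upwards [hK.isClosed.isOpen_compl.mem_nhds hx] with z hz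
  by_cases hzW : z ∈ W
  · rw [SuperFun.extendZero_of_mem _ hzW, h0 ⟨z, hzW⟩ hz]; rfl
  · rw [SuperFun.extendZero_of_notMem _ hzW]; rfl

/-- By Piola's identity the integrand is a sum of derivatives of compactly supported superfunctions
in the j-th chart, and each integrates to zero. -/
theorem chartInt_trans_D_mul_jac (hM : M.PositiveJacobians) (A : Fin n ⊕ Fin m)
    (h : SuperFun m (M.chart i) W) {K : Set X} (hK : IsCompact K) (hKW : K ⊆ W)
    (h0 : ∀ x : W, x.1 ∉ K → h.1 x = 0) :
    chartInt (M.chart j)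
      (extendZero (M.trans i j W hi hj (D hi A h) * (jacFun hM hi hj).1).1) = 0 := by
  have h1 : ∀ B, ∀ x : W, x.1 ∉ K →
      ((jacFun hM hi hj).1 * M.jacInv hi hj A B * M.trans i j W hi hj h).1 x = 0 := by
    intro B x hx
    rw [← ev_apply, map_mul, ev_apply, ev_apply,
      M.trans_eq_zero hi hj x.2 (extendZero_eventually_zero hK h0 hx), mul_zero]
  have h2 : ∀ (B : Fin n ⊕ Fin m) (x : W), x.1 ∉ K → (D hj B ((jacFun hM hi hj).1 * M.jacInv hi hj A B *
      M.trans i j W hi hj h)).1 x = 0 := by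
    intro B x hx
    rw [D_apply hj _ _ x.2, superDeriv_congr (hj x.2) (extendZero_eventually_zero hK (h1 B) hx)]
    rcases B with b | β
    · refine Grassmann.ext_coeff fun I => ?_
      rw [superDeriv_inl, Grassmann.coeff_pd]
      simp
    · exact map_zero (Grassmann.oddDeriv β)
  rw [trans_D_mul_jac]
  have h3 : extendZero (∑ B, sgn (coordParity B * (coordParity A + coordParity B)) •
        D hj B ((jacFun hM hi hj).1 * M.jacInv hi hj A B * M.trans i j W hi hj h)).1
      = fun x => ∑ B, extendZero (sgn (coordParity B * (coordParity A + coordParity B)) •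
        D hj B ((jacFun hM hi hj).1 * M.jacInv hi hj A B * M.trans i j W hi hj h)).1 x := by
    funext x
    by_cases hx : x ∈ W
    · simp only [extendZero_of_mem _ hx, ← ev_apply, map_sum]
    · simp only [extendZero_of_notMem _ hx, Finset.sum_const_zero]
  rw [h3, CompactSmooth.chartInt_sum]
  · refine Finset.sum_eq_zero fun B _ => ?_
    have h4 := extendZero_smul (sgn (coordParity B * (coordParity A + coordParity B)))
      (D hj B ((jacFun hM hi hj).1 * M.jacInv hi hj A B * M.trans i j W hi hj h)).1
    refine (congrArg (chartInt (M.chart j)) h4).trans ?_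
    rw [CompactSmooth.chartInt_smul, chartInt_D hj _ hK hKW (h1 B), mul_zero]
  · intro B _
    refine compactSmooth_extendZero hj (Subtype.property _) hK hKW fun x hx => ?_
    rw [← ev_apply, map_smul, ev_apply, h2 B x hx, smul_zero]

/-- The top coefficient of the transformed top form. -/
theorem top_trans_mul_prod_mul_jac (hM : M.PositiveJacobians) (s : SuperFun m (M.chart i) W)
    (x : W) :
    Grassmann.top ((M.trans i j W hi hj
        (s * (List.ofFn fun α => coord m (M.chart i) W (Sum.inr α)).prod) *
        (jacFun hM hi hj).1).1 x)
      = |(M.jacBody i j x).toBlocks₁₁.det| * Grassmann.body (s.1 x) := by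
  have hxi : x.1 ∈ M.dom i := hi x.2
  have hxj : x.1 ∈ M.dom j := hj x.2
  -- The images of the ξ^α have no body, so their product depends only on their linear parts and
  -- equals the determinant of the odd block times the top monomial. Multiplication by the top
  -- monomial then leaves only the bodies of the other factors.
  have h1 : (M.trans i j W hi hj (List.ofFn fun α => coord m (M.chart i) W (Sum.inr α)).prod).1 x
      = (M.jacBody i j x).toBlocks₂₂.det • Grassmann.monomials m Finset.univ := by
    rw [map_list_prod, ← ev_apply, map_list_prod, List.map_ofFn, List.map_ofFn,
      Grassmann.prod_ofFn_eq]
    · rw [← Matrix.det_transpose]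
      congr 2
      ext α β
      simp only [Matrix.transpose_apply, Matrix.of_apply, Matrix.toBlocks₂₂, jacBody, Matrix.map_apply]
      rw [M.jacobiMatrix_apply hi hj x.2, M.jac_apply, D_inr_apply]
      rfl
    · intro α
      rw [Grassmann.mem_aug]
      exact Grassmann.body_of_odd (M.trans_mem hi hj (coord_mem (Sum.inr α)) x)
  have h2 : (M.trans i j W hi hj
        (s * (List.ofFn fun α => coord m (M.chart i) W (Sum.inr α)).prod) *
        (jacFun hM hi hj).1).1 x
      = (|(M.jacBody i j x).toBlocks₁₁.det| * Grassmann.body (s.1 x)) •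
        Grassmann.monomials m Finset.univ := by
    rw [← SuperFun.even_comm (jacFun hM hi hj).2, map_mul]
    change (jacFun hM hi hj).1.1 x * ((M.trans i j W hi hj s).1 x * (M.trans i j W hi hj
      (List.ofFn fun α => coord m (M.chart i) W (Sum.inr α)).prod).1 x) = _
    rw [h1, mul_smul_comm, Grassmann.mul_monomials_univ, mul_smul_comm, mul_smul_comm,
      Grassmann.mul_monomials_univ, M.body_trans, smul_smul, smul_smul]
    congr 1
    rw [← (body_jacobian_mul_det hM hxi hxj).1, ← evEven_jacFun hM hi hj x]
    change _ * _ * Grassmann.body ((jacFun hM hi hj).1.1 x)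
      = Grassmann.body ((jacFun hM hi hj).1.1 x) * _ * _
    ring
  rw [h2]
  have h3 := Grassmann.top_monomials_univ (m := m)
  rw [Grassmann.top] at h3 ⊢
  rw [map_smul, h3, smul_eq_mul, mul_one]

/-- The change of variables in the integral of a function over `W`. -/
theorem setIntegral_chart_eq (hi : (W : Set X) ⊆ (M.chart i).source)
    (hj : (W : Set X) ⊆ (M.chart j).source) (f : X → ℝ) (h0 : ∀ x ∉ W, f x = 0) :
    ∫ y in (M.chart i).target, f ((M.chart i).symm y)
      = ∫ y in (M.chart j).target, |(M.jacBody i j ((M.chart j).symm y)).toBlocks₁₁.det| *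
          f ((M.chart j).symm y) := by
  set ci := M.chart i
  set cj := M.chart j
  have key : ∀ (c : OpenPartialHomeomorph X (Fin n → ℝ)) (g : (Fin n → ℝ) → ℝ),
      (∀ y, c.symm y ∉ W → g y = 0) →
      ∫ y in c.target, g y = ∫ y in c.target ∩ c.symm ⁻¹' W, g y := by
    intro c g hg
    refine setIntegral_eq_of_subset_of_forall_sdiff_eq_zero c.open_target.measurableSet
      Set.inter_subset_left fun y hy => hg y fun h => hy.2 ⟨hy.1, h⟩
  rw [key ci _ fun y hy => h0 _ hy, key cj _ fun y hy => by rw [h0 _ hy, mul_zero]]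
  set S := cj.target ∩ cj.symm ⁻¹' W
  have hSo : IsOpen S := cj.symm.isOpen_inter_preimage W.2
  have himg : ci.target ∩ ci.symm ⁻¹' W = (fun y => ci (cj.symm y)) '' S := by
    ext y
    constructor
    · rintro ⟨h1, h2⟩
      refine ⟨cj (ci.symm y), ⟨cj.map_source (hj h2), ?_⟩, ?_⟩
      · change cj.symm _ ∈ W
        rw [cj.left_inv (hj h2)]; exact h2
      · change ci (cj.symm _) = y
        rw [cj.left_inv (hj h2), ci.right_inv h1]
    · rintro ⟨z, ⟨h1, h2⟩, rfl⟩
      refine ⟨ci.map_source (hi h2), ?_⟩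
      change ci.symm (ci _) ∈ W
      rw [ci.left_inv (hi h2)]; exact h2
  let F : Fin n → SuperFun m cj W := fun b => M.trans i j W hi hj (coord m ci W (Sum.inl b))
  have hF : ∀ y ∈ S, ∀ b, bodyFn (F b) y = ci (cj.symm y) b := by
    intro y hy b
    have h1 := bodyFn_apply hj (F b) hy.2
    rw [cj.right_inv hy.1] at h1
    rw [h1, M.body_trans hi hj]
    change Grassmann.body (algebraMap ℝ (Grassmann m) (ci (cj.symm y) b)) = _
    rw [AlgHom.commutes]; rfl
  have hFd : ∀ y ∈ S, ∀ b, HasFDerivAt (bodyFn (F b)) (fderiv ℝ (bodyFn (F b)) y) y := by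
    intro y hy b
    have h1 := contDiffAt_bodyFn hj (F b) hy.2
    rw [cj.right_inv hy.1] at h1
    exact (h1.differentiableAt (by simp)).hasFDerivAt
  -- The transition map of the underlying manifold is given by the bodies of the transformed even
  -- coordinates. Its differential is therefore the transpose of the body of the even block of the
  -- Jacobi matrix.
  let φ' : (Fin n → ℝ) → (Fin n → ℝ) →L[ℝ] (Fin n → ℝ) := fun y =>
    ContinuousLinearMap.pi fun b => fderiv ℝ (bodyFn (F b)) y
  have hφ : ∀ y ∈ S, HasFDerivWithinAt (fun y => ci (cj.symm y)) (φ' y) S y := by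
    intro y hy
    refine hasFDerivWithinAt_pi'.2 fun b => ?_
    refine ((hFd y hy b).hasFDerivWithinAt (s := S)).congr (fun z hz => (hF z hz b).symm)
      (hF y hy b).symm
  have hinj : Set.InjOn (fun y => ci (cj.symm y)) S := by
    intro y hy z hz h
    have h1 := ci.injOn (hi hy.2) (hi hz.2) h
    have h2 := congrArg cj h1
    rwa [cj.right_inv hy.1, cj.right_inv hz.1] at h2
  have hdet : ∀ y ∈ S, (φ' y).det = (M.jacBody i j (cj.symm y)).toBlocks₁₁.det := by
    intro y hy
    rw [ContinuousLinearMap.det, ← LinearMap.det_toMatrix', ← Matrix.det_transpose]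
    congr 1
    ext a b
    rw [Matrix.transpose_apply, LinearMap.toMatrix'_apply]
    simp only [Matrix.toBlocks₁₁, jacBody, Matrix.map_apply, Matrix.of_apply]
    rw [M.jacobiMatrix_apply hi hj hy.2, M.jac_apply, D_apply hj _ _ hy.2, superDeriv_inl]
    refine Eq.trans ?_ (Grassmann.linear_pd (smooth hj (F b) hy.2) a
      (Grassmann.body (m := m)).toLinearMap).symm
    rw [cj.right_inv hy.1]
    have h2 : (fun a' => if a' = a then (1 : ℝ) else 0) = Pi.single a 1 := by
      ext a'; simp [Pi.single_apply]
    change fderiv ℝ (bodyFn (F b)) y _ = fderiv ℝ (bodyFn (F b)) y _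
    congr 1
  rw [himg, integral_image_eq_integral_abs_det_fderiv_smul volume hSo.measurableSet hφ hinj]
  refine setIntegral_congr_fun hSo.measurableSet fun y hy => ?_
  simp only [hdet y hy, smul_eq_mul, ci.left_inv (hi hy.2)]

/-- The change of variables in the Berezin integral. -/
theorem chartInt_change (hM : M.PositiveJacobians) (f : SuperFun m (M.chart i) W) {K : Set X}
    (hK : IsCompact K) (hKW : K ⊆ W) (h0 : ∀ x : W, x.1 ∉ K → f.1 x = 0) :
    chartInt (M.chart j) (extendZero (M.trans i j W hi hj f * (jacFun hM hi hj).1).1)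
      = chartInt (M.chart i) (extendZero f.1) := by
  let s : SuperFun m (M.chart i) W :=
    mapValues hi ((Algebra.linearMap ℝ (Grassmann m)).comp (Grassmann.coeff Finset.univ)) f
  let T : SuperFun m (M.chart i) W := (List.ofFn fun α => coord m (M.chart i) W (Sum.inr α)).prod
  let P : Fin m → SuperFun m (M.chart i) W := fun α => mapValues hi (Grassmann.prim α) f
  have hT : ∀ x, T.1 x = Grassmann.monomials m Finset.univ := by
    intro x
    rw [← ev_apply, map_list_prod, List.map_ofFn, Grassmann.monomials_univ_eq_prod]
    rfl
  -- The derivative terms integrate to zero in the new chart by Piola's identity, so only the top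
  -- term s · ξ¹⋯ξᵐ has to be transformed, with s a scalar function.
  have hf : f = s * T + ∑ α, D hi (Sum.inr α) (P α) := by
    refine ext' fun x hx => ?_
    rw [← ev_apply, ← ev_apply, map_add, map_mul, map_sum]
    simp only [ev_apply, D_inr_apply]
    rw [hT]
    change _ = algebraMap ℝ (Grassmann m) (Grassmann.top (f.1 ⟨x, hx⟩)) * _ + _
    rw [← Algebra.smul_def]
    exact Grassmann.eq_top_add_sum_oddDeriv _
  set J := (jacFun hM hi hj).1
  have hP0 : ∀ α, ∀ x : W, x.1 ∉ K → (P α).1 x = 0 := fun α x hx => by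
    change Grassmann.prim α (f.1 x) = 0
    rw [h0 x hx, map_zero]
  have hs0 : ∀ x : W, x.1 ∉ K → (s * T).1 x = 0 := fun x hx => by
    have h1 : s.1 x = 0 := by
      change algebraMap ℝ (Grassmann m) (Grassmann.coeff _ (f.1 x)) = 0
      rw [h0 x hx, map_zero, map_zero]
    rw [← ev_apply, map_mul, ev_apply, h1, zero_mul]
  have hD0 : ∀ α, ∀ x : W, x.1 ∉ K → (D hi (Sum.inr α) (P α)).1 x = 0 := fun α x hx => by
    rw [D_inr_apply, hP0 α x hx, map_zero]
  have hcs : ∀ h : SuperFun m (M.chart i) W, (∀ x : W, x.1 ∉ K → h.1 x = 0) →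
      CompactSmooth (M.chart j) (extendZero (M.trans i j W hi hj h * J).1) := by
    intro h hh
    refine compactSmooth_extendZero hj (Subtype.property _) hK hKW fun x hx => ?_
    rw [← ev_apply, map_mul, ev_apply,
      M.trans_eq_zero hi hj x.2 (extendZero_eventually_zero hK hh hx), zero_mul]
  have h1 : extendZero (M.trans i j W hi hj f * J).1 = fun x =>
      extendZero (M.trans i j W hi hj (s * T) * J).1 x
        + ∑ α, extendZero (M.trans i j W hi hj (D hi (Sum.inr α) (P α)) * J).1 x := by
    funext x
    by_cases hx : x ∈ W
    · simp only [extendZero_of_mem _ hx, ← ev_apply]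
      conv_lhs => rw [hf]
      rw [map_add, add_mul, map_add, map_sum, Finset.sum_mul, map_sum]
    · simp only [extendZero_of_notMem _ hx, Finset.sum_const_zero, add_zero]
  rw [h1, (hcs _ hs0).chartInt_add (CompactSmooth.sum _ fun α _ => hcs _ (hD0 α)),
    CompactSmooth.chartInt_sum _ fun α _ => hcs _ (hD0 α)]
  rw [Finset.sum_eq_zero fun α _ => chartInt_trans_D_mul_jac hi hj hM _ _ hK hKW (hP0 α), add_zero]
  have h2 : ∀ x, Grassmann.top (extendZero (M.trans i j W hi hj (s * T) * J).1 x)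
      = |(M.jacBody i j x).toBlocks₁₁.det| * Grassmann.top (extendZero f.1 x) := by
    intro x
    by_cases hx : x ∈ W
    · rw [extendZero_of_mem _ hx, extendZero_of_mem _ hx,
        top_trans_mul_prod_mul_jac hi hj hM s ⟨x, hx⟩]
      congr 1
      change Grassmann.body (algebraMap ℝ (Grassmann m) _) = _
      rw [AlgHom.commutes]; rfl
    · rw [extendZero_of_notMem _ hx, extendZero_of_notMem _ hx]
      simp [Grassmann.top]
  rw [chartInt, chartInt, setIntegral_chart_eq hi hj (fun x => Grassmann.top (extendZero f.1 x))]
  · simp only [h2]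
  · intro x hx
    rw [extendZero_of_notMem _ hx]
    exact map_zero (Grassmann.coeff _)

/-- The integral of a volume form does not depend on the chart. -/
theorem chartIntegral_eq (hM : M.PositiveJacobians) (φ : M.Densities) {K : Set X}
    (hK : IsCompact K) (hKi : K ⊆ M.dom i) (hKj : K ⊆ M.dom j) (h0 : VanishesOutside φ K) :
    chartIntegral i φ = chartIntegral j φ := by
  have hi : ((M.dom i ⊓ M.dom j : TopologicalSpace.Opens X) : Set X) ⊆ (M.chart i).source :=
    fun x hx => hx.1
  have hj : ((M.dom i ⊓ M.dom j : TopologicalSpace.Opens X) : Set X) ⊆ (M.chart j).source :=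
    fun x hx => hx.2
  have hKW : K ⊆ (M.dom i ⊓ M.dom j : TopologicalSpace.Opens X) := fun x hx => ⟨hKi hx, hKj hx⟩
  have h1 := chartInt_change hi hj hM (componentOn φ i 1 hi) hK hKW fun x hx => by
    rw [componentOn_apply φ i 1 hi x.2]; exact h0 i 1 x hx
  have h2 : extendZero (componentOn φ i 1 hi).1 = component φ i 1 := by
    funext x
    by_cases hx : x ∈ M.dom i ⊓ M.dom j
    · rw [extendZero_of_mem _ hx, componentOn_apply φ i 1 hi hx]
    · rw [extendZero_of_notMem _ hx, h0 i 1 x fun h => hx (hKW h)]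
  have h3 : extendZero (M.trans i j _ hi hj (componentOn φ i 1 hi) * (jacFun hM hi hj).1).1
      = component φ j 1 := by
    funext x
    by_cases hx : x ∈ M.dom i ⊓ M.dom j
    · rw [extendZero_of_mem _ hx, component_trans φ hi hj 1 hx,
        Grassmann.pow_one' (hM i j x hx.1 hx.2), ← evEven_jacFun hM hi hj ⟨x, hx⟩]
      rfl
    · rw [extendZero_of_notMem _ hx, h0 j 1 x fun h => hx (hKW h)]
  rw [h2, h3] at h1
  exact h1.symm

end SuperManifold

/-! ### The integral over the supermanifold -/

namespace SuperManifold

open SuperFun Topology MeasureTheory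

section

variable {n m : ℕ} {X : Type u} [TopologicalSpace X] {M : SuperManifold.{u, v} n m X}

theorem component_mul_eq_zero_left {ψ : M.Densities} {i : M.Index} {x : X}
    (h : ∀ w, component ψ i w x = 0) (χ : M.Densities) (w : ℝ) : component (ψ * χ) i w x = 0 := by
  obtain ⟨s, hs⟩ := exists_eq_sum_weightPart ψ
  rw [hs, Finset.sum_mul, component_sum]
  refine Finset.sum_eq_zero fun a _ => ?_
  rw [(hasWeight_weightPart a ψ).component_mul', component_weightPart, h, zero_mul]

theorem component_mul_eq_zero_right {χ : M.Densities} {i : M.Index} {x : X}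
    (h : ∀ w, component χ i w x = 0) (ψ : M.Densities) (w : ℝ) : component (ψ * χ) i w x = 0 := by
  obtain ⟨s, hs⟩ := exists_eq_sum_weightPart ψ
  rw [hs, Finset.sum_mul, component_sum]
  refine Finset.sum_eq_zero fun a _ => ?_
  rw [(hasWeight_weightPart a ψ).component_mul', h, mul_zero]

namespace VanishesOutside

variable {ψ χ : M.Densities} {K L : Set X}

theorem mono (h : VanishesOutside ψ K) (hKL : K ⊆ L) : VanishesOutside ψ L :=
  fun i w x hx => h i w x fun h' => hx (hKL h')

theorem mul_right (h : VanishesOutside ψ K) (χ : M.Densities) : VanishesOutside (ψ * χ) K :=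
  fun i w x hx => component_mul_eq_zero_left (fun w => h i w x hx) χ w

theorem mul_left (h : VanishesOutside χ K) (ψ : M.Densities) : VanishesOutside (ψ * χ) K :=
  fun i w x hx => component_mul_eq_zero_right (fun w => h i w x hx) ψ w

theorem add (h : VanishesOutside ψ K) (h' : VanishesOutside χ K) : VanishesOutside (ψ + χ) K :=
  fun i w x hx => by rw [component_add, h i w x hx, h' i w x hx, add_zero]

theorem smul (h : VanishesOutside ψ K) (r : ℝ) : VanishesOutside (r • ψ) K :=
  fun i w x hx => by rw [component_smul, h i w x hx, smul_zero]

theorem weightPart (h : VanishesOutside ψ K) (w : ℝ) : VanishesOutside (weightPart w ψ) K :=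
  fun i w' x hx => by
    by_cases hw : w' = w
    · subst hw; rw [component_weightPart, h i _ x hx]
    · rw [(hasWeight_weightPart w ψ).component_eq_zero hw]

theorem parityPart (h : VanishesOutside ψ K) (p : ZMod 2) : VanishesOutside (parityPart p ψ) K :=
  fun i w' x hx => by rw [component_parityPart, h i _ x hx, map_zero]

end VanishesOutside

theorem chartIntegral_eq_chartInt (i : M.Index) (ψ : M.Densities) :
    chartIntegral i ψ = chartInt (M.chart i) (component ψ i 1) := rfl

theorem HasWeight.sub {ψ χ : M.Densities} {w : ℝ} (h : HasWeight ψ w) (h' : HasWeight χ w) :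
    HasWeight (ψ - χ) w := hasWeight_iff.2 fun i w' hw x _ => by
  rw [component_sub, h.component_eq_zero hw, h'.component_eq_zero hw, sub_zero]

theorem chartIntegral_smul (i : M.Index) (r : ℝ) (ψ : M.Densities) :
    chartIntegral i (r • ψ) = r * chartIntegral i ψ := by
  have h : component (r • ψ) i 1 = fun x => r • component ψ i 1 x :=
    funext fun x => component_smul r ψ i 1 x
  rw [chartIntegral_eq_chartInt, h, CompactSmooth.chartInt_smul, chartIntegral_eq_chartInt]

variable [T2Space X]

theorem VanishesOutside.compactSmooth {ψ : M.Densities} {K : Set X} (h : VanishesOutside ψ K)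
    (hK : IsCompact K) {i : M.Index} (hKi : K ⊆ M.dom i) (w : ℝ) :
    CompactSmooth (M.chart i) (component ψ i w) :=
  ⟨fun _ hx => component_smooth ψ w hx, K, hK, hKi, fun x hx => h i w x hx⟩

theorem chartIntegral_add {i : M.Index} {ψ χ : M.Densities} {K L : Set X}
    (hψ : VanishesOutside ψ K) (hK : IsCompact K) (hKi : K ⊆ M.dom i)
    (hχ : VanishesOutside χ L) (hL : IsCompact L) (hLi : L ⊆ M.dom i) :
    chartIntegral i (ψ + χ) = chartIntegral i ψ + chartIntegral i χ := by
  have h : component (ψ + χ) i 1 = fun x => component ψ i 1 x + component χ i 1 x :=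
    funext fun x => component_add ψ χ i 1 x
  rw [chartIntegral_eq_chartInt, h,
    (hψ.compactSmooth hK hKi 1).chartInt_add (hχ.compactSmooth hL hLi 1)]
  rfl

theorem chartIntegral_sum {i : M.Index} {ι : Type*} (s : Finset ι) {ψ : ι → M.Densities}
    {K : Set X} (hψ : ∀ k ∈ s, VanishesOutside (ψ k) K) (hK : IsCompact K) (hKi : K ⊆ M.dom i) :
    chartIntegral i (∑ k ∈ s, ψ k) = ∑ k ∈ s, chartIntegral i (ψ k) := by
  have h : component (∑ k ∈ s, ψ k) i 1 = fun x => ∑ k ∈ s, component (ψ k) i 1 x :=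
    funext fun x => component_sum s ψ i 1 x
  rw [chartIntegral_eq_chartInt, h,
    CompactSmooth.chartInt_sum s fun k hk => (hψ k hk).compactSmooth hK hKi 1]
  rfl

/-- The sums of densities with compact supports in charts. -/
noncomputable def chartSpan (M : SuperManifold.{u, v} n m X) : Submodule ℝ M.Densities :=
  Submodule.span ℝ {φ | ∃ i, ∃ K : Set X, K ⊆ (M.chart i).source ∧ IsCompact K ∧
    VanishesOutside φ K}

theorem mul_mem_chartSpan {φ : M.Densities} (h : φ ∈ M.chartSpan) (ψ : M.Densities) :
    φ * ψ ∈ M.chartSpan := by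
  induction h using Submodule.span_induction with
  | mem φ h =>
    obtain ⟨i, K, hKi, hK, h0⟩ := h
    exact Submodule.subset_span ⟨i, K, hKi, hK, h0.mul_right ψ⟩
  | zero => rw [zero_mul]; exact Submodule.zero_mem _
  | add a b _ _ ha hb => rw [add_mul]; exact Submodule.add_mem _ ha hb
  | smul r a _ ha => rw [smul_mul_assoc]; exact Submodule.smul_mem _ r ha

theorem exists_sum_of_mem_chartSpan {φ : M.Densities} (h : φ ∈ M.chartSpan) :
    ∃ (N : ℕ) (i : Fin N → M.Index) (ρ : Fin N → M.Densities),
      (∀ k, ∃ K ⊆ (M.chart (i k)).source, IsCompact K ∧ VanishesOutside (ρ k) K) ∧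
      φ = ∑ k, ρ k := by
  obtain ⟨N, r, g, hg⟩ := Submodule.mem_span_set'.1 h
  choose i K hKi hK h0 using fun k => (g k).2
  exact ⟨N, i, fun k => r k • (g k).1, fun k => ⟨K k, hKi k, hK k, (h0 k).smul _⟩, hg.symm⟩

/-- A smooth function which is `1` on a compact set and has compact support. -/
theorem exists_cutoff (hM : M.PositiveJacobians) {K : Set X} (hK : IsCompact K) :
    ∃ σ ∈ M.chartSpan, ∀ i w, ∀ x ∈ K, component (1 - σ) i w x = 0 := by
  refine hK.induction_on (p := fun K => ∃ σ ∈ M.chartSpan, ∀ i w, ∀ x ∈ K,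
    component (1 - σ) i w x = 0) ⟨0, Submodule.zero_mem _, by simp⟩
    (fun s t hst ⟨σ, h1, h2⟩ => ⟨σ, h1, fun i w x hx => h2 i w x (hst hx)⟩)
    (fun s t ⟨σ, h1, h2⟩ ⟨τ, h3, h4⟩ => ⟨σ + τ - σ * τ,
      Submodule.sub_mem _ (Submodule.add_mem _ h1 h3) (mul_mem_chartSpan h1 τ),
      fun i w x hx => ?_⟩) (fun x _ => ?_)
  -- Cutoffs for two sets combine so that 1 minus the new cutoff is the product of the two
  -- complements and vanishes on the union.
  · have h5 : 1 - (σ + τ - σ * τ) = (1 - σ) * (1 - τ) := by noncomm_ring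
    rw [h5]
    rcases hx with hx | hx
    · exact component_mul_eq_zero_left (fun w => h2 i w x hx) _ w
    · exact component_mul_eq_zero_right (fun w => h4 i w x hx) _ w
  · obtain ⟨i, hi⟩ := M.exists_chart x
    obtain ⟨ρ, L, hL, hLi, -, h0, hw, -, h1⟩ :=
      exists_bump_density hM (i := i) (x := x) hi Filter.univ_mem
    obtain ⟨U, hU, hUo, hxU⟩ := eventually_nhds_iff.1 h1
    refine ⟨U ∩ M.dom i, mem_nhdsWithin_of_mem_nhds
      ((hUo.inter (M.dom i).2).mem_nhds ⟨hxU, hi⟩), ρ,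
      Submodule.subset_span ⟨i, L, hLi, hL, h0⟩, fun j w z hz => ?_⟩
    have hw' : HasWeight (1 - ρ) 0 := hasWeight_one.sub hw
    by_cases hzj : z ∈ M.dom j
    · by_cases hww : w = 0
      · subst hww
        refine (component_congr_chart (χ := (0 : M.Densities)) hz.2 hzj ?_).trans (component_zero (M := M) j 0 z)
        filter_upwards [(hUo.inter (M.dom i).2).mem_nhds hz] with y hy
        rw [component_sub, component_one hy.2, hU y hy.1, sub_self, component_zero]
      · exact hw'.component_eq_zero hww j z
    · exact component_of_notMem _ _ hzj

theorem eq_mul_of_cutoff {σ ψ : M.Densities} {K : Set X}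
    (hσ : ∀ i w, ∀ x ∈ K, component (1 - σ) i w x = 0) (hψ : VanishesOutside ψ K) :
    ψ = σ * ψ := by
  have h1 : (1 - σ) * ψ = 0 := densities_ext fun i w x _ => by
    rw [component_zero]
    by_cases hx : x ∈ K
    · exact component_mul_eq_zero_left (fun w => hσ i w x hx) _ w
    · exact component_mul_eq_zero_right (fun w => hψ i w x hx) _ w
  rw [sub_mul, one_mul, sub_eq_zero] at h1
  exact h1

/-- The integral of a density is computed with a partition of unity. -/
theorem HasIntegral.eq_sum (hM : M.PositiveJacobians) {N : ℕ} {i : Fin N → M.Index}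
    {ρ : Fin N → M.Densities} {L : Fin N → Set X} (hLi : ∀ k, L k ⊆ (M.chart (i k)).source)
    (hL : ∀ k, IsCompact (L k)) (hρ : ∀ k, VanishesOutside (ρ k) (L k)) {ψ : M.Densities}
    {N' : ℕ} {i' : Fin N' → M.Index} {φ : Fin N' → M.Densities} {K : Fin N' → Set X}
    (hKi : ∀ k, K k ⊆ (M.chart (i' k)).source) (hK : ∀ k, IsCompact (K k))
    (hφ : ∀ k, VanishesOutside (φ k) (K k)) (hψ : ψ = ∑ k, φ k)
    (h1 : ∀ k, φ k = (∑ l, ρ l) * φ k) :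
    ∑ k, chartIntegral (i' k) (φ k) = ∑ l, chartIntegral (i l) (ρ l * ψ) := by
  have h2 : ∀ k, chartIntegral (i' k) (φ k) = ∑ l, chartIntegral (i' k) (ρ l * φ k) := by
    intro k
    conv_lhs => rw [h1 k, Finset.sum_mul]
    exact chartIntegral_sum _ (fun l _ => (hφ k).mul_left _) (hK k) (hKi k)
  have h3 : ∀ l, chartIntegral (i l) (ρ l * ψ) = ∑ k, chartIntegral (i l) (ρ l * φ k) := by
    intro l
    rw [hψ, Finset.mul_sum]
    exact chartIntegral_sum _ (fun k _ => (hρ l).mul_right _) (hL l) (hLi l)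
  rw [Finset.sum_congr rfl fun k _ => h2 k, Finset.sum_congr rfl fun l _ => h3 l, Finset.sum_comm]
  refine Finset.sum_congr rfl fun l _ => Finset.sum_congr rfl fun k _ => ?_
  -- The product ρ_l φ_k is supported in the intersection of the two compact sets, which lies in
  -- both charts, so its integrals in them agree.
  refine chartIntegral_eq hM _ ((hK k).inter (hL l)) (Set.inter_subset_left.trans (hKi k))
    (Set.inter_subset_right.trans (hLi l)) fun i w x hx => ?_
  by_cases hx1 : x ∈ K k
  · exact (hρ l).mul_right _ i w x fun h => hx ⟨hx1, h⟩
  · exact (hφ k).mul_left _ i w x hx1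

/-- One finite partition of unity on the union of all supports in both decompositions is used. Both
sums then equal Σ ∫ ρ_l ψ, which involves no decomposition of ψ. -/
theorem HasIntegral.unique (hM : M.PositiveJacobians) {ψ : M.Densities} {c c' : ℝ}
    (h : HasIntegral ψ c) (h' : HasIntegral ψ c') : c = c' := by
  obtain ⟨N, i, φ, hφ, hψ, rfl⟩ := h
  obtain ⟨N', i', φ', hφ', hψ', rfl⟩ := h'
  choose K hKi hK h0 using hφ
  choose K' hKi' hK' h0' using hφ'
  obtain ⟨σ, hσ, h1⟩ := exists_cutoff hM
    ((isCompact_iUnion hK).union (isCompact_iUnion hK'))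
  obtain ⟨N'', j, ρ, hρ, rfl⟩ := exists_sum_of_mem_chartSpan hσ
  choose L hLi hL hρ0 using hρ
  rw [HasIntegral.eq_sum hM hLi hL hρ0 hKi hK h0 hψ fun k => eq_mul_of_cutoff h1
      ((h0 k).mono fun x hx => Or.inl (Set.mem_iUnion.2 ⟨k, hx⟩)),
    HasIntegral.eq_sum hM hLi hL hρ0 hKi' hK' h0' hψ' fun k => eq_mul_of_cutoff h1
      ((h0' k).mono fun x hx => Or.inr (Set.mem_iUnion.2 ⟨k, hx⟩))]

theorem HasIntegral.integral_eq (hM : M.PositiveJacobians) {ψ : M.Densities} {c : ℝ}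
    (h : HasIntegral ψ c) : integral ψ = c := by
  have h1 : ∃ c, HasIntegral ψ c := ⟨c, h⟩
  rw [integral, dif_pos h1]
  exact h1.choose_spec.unique hM h

/-- The integral over a compact set by means of a partition of unity. -/
theorem exists_integral_eq_sum (hM : M.PositiveJacobians) {K : Set X} (hK : IsCompact K) :
    ∃ (N : ℕ) (i : Fin N → M.Index) (ρ : Fin N → M.Densities) (L : Fin N → Set X),
      (∀ k, L k ⊆ (M.chart (i k)).source ∧ IsCompact (L k) ∧ VanishesOutside (ρ k) (L k)) ∧
      ∀ ψ, VanishesOutside ψ K → ψ = ∑ k, ρ k * ψ ∧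
        integral ψ = ∑ k, chartIntegral (i k) (ρ k * ψ) := by
  obtain ⟨σ, hσ, h1⟩ := exists_cutoff hM hK
  obtain ⟨N, j, ρ, hρ, rfl⟩ := exists_sum_of_mem_chartSpan hσ
  choose L hLi hL hρ0 using hρ
  refine ⟨N, j, ρ, L, fun k => ⟨hLi k, hL k, hρ0 k⟩, fun ψ hψ => ?_⟩
  have h2 := eq_mul_of_cutoff h1 hψ
  rw [Finset.sum_mul] at h2
  exact ⟨h2, HasIntegral.integral_eq hM
    ⟨N, j, fun k => ρ k * ψ, fun k => ⟨L k, hLi k, hL k, (hρ0 k).mul_right ψ⟩, h2, rfl⟩⟩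

theorem integral_eq_chartIntegral (hM : M.PositiveJacobians) {ψ : M.Densities} {i : M.Index}
    {K : Set X} (hK : IsCompact K) (hKi : K ⊆ M.dom i) (h0 : VanishesOutside ψ K) :
    integral ψ = chartIntegral i ψ :=
  HasIntegral.integral_eq hM ⟨1, fun _ => i, fun _ => ψ, fun _ => ⟨K, hKi, hK, h0⟩, by simp, by simp⟩

theorem integral_add (hM : M.PositiveJacobians) {ψ χ : M.Densities} (hψ : CompactlySupported ψ)
    (hχ : CompactlySupported χ) : integral (ψ + χ) = integral ψ + integral χ := by
  obtain ⟨K, hK, h1⟩ := hψ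
  obtain ⟨K', hK', h1'⟩ := hχ
  obtain ⟨N, i, ρ, L, hL, h2⟩ := exists_integral_eq_sum hM (hK.union hK')
  have h3 := h1.mono (L := K ∪ K') Set.subset_union_left
  have h4 := h1'.mono (L := K ∪ K') Set.subset_union_right
  rw [(h2 _ (h3.add h4)).2, (h2 _ h3).2, (h2 _ h4).2, ← Finset.sum_add_distrib]
  refine Finset.sum_congr rfl fun k _ => ?_
  obtain ⟨h5, h6, h7⟩ := hL k
  rw [mul_add, chartIntegral_add (h7.mul_right ψ) h6 h5 (h7.mul_right χ) h6 h5]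

theorem integral_smul (hM : M.PositiveJacobians) (r : ℝ) {ψ : M.Densities}
    (hψ : CompactlySupported ψ) : integral (r • ψ) = r * integral ψ := by
  obtain ⟨K, hK, h1⟩ := hψ
  obtain ⟨N, i, ρ, L, hL, h2⟩ := exists_integral_eq_sum hM hK
  rw [(h2 _ (h1.smul r)).2, (h2 _ h1).2, Finset.mul_sum]
  refine Finset.sum_congr rfl fun k _ => ?_
  rw [mul_smul_comm, chartIntegral_smul]

theorem integral_zero (hM : M.PositiveJacobians) : integral (0 : M.Densities) = 0 := by
  simpa using integral_smul hM 0 (ψ := (0 : M.Densities))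
    ⟨∅, isCompact_empty, fun i w x _ => component_zero i w x⟩

/-- The pairing of functions by the Berezin integral is nondegenerate. -/
theorem eq_zero_of_chartInt_mul {i : M.Index} {U : Set X} (hU : IsOpen U) (hUi : U ⊆ M.dom i)
    {f : X → Grassmann m} (hf : ∀ x ∈ U, SuperSmoothAt (M.chart i) f x)
    (h : ∀ (g : X → Grassmann m) (K : Set X), IsCompact K → K ⊆ U →
      (∀ x ∈ M.dom i, SuperSmoothAt (M.chart i) g x) → (∀ x ∉ K, g x = 0) →
      chartInt (M.chart i) (fun x => f x * g x) = 0) : ∀ x ∈ U, f x = 0 := by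
  intro x hx
  refine Grassmann.eq_zero_of_top_mul fun y => ?_
  set F : X → ℝ := fun z => Grassmann.top (f z * y) with hF
  obtain ⟨b, K, hK, hKi, hKU, hb0, hb1, hbs⟩ := exists_bump (M := M) (hUi hx) (hU.mem_nhds hx)
  -- The test function is b² · top(f y) · y, so that the top coefficient of f g is the square of b ·
  -- top(f y). Its integral vanishes only if it is zero everywhere, in particular at x, where b = 1.
  let g : X → Grassmann m := fun z =>
    algebraMap ℝ (Grassmann m) (b z) * (algebraMap ℝ _ (b z) * (algebraMap ℝ _ (F z) * y))
  have hFs : ∀ z ∈ U, SuperSmoothAt (M.chart i) (fun z => algebraMap ℝ (Grassmann m) (F z)) z :=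
    fun z hz => ((hf z hz).mul (superSmoothAt_const y z)).mapLinear
      ((Algebra.linearMap ℝ (Grassmann m)).comp (Grassmann.coeff Finset.univ))
  have hg0 : ∀ z ∉ K, g z = 0 := fun z hz => by simp [g, hb0 z hz]
  have hzero : ∀ (q : X → Grassmann m) (hq0 : ∀ z ∉ K, q z = 0) z, z ∈ M.dom i → z ∉ U →
      SuperSmoothAt (M.chart i) q z := by
    intro q hq0 z hz hzU
    refine SuperFun.smoothAt_congr hz (superSmoothAt_const 0 z) ?_
    filter_upwards [hK.isClosed.isOpen_compl.mem_nhds fun h => hzU (hKU h)] with z' hz'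
    rw [hq0 z' hz']
  have hgs : ∀ z ∈ M.dom i, SuperSmoothAt (M.chart i) g z := by
    intro z hz
    by_cases hzU : z ∈ U
    · exact (hbs z hz).mul ((hbs z hz).mul ((hFs z hzU).mul (superSmoothAt_const y z)))
    · exact hzero g hg0 z hz hzU
  have hfg : CompactSmooth (M.chart i) fun z => f z * g z := by
    refine ⟨fun z hz => ?_, K, hK, hKi, fun z hz => by rw [hg0 z hz, mul_zero]⟩
    by_cases hzU : z ∈ U
    · exact (hf z hzU).mul (hgs z hz)
    · exact hzero _ (fun z hz => by rw [hg0 z hz, mul_zero]) z hz hzU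
  have htop : ∀ z, Grassmann.top (f z * g z) = (b z * F z) ^ 2 := by
    intro z
    simp only [g, ← Algebra.smul_def, mul_smul_comm, smul_smul]
    rw [Grassmann.top, map_smul, smul_eq_mul]
    change _ * F z = _
    ring
  have hI := h g K hK hKU hgs hg0
  obtain ⟨hc1, hc2⟩ := hfg.contDiff_indicator (Grassmann.coeff Finset.univ)
  have hint2 : ∫ y, (M.chart i).target.indicator
      (fun y => Grassmann.coeff Finset.univ (f ((M.chart i).symm y) * g ((M.chart i).symm y))) y = 0 := by
    rw [MeasureTheory.integral_indicator (M.chart i).open_target.measurableSet]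
    exact hI
  have hnn : 0 ≤ (M.chart i).target.indicator
      (fun y => Grassmann.coeff Finset.univ (f ((M.chart i).symm y) * g ((M.chart i).symm y))) := by
    refine Set.indicator_nonneg fun y _ => ?_
    change 0 ≤ Grassmann.top _
    rw [htop]; positivity
  have h5 : (M.chart i).target.indicator (fun y => Grassmann.coeff Finset.univ
      (f ((M.chart i).symm y) * g ((M.chart i).symm y))) (M.chart i x) = 0 := by
    by_contra hne
    exact (hc1.continuous.integral_pos_of_hasCompactSupport_nonneg_nonzero hc2 hnn hne).ne' hint2
  rw [Set.indicator_of_mem ((M.chart i).map_source (hUi hx)), (M.chart i).left_inv (hUi hx)] at h5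
  change Grassmann.top _ = 0 at h5
  rw [htop, hb1.self_of_nhds, one_mul] at h5
  exact pow_eq_zero_iff (two_ne_zero) |>.1 h5

/-- Only test densities of weight 1 − w pair with g, and testing inside U determines g on U. This
local form allows comparison of densities known only near a point. -/
theorem component_eq_zero_of_chartIntegral_mul (hM : M.PositiveJacobians) {g : M.Densities}
    {i : M.Index} {w : ℝ} (hg : HasWeight g w) {U : Set X} (hU : IsOpen U) (hUi : U ⊆ M.dom i)
    (h : ∀ (χ : M.Densities) (K : Set X), IsCompact K → K ⊆ U → VanishesOutside χ K →
      HasWeight χ (1 - w) → integral (g * χ) = 0) : ∀ x ∈ U, component g i w x = 0 := by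
  refine eq_zero_of_chartInt_mul hU hUi (fun x hx => component_smooth g w (hUi hx))
    fun f K hK hKU hf hf0 => ?_
  obtain ⟨χ, hχw, hχ0, hχ, -⟩ := exists_ofChart hM i (1 - w) hK (hKU.trans hUi) hf hf0
  have h1 := h χ K hK hKU hχ0 hχw
  rw [integral_eq_chartIntegral hM hK (hKU.trans hUi) (hχ0.mul_left g)] at h1
  rw [← h1]
  change _ = chartInt (M.chart i) (component (g * χ) i 1)
  congr 1
  funext x
  rw [hg.component_mul', hχ]

/-- The scalar product is nondegenerate. -/
theorem eq_zero_of_integral_mul (hM : M.PositiveJacobians) {g : M.Densities}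
    (h : ∀ χ, CompactlySupported χ → integral (g * χ) = 0) : g = 0 := by
  refine densities_ext fun i w x hx => ?_
  rw [component_zero]
  refine eq_zero_of_chartInt_mul (M.dom i).2 subset_rfl (fun x hx => component_smooth g w hx)
    (fun f K hK hKU hf hf0 => ?_) x hx
  obtain ⟨χ, hχw, hχ0, hχ, -⟩ := exists_ofChart hM i (1 - w) hK hKU hf hf0
  have h1 := h χ ⟨K, hK, hχ0⟩
  rw [integral_eq_chartIntegral hM hK hKU (hχ0.mul_left g)] at h1
  rw [← h1]
  change _ = chartInt (M.chart i) (component (g * χ) i 1)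
  congr 1
  funext x
  obtain ⟨s, hs⟩ := exists_eq_sum_weightPart g
  have h2 : ∀ w', component (weightPart w' g * χ) i 1 x
      = if w' = w then component g i w x * f x else 0 := by
    intro w'
    rw [(hasWeight_weightPart w' g).component_mul', component_weightPart]
    split_ifs with hw
    · subst hw; rw [hχ]
    · rw [hχw.component_eq_zero (fun h => hw (by linarith)), mul_zero]
  have h3 : component g i w x * f x = component (g * χ) i 1 x := by
    conv_rhs => rw [hs, Finset.sum_mul, component_sum]
    rw [Finset.sum_congr rfl fun w' _ => h2 w', Finset.sum_ite_eq']
    split_ifs with hw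
    · rfl
    · rw [hs, component_sum, Finset.sum_eq_zero, zero_mul]
      intro w' hw'
      exact (hasWeight_weightPart w' g).component_eq_zero (fun h => hw (by rwa [h])) i x
  exact h3

end

end SuperManifold

/-! ### Derivations of the algebra of densities -/

namespace SuperManifold

open SuperFun Topology

variable {n m : ℕ} {X : Type u} [TopologicalSpace X] {M : SuperManifold.{u, v} n m X}

/-- A superderivation of parity `d` and weight `μ` of the algebra of densities. -/
structure IsDensityDerivation (d : ZMod 2) (μ : ℝ) (D : M.Densities →ₗ[ℝ] M.Densities) : Prop where
  parity : ∀ {χ q}, HasParity χ q → HasParity (D χ) (q + d)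
  weight : ∀ {χ w}, HasWeight χ w → HasWeight (D χ) (w + μ)
  leibniz : ∀ {χ q} (φ : M.Densities), HasParity χ q →
    D (χ * φ) = D χ * φ + sgn (d * q) • (χ * D φ)

theorem IsLongBracket.isDensityDerivation {ε : ZMod 2} {l : ℝ}
    {B : M.Densities →ₗ[ℝ] M.Densities →ₗ[ℝ] M.Densities} (hB : IsLongBracket ε l B)
    {ψ : M.Densities} {p : ZMod 2} {w : ℝ} (hp : HasParity ψ p) (hw : HasWeight ψ w) :
    IsDensityDerivation (p + ε) (w + l) (B ψ) where
  parity {χ q} h := by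
    have h1 := hB.parity hp h
    rwa [show p + q + ε = q + (p + ε) by ring] at h1
  weight {χ w'} h := by
    have h1 := hB.weight hw h
    rwa [show w + w' + l = w' + (w + l) by ring] at h1
  leibniz φ h := hB.leibniz φ hp h

namespace IsDensityDerivation

variable {d : ZMod 2} {μ : ℝ} {D : M.Densities →ₗ[ℝ] M.Densities}

/-- The sign of the Leibniz rule is replaced by `twist`, so that χ need not have a parity. -/
theorem component_mul (hD : IsDensityDerivation d μ D) {χ φ : M.Densities} {w w' : ℝ}
    (hχ : HasWeight χ w) (i : M.Index) (x : X) :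
    component (D (χ * φ)) i (w + w' + μ) x
      = component (D χ) i (w + μ) x * component φ i w' x
        + Grassmann.twist d (component χ i w x) * component (D φ) i (w' + μ) x := by
  have key : ∀ q, ∀ χ : M.Densities, HasWeight χ w → HasParity χ q →
      component (D (χ * φ)) i (w + w' + μ) x
        = component (D χ) i (w + μ) x * component φ i w' x
          + Grassmann.twist d (component χ i w x) * component (D φ) i (w' + μ) x := by
    intro q χ hw hq
    rw [hD.leibniz φ hq, component_add, component_smul, (hD.weight hw).component_mul',
      hw.component_mul', Grassmann.twist_of_mem (hq i w x), smul_mul_assoc]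
    congr 3
    · ring
    · congr 1; ring
  have h1 := eq_parityPart_add χ
  have h2 := key 0 _ (hχ.parityPart 0) (hasParity_parityPart 0 χ)
  have h3 := key 1 _ (hχ.parityPart 1) (hasParity_parityPart 1 χ)
  rw [h1, add_mul, map_add, map_add, component_add, component_add, component_add, h2, h3, map_add,
    add_mul, add_mul]
  abel

variable [T2Space X]

/-- Derivations are local. -/
theorem component_eq_zero (hM : M.PositiveJacobians) (hD : IsDensityDerivation d μ D)
    {χ : M.Densities} {w : ℝ} (hχ : HasWeight χ w) {i : M.Index} {x : X} (hx : x ∈ M.dom i)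
    (h : component χ i w =ᶠ[𝓝 x] 0) : component (D χ) i (w + μ) x = 0 := by
  obtain ⟨U, hU, hUo, hxU⟩ := eventually_nhds_iff.1 h
  obtain ⟨ρ, K, hK, hKi, hKU, h0, hρ, hρp, h1⟩ := exists_bump_density hM hx (hUo.mem_nhds hxU)
  -- The bump ρ is supported where χ vanishes. Applying the Leibniz rule to ρχ = 0 at x, where ρ = 1
  -- and χ = 0, leaves Dχ(x) = 0.
  have h2 : ρ * χ = 0 := (hρ.mul hχ).ext (hasWeight_zero _) fun j z hz => by
    rw [hρ.component_mul, component_zero]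
    by_cases hzK : z ∈ K
    · rw [component_congr_chart (ψ := χ) (χ := (0 : M.Densities)) (hKi hzK) hz, component_zero, mul_zero]
      filter_upwards [hUo.mem_nhds (hKU hzK)] with y hy
      rw [hU y hy, component_zero]; rfl
    · rw [h0 j 0 z hzK, zero_mul]
  have h3 := hD.component_mul (φ := χ) (w' := w) hρ i x
  rw [h2, map_zero, component_zero, h.self_of_nhds, h1.self_of_nhds, map_one, one_mul] at h3
  simpa using h3.symm

theorem component_congr (hM : M.PositiveJacobians) (hD : IsDensityDerivation d μ D)
    {χ χ' : M.Densities} {w : ℝ} (hχ : HasWeight χ w) (hχ' : HasWeight χ' w) {i : M.Index} {x : X}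
    (hx : x ∈ M.dom i) (h : component χ i w =ᶠ[𝓝 x] component χ' i w) :
    component (D χ) i (w + μ) x = component (D χ') i (w + μ) x := by
  have h1 := hD.component_eq_zero hM (hχ.sub hχ') hx (by
    filter_upwards [h] with z hz
    rw [component_sub, hz, sub_self]; rfl)
  rwa [map_sub, component_sub, sub_eq_zero] at h1

theorem vanishesOutside (hM : M.PositiveJacobians) (hD : IsDensityDerivation d μ D)
    {χ : M.Densities} {K : Set X} (hK : IsCompact K) (h : VanishesOutside χ K) :
    VanishesOutside (D χ) K := by
  intro i w x hx
  by_cases hxi : x ∈ M.dom i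
  · obtain ⟨s, hs⟩ := exists_eq_sum_weightPart χ
    rw [hs, map_sum, component_sum]
    refine Finset.sum_eq_zero fun a _ => ?_
    by_cases hw : w = a + μ
    · rw [hw]
      refine hD.component_eq_zero hM (hasWeight_weightPart a χ) hxi ?_
      filter_upwards [hK.isClosed.isOpen_compl.mem_nhds hx] with z hz
      rw [component_weightPart, h i a z hz]; rfl
    · exact (hD.weight (hasWeight_weightPart a χ)).component_eq_zero hw i x
  · exact component_of_notMem _ _ hxi

end IsDensityDerivation

variable [T2Space X]

theorem exists_germ (hM : M.PositiveJacobians) {i : M.Index} (w : ℝ) (f : M.Fn i) (x : M.dom i) :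
    ∃ χ : M.Densities, HasWeight χ w ∧ component χ i w =ᶠ[𝓝 x.1] extendZero f.1 ∧
      ∀ p, f ∈ SuperFun.part m (M.chart i) (M.dom i) p → HasParity χ p := by
  obtain ⟨χ, K, -, -, -, -, h1, h2, h3⟩ := exists_density_eventuallyEq hM x.2 w
    (f := extendZero f.1) (fun z hz => smooth (dom_subset i) f hz) Filter.univ_mem
  refine ⟨χ, h1, h2, fun p hp => h3 p fun z => ?_⟩
  by_cases hz : z ∈ M.dom i
  · rw [extendZero_of_mem _ hz]; exact hp _
  · rw [extendZero_of_notMem _ hz]; exact Submodule.zero_mem _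

/-- A density of weight `w` with the coefficient `f` near `x`. -/
noncomputable def germ (hM : M.PositiveJacobians) {i : M.Index} (w : ℝ) (f : M.Fn i)
    (x : M.dom i) : M.Densities := (exists_germ hM w f x).choose

theorem hasWeight_germ (hM : M.PositiveJacobians) {i : M.Index} (w : ℝ) (f : M.Fn i)
    (x : M.dom i) : HasWeight (germ hM w f x) w := (exists_germ hM w f x).choose_spec.1

theorem component_germ (hM : M.PositiveJacobians) {i : M.Index} (w : ℝ) (f : M.Fn i)
    (x : M.dom i) : component (germ hM w f x) i w =ᶠ[𝓝 x.1] extendZero f.1 :=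
  (exists_germ hM w f x).choose_spec.2.1

theorem hasParity_germ (hM : M.PositiveJacobians) {i : M.Index} (w : ℝ) {f : M.Fn i}
    (x : M.dom i) {p : ZMod 2} (hf : f ∈ SuperFun.part m (M.chart i) (M.dom i) p) :
    HasParity (germ hM w f x) p := (exists_germ hM w f x).choose_spec.2.2 p hf

section LocalOp

variable {d : ZMod 2} {μ : ℝ} {D : M.Densities →ₗ[ℝ] M.Densities} (hM : M.PositiveJacobians)
  (hD : IsDensityDerivation d μ D) (i : M.Index)

theorem component_germ_eq (hM : M.PositiveJacobians) (hD : IsDensityDerivation d μ D)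
    {i : M.Index} {w : ℝ} {f : M.Fn i} {χ : M.Densities} (hχ : HasWeight χ w)
    {x : X} (hx : x ∈ M.dom i) (h : component χ i w =ᶠ[𝓝 x] extendZero f.1) :
    component (D (germ hM w f ⟨x, hx⟩)) i (w + μ) x = component (D χ) i (w + μ) x :=
  hD.component_congr hM (hasWeight_germ hM w f _) hχ hx
    ((component_germ hM w f ⟨x, hx⟩).trans h.symm)

/-- The local expression of a derivation, on densities of weight `w`. -/
noncomputable def localOp (w : ℝ) : M.Fn i →ₗ[ℝ] M.Fn i where
  toFun f := ⟨fun x => component (D (germ hM w f x)) i (w + μ) x,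
    (mem_iff (dom_subset i)).2 fun x => by
      -- The germ is chosen anew at every point. By locality the values near x agree with those of
      -- the single density D(germ at x), which is smooth.
      refine smoothAt_congr x.2 (component_smooth (D (germ hM w f x)) (w + μ) x.2) ?_
      filter_upwards [(component_germ hM w f x).eventuallyEq_nhds, (M.dom i).2.mem_nhds x.2]
        with z hz hzi
      rw [extendZero_of_mem _ hzi]
      exact (component_germ_eq hM hD (hasWeight_germ hM w f x) hzi hz).symm⟩
  map_add' f g := ext' fun x hx => by
    change component (D (germ hM w (f + g) ⟨x, hx⟩)) i (w + μ) x = component _ i _ x + component _ i _ x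
    rw [← component_add, ← map_add]
    refine component_germ_eq hM hD ((hasWeight_germ hM w f _).add (hasWeight_germ hM w g _)) hx ?_
    filter_upwards [component_germ hM w f ⟨x, hx⟩, component_germ hM w g ⟨x, hx⟩] with z h1 h2
    rw [component_add, h1, h2]
    exact (congrFun (extendZero_add f.1 g.1) z).symm
  map_smul' r f := ext' fun x hx => by
    change component (D (germ hM w (r • f) ⟨x, hx⟩)) i (w + μ) x = r • component _ i _ x
    rw [← component_smul, ← map_smul]
    refine component_germ_eq hM hD ((hasWeight_germ hM w f _).smul r) hx ?_
    filter_upwards [component_germ hM w f ⟨x, hx⟩] with z h1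
    rw [component_smul, h1]
    exact (congrFun (extendZero_smul r f.1) z).symm

theorem localOp_eq {w : ℝ} {f : M.Fn i} {χ : M.Densities} (hχ : HasWeight χ w)
    {x : X} (hx : x ∈ M.dom i) (h : component χ i w =ᶠ[𝓝 x] extendZero f.1) :
    (localOp hM hD i w f).1 ⟨x, hx⟩ = component (D χ) i (w + μ) x :=
  component_germ_eq hM hD hχ hx h

theorem localOp_mem (w : ℝ) {f : M.Fn i} {p : ZMod 2}
    (hf : f ∈ SuperFun.part m (M.chart i) (M.dom i) p) :
    localOp hM hD i w f ∈ SuperFun.part m (M.chart i) (M.dom i) (p + d) := fun x =>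
  hD.parity (hasParity_germ hM w x hf) i _ _

theorem localOp_mul (w w' : ℝ) (f g : M.Fn i) (x : M.dom i) :
    (localOp hM hD i (w + w') (f * g)).1 x
      = (localOp hM hD i w f).1 x * g.1 x
        + Grassmann.twist d (f.1 x) * (localOp hM hD i w' g).1 x := by
  have hf := component_germ hM w f x
  have hg := component_germ hM w' g x
  rw [localOp_eq hM hD i ((hasWeight_germ hM w f x).mul (hasWeight_germ hM w' g x)) x.2,
    hD.component_mul (hasWeight_germ hM w f x), hf.self_of_nhds,
    hg.self_of_nhds, extendZero_of_mem _ x.2, extendZero_of_mem _ x.2]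
  · rfl
  · filter_upwards [hf, hg] with z h1 h2
    rw [(hasWeight_germ hM w f x).component_mul, h1, h2]
    exact (congrFun (extendZero_mul f.1 g.1) z).symm

/-- In weight zero the local operator, evaluated at a point, is a superderivation over evaluation.
It is therefore a combination of partial derivatives. -/
theorem localOp_zero_eq_sum (f : M.Fn i) (x : M.dom i) :
    (localOp hM hD i 0 f).1 x = ∑ A, (localOp hM hD i 0 (coord m (M.chart i) (M.dom i) A)).1 x *
      (SuperFun.D (dom_subset i) A f).1 x := by
  refine pointDerivation_eq_sum (dom_subset i) (ev x) d
    ((ev x).toLinearMap.comp (localOp hM hD i 0)) (x₀ := x) (fun _ => rfl) (fun p f hf => hf x)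
    (fun f hf => ?_) (fun f g => ?_) (fun f hf => ?_) (fun A => ?_) f
  · have h1 := hf.self_of_nhds
    rw [extendZero_of_mem _ x.2] at h1
    exact h1
  · have h1 := localOp_mul hM hD i 0 0 f g x
    rw [add_zero] at h1
    exact h1
  · refine (localOp_eq hM hD i (hasWeight_germ hM 0 f x) x.2 (component_germ hM 0 f x)).trans ?_
    exact hD.component_eq_zero hM (hasWeight_germ hM 0 f x) x.2 ((component_germ hM 0 f x).trans hf)
  · exact localOp_mem hM hD i 0 (coord_mem A) x

/-- The Leibniz rule for f (Dx)^w as the product of f in weight 0 and (Dx)^w reduces everything to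
weight zero and to the value on (Dx)^w. -/
theorem localOp_eq_sum (w : ℝ) (f : M.Fn i) (x : M.dom i) :
    (localOp hM hD i w f).1 x = ∑ A, (localOp hM hD i 0 (coord m (M.chart i) (M.dom i) A)).1 x *
      (SuperFun.D (dom_subset i) A f).1 x + (localOp hM hD i w 1).1 x * f.1 x := by
  have h1 := localOp_mul hM hD i 0 w f 1 x
  rw [zero_add, mul_one, localOp_zero_eq_sum] at h1
  rw [h1]
  congr 1
  · exact mul_one _
  · have h2 := localOp_mem hM hD i w (f := 1) isSupercommutative.one_mem x
    rw [zero_add] at h2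
    exact (Grassmann.mul_comm_twist h2 _).symm

/-- The Leibniz rule for (Dx)^w (Dx)^w' gives additivity in the weight. An additive function of w
need not be linear, which is why (3) assumes continuity. -/
theorem localOp_one_add (w w' : ℝ) :
    localOp hM hD i (w + w') 1 = localOp hM hD i w 1 + localOp hM hD i w' 1 := ext' fun x hx => by
  have h1 := localOp_mul hM hD i w w' 1 1 ⟨x, hx⟩
  rw [mul_one] at h1
  rw [h1, show Grassmann.twist d ((1 : M.Fn i).1 ⟨x, hx⟩) = 1 from map_one (Grassmann.twist d),
    show (1 : M.Fn i).1 ⟨x, hx⟩ = 1 from rfl, mul_one, one_mul]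
  rfl

/-- The local expression of a derivation. -/
theorem component_derivation {w : ℝ} {χ : M.Densities} (hχ : HasWeight χ w) {x : X}
    (hx : x ∈ M.dom i) :
    component (D χ) i (w + μ) x
      = ∑ A, (localOp hM hD i 0 (coord m (M.chart i) (M.dom i) A)).1 ⟨x, hx⟩ *
          superDeriv (M.chart i) A (component χ i w) x
        + (localOp hM hD i w 1).1 ⟨x, hx⟩ * component χ i w x := by
  have h1 := localOp_eq hM hD i (f := (χ.1 i).coeff w) hχ hx (Filter.EventuallyEq.refl _ _)
  rw [← h1, localOp_eq_sum, component_apply χ w hx]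
  simp only [D_apply (dom_subset i) _ _ hx]
  rfl

end LocalOp

end SuperManifold

/-! ### The divergence of a derivation -/

namespace SuperManifold

open SuperFun Topology

variable {n m : ℕ} {X : Type u} [TopologicalSpace X] {M : SuperManifold.{u, v} n m X}

/-- The local expression of the divergence. -/
noncomputable def divFn {i : M.Index} (d : ZMod 2) (Y : Fin n ⊕ Fin m → M.Fn i) (C : M.Fn i) :
    M.Fn i :=
  C - ∑ A, sgn (coordParity A * (coordParity A + d)) • SuperFun.D (dom_subset i) A (Y A)

theorem divFn_mem {i : M.Index} {d : ZMod 2} {Y : Fin n ⊕ Fin m → M.Fn i} {C : M.Fn i}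
    (hY : ∀ A, Y A ∈ SuperFun.part m (M.chart i) (M.dom i) (coordParity A + d))
    (hC : C ∈ SuperFun.part m (M.chart i) (M.dom i) d) :
    divFn d Y C ∈ SuperFun.part m (M.chart i) (M.dom i) d := by
  refine Submodule.sub_mem _ hC (Submodule.sum_mem _ fun A _ => Submodule.smul_mem _ _ ?_)
  have h1 := D_mem (dom_subset i) A (hY A)
  rwa [show coordParity A + d + coordParity A = d by
    generalize coordParity A = p; clear * -; revert p d; decide] at h1

variable [T2Space X]

/-- Integration by parts for a first order operator. -/
theorem chartIntegral_eq_of_derivation {i : M.Index} {d : ZMod 2}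
    {Y : Fin n ⊕ Fin m → M.Fn i} {C : M.Fn i}
    (hY : ∀ A, Y A ∈ SuperFun.part m (M.chart i) (M.dom i) (coordParity A + d))
    {χ φ : M.Densities} {w : ℝ} {K : Set X} (hK : IsCompact K) (hKi : K ⊆ M.dom i)
    (h0 : VanishesOutside χ K)
    (hφ : ∀ x (hx : x ∈ M.dom i), component φ i 1 x
      = ∑ A, (Y A).1 ⟨x, hx⟩ * superDeriv (M.chart i) A (component χ i w) x
        + C.1 ⟨x, hx⟩ * component χ i w x) :
    chartIntegral i φ
      = chartInt (M.chart i) fun x => extendZero (divFn d Y C).1 x * component χ i w x := by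
  have hs := dom_subset i
  set F : M.Fn i := (χ.1 i).coeff w with hF
  have hFx : ∀ x (hx : x ∈ M.dom i), F.1 ⟨x, hx⟩ = component χ i w x := fun x hx =>
    (component_apply χ w hx).symm
  have hF0 : ∀ x : M.dom i, x.1 ∉ K → F.1 x = 0 := fun x hx => (hFx x.1 x.2).trans (h0 i w x.1 hx)
  have h0' : ∀ (Z : M.Fn i), ∀ x : M.dom i, x.1 ∉ K → (Z * F).1 x = 0 := fun Z x hx => by
    rw [← ev_apply, map_mul, ev_apply, ev_apply, hF0 x hx, mul_zero]
  have hD0 : ∀ A, ∀ x : M.dom i, x.1 ∉ K → (SuperFun.D hs A (Y A * F)).1 x = 0 := fun A x hx => by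
    rw [D_apply hs _ _ x.2, superDeriv_congr (hs x.2) (extendZero_eventually_zero hK (h0' _) hx)]
    rcases A with b | β
    · refine Grassmann.ext_coeff fun I => ?_
      rw [superDeriv_inl, Grassmann.coeff_pd]
      simp
    · exact map_zero (Grassmann.oddDeriv β)
  -- The Leibniz rule read backwards: Y ∂F is a signed derivative of YF, which integrates to zero,
  -- minus a term without derivatives of F.
  have key : ∀ A, Y A * SuperFun.D hs A F
      = sgn (coordParity A * (coordParity A + d)) • SuperFun.D hs A (Y A * F)
        - sgn (coordParity A * (coordParity A + d)) • SuperFun.D hs A (Y A) * F := fun A => by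
    rw [(isSuperderivation_D hs A).mul F (hY A), smul_add, smul_smul, sgn_mul_self, one_smul,
      smul_mul_assoc]
    abel
  have h1 : ∑ A, Y A * SuperFun.D hs A F + C * F
      = divFn d Y C * F
        + ∑ A, sgn (coordParity A * (coordParity A + d)) • SuperFun.D hs A (Y A * F) := by
    rw [Finset.sum_congr rfl fun A _ => key A, Finset.sum_sub_distrib, divFn, sub_mul,
      Finset.sum_mul]
    abel
  rw [chartIntegral_eq_chartInt]
  have h2 : chartInt (M.chart i) (component φ i 1) = chartInt (M.chart i) fun x =>
      extendZero (divFn d Y C * F).1 x + ∑ A, sgn (coordParity A * (coordParity A + d)) •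
        extendZero (SuperFun.D hs A (Y A * F)).1 x := by
    refine chartInt_congr fun x hx => ?_
    rw [hφ x hx]
    simp only [extendZero_of_mem _ (show x ∈ M.dom i from hx)]
    have h3 := congrArg (ev (⟨x, hx⟩ : M.dom i)) h1
    simp only [map_add, map_sum, map_mul, map_smul, ev_apply, D_apply hs _ _ (show x ∈ M.dom i from hx)]
      at h3
    rw [← hFx x hx]
    exact h3
  have h4 : ∀ A ∈ Finset.univ, CompactSmooth (M.chart i) fun x =>
      sgn (coordParity A * (coordParity A + d)) •
        extendZero (SuperFun.D hs A (Y A * F)).1 x := fun A _ =>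
    (compactSmooth_extendZero hs (Subtype.property _) hK hKi (hD0 A)).mapLinear
      (sgn (coordParity A * (coordParity A + d)) • LinearMap.id)
  rw [h2, (compactSmooth_extendZero hs (Subtype.property _) hK hKi (h0' _)).chartInt_add
    (CompactSmooth.sum _ h4), CompactSmooth.chartInt_sum _ h4, Finset.sum_eq_zero, add_zero]
  · refine chartInt_congr fun x hx => ?_
    rw [extendZero_of_mem _ (show x ∈ M.dom i from hx), extendZero_of_mem _ (show x ∈ M.dom i from hx),
      ← hFx x hx]
    rfl
  · intro A _
    rw [CompactSmooth.chartInt_smul, chartInt_D hs _ hK hKi (h0' _), mul_zero]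

theorem HasWeight.sum {ι : Type*} {s : Finset ι} {f : ι → M.Densities} {w : ℝ}
    (h : ∀ k ∈ s, HasWeight (f k) w) : HasWeight (∑ k ∈ s, f k) w :=
  hasWeight_iff.2 fun i w' hw x _ => by
    rw [component_sum]; exact Finset.sum_eq_zero fun k hk => (h k hk).component_eq_zero hw i x

/-- The pieces of a decomposition need not have the weight of ψ. Projecting each piece to weight w
keeps the sum and makes every chart integral zero. -/
theorem integral_eq_zero_of_hasWeight (hM : M.PositiveJacobians) {ψ : M.Densities} {w : ℝ}
    (hψ : HasWeight ψ w) (hw : w ≠ 1) (hc : CompactlySupported ψ) : integral ψ = 0 := by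
  obtain ⟨K, hK, h0⟩ := hc
  obtain ⟨N, i, ρ, L, hL, h⟩ := exists_integral_eq_sum hM hK
  obtain ⟨h1, -⟩ := h ψ h0
  have h2 : ψ = ∑ k, weightPart w (ρ k * ψ) := by
    refine hψ.ext (HasWeight.sum fun k _ => hasWeight_weightPart _ _) fun i x hx => ?_
    conv_lhs => rw [h1, component_sum]
    rw [component_sum]
    simp only [component_weightPart]
  refine HasIntegral.integral_eq hM ⟨N, i, _, fun k => ⟨L k, (hL k).1, (hL k).2.1,
    ((hL k).2.2.mul_right ψ).weightPart w⟩, h2, ?_⟩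
  refine (Finset.sum_eq_zero fun k _ => ?_).symm
  have h3 : component (weightPart w (ρ k * ψ)) (i k) 1 = fun _ => 0 := funext fun x =>
    (hasWeight_weightPart w _).component_eq_zero hw.symm _ x
  rw [chartIntegral_eq_chartInt, h3, chartInt]
  simp [Grassmann.top]

theorem CompactlySupported.mul_left {χ : M.Densities} (h : CompactlySupported χ) (ψ : M.Densities) :
    CompactlySupported (ψ * χ) := by
  obtain ⟨K, hK, h0⟩ := h; exact ⟨K, hK, h0.mul_left ψ⟩

theorem CompactlySupported.mul_right {ψ : M.Densities} (h : CompactlySupported ψ) (χ : M.Densities) :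
    CompactlySupported (ψ * χ) := by
  obtain ⟨K, hK, h0⟩ := h; exact ⟨K, hK, h0.mul_right χ⟩

theorem CompactlySupported.add {ψ χ : M.Densities} (h : CompactlySupported ψ)
    (h' : CompactlySupported χ) : CompactlySupported (ψ + χ) := by
  obtain ⟨K, hK, h0⟩ := h
  obtain ⟨L, hL, h1⟩ := h'
  exact ⟨K ∪ L, hK.union hL,
    (h0.mono Set.subset_union_left).add (h1.mono Set.subset_union_right)⟩

theorem CompactlySupported.smul {ψ : M.Densities} (h : CompactlySupported ψ) (r : ℝ) :
    CompactlySupported (r • ψ) := by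
  obtain ⟨K, hK, h0⟩ := h; exact ⟨K, hK, h0.smul r⟩

theorem integral_sum (hM : M.PositiveJacobians) {ι : Type*} (s : Finset ι) {f : ι → M.Densities}
    (h : ∀ k ∈ s, CompactlySupported (f k)) : integral (∑ k ∈ s, f k) = ∑ k ∈ s, integral (f k) := by
  classical
  have key : CompactlySupported (∑ k ∈ s, f k) ∧ integral (∑ k ∈ s, f k) = ∑ k ∈ s, integral (f k) := by
    induction s using Finset.induction_on with
    | empty =>
      simp only [Finset.sum_empty]
      exact ⟨⟨∅, isCompact_empty, fun i w x _ => component_zero i w x⟩, integral_zero hM⟩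
    | insert a s ha ih =>
      obtain ⟨h1, h2⟩ := ih fun k hk => h k (Finset.mem_insert_of_mem hk)
      have h3 := h a (Finset.mem_insert_self _ _)
      simp only [Finset.sum_insert ha]
      exact ⟨h3.add h1, by rw [integral_add hM h3 h1, h2]⟩
  exact key.2

section Divergence

variable {d : ZMod 2} {μ : ℝ} {D : M.Densities →ₗ[ℝ] M.Densities} (hM : M.PositiveJacobians)
  (hD : IsDensityDerivation d μ D)

/-- The divergence of a derivation in a chart. -/
noncomputable def localDiv (i : M.Index) : M.Fn i :=
  divFn d (fun A => localOp hM hD i 0 (coord m (M.chart i) (M.dom i) A)) (localOp hM hD i (1 - μ) 1)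

theorem localDiv_mem (i : M.Index) :
    localDiv hM hD i ∈ SuperFun.part m (M.chart i) (M.dom i) d := by
  refine divFn_mem (fun A => localOp_mem hM hD i 0 (coord_mem A)) ?_
  have h := localOp_mem hM hD i (1 - μ) (f := 1) isSupercommutative.one_mem
  rwa [zero_add] at h

theorem chartIntegral_derivation {i : M.Index} {χ : M.Densities} {K : Set X} (hK : IsCompact K)
    (hKi : K ⊆ M.dom i) (h0 : VanishesOutside χ K) (hχ : HasWeight χ (1 - μ)) :
    chartIntegral i (D χ)
      = chartInt (M.chart i) fun x => extendZero (localDiv hM hD i).1 x * component χ i (1 - μ) x := by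
  refine chartIntegral_eq_of_derivation (fun A => localOp_mem hM hD i 0 (coord_mem A)) hK hKi h0
    fun x hx => ?_
  have h1 := component_derivation hM hD i hχ hx
  rwa [sub_add_cancel] at h1

theorem integral_germ_localDiv_mul {i : M.Index} {x : M.dom i} {χ : M.Densities} {U K : Set X}
    (hU : ∀ z ∈ U, component (germ hM μ (localDiv hM hD i) x) i μ z
      = extendZero (localDiv hM hD i).1 z) (hKU : K ⊆ U) (hK : IsCompact K)
    (hKi : K ⊆ M.dom i) (h0 : VanishesOutside χ K) (hχ : HasWeight χ (1 - μ)) :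
    integral (germ hM μ (localDiv hM hD i) x * χ) = integral (D χ) := by
  rw [integral_eq_chartIntegral hM hK hKi (h0.mul_left _),
    integral_eq_chartIntegral hM hK hKi (hD.vanishesOutside hM hK h0),
    chartIntegral_derivation hM hD hK hKi h0 hχ, chartIntegral_eq_chartInt]
  congr 1
  funext z
  rw [(hasWeight_germ hM μ _ x).component_mul']
  by_cases hz : z ∈ K
  · rw [hU z (hKU hz)]
  · rw [h0 i _ z hz, mul_zero, mul_zero]

/-- Near x both local divergences represent the functional χ ↦ ∫Dχ on densities supported near x.
Nondegeneracy forces them to be the coefficients of one density, so no transformation formula has to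
be computed. -/
theorem localDiv_compatible {i j : M.Index} {x : X} (hi : x ∈ M.dom i) (hj : x ∈ M.dom j) :
    (localDiv hM hD j).1 ⟨x, hj⟩ =
      (M.change i j (SuperFun.res inf_le_left (localDiv hM hD i))).1 ⟨x, hi, hj⟩ *
        (Grassmann.pow (M.jacobian i j x) μ : Grassmann m) := by
  set G := germ hM μ (localDiv hM hD i) ⟨x, hi⟩
  set G' := germ hM μ (localDiv hM hD j) ⟨x, hj⟩
  have hG : HasWeight G μ := hasWeight_germ hM μ _ _
  have hG' : HasWeight G' μ := hasWeight_germ hM μ _ _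
  have hGi : component G i μ =ᶠ[𝓝 x] extendZero (localDiv hM hD i).1 := component_germ hM μ _ ⟨x, hi⟩
  have hGj : component G' j μ =ᶠ[𝓝 x] extendZero (localDiv hM hD j).1 := component_germ hM μ _ ⟨x, hj⟩
  obtain ⟨U, hU, hUo, hxU⟩ := eventually_nhds_iff.1 (hGi.and hGj)
  have h1 : component (G - G') j μ x = 0 := by
    refine component_eq_zero_of_chartIntegral_mul hM (hG.sub hG')
      (U := U ∩ (M.dom i ∩ M.dom j)) (hUo.inter ((M.dom i).2.inter (M.dom j).2))
      (fun z hz => hz.2.2) (fun χ K hK hKU h0 hχ => ?_) x ⟨hxU, hi, hj⟩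
    have hc : CompactlySupported χ := ⟨K, hK, h0⟩
    have h2 := integral_germ_localDiv_mul hM hD (x := ⟨x, hi⟩) (fun z hz => (hU z hz).1)
      (fun z hz => (hKU hz).1) hK (fun z hz => (hKU hz).2.1) h0 hχ
    have h3 := integral_germ_localDiv_mul hM hD (x := ⟨x, hj⟩) (fun z hz => (hU z hz).2)
      (fun z hz => (hKU hz).1) hK (fun z hz => (hKU hz).2.2) h0 hχ
    have h4 : (G - G') * χ = G * χ + (-1 : ℝ) • (G' * χ) := by
      rw [sub_mul, neg_one_smul, sub_eq_add_neg]
    rw [h4, integral_add hM (hc.mul_left G) ((hc.mul_left G').smul _), integral_smul hM _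
      (hc.mul_left G'), h2, h3]
    ring
  rw [component_sub, sub_eq_zero, hGj.self_of_nhds, extendZero_of_mem _ hj] at h1
  rw [← h1]
  refine component_eq_trans G (W := M.dom i ⊓ M.dom j) (fun _ h => h.1) (fun _ h => h.2) μ ⟨hi, hj⟩ ?_
  refine (extendZero_eventuallyEq (W := M.dom i ⊓ M.dom j) ⟨hi, hj⟩ fun y => ?_).trans hGi.symm
  rw [extendZero_of_mem _ (show y.1 ∈ M.dom i from y.2.1)]
  rfl

/-- The divergence of a derivation: the formal adjoint of a derivation applied to `1`. -/
theorem exists_divergence (hM : M.PositiveJacobians) (hD : IsDensityDerivation d μ D) :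
    ∃ g : M.Densities, HasWeight g μ ∧ HasParity g d ∧
    ∀ χ, CompactlySupported χ → integral (g * χ) = integral (D χ) := by
  classical
  let g : M.Densities := ofFamily {μ} (fun i w => if w = μ then localDiv hM hD i else 0)
    (fun i w hw => if_neg (by simpa using hw)) fun i j w x hi hj => by
      by_cases hw : w = μ
      · subst hw
        simp only [if_pos]
        exact localDiv_compatible hM hD hi hj
      · simp only [if_neg hw, map_zero]
        exact (zero_mul _).symm
  have hgμ : ∀ i, ∀ x (hx : x ∈ M.dom i), component g i μ x = (localDiv hM hD i).1 ⟨x, hx⟩ :=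
    fun i x hx => by rw [component_ofFamily _ _ hx, if_pos rfl]
  have hgw : HasWeight g μ := hasWeight_iff.2 fun i w hw x hx => by
    rw [component_ofFamily _ _ hx, if_neg hw]; rfl
  refine ⟨g, hgw, fun i w x => ?_, fun χ hχ => ?_⟩
  · by_cases hw : w = μ
    · subst hw
      by_cases hx : x ∈ M.dom i
      · rw [hgμ i x hx]; exact localDiv_mem hM hD i _
      · rw [component_of_notMem _ _ hx]; exact Submodule.zero_mem _
    · rw [hgw.component_eq_zero hw]; exact Submodule.zero_mem _
  · have key : ∀ i, ∀ χ : M.Densities, HasWeight χ (1 - μ) → ∀ K, IsCompact K → K ⊆ M.dom i →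
        VanishesOutside χ K → integral (g * χ) = integral (D χ) := by
      intro i χ hχ K hK hKi h0
      rw [integral_eq_chartIntegral hM hK hKi (h0.mul_left _),
        integral_eq_chartIntegral hM hK hKi (hD.vanishesOutside hM hK h0),
        chartIntegral_derivation hM hD hK hKi h0 hχ, chartIntegral_eq_chartInt]
      congr 1
      funext z
      rw [hgw.component_mul']
      by_cases hz : z ∈ M.dom i
      · rw [hgμ i z hz, extendZero_of_mem _ hz]
      · rw [h0 i _ z fun h => hz (hKi h), mul_zero, mul_zero]
    obtain ⟨K, hK, h0⟩ := hχ
    obtain ⟨s, hs⟩ := exists_eq_sum_weightPart χ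
    have hcw : ∀ w, CompactlySupported (weightPart w χ) := fun w => ⟨K, hK, h0.weightPart w⟩
    have hDw : ∀ w, CompactlySupported (D (weightPart w χ)) := fun w =>
      ⟨K, hK, hD.vanishesOutside hM hK (h0.weightPart w)⟩
    rw [hs, Finset.mul_sum, map_sum, integral_sum hM s fun w _ => (hcw w).mul_left g,
      integral_sum hM s fun w _ => hDw w]
    refine Finset.sum_congr rfl fun w _ => ?_
    -- Since D shifts the weight by μ and g has weight μ, only the component of weight 1 − μ
    -- contributes to either side.
    by_cases hw : w = 1 - μ
    · subst hw
      obtain ⟨N, i, ρ, L, hL, h⟩ := exists_integral_eq_sum hM hK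
      obtain ⟨h1, -⟩ := h _ (h0.weightPart (1 - μ))
      have h2 : weightPart (1 - μ) χ = ∑ k, weightPart (1 - μ) (ρ k * weightPart (1 - μ) χ) := by
        refine (hasWeight_weightPart _ _).ext (HasWeight.sum fun k _ => hasWeight_weightPart _ _)
          fun i x hx => ?_
        conv_lhs => rw [h1, component_sum]
        rw [component_sum]
        simp only [component_weightPart]
      have h3 : ∀ k, VanishesOutside (weightPart (1 - μ) (ρ k * weightPart (1 - μ) χ)) (L k) :=
        fun k => ((hL k).2.2.mul_right _).weightPart _
      rw [h2, Finset.mul_sum, map_sum, integral_sum hM _ fun k _ =>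
          CompactlySupported.mul_left ⟨L k, (hL k).2.1, h3 k⟩ g,
        integral_sum hM _ fun k _ => ⟨L k, (hL k).2.1, hD.vanishesOutside hM (hL k).2.1 (h3 k)⟩]
      exact Finset.sum_congr rfl fun k _ => key (i k) _ (hasWeight_weightPart _ _) (L k) (hL k).2.1
        (hL k).1 (h3 k)
    · rw [integral_eq_zero_of_hasWeight hM (hgw.mul (hasWeight_weightPart w χ))
          (fun h => hw (by linarith)) ((hcw w).mul_left g),
        integral_eq_zero_of_hasWeight hM (hD.weight (hasWeight_weightPart w χ))
          (fun h => hw (by linarith)) (hDw w)]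

end Divergence

end SuperManifold

/-! ### Symmetric biderivations of a supercommutative algebra and their generators -/

section

variable {A : Type*} [Ring A] [Algebra ℝ A]

/-- A symmetric biderivation of parity `ε`. -/
structure IsBiderivation (P : ZMod 2 → Submodule ℝ A) (ε : ZMod 2) (B : A →ₗ[ℝ] A →ₗ[ℝ] A) :
    Prop where
  parity : ∀ {x y p q}, x ∈ P p → y ∈ P q → B x y ∈ P (p + q + ε)
  symm : ∀ {x y p q}, x ∈ P p → y ∈ P q → B x y = sgn (p * q) • B y x
  leibniz : ∀ {x y p q} (z : A), x ∈ P p → y ∈ P q →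
    B x (y * z) = B x y * z + sgn ((p + ε) * q) • (y * B x z)

/-- A nondegenerate trace functional, defined on an ideal `C` of test elements. -/
structure IsTestIntegral (P : ZMod 2 → Submodule ℝ A) (C : Submodule ℝ A) (I : A → ℝ) : Prop where
  decomp : ∀ x, ∃ x₀ ∈ P 0, ∃ x₁ ∈ P 1, x = x₀ + x₁
  decomp_test : ∀ x ∈ C, ∃ x₀ ∈ P 0, x₀ ∈ C ∧ ∃ x₁ ∈ P 1, x₁ ∈ C ∧ x = x₀ + x₁
  mul_left : ∀ {c}, c ∈ C → ∀ a, a * c ∈ C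
  mul_right : ∀ {c}, c ∈ C → ∀ a, c * a ∈ C
  add : ∀ {x y}, x ∈ C → y ∈ C → I (x + y) = I x + I y
  smul : ∀ (r : ℝ) {x}, x ∈ C → I (r • x) = r * I x
  eq_zero : ∀ g, (∀ c ∈ C, I (g * c) = 0) → g = 0
  exists_unit : ∀ c ∈ C, ∃ s ∈ C, c = s * c

variable {P : ZMod 2 → Submodule ℝ A} {ε : ZMod 2} {B : A →ₗ[ℝ] A →ₗ[ℝ] A} {C : Submodule ℝ A}
  {I : A → ℝ}

namespace IsTestIntegral

theorem sub (h : IsTestIntegral P C I) {x y : A} (hx : x ∈ C) (hy : y ∈ C) :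
    I (x - y) = I x - I y := by
  rw [sub_eq_add_neg, ← neg_one_smul ℝ y, h.add hx (C.smul_mem _ hy), h.smul _ hy]
  ring

theorem ext (h : IsTestIntegral P C I) {g g' : A} (hg : ∀ c ∈ C, I (g * c) = I (g' * c)) :
    g = g' := by
  refine sub_eq_zero.1 (h.eq_zero _ fun c hc => ?_)
  rw [sub_mul, h.sub (h.mul_left hc g) (h.mul_left hc g'), hg c hc, sub_self]

/-- A property which is additive may be checked on homogeneous elements. -/
theorem induction (h : IsTestIntegral P C I) {Q : A → Prop} (hadd : ∀ x y, Q x → Q y → Q (x + y))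
    (hQ : ∀ p, ∀ x ∈ P p, Q x) (x : A) : Q x := by
  obtain ⟨x₀, h0, x₁, h1, rfl⟩ := h.decomp x
  exact hadd _ _ (hQ 0 _ h0) (hQ 1 _ h1)

theorem induction_test (h : IsTestIntegral P C I) {Q : A → Prop}
    (hadd : ∀ x y, x ∈ C → y ∈ C → Q x → Q y → Q (x + y))
    (hQ : ∀ p, ∀ x ∈ P p, x ∈ C → Q x) {x : A} (hx : x ∈ C) : Q x := by
  obtain ⟨x₀, h0, h0c, x₁, h1, h1c, rfl⟩ := h.decomp_test x hx
  exact hadd _ _ h0c h1c (hQ 0 _ h0 h0c) (hQ 1 _ h1 h1c)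

end IsTestIntegral

namespace IsBiderivation

/-- The defect of the Leibniz rule with respect to the first argument. -/
theorem map_mul (hI : IsTestIntegral P C I) (hP : IsSupercommutative P)
    (hB : IsBiderivation P ε B) {x y : A} {p q : ZMod 2}
    (hp : x ∈ P p) (hq : y ∈ P q) (z : A) :
    B (x * y) z = B x (y * z) + sgn (p * q) • B y (x * z) - (2 : ℝ) • (B x y * z) := by
  refine hI.induction (Q := fun z => B (x * y) z = B x (y * z) + sgn (p * q) • B y (x * z)
    - (2 : ℝ) • (B x y * z)) (fun z z' h h' => ?_) (fun r z hr => ?_) z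
  · simp only [mul_add, map_add, smul_add, h, h']
    abel
  · rw [hB.symm (hP.mul_mem hp hq) hr, hB.leibniz y hr hp, hB.leibniz z hp hq, hB.leibniz z hq hp,
      hB.symm hr hp, hB.symm hr hq, hB.symm hq hp, smul_mul_assoc, smul_mul_assoc, mul_smul_comm,
      hP.comm (hB.parity hp hr) hq]
    simp only [smul_add, smul_smul, ← sgn_add, two_smul]
    -- The product is moved to the second slot by symmetry, expanded there, and the terms are moved
    -- back. These parity identities say that all signs collapse.
    have e1 : (p + q) * r + (r * p + (p + r + ε) * q) = (p + ε) * q := by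
      clear * -; revert p q r ε; decide
    have e2 : (p + q) * r + ((r + ε) * p + r * q) = p * q + (q + ε) * p := by
      clear * -; revert p q r ε; decide
    have e3 : p * q + q * p = 0 := by clear * -; revert p q; decide
    simp only [e1, e2, e3, sgn_zero, one_smul]
    abel

theorem map_one (hI : IsTestIntegral P C I) (hP : IsSupercommutative P)
    (hB : IsBiderivation P ε B) (z : A) : B 1 z = 0 := by
  refine hI.induction (Q := fun z => B 1 z = 0) (fun x y hx hy => ?_) (fun q z hq => ?_) z
  · rw [map_add, hx, hy, add_zero]
  · have h1 : B z 1 = B z 1 + B z 1 := by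
      conv_lhs => rw [← mul_one (1 : A)]
      rw [hB.leibniz 1 hq hP.one_mem, mul_zero, sgn_zero, one_smul, mul_one, one_mul]
    rw [hB.symm hP.one_mem hq, left_eq_add.1 h1, smul_zero]

variable {Δ : A →ₗ[ℝ] A}

/-- The operator adjoint to a biderivation is self-adjoint. -/
theorem selfAdjoint_of_adjoint (hI : IsTestIntegral P C I) (hP : IsSupercommutative P)
    (hB : IsBiderivation P ε B) (hBC : ∀ x, ∀ c ∈ C, B x c ∈ C)
    (hΔ : ∀ x, ∀ c ∈ C, I (Δ x * c) = -1 / 2 * I (B x c)) (hp : ∀ p, ∀ x ∈ P p, Δ x ∈ P (p + ε))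
    {x y : A} {p : ZMod 2} (hx : x ∈ P p) (hxC : x ∈ C) (hyC : y ∈ C) :
    I (Δ x * y) = sgn (p * ε) * I (x * Δ y) := by
  refine hI.induction_test (Q := fun y => I (Δ x * y) = sgn (p * ε) * I (x * Δ y))
    (fun y z hy hz h h' => ?_) (fun q y hq hy => ?_) hyC
  · rw [mul_add, map_add, mul_add, hI.add (hI.mul_left hy _) (hI.mul_left hz _),
      hI.add (hI.mul_right hxC _) (hI.mul_right hxC _), h, h', mul_add]
  · rw [hP.comm hx (hp q y hq), hI.smul _ (hI.mul_left hxC _), hΔ x y hy, hΔ y x hxC, hB.symm hq hx,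
      hI.smul _ (hBC x y hy)]
    have e : sgn (p * ε) * sgn (p * (q + ε)) * sgn (q * p) = 1 := by
      rw [← sgn_add, ← sgn_add, show p * ε + p * (q + ε) + q * p = 0 by
        clear * -; revert p q ε; decide, sgn_zero]
    linear_combination (-(-1 / 2 * I (B x y))) * e

/-- A biderivation annihilates 1, so Δ1 pairs to zero with every test element. -/
theorem map_one_of_adjoint (hI : IsTestIntegral P C I) (hP : IsSupercommutative P)
    (hB : IsBiderivation P ε B) (hΔ : ∀ x, ∀ c ∈ C, I (Δ x * c) = -1 / 2 * I (B x c)) :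
    Δ 1 = 0 := by
  have h0 : I 0 = 0 := by simpa using hI.smul 0 C.zero_mem
  refine hI.eq_zero _ fun c hc => ?_
  rw [hΔ 1 c hc, hB.map_one hI hP, h0, mul_zero]

/-- The operator adjoint to a biderivation generates it. -/
theorem generates_of_adjoint (hI : IsTestIntegral P C I) (hP : IsSupercommutative P)
    (hB : IsBiderivation P ε B) (hBC : ∀ x, ∀ c ∈ C, B x c ∈ C)
    (hΔ : ∀ x, ∀ c ∈ C, I (Δ x * c) = -1 / 2 * I (B x c)) (hp : ∀ p, ∀ x ∈ P p, Δ x ∈ P (p + ε))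
    {x : A} {p : ZMod 2} (hx : x ∈ P p) (y : A) :
    B x y = Δ (x * y) - Δ x * y - sgn (p * ε) • (x * Δ y) := by
  refine hI.induction (Q := fun y => B x y = Δ (x * y) - Δ x * y - sgn (p * ε) • (x * Δ y))
    (fun y z hy hz => ?_) (fun q y hq => ?_) y
  · simp only [mul_add, map_add, smul_add, hy, hz]
    abel
  · have e : p * ε + p * (q + ε) = p * q := by clear * -; revert p q ε; decide
    rw [hP.comm hx (hp q y hq), smul_smul, ← sgn_add, e]
    -- Tested against c, the term Δ(xy) expands by the defect formula into the two adjoint terms Δx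
    -- · y and ± Δy · x plus the bracket. The factor −½ cancels the coefficient −2 in front of the
    -- bracket.
    refine hI.ext fun c hc => ?_
    have hl := hI.mul_left hc
    have hl' := fun a b => hI.mul_left (hI.mul_left hc a) b
    have hx' := fun a => hBC x _ (hl a)
    have hy' := fun a => hBC y _ (hl a)
    have h1 := hΔ (x * y) c hc
    rw [hB.map_mul hI hP hx hq, hI.sub (C.add_mem (hx' y) (C.smul_mem _ (hy' x)))
      (C.smul_mem _ (hl _)), hI.add (hx' y) (C.smul_mem _ (hy' x)), hI.smul _ (hy' x),
      hI.smul _ (hl _)] at h1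
    rw [sub_mul, sub_mul, smul_mul_assoc, mul_assoc, mul_assoc,
      hI.sub (C.sub_mem (hl _) (hl' _ _)) (C.smul_mem _ (hl' _ _)), hI.sub (hl _) (hl' _ _),
      hI.smul _ (hl' _ _), hΔ x _ (hl y), hΔ y _ (hl x), h1]
    ring

end IsBiderivation

/-- A formally self-adjoint superderivation is zero. -/
theorem IsTestIntegral.eq_zero_of_selfAdjoint_derivation (hI : IsTestIntegral P C I)
    (hP : IsSupercommutative P) {E : A →ₗ[ℝ] A}
    (hE : ∀ {x p} (y : A), x ∈ P p → E (x * y) = E x * y + sgn (p * ε) • (x * E y))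
    (hp : ∀ p, ∀ x ∈ P p, E x ∈ P (p + ε))
    (hs : ∀ {x y p}, x ∈ P p → x ∈ C → y ∈ C → I (E x * y) = sgn (p * ε) * I (x * E y)) :
    E = 0 := by
  -- Compute ∫E(xy)c once by self-adjointness of E on xy, and once by Leibniz followed by
  -- self-adjointness on x against yc. The terms with E c agree and 2 ∫ x E(y) c = 0 remains.
  have h1 : ∀ p q x y, x ∈ P p → x ∈ C → y ∈ P q → y ∈ C → x * E y = 0 := by
    intro p q x y hx hxC hy hyC
    refine hI.eq_zero _ fun c hc => ?_
    have m1 : x * (E y * c) ∈ C := hI.mul_right hxC _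
    have m2 : x * (y * E c) ∈ C := hI.mul_right hxC _
    have e1 := hs (hP.mul_mem hx hy) (hI.mul_left hyC x) hc
    have e2 := hs hx hxC (hI.mul_left hc y)
    have e3 : I (E (x * y) * c) = I (E x * (y * c)) + sgn (p * ε) * I (x * (E y * c)) := by
      rw [hE y hx, add_mul, smul_mul_assoc, mul_assoc, mul_assoc,
        hI.add (hI.mul_left (hI.mul_left hc _) _) (C.smul_mem _ m1), hI.smul _ m1]
    have e4 : I (x * E (y * c)) = I (x * (E y * c)) + sgn (q * ε) * I (x * (y * E c)) := by
      rw [hE c hy, mul_add, mul_smul_comm, hI.add m1 (C.smul_mem _ m2), hI.smul _ m2]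
    rw [e3, e2, e4, add_mul, sgn_add, mul_assoc x y] at e1
    have e5 : sgn (p * ε) * sgn (p * ε) = 1 := sgn_mul_self _
    rw [mul_assoc]
    linear_combination (sgn (p * ε) / 2) * e1 - I (x * (E y * c)) * e5
  -- To reach E x for arbitrary x, apply the previous step to the test element bx. In a E(bx) = 0
  -- the term a E(b) x also vanishes, which leaves a b E x = 0.
  have h2 : ∀ p q, ∀ x ∈ P p, ∀ b ∈ P q, b ∈ C → ∀ a ∈ C, a * (b * E x) = 0 := by
    intro p q x hx b hb hbC a haC
    refine hI.induction_test (Q := fun a => a * (b * E x) = 0)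
      (fun a a' _ _ h h' => by rw [add_mul, h, h', add_zero]) (fun r a ha haC => ?_) haC
    have e1 := h1 r _ a _ ha haC (hP.mul_mem hb hx) (hI.mul_right hbC x)
    have e2 := h1 r _ a _ ha haC hb hbC
    rw [hE x hb, mul_add, ← mul_assoc a (E b), e2, zero_mul, zero_add, mul_smul_comm] at e1
    have e3 := congrArg (fun z => sgn (q * ε) • z) e1
    simpa only [smul_smul, sgn_mul_self, one_smul, smul_zero] using e3
  refine LinearMap.ext fun x => ?_
  rw [LinearMap.zero_apply]
  refine hI.induction (Q := fun x => E x = 0) (fun x y h h' => by rw [map_add, h, h', add_zero])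
    (fun p x hx => hI.eq_zero _ fun c hc => ?_) x
  have h3 : E x * c = 0 := by
    refine hI.induction_test (Q := fun c => E x * c = 0)
      (fun a a' _ _ h h' => by rw [mul_add, h, h', add_zero]) (fun q c hcq hc => ?_) hc
    -- A local unit s on the support of c supplies the second test factor needed for c E x = s c E x
    -- = 0.
    obtain ⟨s, hs, hsc⟩ := hI.exists_unit c hc
    rw [hP.comm (hp p x hx) hcq, hsc, mul_assoc, h2 p q x hx c hcq hc s hs, smul_zero]
  rw [h3]
  simpa using hI.smul 0 C.zero_mem

/-- A linear operator adjoint to a bilinear operation. -/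
theorem IsTestIntegral.exists_adjoint (hI : IsTestIntegral P C I) (hBC : ∀ x, ∀ c ∈ C, B x c ∈ C)
    (h : ∀ x, ∃ g, ∀ c ∈ C, I (g * c) = I (B x c)) :
    ∃ Δ : A →ₗ[ℝ] A, ∀ x, ∀ c ∈ C, I (Δ x * c) = -1 / 2 * I (B x c) := by
  choose g hg using h
  -- The representing elements are chosen one by one; nondegeneracy makes the choice unique, hence
  -- linear in x.
  let G : A →ₗ[ℝ] A :=
    { toFun := g
      map_add' := fun x y => hI.ext fun c hc => by
        rw [hg _ c hc, add_mul, hI.add (hI.mul_left hc _) (hI.mul_left hc _), hg x c hc, hg y c hc,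
          map_add, LinearMap.add_apply, hI.add (hBC x c hc) (hBC y c hc)]
      map_smul' := fun r x => hI.ext fun c hc => by
        rw [hg _ c hc, RingHom.id_apply, smul_mul_assoc, hI.smul _ (hI.mul_left hc _), hg x c hc,
          map_smul, LinearMap.smul_apply, hI.smul _ (hBC x c hc)] }
  refine ⟨(-1 / 2 : ℝ) • G, fun x c hc => ?_⟩
  rw [LinearMap.smul_apply, smul_mul_assoc, hI.smul _ (hI.mul_left hc _)]
  exact congrArg _ (hg x c hc)

theorem IsTestIntegral.adjoint_eq (hI : IsTestIntegral P C I) {Δ : A →ₗ[ℝ] A} {x g : A}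
    (hΔ : ∀ c ∈ C, I (Δ x * c) = -1 / 2 * I (B x c)) (hg : ∀ c ∈ C, I (g * c) = I (B x c)) :
    Δ x = (-1 / 2 : ℝ) • g := hI.ext fun c hc => by
  rw [hΔ c hc, smul_mul_assoc, hI.smul _ (hI.mul_left hc _), hg c hc]

/-- The self-adjoint generator of a biderivation is unique. -/
theorem IsTestIntegral.generator_unique (hI : IsTestIntegral P C I) (hP : IsSupercommutative P)
    {Δ Δ' : A →ₗ[ℝ] A} (hp : ∀ p, ∀ x ∈ P p, Δ x ∈ P (p + ε))
    (hp' : ∀ p, ∀ x ∈ P p, Δ' x ∈ P (p + ε))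
    (hs : ∀ {x y p}, x ∈ P p → x ∈ C → y ∈ C → I (Δ x * y) = sgn (p * ε) * I (x * Δ y))
    (hs' : ∀ {x y p}, x ∈ P p → x ∈ C → y ∈ C → I (Δ' x * y) = sgn (p * ε) * I (x * Δ' y))
    (hg : ∀ {x p} (y), x ∈ P p → B x y = Δ (x * y) - Δ x * y - sgn (p * ε) • (x * Δ y))
    (hg' : ∀ {x p} (y), x ∈ P p → B x y = Δ' (x * y) - Δ' x * y - sgn (p * ε) • (x * Δ' y)) :
    Δ = Δ' := by
  refine sub_eq_zero.1 (hI.eq_zero_of_selfAdjoint_derivation (E := Δ - Δ') (ε := ε)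
    hP (fun {x p} y hx => ?_) (fun p x hx => ?_) (fun {x y p} hx hxC hyC => ?_))
  · have e := (hg y hx).symm.trans (hg' y hx)
    rw [LinearMap.sub_apply, LinearMap.sub_apply, LinearMap.sub_apply, sub_mul, mul_sub, smul_sub]
    rw [sub_sub, sub_sub, sub_eq_sub_iff_sub_eq_sub] at e
    rw [e]
    abel
  · exact Submodule.sub_mem _ (hp p x hx) (hp' p x hx)
  · rw [LinearMap.sub_apply, LinearMap.sub_apply, sub_mul, mul_sub,
      hI.sub (hI.mul_left hyC _) (hI.mul_left hyC _), hI.sub (hI.mul_right hxC _) (hI.mul_right hxC _),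
      hs hx hxC hyC, hs' hx hxC hyC, mul_sub]

end

/-! ### The canonical generator of a long bracket -/

namespace SuperManifold

open SuperFun Topology

variable {n m : ℕ} {X : Type u} [TopologicalSpace X]

/-- The densities of parity `p`. -/
noncomputable def parityModule (M : SuperManifold.{u, v} n m X) (p : ZMod 2) :
    Submodule ℝ M.Densities where
  carrier := {ψ | HasParity ψ p}
  add_mem' h h' := h.add h'
  zero_mem' := hasParity_zero p
  smul_mem' r _ h := h.smul r

/-- The densities with compact support. -/
noncomputable def testModule (M : SuperManifold.{u, v} n m X) [T2Space X] :
    Submodule ℝ M.Densities where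
  carrier := {ψ | CompactlySupported ψ}
  add_mem' h h' := h.add h'
  zero_mem' := ⟨∅, isCompact_empty, fun i w x _ => component_zero i w x⟩
  smul_mem' r _ h := h.smul r

variable {M : SuperManifold.{u, v} n m X}

theorem isSupercommutative_parityModule : IsSupercommutative M.parityModule where
  one_mem := hasParity_one
  mul_mem h h' := HasParity.mul h h'
  comm h h' := HasParity.mul_comm h h'

variable {ε : ZMod 2} {l : ℝ} {B : M.Densities →ₗ[ℝ] M.Densities →ₗ[ℝ] M.Densities}

theorem IsLongBracket.isBiderivation (hB : IsLongBracket ε l B) :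
    IsBiderivation M.parityModule ε B where
  parity h h' := hB.parity h h'
  symm h h' := hB.symm h h'
  leibniz z h h' := hB.leibniz z h h'

variable [T2Space X]

theorem CompactlySupported.parityPart {χ : M.Densities} (h : CompactlySupported χ) (p : ZMod 2) :
    CompactlySupported (parityPart p χ) := by
  obtain ⟨K, hK, h0⟩ := h; exact ⟨K, hK, h0.parityPart p⟩

theorem compactlySupported_of_mem_chartSpan {σ : M.Densities} (h : σ ∈ M.chartSpan) :
    CompactlySupported σ := by
  have h1 : M.chartSpan ≤ M.testModule := Submodule.span_le.2 fun φ hφ => by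
    obtain ⟨i, K, -, hK, h0⟩ := hφ
    exact ⟨K, hK, h0⟩
  exact h1 h

theorem isTestIntegral (hM : M.PositiveJacobians) :
    IsTestIntegral M.parityModule M.testModule integral where
  decomp ψ := ⟨_, hasParity_parityPart 0 ψ, _, hasParity_parityPart 1 ψ, eq_parityPart_add ψ⟩
  decomp_test ψ h := ⟨_, hasParity_parityPart 0 ψ, CompactlySupported.parityPart h 0, _,
    hasParity_parityPart 1 ψ, CompactlySupported.parityPart h 1, eq_parityPart_add ψ⟩
  mul_left h ψ := CompactlySupported.mul_left h ψ
  mul_right h ψ := CompactlySupported.mul_right h ψ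
  add h h' := integral_add hM h h'
  smul r _ h := integral_smul hM r h
  eq_zero _ h := eq_zero_of_integral_mul hM h
  exists_unit χ h := by
    obtain ⟨K, hK, h0⟩ := h
    obtain ⟨σ, hσ, h1⟩ := exists_cutoff hM hK
    exact ⟨σ, compactlySupported_of_mem_chartSpan hσ, eq_mul_of_cutoff h1 h0⟩

/-- An additive property holds for all densities if it holds for those which are homogeneous in
weight and parity. -/
theorem induction_homogeneous {Q : M.Densities → Prop} (hadd : ∀ ψ χ, Q ψ → Q χ → Q (ψ + χ))
    (hzero : Q 0) (h : ∀ ψ p w, HasParity ψ p → HasWeight ψ w → Q ψ) (ψ : M.Densities) : Q ψ := by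
  classical
  have h1 : ∀ w, Q (weightPart w ψ) := fun w => by
    rw [eq_parityPart_add (weightPart w ψ)]
    exact hadd _ _ (h _ 0 w (hasParity_parityPart _ _) ((hasWeight_weightPart w ψ).parityPart 0))
      (h _ 1 w (hasParity_parityPart _ _) ((hasWeight_weightPart w ψ).parityPart 1))
  have h2 : ∀ s : Finset ℝ, Q (∑ w ∈ s, weightPart w ψ) := fun s => by
    induction s using Finset.induction_on with
    | empty => rw [Finset.sum_empty]; exact hzero
    | insert a s ha ih => rw [Finset.sum_insert ha]; exact hadd _ _ (h1 a) ih
  obtain ⟨s, hs⟩ := exists_eq_sum_weightPart ψ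
  rw [hs]
  exact h2 s

theorem IsLongBracket.compactlySupported (hM : M.PositiveJacobians) (hB : IsLongBracket ε l B)
    (ψ : M.Densities) {χ : M.Densities} (h : CompactlySupported χ) :
    CompactlySupported (B ψ χ) := by
  obtain ⟨K, hK, h0⟩ := h
  refine induction_homogeneous (Q := fun ψ => CompactlySupported (B ψ χ)) (fun ψ φ h1 h2 => ?_) ?_
    (fun ψ p w hp hw => ?_) ψ
  · rw [map_add, LinearMap.add_apply]; exact h1.add h2
  · rw [map_zero, LinearMap.zero_apply]
    exact ⟨∅, isCompact_empty, fun i w x _ => component_zero i w x⟩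
  · exact ⟨K, hK, (hB.isDensityDerivation hp hw).vanishesOutside hM hK h0⟩

theorem IsLongBracket.exists_divergence (hM : M.PositiveJacobians) (hB : IsLongBracket ε l B)
    (ψ : M.Densities) :
    ∃ g : M.Densities, ∀ χ, CompactlySupported χ → integral (g * χ) = integral (B ψ χ) := by
  refine induction_homogeneous (Q := fun ψ => ∃ g : M.Densities, ∀ χ, CompactlySupported χ →
    integral (g * χ) = integral (B ψ χ)) (fun ψ φ h1 h2 => ?_) ?_ (fun ψ p w hp hw => ?_) ψ
  · obtain ⟨g, hg⟩ := h1
    obtain ⟨g', hg'⟩ := h2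
    refine ⟨g + g', fun χ hχ => ?_⟩
    rw [add_mul, map_add, LinearMap.add_apply, integral_add hM (hχ.mul_left g) (hχ.mul_left g'),
      integral_add hM (hB.compactlySupported hM ψ hχ) (hB.compactlySupported hM φ hχ), hg χ hχ,
      hg' χ hχ]
  · exact ⟨0, fun χ _ => by rw [zero_mul, map_zero, LinearMap.zero_apply]⟩
  · obtain ⟨g, -, -, hg⟩ := SuperManifold.exists_divergence hM (hB.isDensityDerivation hp hw)
    exact ⟨g, hg⟩

section Generator

variable (hM : M.PositiveJacobians) (hB : IsLongBracket ε l B)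

theorem exists_generator (hM : M.PositiveJacobians) (hB : IsLongBracket ε l B) :
    ∃ Δ : M.Densities →ₗ[ℝ] M.Densities, ∀ ψ, ∀ χ ∈ M.testModule,
      integral (Δ ψ * χ) = -1 / 2 * integral (B ψ χ) :=
  (isTestIntegral hM).exists_adjoint (fun ψ _ hχ => hB.compactlySupported hM ψ hχ)
    (hB.exists_divergence hM)

/-- The canonical generator `Δ` of a long bracket: `⟨Δψ, χ⟩ = -1/2 ∫ {ψ; χ}`. -/
noncomputable def generator : M.Densities →ₗ[ℝ] M.Densities := (exists_generator hM hB).choose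

theorem integral_generator_mul (ψ : M.Densities) :
    ∀ χ ∈ M.testModule, integral (generator hM hB ψ * χ) = -1 / 2 * integral (B ψ χ) :=
  (exists_generator hM hB).choose_spec ψ

theorem generator_eq {ψ g : M.Densities}
    (hg : ∀ χ, CompactlySupported χ → integral (g * χ) = integral (B ψ χ)) :
    generator hM hB ψ = (-1 / 2 : ℝ) • g :=
  (isTestIntegral hM).adjoint_eq (integral_generator_mul hM hB ψ) hg

/-- The generator is −½ times the divergence, which inherits the weight w + λ and the parity p + ε
of the derivation {ψ; ·}. -/
theorem generator_homogeneous {ψ : M.Densities} {p : ZMod 2} {w : ℝ} (hp : HasParity ψ p)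
    (hw : HasWeight ψ w) :
    HasWeight (generator hM hB ψ) (w + l) ∧ HasParity (generator hM hB ψ) (p + ε) := by
  obtain ⟨g, h1, h2, h3⟩ := SuperManifold.exists_divergence hM (hB.isDensityDerivation hp hw)
  rw [generator_eq hM hB h3]
  exact ⟨h1.smul _, h2.smul _⟩

theorem generator_weight : OperatorWeight l (generator hM hB) := by
  intro ψ w hw
  rw [eq_parityPart_add ψ, map_add]
  exact (generator_homogeneous hM hB (hasParity_parityPart 0 ψ) (hw.parityPart 0)).1.add
    (generator_homogeneous hM hB (hasParity_parityPart 1 ψ) (hw.parityPart 1)).1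

theorem generator_parity : OperatorParity ε (generator hM hB) := by
  intro ψ p hp
  obtain ⟨s, hs⟩ := exists_eq_sum_weightPart ψ
  rw [hs, map_sum]
  exact HasParity.sum fun w _ =>
    (generator_homogeneous hM hB (hp.weightPart w) (hasWeight_weightPart w ψ)).2

theorem isCanonicalGenerator_generator : IsCanonicalGenerator ε B (generator hM hB) := by
  have hI := isTestIntegral hM
  have hP := isSupercommutative_parityModule (M := M)
  have hB' := hB.isBiderivation
  have hBC : ∀ ψ, ∀ χ ∈ M.testModule, B ψ χ ∈ M.testModule := fun ψ χ hχ =>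
    hB.compactlySupported hM ψ hχ
  have hΔ : ∀ ψ, ∀ χ ∈ M.testModule, integral (generator hM hB ψ * χ) = -1 / 2 * integral (B ψ χ) :=
    integral_generator_mul hM hB
  have hp : ∀ p, ∀ ψ ∈ M.parityModule p, generator hM hB ψ ∈ M.parityModule (p + ε) :=
    fun p ψ h => generator_parity hM hB ψ p h
  exact ⟨generator_parity hM hB,
    fun ψ χ p h h1 h2 => hB'.selfAdjoint_of_adjoint hI hP hBC hΔ hp h h1 h2,
    hB'.map_one_of_adjoint hI hP hΔ,
    fun ψ χ p h => hB'.generates_of_adjoint hI hP hBC hΔ hp h χ⟩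

theorem IsCanonicalGenerator.unique (hM : M.PositiveJacobians)
    {Δ Δ' : M.Densities →ₗ[ℝ] M.Densities} (h : IsCanonicalGenerator ε B Δ)
    (h' : IsCanonicalGenerator ε B Δ') : Δ = Δ' := by
  exact (isTestIntegral hM).generator_unique isSupercommutative_parityModule
    (fun p ψ hp => h.parity ψ p hp) (fun p ψ hp => h'.parity ψ p hp)
    (fun {ψ χ p} hp h1 h2 => h.selfAdjoint ψ χ p hp h1 h2)
    (fun {ψ χ p} hp h1 h2 => h'.selfAdjoint ψ χ p hp h1 h2)
    (fun {ψ p} χ hp => h.generates ψ χ p hp) (fun {ψ p} χ hp => h'.generates ψ χ p hp)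

end Generator

end SuperManifold

/-! ### The canonical pencil -/

namespace SuperManifold

open SuperFun Topology

variable {n m : ℕ} {X : Type u} [TopologicalSpace X] {M : SuperManifold.{u, v} n m X}
  {ε : ZMod 2} {l : ℝ} {B : M.Densities →ₗ[ℝ] M.Densities →ₗ[ℝ] M.Densities}

/-- The canonical pencil as an operator on superfunctions. -/
noncomputable def pencilFn {i : M.Index} (d : M.BracketData ε i) (l w : ℝ) (F : M.Fn i) : M.Fn i :=
  (1 / 2 : ℝ) • ((∑ a, ∑ b, d.S a b * SuperFun.D (dom_subset i) b (SuperFun.D (dom_subset i) a F)) +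
    (∑ a, ((∑ b, sgn (coordParity b * (ε + 1)) • SuperFun.D (dom_subset i) b (d.S b a)) +
      (2 * w + l - 1) • d.γ a) * SuperFun.D (dom_subset i) a F) +
    w • ((∑ a, sgn (coordParity a * (ε + 1)) • SuperFun.D (dom_subset i) a (d.γ a)) * F) +
    (w * (w + l - 1)) • (d.θ * F))

theorem pencil_eq {i : M.Index} (d : M.BracketData ε i) (l w : ℝ) (F : M.Fn i) (x : M.dom i) :
    d.pencil l w (extendZero F.1) x = (pencilFn d l w F).1 x := by
  have hs := dom_subset i
  have h1 : ∀ a (G : M.Fn i), (SuperFun.D hs a G).1 x = superDeriv (M.chart i) a (extendZero G.1) x :=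
    fun a G => D_apply hs a G x.2
  have h2 : ∀ a b, (SuperFun.D hs b (SuperFun.D hs a F)).1 x
      = superDeriv (M.chart i) b (superDeriv (M.chart i) a (extendZero F.1)) x := fun a b => by
    rw [h1]
    refine superDeriv_congr x.2 ?_ b
    exact extendZero_eventuallyEq x.2 fun y => D_apply hs a F y.2
  rw [← ev_apply, pencilFn, BracketData.pencil]
  simp only [map_add, map_smul, map_sum, map_mul, ev_apply, h2]
  simp only [h1, extendZero_of_mem _ x.2]

/-- The divergence of the derivation `{ψ; ·}` in coordinates. -/
theorem divFn_bracketData {i : M.Index} (d : M.BracketData ε i) (l w : ℝ) (p : ZMod 2)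
    (F : M.Fn i) :
    (-1 / 2 : ℝ) • divFn (p + ε) (fun a => sgn (coordParity a * p) •
        (∑ b, d.S a b * SuperFun.D (dom_subset i) b F + w • (d.γ a * F)))
      ((1 - (w + l)) • ∑ a, d.γ a * SuperFun.D (dom_subset i) a F
        + (w * (1 - (w + l))) • (d.θ * F)) = pencilFn d l w F := by
  have hs := dom_subset i
  set δ := SuperFun.D hs with hδ
  -- In the Leibniz rule the undifferentiated S^{ab} is replaced by S^{ba}; its symmetry sign
  -- cancels the remaining signs and gives the second order term of the pencil.
  have h1 : ∀ a b, sgn (coordParity a * (ε + 1)) • δ a (d.S a b * δ b F)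
      = sgn (coordParity a * (ε + 1)) • δ a (d.S a b) * δ b F + d.S b a * δ a (δ b F) := by
    intro a b
    rw [(isSuperderivation_D hs a).mul _ (fun x => d.parity_S a b x), d.symm_S b a, smul_add,
      smul_smul, ← sgn_add, smul_mul_assoc, smul_mul_assoc]
    congr 3
    generalize coordParity a = q; generalize coordParity b = r
    clear * -; revert q r ε; decide
  have h2 : ∀ a, sgn (coordParity a * (ε + 1)) • δ a (d.γ a * F)
      = sgn (coordParity a * (ε + 1)) • δ a (d.γ a) * F + d.γ a * δ a F := by
    intro a
    rw [(isSuperderivation_D hs a).mul _ (fun x => d.parity_γ a x), smul_add,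
      smul_smul, ← sgn_add, smul_mul_assoc]
    have : coordParity a * (ε + 1) + coordParity a * (coordParity a + ε) = 0 := by
      generalize coordParity a = q
      clear * -; revert q ε; decide
    rw [this, sgn_zero, one_smul]
  have h3 : ∀ a, sgn (coordParity a * (coordParity a + (p + ε))) •
      δ a (sgn (coordParity a * p) • (∑ b, d.S a b * δ b F + w • (d.γ a * F)))
      = ∑ b, (sgn (coordParity a * (ε + 1)) • δ a (d.S a b) * δ b F + d.S b a * δ a (δ b F))
        + w • (sgn (coordParity a * (ε + 1)) • δ a (d.γ a) * F + d.γ a * δ a F) := by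
    intro a
    have e : coordParity a * (coordParity a + (p + ε)) + coordParity a * p
        = coordParity a * (ε + 1) := by
      generalize coordParity a = q
      clear * -; revert q p ε; decide
    rw [map_smul, smul_smul, ← sgn_add, e, map_add, map_sum, map_smul, smul_add, Finset.smul_sum,
      smul_comm _ w, h2, Finset.sum_congr rfl fun b _ => h1 a b]
  -- The coefficient of γ^a ∂_a is (1 − w − λ) from the zeroth order part minus w from the
  -- divergence, that is 1 − 2w − λ; that of θ is w(1 − w − λ). The factor −½ turns these into the
  -- coefficients of the pencil.
  rw [divFn, Finset.sum_congr rfl fun a _ => h3 a, pencilFn]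
  simp only [smul_add, Finset.sum_add_distrib, add_mul, Finset.sum_mul, Finset.smul_sum, ← hδ,
    smul_mul_assoc]
  rw [Finset.sum_comm (f := fun a b => sgn (coordParity a * (ε + 1)) • (δ a (d.S a b) * δ b F)),
    Finset.sum_comm (f := fun a b => d.S b a * δ a (δ b F))]
  simp only [← Finset.smul_sum]
  module

variable [T2Space X]

/-- The local expression is needed only on densities of weight 1 − μ, since no others pair with g.
Nondegeneracy near the point then identifies the coefficient of g. -/
theorem component_divergence (hM : M.PositiveJacobians) {d : ZMod 2} {μ : ℝ}
    {D : M.Densities →ₗ[ℝ] M.Densities} (hD : IsDensityDerivation d μ D) {g : M.Densities}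
    (hg : HasWeight g μ) (hgD : ∀ χ, CompactlySupported χ → integral (g * χ) = integral (D χ))
    {i : M.Index} {Y : Fin n ⊕ Fin m → M.Fn i} {C : M.Fn i}
    (hY : ∀ A, Y A ∈ SuperFun.part m (M.chart i) (M.dom i) (coordParity A + d))
    (hDY : ∀ χ, HasWeight χ (1 - μ) → ∀ x (hx : x ∈ M.dom i), component (D χ) i 1 x
      = ∑ A, (Y A).1 ⟨x, hx⟩ * superDeriv (M.chart i) A (component χ i (1 - μ)) x
        + C.1 ⟨x, hx⟩ * component χ i (1 - μ) x) (x : M.dom i) :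
    component g i μ x = (divFn d Y C).1 x := by
  set G := germ hM μ (divFn d Y C) x
  have hG : HasWeight G μ := hasWeight_germ hM μ _ _
  have hGi : component G i μ =ᶠ[𝓝 x.1] extendZero (divFn d Y C).1 := component_germ hM μ _ x
  obtain ⟨U, hU, hUo, hxU⟩ := eventually_nhds_iff.1 hGi
  have h1 : component (g - G) i μ x = 0 := by
    refine component_eq_zero_of_chartIntegral_mul hM (hg.sub hG)
      (U := U ∩ M.dom i) (hUo.inter (M.dom i).2)
      (fun z hz => hz.2) (fun χ K hK hKU h0 hχ => ?_) x ⟨hxU, x.2⟩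
    have hc : CompactlySupported χ := ⟨K, hK, h0⟩
    have hKi : K ⊆ M.dom i := fun z hz => (hKU hz).2
    have h2 : integral (G * χ) = integral (D χ) := by
      rw [integral_eq_chartIntegral hM hK hKi (h0.mul_left _),
        integral_eq_chartIntegral hM hK hKi (hD.vanishesOutside hM hK h0),
        chartIntegral_eq_of_derivation hY hK hKi h0 (hDY χ hχ), chartIntegral_eq_chartInt]
      congr 1
      funext z
      rw [hG.component_mul']
      by_cases hz : z ∈ K
      · rw [hU z (hKU hz).1]
      · rw [h0 i _ z hz, mul_zero, mul_zero]
    have h4 : (g - G) * χ = g * χ + (-1 : ℝ) • (G * χ) := by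
      rw [sub_mul, neg_one_smul, sub_eq_add_neg]
    rw [h4, integral_add hM (hc.mul_left g) ((hc.mul_left G).smul _), integral_smul hM _
      (hc.mul_left G), h2, hgD χ hc]
    ring
  rw [component_sub, sub_eq_zero, hGi.self_of_nhds, extendZero_of_mem _ x.2] at h1
  exact h1

theorem isPencilOf_generator (hM : M.PositiveJacobians) (hB : IsLongBracket ε l B) {i : M.Index}
    {d : M.BracketData ε i} (hd : d.Represents l B) : d.IsPencilOf l (generator hM hB) := by
  have hs := dom_subset i
  have key : ∀ p, ∀ (ψ : M.Densities) (w : ℝ), HasParity ψ p → HasWeight ψ w → ∀ x : M.dom i,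
      component (generator hM hB ψ) i (w + l) x = (pencilFn d l w ((ψ.1 i).coeff w)).1 x := by
    intro p ψ w hp hw x
    have hD := hB.isDensityDerivation hp hw
    obtain ⟨g, hg, -, hgD⟩ := SuperManifold.exists_divergence hM hD
    have hF : (ψ.1 i).coeff w ∈ SuperFun.part m (M.chart i) (M.dom i) p := fun y => by
      rw [← component_apply ψ w y.2]; exact hp i w y
    set F : M.Fn i := (ψ.1 i).coeff w with hFdef
    have hFx : extendZero F.1 = component ψ i w := rfl
    rw [generator_eq hM hB hgD, component_smul, ← divFn_bracketData d l w p F,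
      component_divergence hM hD hg hgD (i := i) (Y := fun a => sgn (coordParity a * p) •
        (∑ b, d.S a b * SuperFun.D (dom_subset i) b F + w • (d.γ a * F)))
        (C := (1 - (w + l)) • ∑ a, d.γ a * SuperFun.D (dom_subset i) a F
        + (w * (1 - (w + l))) • (d.θ * F)) ?_ ?_ x]
    · rfl
    · intro a
      refine Submodule.smul_mem _ _ (Submodule.add_mem _ (Submodule.sum_mem _ fun b _ => ?_)
        (Submodule.smul_mem _ _ ?_))
      · have h1 := isSupercommutative.mul_mem (fun x => d.parity_S a b x) (D_mem hs b hF)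
        rwa [show coordParity a + coordParity b + ε + (p + coordParity b)
            = coordParity a + (p + ε) by
          generalize coordParity a = q; generalize coordParity b = r
          clear * -; revert q r ε p; decide] at h1
      · have h1 := isSupercommutative.mul_mem (fun x => d.parity_γ a x) hF
        rwa [show coordParity a + ε + p = coordParity a + (p + ε) by ring] at h1
    · intro χ hχ y hy
      have h1 := hd ψ χ w (1 - (w + l)) p hw hχ hp ⟨y, hy⟩
      rw [show w + (1 - (w + l)) + l = 1 by ring] at h1
      rw [h1]
      have h2 : ∀ a, (SuperFun.D hs a F).1 ⟨y, hy⟩ = superDeriv (M.chart i) a (component ψ i w) y :=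
        fun a => by rw [D_apply hs a F hy, hFx]
      have h3 : F.1 ⟨y, hy⟩ = component ψ i w y := (component_apply ψ w hy).symm
      simp only [← ev_apply, map_add, map_smul, map_sum, map_mul]
      simp only [ev_apply, h2, h3]
      simp only [mul_add, add_mul, smul_add, Finset.sum_add_distrib, Finset.sum_mul, Finset.smul_sum,
        smul_mul_assoc, mul_smul_comm, smul_smul, mul_assoc]
      abel
  intro ψ w hw x
  -- The coordinate form of the bracket assumes that ψ has a parity. Both sides are additive in ψ,
  -- so the parity components may be treated separately.
  have e0 := key 0 _ w (hasParity_parityPart 0 ψ) (hw.parityPart 0) x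
  have e1 := key 1 _ w (hasParity_parityPart 1 ψ) (hw.parityPart 1) x
  have h1 : component ψ i w = extendZero ((ψ.1 i).coeff w).1 := rfl
  rw [h1, pencil_eq]
  have h2 : (ψ.1 i).coeff w = ((parityPart 0 ψ).1 i).coeff w + ((parityPart 1 ψ).1 i).coeff w := by
    conv_lhs => rw [eq_parityPart_add ψ]
    rfl
  conv_lhs => rw [eq_parityPart_add ψ]
  rw [map_add, component_add, e0, e1, h2]
  have h3 : ∀ F G, pencilFn d l w (F + G) = pencilFn d l w F + pencilFn d l w G := by
    intro F G
    simp only [pencilFn, map_add, mul_add, Finset.sum_add_distrib]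
    module
  rw [h3]
  rfl

end SuperManifold

/-! ### The local expression of a long bracket -/

namespace SuperManifold

open SuperFun Topology

variable {n m : ℕ} {X : Type u} [TopologicalSpace X] {M : SuperManifold.{u, v} n m X}
  {ε : ZMod 2} {l : ℝ} {B : M.Densities →ₗ[ℝ] M.Densities →ₗ[ℝ] M.Densities} [T2Space X]

/-- A long bracket is local in both arguments. -/
theorem IsLongBracket.component_congr (hM : M.PositiveJacobians) (hB : IsLongBracket ε l B)
    {ψ ψ' χ χ' : M.Densities} {p q : ZMod 2} {w₁ w₂ : ℝ} (hp : HasParity ψ p)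
    (hp' : HasParity ψ' p) (hw : HasWeight ψ w₁) (hw' : HasWeight ψ' w₁)
    (hq' : HasParity χ' q)
    (hv : HasWeight χ w₂) (hv' : HasWeight χ' w₂) {i : M.Index} {x : X} (hx : x ∈ M.dom i)
    (hψ : component ψ i w₁ =ᶠ[𝓝 x] component ψ' i w₁)
    (hχ : component χ i w₂ =ᶠ[𝓝 x] component χ' i w₂) :
    component (B ψ χ) i (w₁ + w₂ + l) x = component (B ψ' χ') i (w₁ + w₂ + l) x := by
  have h1 := (hB.isDensityDerivation hp hw).component_congr hM hv hv' hx hχ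
  have h2 := (hB.isDensityDerivation hq' hv').component_congr hM hw hw' hx hψ
  rw [show w₂ + (w₁ + l) = w₁ + w₂ + l by ring] at h1
  rw [show w₁ + (w₂ + l) = w₁ + w₂ + l by ring] at h2
  rw [h1, hB.symm hp hq', hB.symm hp' hq', component_smul, component_smul, h2]

theorem localOp_apply (hM : M.PositiveJacobians) {D : M.Densities →ₗ[ℝ] M.Densities}
    {d : ZMod 2} {μ : ℝ} (hD : IsDensityDerivation d μ D) (i : M.Index) (w : ℝ) (f : M.Fn i)
    (x : M.dom i) :
    (localOp hM hD i w f).1 x = component (D (germ hM w f x)) i (w + μ) x := rfl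

section BracketFn

variable (hM : M.PositiveJacobians) (hB : IsLongBracket ε l B) {i : M.Index}

/-- The bracket of two homogeneous local superfunctions, considered as densities of weights `w₁`
and `w₂`. -/
noncomputable def bracketFn (w₁ w₂ : ℝ) {p q : ZMod 2} {f g : M.Fn i}
    (hf : f ∈ SuperFun.part m (M.chart i) (M.dom i) p)
    (hg : g ∈ SuperFun.part m (M.chart i) (M.dom i) q) : M.Fn i :=
  ⟨fun x => component (B (germ hM w₁ f x) (germ hM w₂ g x)) i (w₁ + w₂ + l) x,
    (mem_iff (dom_subset i)).2 fun x => by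
      refine smoothAt_congr x.2
        (component_smooth (B (germ hM w₁ f x) (germ hM w₂ g x)) (w₁ + w₂ + l) x.2) ?_
      filter_upwards [(component_germ hM w₁ f x).eventuallyEq_nhds,
        (component_germ hM w₂ g x).eventuallyEq_nhds, (M.dom i).2.mem_nhds x.2] with z hz hz' hzi
      rw [extendZero_of_mem _ hzi]
      exact hB.component_congr hM (hasParity_germ hM w₁ _ hf) (hasParity_germ hM w₁ _ hf)
        (hasWeight_germ hM w₁ _ _) (hasWeight_germ hM w₁ _ _)
        (hasParity_germ hM w₂ _ hg) (hasWeight_germ hM w₂ _ _) (hasWeight_germ hM w₂ _ _) hzi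
        (hz.trans (component_germ hM w₁ f ⟨z, hzi⟩).symm)
        (hz'.trans (component_germ hM w₂ g ⟨z, hzi⟩).symm)⟩

theorem bracketFn_mem (w₁ w₂ : ℝ) {p q : ZMod 2} {f g : M.Fn i}
    (hf : f ∈ SuperFun.part m (M.chart i) (M.dom i) p)
    (hg : g ∈ SuperFun.part m (M.chart i) (M.dom i) q) :
    bracketFn hM hB w₁ w₂ hf hg ∈ SuperFun.part m (M.chart i) (M.dom i) (p + q + ε) := fun x =>
  hB.parity (hasParity_germ hM w₁ x hf) (hasParity_germ hM w₂ x hg) i _ _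

theorem bracketFn_symm (w₁ w₂ : ℝ) {p q : ZMod 2} {f g : M.Fn i}
    (hf : f ∈ SuperFun.part m (M.chart i) (M.dom i) p)
    (hg : g ∈ SuperFun.part m (M.chart i) (M.dom i) q) :
    bracketFn hM hB w₁ w₂ hf hg = sgn (p * q) • bracketFn hM hB w₂ w₁ hg hf :=
  ext' fun x hx => by
    refine (congrArg (fun ψ => component ψ i (w₁ + w₂ + l) x)
      (hB.symm (hasParity_germ hM w₁ ⟨x, hx⟩ hf) (hasParity_germ hM w₂ ⟨x, hx⟩ hg))).trans ?_
    rw [component_smul, add_comm w₁ w₂]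
    rfl

end BracketFn

/-- By continuity the dependence on the weight is linear. -/
theorem component_germ_one_eq_smul (hM : M.PositiveJacobians) (hB : IsLongBracket ε l B)
    {i : M.Index} (hc : ContinuousInWeight l B) {ψ : M.Densities} {p : ZMod 2}
    {w₁ : ℝ} (hp : HasParity ψ p) (hw : HasWeight ψ w₁) (x : M.dom i) (w : ℝ) :
    component (B ψ (germ hM w (1 : M.Fn i) x)) i (w + (w₁ + l)) x
      = w • component (B ψ (germ hM 1 (1 : M.Fn i) x)) i (1 + (w₁ + l)) x := by
  have hD := hB.isDensityDerivation hp hw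
  obtain ⟨b, K, hK, hKi, -, hb0, hb1, hbs⟩ := exists_bump (M := M) x.2 Filter.univ_mem
  -- The germs for different w are chosen independently, while continuity is assumed for one and the
  -- same coefficient. So all (Dx)^w are cut off by a common bump function b; by locality this does
  -- not change the values at x.
  choose χ hχw _h0 hχ _hp using fun w => exists_ofChart hM i w
    (f := fun z => algebraMap ℝ (Grassmann m) (b z)) hK hKi hbs
    (fun z hz => by rw [hb0 z hz, map_zero])
  have h1 : ∀ w, component (B ψ (germ hM w (1 : M.Fn i) x)) i (w + (w₁ + l)) x
      = component (B ψ (χ w)) i (w₁ + w + l) x := by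
    intro w
    rw [show w₁ + w + l = w + (w₁ + l) by ring]
    refine localOp_eq hM hD i (hχw w) x.2 ?_
    filter_upwards [hb1, (M.dom i).2.mem_nhds x.2] with z hz hzi
    rw [hχ, hz, map_one, extendZero_of_mem _ hzi]
    rfl
  refine Grassmann.ext_coeff fun I => ?_
  -- An additive and continuous function of the weight is real linear.
  let c : ℝ →+ ℝ := AddMonoidHom.mk'
    (fun w => Grassmann.coeff I ((localOp hM hD i w 1).1 x))
    fun w w' => by
      rw [← map_add, localOp_one_add]
      rfl
  have hcont : Continuous c := by
    have h2 := hc i ψ w₁ χ hw hχw (fun w w' => by funext z; rw [hχ, hχ]) x I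
    refine h2.congr fun w => ?_
    rw [← h1 w]
    exact congrArg _ (localOp_apply hM hD i w 1 x).symm
  have h3 := map_real_smul c hcont w 1
  rw [smul_eq_mul, mul_one] at h3
  rw [map_smul, ← localOp_apply hM hD i w, ← localOp_apply hM hD i 1]
  exact h3

section LocalData

variable (hM : M.PositiveJacobians) (hB : IsLongBracket ε l B) (i : M.Index)

theorem coord_mem_part (a : Fin n ⊕ Fin m) : coord m (M.chart i) (M.dom i) a ∈
    SuperFun.part m (M.chart i) (M.dom i) (coordParity a) :=
  coord_mem a

theorem one_mem_part : (1 : M.Fn i) ∈ SuperFun.part m (M.chart i) (M.dom i) 0 :=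
  isSupercommutative.one_mem

/-- The coefficients `S^{ab}` of a long bracket. -/
noncomputable def bracketS (a b : Fin n ⊕ Fin m) : M.Fn i :=
  bracketFn hM hB 0 0 (coord_mem_part i a) (coord_mem_part i b)

/-- The coefficients `γ^a` of a long bracket. -/
noncomputable def bracketγ (a : Fin n ⊕ Fin m) : M.Fn i :=
  bracketFn hM hB 0 1 (coord_mem_part i a) (one_mem_part i)

/-- The coefficient `θ` of a long bracket. -/
noncomputable def bracketθ : M.Fn i :=
  bracketFn hM hB 1 1 (one_mem_part i) (one_mem_part i)

theorem bracketS_mem (a b : Fin n ⊕ Fin m) : bracketS hM hB i a b ∈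
    SuperFun.part m (M.chart i) (M.dom i) (coordParity a + coordParity b + ε) :=
  bracketFn_mem hM hB 0 0 (coord_mem_part i a) (coord_mem_part i b)

theorem bracketγ_mem (a : Fin n ⊕ Fin m) : bracketγ hM hB i a ∈
    SuperFun.part m (M.chart i) (M.dom i) (coordParity a + ε) := by
  have h := bracketFn_mem hM hB 0 1 (coord_mem_part i a) (one_mem_part i)
  rwa [add_zero] at h

theorem bracketθ_mem : bracketθ hM hB i ∈ SuperFun.part m (M.chart i) (M.dom i) ε := by
  have h := bracketFn_mem hM hB 1 1 (one_mem_part i) (one_mem_part i)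
  rwa [add_zero, zero_add] at h

theorem bracketS_symm (a b : Fin n ⊕ Fin m) : bracketS hM hB i a b =
    sgn (coordParity a * coordParity b) • bracketS hM hB i b a :=
  bracketFn_symm hM hB 0 0 (coord_mem_part i a) (coord_mem_part i b)

/-- The local data of a long bracket. -/
noncomputable def localData : M.BracketData ε i where
  S := bracketS hM hB i
  γ := bracketγ hM hB i
  θ := bracketθ hM hB i
  parity_S := bracketS_mem hM hB i
  parity_γ := bracketγ_mem hM hB i
  parity_θ := bracketθ_mem hM hB i
  symm_S := bracketS_symm hM hB i

end LocalData

/-- A continuous long bracket is determined by its values on coordinates and on `Dx`. -/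
theorem component_bracket_eq_sum (hM : M.PositiveJacobians) (hB : IsLongBracket ε l B)
    (hc : ContinuousInWeight l B) {i : M.Index} {ψ χ : M.Densities} {p : ZMod 2} {w₁ w₂ : ℝ}
    (hp : HasParity ψ p) (hw : HasWeight ψ w₁) (hv : HasWeight χ w₂) (x : M.dom i) :
    component (B ψ χ) i (w₂ + (w₁ + l)) x
      = ∑ a, component (B ψ (germ hM 0 (coord m (M.chart i) (M.dom i) a) x)) i (0 + (w₁ + l)) x *
          superDeriv (M.chart i) a (component χ i w₂) x
        + (w₂ • component (B ψ (germ hM 1 (1 : M.Fn i) x)) i (1 + (w₁ + l)) x) *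
          component χ i w₂ x := by
  have hD := hB.isDensityDerivation hp hw
  refine (component_derivation hM hD i hv x.2).trans ?_
  rw [← component_germ_one_eq_smul hM hB hc hp hw x w₂, ← localOp_apply hM hD i w₂]
  rfl

theorem hasParity_germ_coord (hM : M.PositiveJacobians) (w : ℝ) {i : M.Index} (x : M.dom i)
    (a : Fin n ⊕ Fin m) :
    HasParity (germ hM w (coord m (M.chart i) (M.dom i) a) x) (coordParity a) :=
  hasParity_germ hM w x (coord_mem_part i a)

theorem hasParity_germ_one (hM : M.PositiveJacobians) (w : ℝ) {i : M.Index} (x : M.dom i) :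
    HasParity (germ hM w (1 : M.Fn i) x) 0 :=
  hasParity_germ hM w x (one_mem_part i)

/-- With a coordinate in the second slot the arguments are exchanged by symmetry, and the local form
of derivations is used again, now in ψ. -/
theorem component_bracket_coord (hM : M.PositiveJacobians) (hB : IsLongBracket ε l B)
    (hc : ContinuousInWeight l B) {i : M.Index} {ψ : M.Densities} {p : ZMod 2} {w₁ : ℝ}
    (hp : HasParity ψ p) (hw : HasWeight ψ w₁) (x : M.dom i) (a : Fin n ⊕ Fin m) :
    component (B ψ (germ hM 0 (coord m (M.chart i) (M.dom i) a) x)) i (0 + (w₁ + l)) x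
      = sgn (coordParity a * p) •
        (∑ b, ((localData hM hB i).S a b).1 x * superDeriv (M.chart i) b (component ψ i w₁) x
          + (w₁ • ((localData hM hB i).γ a).1 x) * component ψ i w₁ x) := by
  have hZ := hasParity_germ_coord hM 0 x a
  have h1 := component_bracket_eq_sum hM hB hc hZ (hasWeight_germ hM 0 _ x) hw x
  rw [hB.symm hp hZ, component_smul, mul_comm p, show 0 + (w₁ + l) = w₁ + (0 + l) by ring, h1,
    ← add_assoc 0 0 l, ← add_assoc 1 0 l, add_comm (1 : ℝ) 0]
  rfl

theorem component_bracket_one (hM : M.PositiveJacobians) (hB : IsLongBracket ε l B)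
    (hc : ContinuousInWeight l B) {i : M.Index} {ψ : M.Densities} {p : ZMod 2} {w₁ : ℝ}
    (hp : HasParity ψ p) (hw : HasWeight ψ w₁) (x : M.dom i) :
    component (B ψ (germ hM 1 (1 : M.Fn i) x)) i (1 + (w₁ + l)) x
      = ∑ b, ((localData hM hB i).γ b).1 x * superDeriv (M.chart i) b (component ψ i w₁) x
          + (w₁ • (localData hM hB i).θ.1 x) * component ψ i w₁ x := by
  have hT := hasParity_germ_one hM 1 x
  have h1 := component_bracket_eq_sum hM hB hc hT (hasWeight_germ hM 1 _ x) hw x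
  rw [hB.symm hp hT, mul_zero, sgn_zero, one_smul, show 1 + (w₁ + l) = w₁ + (1 + l) by ring, h1,
    ← add_assoc 1 1 l, ← add_assoc 0 1 l]
  congr 1
  refine Finset.sum_congr rfl fun b _ => ?_
  rw [hB.symm hT (hasParity_germ_coord hM 0 x b), zero_mul, sgn_zero, one_smul]
  rfl

theorem localData_represents (hM : M.PositiveJacobians) (hB : IsLongBracket ε l B)
    (hc : ContinuousInWeight l B) (i : M.Index) : (localData hM hB i).Represents l B := by
  intro ψ χ w₁ w₂ p hw hv hp x
  rw [show w₁ + w₂ + l = w₂ + (w₁ + l) by ring, component_bracket_eq_sum hM hB hc hp hw hv x,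
    component_bracket_one hM hB hc hp hw x,
    Finset.sum_congr rfl fun a _ => congrArg (· * superDeriv (M.chart i) a (component χ i w₂) x)
      (component_bracket_coord hM hB hc hp hw x a)]
  generalize (localData hM hB i) = d
  generalize component ψ i w₁ x = f
  generalize component χ i w₂ x = g
  simp only [mul_add, add_mul, smul_add, Finset.sum_add_distrib, Finset.sum_mul, Finset.smul_sum,
    smul_mul_assoc, mul_smul_comm, smul_smul, mul_assoc, mul_comm w₂ w₁]
  abel

/-- The data are recovered as the brackets of germs of two coordinates, of a coordinate and Dx, and
of Dx with itself, up to a sign in the first case. -/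
theorem BracketData.Represents.unique (hM : M.PositiveJacobians) {i : M.Index}
    {d d' : M.BracketData ε i} (h : d.Represents l B) (h' : d'.Represents l B) : d = d' := by
  have hZ : ∀ (x : M.dom i) a, HasParity (germ hM 0 (coord m (M.chart i) (M.dom i) a) x)
    (coordParity a) := fun x a => hasParity_germ hM 0 x (coord_mem a)
  have hT : ∀ x, HasParity (germ hM 1 (1 : M.Fn i) x) 0 := fun x =>
    hasParity_germ hM 1 x isSupercommutative.one_mem
  have hZD : ∀ (x : M.dom i) a b, superDeriv (M.chart i) b
      (component (germ hM 0 (coord m (M.chart i) (M.dom i) a) x) i 0) x = if b = a then 1 else 0 := by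
    intro x a b
    rw [superDeriv_congr x.2 (component_germ hM 0 _ x), ← D_apply (dom_subset i) b _ x.2, D_coord]
    split_ifs <;> rfl
  have hTD : ∀ (x : M.dom i) b, superDeriv (M.chart i) b
      (component (germ hM 1 (1 : M.Fn i) x) i 1) x = 0 := by
    intro x b
    have h1 : SuperFun.D (dom_subset i) b (1 : M.Fn i) = 0 := by
      simpa using (isSuperderivation_D (dom_subset i) b).mul (1 : M.Fn i)
        (isSupercommutative (m := m) (c := M.chart i) (W := M.dom i)).one_mem
    rw [superDeriv_congr x.2 (component_germ hM 1 _ x), ← D_apply (dom_subset i) b _ x.2, h1]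
    rfl
  have hT1 : ∀ x : M.dom i, component (germ hM 1 (1 : M.Fn i) x) i 1 x = 1 := fun x => by
    rw [(component_germ hM 1 (1 : M.Fn i) x).self_of_nhds, extendZero_of_mem _ x.2]; rfl
  have hS : ∀ d : M.BracketData ε i, d.Represents l B → ∀ a b (x : M.dom i),
      component (B (germ hM 0 (coord m (M.chart i) (M.dom i) b) x)
        (germ hM 0 (coord m (M.chart i) (M.dom i) a) x)) i (0 + 0 + l) x
        = sgn (coordParity a * coordParity b) • (d.S a b).1 x := by
    intro d h a b x
    rw [h _ _ 0 0 _ (hasWeight_germ hM 0 _ x) (hasWeight_germ hM 0 _ x) (hZ x b) x]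
    simp [hZD]
  have hγ : ∀ d : M.BracketData ε i, d.Represents l B → ∀ a (x : M.dom i),
      component (B (germ hM 0 (coord m (M.chart i) (M.dom i) a) x)
        (germ hM 1 (1 : M.Fn i) x)) i (0 + 1 + l) x = (d.γ a).1 x := by
    intro d h a x
    rw [h _ _ 0 1 _ (hasWeight_germ hM 0 _ x) (hasWeight_germ hM 1 _ x) (hZ x a) x]
    simp [hZD, hTD, hT1]
  have hθ : ∀ d : M.BracketData ε i, d.Represents l B → ∀ (x : M.dom i),
      component (B (germ hM 1 (1 : M.Fn i) x)
        (germ hM 1 (1 : M.Fn i) x)) i (1 + 1 + l) x = d.θ.1 x := by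
    intro d h x
    rw [h _ _ 1 1 _ (hasWeight_germ hM 1 _ x) (hasWeight_germ hM 1 _ x) (hT x) x]
    simp [hTD, hT1]
  have h1 : d.S = d'.S := funext fun a => funext fun b => ext' fun x hx => by
    have e := (hS d h a b ⟨x, hx⟩).symm.trans (hS d' h' a b ⟨x, hx⟩)
    have e2 := congrArg (fun z => sgn (coordParity a * coordParity b) • z) e
    simpa only [smul_smul, sgn_mul_self, one_smul] using e2
  have h2 : d.γ = d'.γ := funext fun a => ext' fun x hx =>
    (hγ d h a ⟨x, hx⟩).symm.trans (hγ d' h' a ⟨x, hx⟩)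
  have h3 : d.θ = d'.θ := ext' fun x hx => (hθ d h ⟨x, hx⟩).symm.trans (hθ d' h' ⟨x, hx⟩)
  obtain ⟨S, γ, θ, _, _, _, _⟩ := d
  obtain ⟨S', γ', θ', _, _, _, _⟩ := d'
  obtain rfl : S = S' := h1
  obtain rfl : γ = γ' := h2
  obtain rfl : θ = θ' := h3
  rfl

end SuperManifold

/-! ### The main theorem. -/

theorem mainTheorem1 {n m : ℕ} {X : Type u} [TopologicalSpace X] [T2Space X]
    [SecondCountableTopology X] (M : SuperManifold.{u, v} n m X) (hM : M.PositiveJacobians)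
    (ε : ZMod 2) (l : ℝ) (B : M.Densities →ₗ[ℝ] M.Densities →ₗ[ℝ] M.Densities)
    (hB : SuperManifold.IsLongBracket ε l B) :
    (∃! Δ : M.Densities →ₗ[ℝ] M.Densities, SuperManifold.IsCanonicalGenerator ε B Δ) ∧
      (∀ Δ : M.Densities →ₗ[ℝ] M.Densities, SuperManifold.IsCanonicalGenerator ε B Δ →
        SuperManifold.OperatorWeight l Δ ∧
          ∀ i (d : M.BracketData ε i), d.Represents l B → d.IsPencilOf l Δ) ∧
      (SuperManifold.ContinuousInWeight l B →
        ∀ i, ∃! d : M.BracketData ε i, d.Represents l B) := by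
  have h := SuperManifold.isCanonicalGenerator_generator hM hB
  refine ⟨⟨_, h, fun Δ hΔ => hΔ.unique hM h⟩, fun Δ hΔ => ?_, fun hc i =>
    ⟨_, SuperManifold.localData_represents hM hB hc i, fun d hd =>
      hd.unique hM (SuperManifold.localData_represents hM hB hc i)⟩⟩
  rw [hΔ.unique hM h]
  exact ⟨SuperManifold.generator_weight hM hB, fun i d hd =>
    SuperManifold.isPencilOf_generator hM hB hd⟩
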